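/- **Setting.** Let $(W,S)$ be a Coxeter system with $S$ finite, let $\Bbbk$ be an integral domain, and let $\mathfrak h=(V,\{\alpha_s^\vee\},\{\alpha_s\})$ be a balanced realization of $(W,S)$ over $\Bbbk$ ($V$ free of finite rank) satisfying Demazure surjectivity. Let $\mathscr D_{\mathrm{BS}}(\mathfrak h,W)$ be the Elias–Williamson diagrammatic category: its objects are $B_{\underline w}(n)$ ($\underline w$ a word in $S$, $n\in\mathbb Z$), its morphisms are linear combinations of Soergel diagrams modulo the Elias–Williamson relations (in the three-colour relations of type $H_3$ the lower-order terms are any fixed choice), and its monoidal product $\star$ is horizontal concatenation, with unit $B_\varnothing$. Let $\mathscr D_{\mathrm{BS}}^\oplus(\mathfrak h,W)$ be its additive envelope. A summand $B_{\underline w}(n)$ is *even* or *odd* according to the parity of $\ell(\underline w)+n$; morphisms preserve the parity, so every morphism $f$ is a sum $f_{\mathrm{ev}}+f_{\mathrm{od}}$. A *sequence* is a family $\mathcal F=(\mathcal F^i)_{i\in\mathbb Z}$ of objects of $\mathscr D_{\mathrm{BS}}^\oplus(\mathfrak h,W)$, almost all zero. Put $$\underline{\mathrm{Hom}}_{\mathsf{BE}}(\mathcal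 F,\mathcal G)^i_j=\prod_{q-p=i-j}\mathrm{Hom}(\mathcal F^p,\mathcal G^q(j)),\qquad (\mathcal F\,\underline\star\,\mathcal G)^i=\bigoplus_{p+q=i}\mathcal F^p\star\mathcal G^q,$$ and for $f:\mathcal F^p\to\mathcal G^q(j)$ and $h:\mathcal F'^{p'}\to\mathcal G'^{q'}(j')$ put $$f\,\underline\star\,h=(-1)^{p(q'-p'+j')}f_{\mathrm{ev}}\star h+(-1)^{(p+1)(q'-p'+j')}f_{\mathrm{od}}\star h .$$ Let $R=\mathrm{Sym}(V^*)=\underline{\mathrm{End}}_{\mathsf{BE}}(B_\varnothing)$, let $\Lambda=\bigwedge V^*$ ($V^*$ in bidegree $(1,2)$), let $R^\vee=\mathrm{Sym}(V)$ ($V$ in bidegree $(0,-2)$), and let $$\underline{\mathrm{Hom}}_{\mathsf{FM}}(\mathcal F,\mathcal G)=\Lambda\otimes\underline{\mathrm{Hom}}_{\mathsf{BE}}(\mathcal F,\mathcal G)\otimes R^\vee,\qquad (r\otimes f\otimes x)\circ(s\otimes g\otimes y)=(-1)^{|f||s|}(r\wedge s)\otimes(f\circ g)\otimes xy ,$$ where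 $|\cdot|$ is the first (cohomological) degree. Put $\underline{\mathrm{Hom}}_{\mathsf{FM}}^{\lhd}=\Lambda\otimes\underline{\mathrm{Hom}}_{\mathsf{BE}}\otimes 1$ and $\underline{\mathrm{Hom}}_{\mathsf{FM}}^{\rhd}=1\otimes\underline{\mathrm{Hom}}_{\mathsf{BE}}\otimes R^\vee$. For $x\in V$ let $x\frown(-)$ be the contraction (graded derivation) of the factor $\Lambda$ with $x$, and for $r\in V^*$ let $(-)\frown r$ be the derivation of the factor $R^\vee$ determined by $r$. With dual bases $(e_i)$ of $V^*$ and $(\check e_i)$ of $V$ put $$\kappa(r\otimes f\otimes x)=\sum_i(\check e_i\frown r)\otimes(e_i\,\underline\star\,f)\otimes x,\quad \Theta_{\mathcal F}=\sum_i 1\otimes(\mathrm{id}_{\mathcal F}\,\underline\star\,e_i)\otimes\check e_i,\quad \theta_{\mathcal F}=\sum_i e_i\otimes\mathrm{id}_{\mathcal F}\otimes\check e_i .$$ A *convolutive free-monodromic complex* is a sequence $\mathcal F$ together with $\delta_{\mathcal F}\in\underline{\mathrm{End}}_{\mathsf{FM}}(\mathcal F)^1_0$ such that $\delta_{\mathcal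 F}\circ\delta_{\mathcal F}+\kappa(\delta_{\mathcal F})=\Theta_{\mathcal F}$ and $\delta_{\mathcal F}\in(\Bbbk\oplus V^*)\otimes\underline{\mathrm{End}}_{\mathsf{BE}}(\mathcal F)\otimes(\Bbbk\oplus V)$. These are the objects of the category $\mathrm{Conv}_{\mathsf{FM}}(\mathfrak h,W)$; the morphisms $\mathcal F\to\mathcal G$ are the elements of $\mathsf H^0_0$ of $\underline{\mathrm{Hom}}_{\mathsf{FM}}(\mathcal F,\mathcal G)$ for the differential $d(f)=\kappa(f)+\delta_{\mathcal G}\circ f+(-1)^{|f|+1}f\circ\delta_{\mathcal F}$. Let $\mathrm{Conv}^{\rhd}_{\mathsf{FM}}(\mathfrak h,W)$ and $\mathrm{Conv}^{\lhd}_{\mathsf{FM}}(\mathfrak h,W)$ be the (non-full) subcategories with the same objects and those morphisms that are represented by a cocycle in $\underline{\mathrm{Hom}}^{\rhd}_{\mathsf{FM}}$, respectively $\underline{\mathrm{Hom}}^{\lhd}_{\mathsf{FM}}$. For a convolutive $\mathcal F$ let $\mu_{\mathcal F}:R^\vee\to\underline{\mathrm{End}}^{\rhd}_{\mathsf{FM}}(\mathcal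 F)$ and $\nu_{\mathcal F}:\Lambda\to\underline{\mathrm{End}}^{\lhd}_{\mathsf{FM}}(\mathcal F)$ be the algebra homomorphisms with $\mu_{\mathcal F}(x)=x\frown\delta_{\mathcal F}$ for $x\in V$ and $\nu_{\mathcal F}(r)=\delta_{\mathcal F}\frown r$ for $r\in V^*$. For $f=r\otimes f'\otimes x\in\underline{\mathrm{Hom}}_{\mathsf{FM}}(\mathcal F,\mathcal G)$ and $h=t\otimes h'\otimes z\in\underline{\mathrm{Hom}}_{\mathsf{FM}}(\mathcal F',\mathcal G')$ put $$f\,\widehat\star\,h=\bigl((r\otimes f'\otimes1)\circ\nu_{\mathcal F}(t)\bigr)\,\underline\star\,\bigl(\mu_{\mathcal G'}(x)\circ(1\otimes h'\otimes z)\bigr),$$ where $(r\otimes a\otimes1)\,\underline\star\,(1\otimes b\otimes z)=r\otimes(a\,\underline\star\,b)\otimes z$, and let $\mathcal F\,\widehat\star\,\mathcal F'$ be the sequence $\mathcal F\,\underline\star\,\mathcal F'$ with $$\delta_{\mathcal F\widehat\star\mathcal F'}=\delta_{\mathcal F}\,\widehat\star\,\mathrm{id}_{\mathcal F'}+\mathrm{id}_{\mathcal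 F}\,\widehat\star\,\delta_{\mathcal F'}-\sum_i\nu_{\mathcal F}(e_i)\,\underline\star\,\mu_{\mathcal F'}(\check e_i).$$ Let $\mathbf 1=\widetilde{\mathcal T}_\varnothing$ be the sequence $B_\varnothing$ in position $0$ with $\delta=\theta_{B_\varnothing}$. **Proposition.** All of the above is well defined on convolutive complexes: $\mu_{\mathcal F}$ and $\nu_{\mathcal F}$ exist, $\mathbf 1$ and $\mathcal F\,\widehat\star\,\mathcal G$ are convolutive, $\widehat\star$ induces an operation on the morphisms of $\mathrm{Conv}_{\mathsf{FM}}(\mathfrak h,W)$ which preserves the morphisms of $\mathrm{Conv}^{\rhd}_{\mathsf{FM}}(\mathfrak h,W)$ and those of $\mathrm{Conv}^{\lhd}_{\mathsf{FM}}(\mathfrak h,W)$, and the canonical unitor and associator isomorphisms of sequences induce isomorphisms $$\lambda_{\mathcal F}:\mathbf 1\,\widehat\star\,\mathcal F\cong\mathcal F,\qquad \varrho_{\mathcal F}:\mathcal F\,\widehat\star\,\mathbf 1\cong\mathcal F,\qquad \alpha_{\mathcal F,\mathcal G,\mathcal H}:\mathcal F\,\widehat\star\,(\mathcal G\,\widehat\star\,\mathcal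 H)\cong(\mathcal F\,\widehat\star\,\mathcal G)\,\widehat\star\,\mathcal H$$ in $\mathrm{Conv}_{\mathsf{FM}}(\mathfrak h,W)$ which lie in both subcategories. These isomorphisms satisfy Mac Lane's coherence conditions: 1. for all morphisms $f:\mathcal F\to\mathcal F'$, $g:\mathcal G\to\mathcal G'$, $h:\mathcal H\to\mathcal H'$ of $\mathrm{Conv}_{\mathsf{FM}}(\mathfrak h,W)$: $\lambda_{\mathcal F'}\circ(\mathrm{id}_{\mathbf 1}\,\widehat\star\,f)=f\circ\lambda_{\mathcal F}$, $\varrho_{\mathcal F'}\circ(f\,\widehat\star\,\mathrm{id}_{\mathbf 1})=f\circ\varrho_{\mathcal F}$ and $\alpha_{\mathcal F',\mathcal G',\mathcal H'}\circ(f\,\widehat\star\,(g\,\widehat\star\,h))=((f\,\widehat\star\,g)\,\widehat\star\,h)\circ\alpha_{\mathcal F,\mathcal G,\mathcal H}$; 2. $\alpha_{\mathcal F\widehat\star\mathcal G,\mathcal H,\mathcal K}\circ\alpha_{\mathcal F,\mathcal G,\mathcal H\widehat\star\mathcal K}=(\alpha_{\mathcal F,\mathcal G,\mathcal H}\,\widehat\star\,\mathrm{id}_{\mathcal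 K})\circ\alpha_{\mathcal F,\mathcal G\widehat\star\mathcal H,\mathcal K}\circ(\mathrm{id}_{\mathcal F}\,\widehat\star\,\alpha_{\mathcal G,\mathcal H,\mathcal K})$; 3. $(\varrho_{\mathcal F}\,\widehat\star\,\mathrm{id}_{\mathcal G})\circ\alpha_{\mathcal F,\mathbf 1,\mathcal G}=\mathrm{id}_{\mathcal F}\,\widehat\star\,\lambda_{\mathcal G}$; 4. $\lambda_{\mathbf 1}=\varrho_{\mathbf 1}$. In particular, $\widehat\star$ is a bifunctor on each of $\mathrm{Conv}^{\rhd}_{\mathsf{FM}}(\mathfrak h,W)$ and $\mathrm{Conv}^{\lhd}_{\mathsf{FM}}(\mathfrak h,W)$, and $(\widehat\star,\mathbf 1,\alpha,\lambda,\varrho)$ makes each of these two categories a monoidal category. -/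

import Mathlib

open CategoryTheory TensorProduct

noncomputable section

namespace FreeMonodromic

universe uB uW uk uV

/-! ## Realizations of Coxeter systems -/

/-- The 2-coloured quantum number `[n]_x`, evaluated at elements `x`, `y` of a commutative ring;
`[n]_y` is `qnum y x n`. -/
def qnum {k : Type uk} [CommRing k] (x y : k) : ℕ → k
  | 0 => 0
  | 1 => 1
  | n + 2 => (if Even n then x else y) * qnum x y (n + 1) - qnum x y n

/-- A balanced realization of the Coxeter system `cs` on the `k`-module `V` which satisfies
Demazure surjectivity. -/
structure Realization {B : Type uB} {M : CoxeterMatrix B} {W : Type uW} [Group W]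
    (cs : CoxeterSystem M W) (k : Type uk) [CommRing k] (V : Type uV) [AddCommGroup V]
    [Module k V] where
  root : B → Module.Dual k V
  coroot : B → V
  pairing_self : ∀ s, root s (coroot s) = 2
  representation : ∃ ρ : W →* Module.End k V,
    ∀ s v, ρ (cs.simple s) v = v - root s v • coroot s
  qnum_eq_zero : ∀ s t, s ≠ t → M s t ≠ 0 →
    qnum (-root t (coroot s)) (-root s (coroot t)) (M s t) = 0
  balanced : ∀ s t, s ≠ t → M s t ≠ 0 →
    qnum (-root t (coroot s)) (-root s (coroot t)) (M s t - 1) = 1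
  root_surjective : ∀ s, Function.Surjective (root s)
  coroot_surjective : ∀ s, Function.Surjective (Module.Dual.eval k V (coroot s))

/-! ## Diagrams -/

/-- The alternating word `(s, t, s, …)` with `n` letters. -/
def alt {B : Type uB} (s t : B) : ℕ → List B
  | 0 => []
  | n + 1 => s :: alt t s n

/-- The last letter of `alt s t (n + 1)`. -/
def altLast {B : Type uB} (s t : B) : ℕ → B
  | 0 => s
  | n + 1 => altLast t s n

theorem alt_succ {B : Type uB} (s t : B) (n : ℕ) :
    alt s t (n + 1) = alt s t n ++ [altLast s t n] := by
  induction n generalizing s t with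
  | zero => rfl
  | succ n ih =>
    rw [alt, ih t s, altLast, ← List.cons_append]
    rfl

theorem altLast_succ {B : Type uB} (s t : B) (n : ℕ) : altLast s t (n + 1) = altLast t s n := rfl

theorem alt_snoc_snoc {B : Type uB} (s t : B) (n : ℕ) :
    alt t s n ++ [altLast t s n, altLast t s n] = t :: (alt s t n ++ [altLast t s n]) := by
  rw [← List.cons_append]
  change _ = alt t s (n + 1) ++ _
  rw [alt_succ]; simp

theorem alt_snoc_cons {B : Type uB} (s t : B) (n : ℕ) :
    alt s t n ++ [altLast s t n, altLast s t n] = alt s t (n + 1) ++ [altLast s t n] := by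
  rw [alt_succ]; simp

theorem mem_alt {B : Type uB} {s t x : B} {n : ℕ} (h : x ∈ alt s t n) : x = s ∨ x = t := by
  induction n generalizing s t with
  | zero => simp [alt] at h
  | succ n ih =>
    rcases List.mem_cons.1 h with h | h
    · exact Or.inl h
    · exact (ih h).symm

theorem symm_eq {B : Type uB} {M : CoxeterMatrix B} {s t : B} {m : ℕ} (h : M s t = m) :
    M t s = m := (M.symmetric t s).trans h

theorem mem_alt_comm {B : Type uB} {M : CoxeterMatrix B} {r s t : B} {n : ℕ} (hs : M r s = 2)
    (ht : M r t = 2) : ∀ x ∈ alt s t n, M r x = 2 := by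
  intro x hx
  rcases mem_alt hx with rfl | rfl <;> assumption

section Diagrams

variable {B : Type uB} (M : CoxeterMatrix B) (k : Type uk) [CommRing k]
  (V : Type uV) [AddCommGroup V] [Module k V]

/-- Linear combinations of Soergel diagrams from the bottom word `w` to the top word `v`: everything
that is obtained from the generating diagrams by vertical concatenation (`comp D E` is `D` with `E`
on top of it), horizontal concatenation and linear combination. -/
inductive Diag : List B → List B → Type (max uB uk uV)
  | id (w : List B) : Diag w w
  | comp {w v u : List B} : Diag w v → Diag v u → Diag w u
  | tens {w v w' v' : List B} : Diag w v → Diag w' v' → Diag (w ++ w') (v ++ v')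
  | zero (w v : List B) : Diag w v
  | add {w v : List B} : Diag w v → Diag w v → Diag w v
  | smul {w v : List B} : k → Diag w v → Diag w v
  | box (f : SymmetricAlgebra k (Module.Dual k V)) : Diag [] []
  | endDot (s : B) : Diag [s] []
  | startDot (s : B) : Diag [] [s]
  | split (s : B) : Diag [s] [s, s]
  | merge (s : B) : Diag [s, s] [s]
  | vtx (s t : B) (n : ℕ) (h : M s t = n + 2) : Diag (alt s t (n + 2)) (alt t s (n + 2))

variable {M k V}

namespace Diag

/-- Transport of a diagram along equalities of its boundary words. -/
protected def cast {w v w' v' : List B} (hw : w = w') (hv : v = v') (D : Diag M k V w v) :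
    Diag M k V w' v' := hw ▸ hv ▸ D

/-- The identity diagram, seen between equal words. -/
def eqId {w v : List B} (h : w = v) : Diag M k V w v := Diag.cast rfl h (id w)

def cap (s : B) : Diag M k V [s, s] [] := comp (merge s) (endDot s)

def cup (s : B) : Diag M k V [] [s, s] := comp (startDot s) (split s)

/-- The degree of diagrams: dots have degree `1`, trivalent vertices degree `-1`, `2m`-valent
vertices degree `0`, and `V*` is in degree `2`. -/
inductive Homog : ∀ {w v : List B}, Diag M k V w v → ℤ → Prop
  | id (w : List B) : Homog (id w) 0
  | comp {w v u : List B} {D : Diag M k V w v} {E : Diag M k V v u} {d e : ℤ} :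
      Homog D d → Homog E e → Homog (comp D E) (d + e)
  | tens {w v w' v' : List B} {D : Diag M k V w v} {E : Diag M k V w' v'} {d e : ℤ} :
      Homog D d → Homog E e → Homog (tens D E) (d + e)
  | zero (w v : List B) (d : ℤ) : Homog (zero w v) d
  | add {w v : List B} {D E : Diag M k V w v} {d : ℤ} :
      Homog D d → Homog E d → Homog (add D E) d
  | smul {w v : List B} {D : Diag M k V w v} {d : ℤ} (c : k) : Homog D d → Homog (smul c D) d
  | box {f : SymmetricAlgebra k (Module.Dual k V)} {n : ℕ}
      (hf : f ∈ LinearMap.range (SymmetricAlgebra.ι k (Module.Dual k V)) ^ n) :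
      Homog (box f) (2 * n)
  | endDot (s : B) : Homog (endDot s) 1
  | startDot (s : B) : Homog (startDot s) 1
  | split (s : B) : Homog (split s) (-1)
  | merge (s : B) : Homog (merge s) (-1)
  | vtx (s t : B) (n : ℕ) (h : M s t = n + 2) : Homog (vtx s t n h) 0

/-- Linear combinations of diagrams which factor through words with fewer than `n` letters. -/
inductive Lower (n : ℕ) : ∀ {w v : List B}, Diag M k V w v → Prop
  | comp {w v u : List B} (D : Diag M k V w v) (E : Diag M k V v u) (h : v.length < n) :
      Lower n (comp D E)
  | zero (w v : List B) : Lower n (zero w v)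
  | add {w v : List B} {D E : Diag M k V w v} : Lower n D → Lower n E → Lower n (add D E)
  | smul {w v : List B} {D : Diag M k V w v} (c : k) : Lower n D → Lower n (smul c D)

/-- The diagram `(s, t, s) → (s) → (s, t, s)` which represents a Temperley--Lieb generator. -/
def tlCore (s t : B) : Diag M k V [s, t, s] [s, t, s] :=
  comp (tens (id [s]) (tens (endDot t) (id [s]))) <|
  comp (merge s) <|
  comp (split s) <|
  tens (id [s]) (tens (startDot t) (id [s]))

/-- The `i`-th Temperley--Lieb generator on the word `alt s t n`: it is `tlCore` on the letters
`i`, `i + 1`, `i + 2` (counted from `0`). -/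
def tlGen : (s t : B) → (n i : ℕ) → Diag M k V (alt s t n) (alt s t n)
  | s, t, n + 3, 0 => tens (tlCore s t) (id (alt t s n))
  | s, t, n + 1, i + 1 => tens (id [s]) (tlGen t s n i)
  | s, t, n, _ => zero (alt s t n) (alt s t n)

/-- `TLRep s t n x D`: the diagram `D` is an expression for the element `x` of the free algebra,
with the `i`-th generator read as `tlGen s t (n + 2) i`. -/
inductive TLRep (s t : B) (n : ℕ) :
    FreeAlgebra k (Fin n) → Diag M k V (alt s t (n + 2)) (alt s t (n + 2)) → Prop
  | one : TLRep s t n 1 (id _)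
  | gen (i : Fin n) : TLRep s t n (FreeAlgebra.ι k i) (tlGen s t (n + 2) i)
  | zero : TLRep s t n 0 (zero _ _)
  | add {x y : FreeAlgebra k (Fin n)} {D E : Diag M k V (alt s t (n + 2)) (alt s t (n + 2))} :
      TLRep s t n x D → TLRep s t n y E → TLRep s t n (x + y) (add D E)
  | smul (c : k) {x : FreeAlgebra k (Fin n)} {D : Diag M k V (alt s t (n + 2)) (alt s t (n + 2))} :
      TLRep s t n x D → TLRep s t n (c • x) (smul c D)
  | mul {x y : FreeAlgebra k (Fin n)} {D E : Diag M k V (alt s t (n + 2)) (alt s t (n + 2))} :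
      TLRep s t n x D → TLRep s t n y E → TLRep s t n (x * y) (comp E D)

/-- A `2m`-valent vertex between identity strands. -/
def mv (w : List B) (s t : B) (n : ℕ) (h : M s t = n + 2) (v : List B) :
    Diag M k V (w ++ (alt s t (n + 2) ++ v)) (w ++ (alt t s (n + 2) ++ v)) :=
  tens (id w) (tens (vtx s t n h) (id v))

/-- A strand coloured `r` crosses the strands of the word `w`, whose letters commute with `r`. -/
def cross (r : B) : (w : List B) → (∀ x ∈ w, M r x = 2) → Diag M k V (r :: w) (w ++ [r])
  | [], _ => id [r]
  | x :: w, h =>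
      comp (v := [x] ++ (r :: w)) (tens (vtx r x 0 (h x List.mem_cons_self)) (id w))
        (tens (w' := r :: w) (v' := w ++ [r]) (id [x]) (cross r w fun y hy => h y (List.mem_cons_of_mem x hy)))

/-! The two sides of the three-colour relations of types `A₃`, `B₃`, `H₃`: the two ways around the
graph of reduced expressions of the longest element. -/

def zamA3Left (s t u : B) (hst : M s t = 3) (htu : M t u = 3) (hsu : M s u = 2) :
    Diag M k V [s, u, t, s, u, t] [t, s, u, t, s, u] :=
  Diag.comp (mv [s, u, t] s u 0 hsu [t]) <|
  Diag.comp (mv [s] u t 1 (symm_eq htu) [s, t]) <|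
  Diag.comp (mv [s, t, u] t s 1 (symm_eq hst) []) <|
  Diag.comp (mv [s, t] u s 0 (symm_eq hsu) [t, s]) <|
  Diag.comp (mv [] s t 1 hst [u, t, s]) <|
  Diag.comp (mv [t, s] t u 1 htu [s]) <|
  mv [t, s, u, t] u s 0 (symm_eq hsu) []

def zamA3Right (s t u : B) (hst : M s t = 3) (htu : M t u = 3) (hsu : M s u = 2) :
    Diag M k V [s, u, t, s, u, t] [t, s, u, t, s, u] :=
  Diag.comp (mv [] s u 0 hsu [t, s, u, t]) <|
  Diag.comp (mv [u] s t 1 hst [u, t]) <|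
  Diag.comp (mv [u, t, s] t u 1 htu []) <|
  Diag.comp (mv [u, t] s u 0 hsu [t, u]) <|
  Diag.comp (mv [] u t 1 (symm_eq htu) [s, t, u]) <|
  Diag.comp (mv [t, u] t s 1 (symm_eq hst) [u]) <|
  mv [t] u s 0 (symm_eq hsu) [t, s, u]

def zamB3Left (s t u : B) (hst : M s t = 3) (htu : M t u = 4) (hsu : M s u = 2) :
    Diag M k V [s, u, t, s, u, t, s, u, t] [t, s, u, t, s, u, t, s, u] :=
  Diag.comp (mv [s, u, t] s u 0 hsu [t, s, u, t]) <|
  Diag.comp (mv [s, u, t, u] s t 1 hst [u, t]) <|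
  Diag.comp (mv [s] u t 2 (symm_eq htu) [s, t, u, t]) <|
  Diag.comp (mv [s, t, u, t] u s 0 (symm_eq hsu) [t, u, t]) <|
  Diag.comp (mv [s, t, u, t, s] u t 2 (symm_eq htu) []) <|
  Diag.comp (mv [s, t, u] t s 1 (symm_eq hst) [u, t, u]) <|
  Diag.comp (mv [s, t] u s 0 (symm_eq hsu) [t, s, u, t, u]) <|
  Diag.comp (mv [] s t 1 hst [u, t, s, u, t, u]) <|
  Diag.comp (mv [t, s, t, u, t] s u 0 hsu [t, u]) <|
  Diag.comp (mv [t, s] t u 2 htu [s, t, u]) <|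
  Diag.comp (mv [t, s, u, t, u] t s 1 (symm_eq hst) [u]) <|
  mv [t, s, u, t] u s 0 (symm_eq hsu) [t, s, u]

def zamB3Right (s t u : B) (hst : M s t = 3) (htu : M t u = 4) (hsu : M s u = 2) :
    Diag M k V [s, u, t, s, u, t, s, u, t] [t, s, u, t, s, u, t, s, u] :=
  Diag.comp (mv [] s u 0 hsu [t, s, u, t, s, u, t]) <|
  Diag.comp (mv [u] s t 1 hst [u, t, s, u, t]) <|
  Diag.comp (mv [u, t, s, t, u, t] s u 0 hsu [t]) <|
  Diag.comp (mv [u, t, s] t u 2 htu [s, t]) <|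
  Diag.comp (mv [u, t, s, u, t, u] t s 1 (symm_eq hst) []) <|
  Diag.comp (mv [u, t] s u 0 hsu [t, u, s, t, s]) <|
  Diag.comp (mv [u, t, u, s, t] u s 0 (symm_eq hsu) [t, s]) <|
  Diag.comp (mv [u, t, u] s t 1 hst [u, t, s]) <|
  Diag.comp (mv [] u t 2 (symm_eq htu) [s, t, u, t, s]) <|
  Diag.comp (mv [t, u, t] u s 0 (symm_eq hsu) [t, u, t, s]) <|
  Diag.comp (mv [t, u, t, s] u t 2 (symm_eq htu) [s]) <|
  Diag.comp (mv [t, u] t s 1 (symm_eq hst) [u, t, u, s]) <|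
  Diag.comp (mv [t] u s 0 (symm_eq hsu) [t, s, u, t, u, s]) <|
  mv [t, s, u, t, s, u, t] u s 0 (symm_eq hsu) []

def zamH3Left (s t u : B) (hst : M s t = 3) (htu : M t u = 5) (hsu : M s u = 2) :
    Diag M k V [s, u, t, s, u, t, s, u, t, s, u, t, s, u, t] [t, s, u, t, s, u, t, s, u, t, s, u, t, s, u] :=
  Diag.comp (mv [s, u, t, s, u, t] s u 0 hsu [t, s, u, t, s, u, t]) <|
  Diag.comp (mv [s, u, t, s, u, t, u] s t 1 hst [u, t, s, u, t]) <|
  Diag.comp (mv [] s u 0 hsu [t, s, u, t, u, t, s, t, u, t, s, u, t]) <|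
  Diag.comp (mv [u] s t 1 hst [u, t, u, t, s, t, u, t, s, u, t]) <|
  Diag.comp (mv [u, t, s] t u 3 htu [s, t, u, t, s, u, t]) <|
  Diag.comp (mv [u, t, s, u, t, u, t] u s 0 (symm_eq hsu) [t, u, t, s, u, t]) <|
  Diag.comp (mv [u, t, s, u, t, u, t, s, u, t, u, t] s u 0 hsu [t]) <|
  Diag.comp (mv [u, t, s, u, t, u, t, s] u t 3 (symm_eq htu) [s, t]) <|
  Diag.comp (mv [u, t, s, u, t, u, t, s, t, u, t, u] t s 1 (symm_eq hst) []) <|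
  Diag.comp (mv [u, t, s, u, t, u] t s 1 (symm_eq hst) [u, t, u, s, t, s]) <|
  Diag.comp (mv [u, t] s u 0 hsu [t, u, s, t, s, u, t, u, s, t, s]) <|
  Diag.comp (mv [u, t, u, s, t] u s 0 (symm_eq hsu) [t, s, u, t, u, s, t, s]) <|
  Diag.comp (mv [u, t, u] s t 1 hst [u, t, s, u, t, u, s, t, s]) <|
  Diag.comp (mv [u, t, u, t, s, t, u, t] s u 0 hsu [t, u, s, t, s]) <|
  Diag.comp (mv [u, t, u, t, s, t, u, t, u, s, t] u s 0 (symm_eq hsu) [t, s]) <|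
  Diag.comp (mv [u, t, u, t, s, t, u, t, u] s t 1 hst [u, t, s]) <|
  Diag.comp (mv [u, t, u, t, s] t u 3 htu [s, t, u, t, s]) <|
  Diag.comp (mv [u, t, u, t] s u 0 hsu [t, u, t, u, s, t, u, t, s]) <|
  Diag.comp (mv [] u t 3 (symm_eq htu) [s, t, u, t, u, s, t, u, t, s]) <|
  Diag.comp (mv [t, u, t, u] t s 1 (symm_eq hst) [u, t, u, s, t, u, t, s]) <|
  Diag.comp (mv [t, u, t, u, s, t] s u 0 hsu [t, u, s, t, u, t, s]) <|
  Diag.comp (mv [t, u, t, u, s, t, u, s, t] u s 0 (symm_eq hsu) [t, u, t, s]) <|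
  Diag.comp (mv [t, u, t, u, s, t, u] s t 1 hst [u, t, u, t, s]) <|
  Diag.comp (mv [t, u, t, u, s, t, u, t, s] t u 3 htu [s]) <|
  Diag.comp (mv [t, u, t] u s 0 (symm_eq hsu) [t, u, t, s, u, t, u, t, u, s]) <|
  Diag.comp (mv [t, u, t, s, u, t, u, t] s u 0 hsu [t, u, t, u, s]) <|
  Diag.comp (mv [t, u, t, s] u t 3 (symm_eq htu) [s, t, u, t, u, s]) <|
  Diag.comp (mv [t, u] t s 1 (symm_eq hst) [u, t, u, t, s, t, u, t, u, s]) <|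
  Diag.comp (mv [t, u, s, t, s, u, t, u] t s 1 (symm_eq hst) [u, t, u, s]) <|
  Diag.comp (mv [t] u s 0 (symm_eq hsu) [t, s, u, t, u, s, t, s, u, t, u, s]) <|
  Diag.comp (mv [t, s, u, t, s, u, t] u s 0 (symm_eq hsu) [t, s, u, t, u, s]) <|
  mv [t, s, u, t, s, u, t, s, u, t, s, u, t] u s 0 (symm_eq hsu) []

def zamH3Right (s t u : B) (hst : M s t = 3) (htu : M t u = 5) (hsu : M s u = 2) :
    Diag M k V [s, u, t, s, u, t, s, u, t, s, u, t, s, u, t] [t, s, u, t, s, u, t, s, u, t, s, u, t, s, u] :=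
  Diag.comp (mv [s, u, t] s u 0 hsu [t, s, u, t, s, u, t, s, u, t]) <|
  Diag.comp (mv [s, u, t, u] s t 1 hst [u, t, s, u, t, s, u, t]) <|
  Diag.comp (mv [s, u, t, u, t, s, t, u, t] s u 0 hsu [t, s, u, t]) <|
  Diag.comp (mv [s, u, t, u, t, s, t, u, t, u] s t 1 hst [u, t]) <|
  Diag.comp (mv [s, u, t, u, t, s] t u 3 htu [s, t, u, t]) <|
  Diag.comp (mv [s, u, t, u, t] s u 0 hsu [t, u, t, u, s, t, u, t]) <|
  Diag.comp (mv [s] u t 3 (symm_eq htu) [s, t, u, t, u, s, t, u, t]) <|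
  Diag.comp (mv [s, t, u, t, u] t s 1 (symm_eq hst) [u, t, u, s, t, u, t]) <|
  Diag.comp (mv [s, t, u, t, u, s, t] s u 0 hsu [t, u, s, t, u, t]) <|
  Diag.comp (mv [s, t, u, t, u, s, t, u, s, t] u s 0 (symm_eq hsu) [t, u, t]) <|
  Diag.comp (mv [s, t, u, t, u, s, t, u] s t 1 hst [u, t, u, t]) <|
  Diag.comp (mv [s, t, u, t, u, s, t, u, t, s] t u 3 htu []) <|
  Diag.comp (mv [s, t, u, t] u s 0 (symm_eq hsu) [t, u, t, s, u, t, u, t, u]) <|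
  Diag.comp (mv [s, t, u, t, s, u, t, u, t] s u 0 hsu [t, u, t, u]) <|
  Diag.comp (mv [s, t, u, t, s] u t 3 (symm_eq htu) [s, t, u, t, u]) <|
  Diag.comp (mv [s, t, u, t, s, t, u, t, u] t s 1 (symm_eq hst) [u, t, u]) <|
  Diag.comp (mv [s, t, u] t s 1 (symm_eq hst) [u, t, u, s, t, s, u, t, u]) <|
  Diag.comp (mv [s, t] u s 0 (symm_eq hsu) [t, s, u, t, u, s, t, s, u, t, u]) <|
  Diag.comp (mv [] s t 1 hst [u, t, s, u, t, u, s, t, s, u, t, u]) <|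
  Diag.comp (mv [t, s, t, u, t] s u 0 hsu [t, u, s, t, s, u, t, u]) <|
  Diag.comp (mv [t, s, t, u, t, u, s, t] u s 0 (symm_eq hsu) [t, s, u, t, u]) <|
  Diag.comp (mv [t, s, t, u, t, u] s t 1 hst [u, t, s, u, t, u]) <|
  Diag.comp (mv [t, s] t u 3 htu [s, t, u, t, s, u, t, u]) <|
  Diag.comp (mv [t, s, u, t, u, t] u s 0 (symm_eq hsu) [t, u, t, s, u, t, u]) <|
  Diag.comp (mv [t, s, u, t, u, t, s, u, t, u, t] s u 0 hsu [t, u]) <|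
  Diag.comp (mv [t, s, u, t, u, t, s] u t 3 (symm_eq htu) [s, t, u]) <|
  Diag.comp (mv [t, s, u, t, u, t, s, t, u, t, u] t s 1 (symm_eq hst) [u]) <|
  Diag.comp (mv [t, s, u, t, u] t s 1 (symm_eq hst) [u, t, u, s, t, s, u]) <|
  Diag.comp (mv [t, s, u, t] u s 0 (symm_eq hsu) [t, s, u, t, u, s, t, s, u]) <|
  mv [t, s, u, t, s, u, t, s, u, t] u s 0 (symm_eq hsu) [t, s, u]

end Diag

/-- The defining relations of the 2-coloured Temperley--Lieb algebra of the word `alt s t (n + 2)`;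
the `i`-th loop parameter is `⟨α_c^∨, α_{c'}⟩`, where `c`, `c'` are the letters `i`, `i + 1`. -/
inductive TLRel (loop : ℕ → k) (n : ℕ) : FreeAlgebra k (Fin n) → FreeAlgebra k (Fin n) → Prop
  | sq (i : Fin n) : TLRel loop n (FreeAlgebra.ι k i * FreeAlgebra.ι k i)
      (loop i • FreeAlgebra.ι k i)
  | adj (i j : Fin n) (h : (i : ℕ) + 1 = j ∨ (j : ℕ) + 1 = i) :
      TLRel loop n (FreeAlgebra.ι k i * FreeAlgebra.ι k j * FreeAlgebra.ι k i) (FreeAlgebra.ι k i)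
  | far (i j : Fin n) (h : (i : ℕ) + 2 ≤ j) :
      TLRel loop n (FreeAlgebra.ι k i * FreeAlgebra.ι k j) (FreeAlgebra.ι k j * FreeAlgebra.ι k i)

/-- `x` represents the Jones--Wenzl projector: the element of the Temperley--Lieb algebra in which
the coefficient of the identity is `1` and which is killed by all the generators. -/
def IsJonesWenzl (loop : ℕ → k) (n : ℕ) (x : FreeAlgebra k (Fin n)) : Prop :=
  FreeAlgebra.lift k (fun _ : Fin n => (0 : k)) x = 1 ∧
  ∀ i : Fin n,
    RingQuot.mkAlgHom k (TLRel loop n) (FreeAlgebra.ι k i * x) = 0 ∧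
    RingQuot.mkAlgHom k (TLRel loop n) (x * FreeAlgebra.ι k i) = 0

variable {W : Type uW} [Group W] {cs : CoxeterSystem M W}

/-- The simple reflection `s` on `V*`. -/
def Realization.reflection (𝔥 : Realization cs k V) (s : B) :
    Module.Dual k V →ₗ[k] Module.Dual k V :=
  LinearMap.id - (Module.Dual.eval k V (𝔥.coroot s)).smulRight (𝔥.root s)

/-- The simple reflection `s` on the symmetric algebra of `V*`. -/
def Realization.symReflection (𝔥 : Realization cs k V) (s : B) :
    SymmetricAlgebra k (Module.Dual k V) →ₐ[k] SymmetricAlgebra k (Module.Dual k V) :=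
  SymmetricAlgebra.lift (SymmetricAlgebra.ι k (Module.Dual k V) ∘ₗ 𝔥.reflection s)

/-- The loop parameters of the word `(s, t, s, …)`. -/
def Realization.loop (𝔥 : Realization cs k V) (s t : B) (i : ℕ) : k :=
  if Even i then 𝔥.root t (𝔥.coroot s) else 𝔥.root s (𝔥.coroot t)

variable (M k V) in
/-- A choice of the lower-order terms in the three-colour relations of type `H₃`. -/
structure LowerTerms where
  term : ∀ s t u : B, M s t = 3 → M t u = 5 → M s u = 2 →
    Diag M k V [s, u, t, s, u, t, s, u, t, s, u, t, s, u, t]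
      [t, s, u, t, s, u, t, s, u, t, s, u, t, s, u]
  homog : ∀ s t u hst htu hsu, (term s t u hst htu hsu).Homog 0
  lower : ∀ s t u hst htu hsu, (term s t u hst htu hsu).Lower 15

open Diag

/-- The relations between diagrams. The first groups say that diagrams form a strict `k`-linear
monoidal category, the later ones are the relations of the Elias--Williamson category. -/
inductive DRel (𝔥 : Realization cs k V) (ζ : LowerTerms M k V) :
    ∀ {w v : List B}, Diag M k V w v → Diag M k V w v → Prop
  -- congruence
  | comp_left {w v u : List B} {D D' : Diag M k V w v} (E : Diag M k V v u) :
      DRel 𝔥 ζ D D' → DRel 𝔥 ζ (comp D E) (comp D' E)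
  | comp_right {w v u : List B} (D : Diag M k V w v) {E E' : Diag M k V v u} :
      DRel 𝔥 ζ E E' → DRel 𝔥 ζ (comp D E) (comp D E')
  | tens_left {w v w' v' : List B} {D D' : Diag M k V w v} (E : Diag M k V w' v') :
      DRel 𝔥 ζ D D' → DRel 𝔥 ζ (tens D E) (tens D' E)
  | tens_right {w v w' v' : List B} (D : Diag M k V w v) {E E' : Diag M k V w' v'} :
      DRel 𝔥 ζ E E' → DRel 𝔥 ζ (tens D E) (tens D E')
  | add_left {w v : List B} {D D' : Diag M k V w v} (E : Diag M k V w v) :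
      DRel 𝔥 ζ D D' → DRel 𝔥 ζ (add D E) (add D' E)
  | add_right {w v : List B} (D : Diag M k V w v) {E E' : Diag M k V w v} :
      DRel 𝔥 ζ E E' → DRel 𝔥 ζ (add D E) (add D E')
  | smul_congr {w v : List B} (c : k) {D D' : Diag M k V w v} :
      DRel 𝔥 ζ D D' → DRel 𝔥 ζ (smul c D) (smul c D')
  -- module axioms
  | add_assoc {w v : List B} (D E F : Diag M k V w v) :
      DRel 𝔥 ζ (add (add D E) F) (add D (add E F))
  | add_comm {w v : List B} (D E : Diag M k V w v) : DRel 𝔥 ζ (add D E) (add E D)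
  | zero_add {w v : List B} (D : Diag M k V w v) : DRel 𝔥 ζ (add (zero w v) D) D
  | smul_add {w v : List B} (c : k) (D E : Diag M k V w v) :
      DRel 𝔥 ζ (smul c (add D E)) (add (smul c D) (smul c E))
  | add_smul {w v : List B} (c d : k) (D : Diag M k V w v) :
      DRel 𝔥 ζ (smul (c + d) D) (add (smul c D) (smul d D))
  | mul_smul {w v : List B} (c d : k) (D : Diag M k V w v) :
      DRel 𝔥 ζ (smul (c * d) D) (smul c (smul d D))
  | one_smul {w v : List B} (D : Diag M k V w v) : DRel 𝔥 ζ (smul 1 D) D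
  | zero_smul {w v : List B} (D : Diag M k V w v) : DRel 𝔥 ζ (smul 0 D) (zero w v)
  -- bilinearity of the two concatenations
  | add_comp {w v u : List B} (D D' : Diag M k V w v) (E : Diag M k V v u) :
      DRel 𝔥 ζ (comp (add D D') E) (add (comp D E) (comp D' E))
  | comp_add {w v u : List B} (D : Diag M k V w v) (E E' : Diag M k V v u) :
      DRel 𝔥 ζ (comp D (add E E')) (add (comp D E) (comp D E'))
  | smul_comp {w v u : List B} (c : k) (D : Diag M k V w v) (E : Diag M k V v u) :
      DRel 𝔥 ζ (comp (smul c D) E) (smul c (comp D E))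
  | comp_smul {w v u : List B} (c : k) (D : Diag M k V w v) (E : Diag M k V v u) :
      DRel 𝔥 ζ (comp D (smul c E)) (smul c (comp D E))
  | add_tens {w v w' v' : List B} (D D' : Diag M k V w v) (E : Diag M k V w' v') :
      DRel 𝔥 ζ (tens (add D D') E) (add (tens D E) (tens D' E))
  | tens_add {w v w' v' : List B} (D : Diag M k V w v) (E E' : Diag M k V w' v') :
      DRel 𝔥 ζ (tens D (add E E')) (add (tens D E) (tens D E'))
  | smul_tens {w v w' v' : List B} (c : k) (D : Diag M k V w v) (E : Diag M k V w' v') :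
      DRel 𝔥 ζ (tens (smul c D) E) (smul c (tens D E))
  | tens_smul {w v w' v' : List B} (c : k) (D : Diag M k V w v) (E : Diag M k V w' v') :
      DRel 𝔥 ζ (tens D (smul c E)) (smul c (tens D E))
  -- strict monoidal category axioms
  | id_comp {w v : List B} (D : Diag M k V w v) : DRel 𝔥 ζ (comp (id w) D) D
  | comp_id {w v : List B} (D : Diag M k V w v) : DRel 𝔥 ζ (comp D (id v)) D
  | comp_assoc {w v u x : List B} (D : Diag M k V w v) (E : Diag M k V v u) (F : Diag M k V u x) :
      DRel 𝔥 ζ (comp (comp D E) F) (comp D (comp E F))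
  | id_tens_id (w v : List B) : DRel 𝔥 ζ (tens (id w) (id v)) (id (w ++ v))
  | interchange {w v u w' v' u' : List B} (D : Diag M k V w v) (E : Diag M k V v u)
      (D' : Diag M k V w' v') (E' : Diag M k V v' u') :
      DRel 𝔥 ζ (tens (comp D E) (comp D' E')) (comp (tens D D') (tens E E'))
  | tens_assoc {w v w' v' w'' v'' : List B} (D : Diag M k V w v) (E : Diag M k V w' v')
      (F : Diag M k V w'' v'') :
      DRel 𝔥 ζ (Diag.cast (List.append_assoc _ _ _) (List.append_assoc _ _ _) (tens (tens D E) F))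
        (tens D (tens E F))
  | nil_tens {w v : List B} (D : Diag M k V w v) : DRel 𝔥 ζ (tens (id []) D) D
  | tens_nil {w v : List B} (D : Diag M k V w v) :
      DRel 𝔥 ζ (Diag.cast (List.append_nil _) (List.append_nil _) (tens D (id []))) D
  -- boxes
  | box_add (f g : SymmetricAlgebra k (Module.Dual k V)) :
      DRel 𝔥 ζ (box (f + g)) (add (box f) (box g))
  | box_smul (c : k) (f : SymmetricAlgebra k (Module.Dual k V)) :
      DRel 𝔥 ζ (box (c • f)) (smul c (box f))
  | box_mul (f g : SymmetricAlgebra k (Module.Dual k V)) :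
      DRel 𝔥 ζ (box (f * g)) (comp (box f) (box g))
  | box_one : DRel 𝔥 ζ (box 1) (id [])
  -- Frobenius unit and associativity relations
  | split_endDot_left (s : B) :
      DRel 𝔥 ζ (comp (split s) (tens (endDot s) (id [s]))) (id [s])
  | split_endDot_right (s : B) :
      DRel 𝔥 ζ (comp (split s) (tens (id [s]) (endDot s))) (id [s])
  | merge_startDot_left (s : B) :
      DRel 𝔥 ζ (comp (tens (startDot s) (id [s])) (merge s)) (id [s])
  | merge_startDot_right (s : B) :
      DRel 𝔥 ζ (comp (tens (id [s]) (startDot s)) (merge s)) (id [s])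
  | frobenius_left (s : B) :
      DRel 𝔥 ζ (comp (merge s) (split s))
        (comp (tens (split s) (id [s])) (tens (id [s]) (merge s)))
  | frobenius_right (s : B) :
      DRel 𝔥 ζ (comp (merge s) (split s))
        (comp (tens (id [s]) (split s)) (tens (merge s) (id [s])))
  -- needle, barbell and nil-Hecke relations
  | needle (s : B) : DRel 𝔥 ζ (comp (split s) (merge s)) (zero [s] [s])
  | barbell (s : B) :
      DRel 𝔥 ζ (comp (startDot s) (endDot s)) (box (SymmetricAlgebra.ι k _ (𝔥.root s)))
  | nilHecke (s : B) (f g : SymmetricAlgebra k (Module.Dual k V))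
      (h : SymmetricAlgebra.ι k _ (𝔥.root s) * g = f - 𝔥.symReflection s f) :
      DRel 𝔥 ζ (tens (box f) (id [s]))
        (add (tens (w := [s]) (v := [s]) (w' := []) (v' := []) (id [s]) (box (𝔥.symReflection s f)))
          (comp (endDot s) (comp (box g) (startDot s))))
  -- cyclicity of the `2m`-valent vertices
  | cyclic_left (s t : B) (n : ℕ) (h : M s t = n + 2) :
      DRel 𝔥 ζ (vtx t s n (symm_eq h))
        (comp (eqId (List.append_nil _).symm) <|
        comp (tens (id (alt t s (n + 2))) (cup (altLast s t (n + 1)))) <|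
        comp (eqId (alt_snoc_snoc s t (n + 2))) <|
        comp (v := [t, t] ++ (alt s t (n + 1) ++ [altLast s t (n + 1)]))
          (tens (id [t]) (tens (vtx s t n h) (id [altLast s t (n + 1)]))) <|
        comp (tens (cap t) (id (alt s t (n + 1) ++ [altLast s t (n + 1)])))
          (eqId (alt_succ s t (n + 1)).symm))
  | cyclic_right (s t : B) (n : ℕ) (h : M s t = n + 2) :
      DRel 𝔥 ζ (vtx t s n (symm_eq h))
        (comp (tens (cup s) (id (alt t s (n + 2)))) <|
        comp (eqId (congrArg (s :: ·) (alt_succ s t (n + 2)))) <|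
        comp (tens (id [s]) (tens (vtx s t n h) (id [altLast t s (n + 1)]))) <|
        comp (eqId (alt_snoc_snoc t s (n + 2)).symm) <|
        comp (tens (id (alt s t (n + 2))) (cap (altLast t s (n + 1))))
          (eqId (List.append_nil _)))
  -- two-colour associativity
  | assoc_two (s t : B) (n : ℕ) (h : M s t = n + 2) :
      DRel 𝔥 ζ
        (comp (vtx s t n h) <|
        comp (eqId (alt_succ t s (n + 1))) <|
        comp (tens (id (alt t s (n + 1))) (split (altLast t s (n + 1)))) <|
        eqId (alt_snoc_cons t s (n + 1)))
        (comp (tens (split s) (id (alt t s (n + 1)))) <|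
        comp (v := s :: alt t s (n + 2))
          (tens (w' := alt s t (n + 2)) (v' := alt t s (n + 2)) (id [s]) (vtx s t n h)) <|
        comp (eqId (alt_succ s t (n + 2))) <|
        tens (vtx s t n h) (id [altLast t s (n + 1)]))
  -- Jones--Wenzl relation
  | jonesWenzl (s t : B) (n : ℕ) (h : M s t = n + 2) (x : FreeAlgebra k (Fin n))
      (hx : IsJonesWenzl (𝔥.loop s t) n x) (D : Diag M k V (alt s t (n + 2)) (alt s t (n + 2)))
      (hD : TLRep s t n x D) :
      DRel 𝔥 ζ
        (comp (vtx s t n h) <|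
        comp (eqId (alt_succ t s (n + 1))) <|
        comp (tens (id (alt t s (n + 1))) (endDot (altLast t s (n + 1)))) <|
        eqId (List.append_nil _))
        (comp D (tens (endDot s) (id (alt t s (n + 1)))))
  -- three-colour (Zamolodchikov) relations
  | zamA1 (r s t : B) (n : ℕ) (h : M s t = n + 2) (hrs : M r s = 2) (hrt : M r t = 2) :
      DRel 𝔥 ζ
        (comp (tens (id [r]) (vtx s t n h))
          (cross r (alt t s (n + 2)) (mem_alt_comm hrt hrs)))
        (comp (cross r (alt s t (n + 2)) (mem_alt_comm hrs hrt))
          (tens (vtx s t n h) (id [r])))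
  | zamA3 (s t u : B) (hst : M s t = 3) (htu : M t u = 3) (hsu : M s u = 2) :
      DRel 𝔥 ζ (zamA3Left s t u hst htu hsu) (zamA3Right s t u hst htu hsu)
  | zamB3 (s t u : B) (hst : M s t = 3) (htu : M t u = 4) (hsu : M s u = 2) :
      DRel 𝔥 ζ (zamB3Left s t u hst htu hsu) (zamB3Right s t u hst htu hsu)
  | zamH3 (s t u : B) (hst : M s t = 3) (htu : M t u = 5) (hsu : M s u = 2) :
      DRel 𝔥 ζ (zamH3Left s t u hst htu hsu)
        (add (zamH3Right s t u hst htu hsu) (ζ.term s t u hst htu hsu))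

/-- The morphism spaces of the diagrammatic category, all degrees together. -/
def DHom (𝔥 : Realization cs k V) (ζ : LowerTerms M k V) (w v : List B) : Type (max uB uk uV) :=
  Quot (DRel 𝔥 ζ (w := w) (v := v))

namespace DHom

variable {𝔥 : Realization cs k V} {ζ : LowerTerms M k V}

/-- The class of a diagram. -/
def mk {w v : List B} (D : Diag M k V w v) : DHom 𝔥 ζ w v := Quot.mk _ D

theorem sound {w v : List B} {D E : Diag M k V w v} (h : DRel 𝔥 ζ D E) :
    (mk D : DHom 𝔥 ζ w v) = mk E := Quot.sound h

instance {w v : List B} : Zero (DHom 𝔥 ζ w v) := ⟨mk (zero w v)⟩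

instance {w v : List B} : Add (DHom 𝔥 ζ w v) :=
  ⟨Quot.map₂ add (fun D _ _ h => DRel.add_right D h) (fun _ _ E h => DRel.add_left E h)⟩

instance {w v : List B} : SMul k (DHom 𝔥 ζ w v) :=
  ⟨fun c => Quot.map (smul c) (fun _ _ h => DRel.smul_congr c h)⟩

instance {w v : List B} : Neg (DHom 𝔥 ζ w v) := ⟨fun x => (-1 : k) • x⟩

theorem neg_one_smul_add {w v : List B} (x : DHom 𝔥 ζ w v) : (-1 : k) • x + x = 0 := by
  induction x using Quot.ind with
  | mk D =>
    have h1 : (mk (smul (-1 + 1) D) : DHom 𝔥 ζ w v) = mk (add (smul (-1) D) (smul 1 D)) :=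
      sound (DRel.add_smul _ _ D)
    have h2 : (mk (add (smul (-1) D) (smul 1 D)) : DHom 𝔥 ζ w v) = mk (add (smul (-1) D) D) :=
      sound (DRel.add_right _ (DRel.one_smul D))
    have h3 : (mk (smul (-1 + 1) D) : DHom 𝔥 ζ w v) = mk (zero w v) := by
      rw [neg_add_cancel]; exact sound (DRel.zero_smul D)
    exact (h2.symm.trans h1.symm).trans h3

instance {w v : List B} : AddCommGroup (DHom 𝔥 ζ w v) where
  add_assoc := by rintro ⟨D⟩ ⟨E⟩ ⟨F⟩; exact sound (DRel.add_assoc D E F)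
  zero_add := by rintro ⟨D⟩; exact sound (DRel.zero_add D)
  add_zero := by
    rintro ⟨D⟩; exact (sound (DRel.add_comm D _)).trans (sound (DRel.zero_add D))
  add_comm := by rintro ⟨D⟩ ⟨E⟩; exact sound (DRel.add_comm D E)
  nsmul := nsmulRec
  zsmul := zsmulRec
  neg_add_cancel := neg_one_smul_add

instance {w v : List B} : Module k (DHom 𝔥 ζ w v) where
  one_smul := by rintro ⟨D⟩; exact sound (DRel.one_smul D)
  mul_smul := by rintro c d ⟨D⟩; exact sound (DRel.mul_smul c d D)
  smul_zero c := by
    have h : (mk (smul c (smul 0 (zero w v))) : DHom 𝔥 ζ w v) = mk (smul 0 (zero w v)) := by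
      rw [← sound (DRel.mul_smul c 0 (zero w v)), mul_zero]
    have h2 : (mk (smul c (smul 0 (zero w v))) : DHom 𝔥 ζ w v) = mk (smul c (zero w v)) :=
      sound (DRel.smul_congr c (DRel.zero_smul _))
    exact (h2.symm.trans h).trans (sound (DRel.zero_smul _))
  smul_add := by rintro c ⟨D⟩ ⟨E⟩; exact sound (DRel.smul_add c D E)
  add_smul := by rintro c d ⟨D⟩; exact sound (DRel.add_smul c d D)
  zero_smul := by rintro ⟨D⟩; exact sound (DRel.zero_smul D)

/-- Vertical concatenation; `comp x y` is `x` followed by `y`. -/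
def comp {w v u : List B} : DHom 𝔥 ζ w v →ₗ[k] DHom 𝔥 ζ v u →ₗ[k] DHom 𝔥 ζ w u :=
  LinearMap.mk₂ k
    (Quot.map₂ Diag.comp (fun D _ _ h => DRel.comp_right D h) (fun _ _ E h => DRel.comp_left E h))
    (by rintro ⟨D⟩ ⟨D'⟩ ⟨E⟩; exact sound (DRel.add_comp D D' E))
    (by rintro c ⟨D⟩ ⟨E⟩; exact sound (DRel.smul_comp c D E))
    (by rintro ⟨D⟩ ⟨E⟩ ⟨E'⟩; exact sound (DRel.comp_add D E E'))
    (by rintro c ⟨D⟩ ⟨E⟩; exact sound (DRel.comp_smul c D E))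

/-- Horizontal concatenation. -/
def tens {w v w' v' : List B} :
    DHom 𝔥 ζ w v →ₗ[k] DHom 𝔥 ζ w' v' →ₗ[k] DHom 𝔥 ζ (w ++ w') (v ++ v') :=
  LinearMap.mk₂ k
    (Quot.map₂ Diag.tens (fun D _ _ h => DRel.tens_right D h) (fun _ _ E h => DRel.tens_left E h))
    (by rintro ⟨D⟩ ⟨D'⟩ ⟨E⟩; exact sound (DRel.add_tens D D' E))
    (by rintro c ⟨D⟩ ⟨E⟩; exact sound (DRel.smul_tens c D E))
    (by rintro ⟨D⟩ ⟨E⟩ ⟨E'⟩; exact sound (DRel.tens_add D E E'))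
    (by rintro c ⟨D⟩ ⟨E⟩; exact sound (DRel.tens_smul c D E))

variable (𝔥 ζ) in
/-- The morphisms of degree `e`. -/
def deg (w v : List B) (e : ℤ) : Submodule k (DHom 𝔥 ζ w v) :=
  Submodule.span k {x | ∃ D : Diag M k V w v, D.Homog e ∧ mk D = x}

theorem comp_mk {w v u : List B} (D : Diag M k V w v) (E : Diag M k V v u) :
    comp (mk D : DHom 𝔥 ζ w v) (mk E) = mk (D.comp E) := rfl

theorem tens_mk {w v w' v' : List B} (D : Diag M k V w v) (E : Diag M k V w' v') :
    tens (mk D : DHom 𝔥 ζ w v) (mk E) = mk (D.tens E) := rfl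

theorem comp_assoc {w v u x : List B} (f : DHom 𝔥 ζ w v) (g : DHom 𝔥 ζ v u)
    (h : DHom 𝔥 ζ u x) : comp (comp f g) h = comp f (comp g h) := by
  obtain ⟨D⟩ := f; obtain ⟨E⟩ := g; obtain ⟨F⟩ := h
  exact sound (DRel.comp_assoc D E F)

theorem id_comp {w v : List B} (f : DHom 𝔥 ζ w v) : comp (mk (Diag.id w)) f = f := by
  obtain ⟨D⟩ := f
  exact sound (DRel.id_comp D)

theorem comp_id {w v : List B} (f : DHom 𝔥 ζ w v) : comp f (mk (Diag.id v)) = f := by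
  obtain ⟨D⟩ := f
  exact sound (DRel.comp_id D)

theorem interchange {w v u w' v' u' : List B} (f : DHom 𝔥 ζ w v) (g : DHom 𝔥 ζ v u)
    (f' : DHom 𝔥 ζ w' v') (g' : DHom 𝔥 ζ v' u') :
    tens (comp f g) (comp f' g') = comp (tens f f') (tens g g') := by
  obtain ⟨D⟩ := f; obtain ⟨E⟩ := g; obtain ⟨D'⟩ := f'; obtain ⟨E'⟩ := g'
  exact sound (DRel.interchange D E D' E')

theorem comp_mem_deg {w v u : List B} {d e : ℤ} {f : DHom 𝔥 ζ w v} {g : DHom 𝔥 ζ v u}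
    (hf : f ∈ deg 𝔥 ζ w v d) (hg : g ∈ deg 𝔥 ζ v u e) : comp f g ∈ deg 𝔥 ζ w u (d + e) := by
  induction hf, hg using Submodule.span_induction₂ with
  | mem_mem x y hx hy =>
    obtain ⟨D, hD, rfl⟩ := hx
    obtain ⟨E, hE, rfl⟩ := hy
    exact Submodule.subset_span ⟨_, hD.comp hE, rfl⟩
  | zero_left y hy => simp
  | zero_right x hx => simp
  | add_left x y z _ _ _ h1 h2 => simpa using add_mem h1 h2
  | add_right x y z _ _ _ h1 h2 => simpa using add_mem h1 h2
  | smul_left r x y _ _ h => simpa using Submodule.smul_mem _ r h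
  | smul_right r x y _ _ h => simpa using Submodule.smul_mem _ r h

/-- A homogeneous diagram of the wrong parity vanishes. -/
theorem mk_eq_zero_or_parity {w v : List B} {D : Diag M k V w v} {e : ℤ} (h : D.Homog e) :
    (mk D : DHom 𝔥 ζ w v) = 0 ∨ Even (e + w.length + v.length) := by
  induction h with
  | id w => right; exact ⟨w.length, by ring⟩
  | @comp w v u D E d e hD hE h1 h2 =>
    rcases h1 with h1 | h1
    · left; rw [← comp_mk, h1]; simp
    rcases h2 with h2 | h2
    · left; rw [← comp_mk, h2]; simp
    right; obtain ⟨a, ha⟩ := h1; obtain ⟨b, hb⟩ := h2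
    exact ⟨a + b - v.length, by linarith⟩
  | @tens w v w' v' D E d e hD hE h1 h2 =>
    rcases h1 with h1 | h1
    · left; rw [← tens_mk, h1]; simp
    rcases h2 with h2 | h2
    · left; rw [← tens_mk, h2]; simp
    right; obtain ⟨a, ha⟩ := h1; obtain ⟨b, hb⟩ := h2
    exact ⟨a + b, by simp only [List.length_append, Nat.cast_add]; linarith⟩
  | zero w v d => left; rfl
  | @add w v D E d hD hE h1 h2 =>
    rcases h1 with h1 | h1
    · rcases h2 with h2 | h2
      · left
        change (mk D : DHom 𝔥 ζ w v) + mk E = 0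
        rw [h1, h2, add_zero]
      · exact Or.inr h2
    · exact Or.inr h1
  | @smul w v D d c hD h1 =>
    rcases h1 with h1 | h1
    · left
      change c • (mk D : DHom 𝔥 ζ w v) = 0
      rw [h1, smul_zero]
    · exact Or.inr h1
  | @box f n hf => right; exact ⟨n, by simp; ring⟩
  | endDot s => right; exact ⟨1, by simp⟩
  | startDot s => right; exact ⟨1, by simp⟩
  | split s => right; exact ⟨1, by simp⟩
  | merge s => right; exact ⟨1, by simp⟩
  | vtx s t n h =>
    right
    have : ∀ (a b : B) (m : ℕ), (alt a b m).length = m := by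
      intro a b m
      induction m generalizing a b with
      | zero => rfl
      | succ m ih => simp [alt, ih]
    rw [this, this]
    exact ⟨(n + 2 : ℕ), by ring⟩

theorem eq_zero_of_mem_deg {w v : List B} {e : ℤ} {f : DHom 𝔥 ζ w v} (hf : f ∈ deg 𝔥 ζ w v e)
    (he : ¬ Even (e + w.length + v.length)) : f = 0 := by
  induction hf using Submodule.span_induction with
  | mem x hx =>
    obtain ⟨D, hD, rfl⟩ := hx
    exact (mk_eq_zero_or_parity hD).resolve_right he
  | zero => rfl
  | add x y _ _ hx hy => rw [hx, hy, add_zero]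
  | smul c x _ hx => rw [hx, smul_zero]

end DHom

/-! ## Sequences and the bigraded morphism spaces -/

end Diagrams

/-- A sequence of finite formal sums of shifted words with finitely many nonzero terms: the term in
position `p` is `⨁_{a, pos a = p} B_{word a}(shift a)`. -/
structure Seq (B : Type uB) : Type (max 1 uB) where
  ι : Type
  [fintype : Fintype ι]
  pos : ι → ℤ
  word : ι → List B
  shift : ι → ℤ

attribute [instance] Seq.fintype

namespace Seq

variable {B : Type uB}

/-- The parity of a summand: a nonzero component of cohomological degree `i` between two summands
`a`, `b` has `i ≡ sigma a + sigma b` modulo `2`. -/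
def sigma (F : Seq B) (a : F.ι) : ℤ := (F.word a).length + F.shift a + F.pos a

/-- The convolution product of sequences. -/
def star (F G : Seq B) : Seq B where
  ι := F.ι × G.ι
  pos a := F.pos a.1 + G.pos a.2
  word a := F.word a.1 ++ G.word a.2
  shift a := F.shift a.1 + G.shift a.2

/-- The sequence which consists of the empty word in position `0`. -/
def unit (B : Type uB) : Seq B where
  ι := Unit
  pos _ := 0
  word _ := []
  shift _ := 0

end Seq

section BE

variable {B : Type uB} {M : CoxeterMatrix B} {k : Type uk} [CommRing k]
  {V : Type uV} [AddCommGroup V] [Module k V]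
  {W : Type uW} [Group W] {cs : CoxeterSystem M W}
  (𝔥 : Realization cs k V) (ζ : LowerTerms M k V)

/-- The (biequivariant) morphism space of two sequences: matrices of morphisms. -/
abbrev HomBE (F G : Seq B) : Type (max uB uk uV) :=
  (a : F.ι) → (b : G.ι) → DHom 𝔥 ζ (F.word a) (G.word b)

/-- The part of bidegree `(i, j)`: the product of the spaces of morphisms from the term of `F` in
position `p` to the term of `G` in position `q`, shifted by `j`, over `q - p = i - j`. -/
def bidegBE (F G : Seq B) (i j : ℤ) : Submodule k (HomBE 𝔥 ζ F G) where
  carrier := {f | ∀ a b, (i - j = G.pos b - F.pos a →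
      f a b ∈ DHom.deg 𝔥 ζ (F.word a) (G.word b) (j + G.shift b - F.shift a)) ∧
    (i - j ≠ G.pos b - F.pos a → f a b = 0)}
  zero_mem' := fun _ _ => ⟨fun _ => zero_mem _, fun _ => rfl⟩
  add_mem' := fun {f g} hf hg a b => ⟨fun h => add_mem ((hf a b).1 h) ((hg a b).1 h),
    fun h => by simp [(hf a b).2 h, (hg a b).2 h]⟩
  smul_mem' := fun c f hf a b => ⟨fun h => Submodule.smul_mem _ c ((hf a b).1 h),
    fun h => by simp [(hf a b).2 h]⟩

variable {𝔥 ζ}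

/-- Composition of matrices, `compBE g f = g ∘ f`. -/
def compBE {F G K : Seq B} :
    HomBE 𝔥 ζ G K →ₗ[k] HomBE 𝔥 ζ F G →ₗ[k] HomBE 𝔥 ζ F K :=
  LinearMap.mk₂ k (fun g f a c => ∑ b, DHom.comp (f a b) (g b c))
    (fun g g' f => by funext a c; simp [Finset.sum_add_distrib])
    (fun r g f => by funext a c; simp [Finset.smul_sum])
    (fun g f f' => by funext a c; simp [Finset.sum_add_distrib])
    (fun r g f => by funext a c; simp [Finset.smul_sum])

open Classical in
/-- The isomorphism of sequences which permutes the summands according to a bijection that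
preserves the words. -/
def reindexBE {F G : Seq B} (e : F.ι ≃ G.ι) (h : ∀ a, F.word a = G.word (e a)) :
    HomBE 𝔥 ζ F G :=
  fun a => Pi.single (e a) (DHom.mk (Diag.eqId (h a)))

variable (𝔥 ζ) in
/-- The identity of a sequence. -/
def idBE (F : Seq B) : HomBE 𝔥 ζ F F := reindexBE (Equiv.refl _) (fun _ => rfl)

/-- The map `f ↦ r ⋆ f`, which puts a box on the left. -/
def boxLeft {F G : Seq B} (r : SymmetricAlgebra k (Module.Dual k V)) :
    HomBE 𝔥 ζ F G →ₗ[k] HomBE 𝔥 ζ F G where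
  toFun f a b := (DHom.tens (DHom.mk (Diag.box r)) (f a b) :
    DHom 𝔥 ζ ([] ++ F.word a) ([] ++ G.word b))
  map_add' f g := by
    funext a b
    exact map_add (DHom.tens (DHom.mk (Diag.box r) : DHom 𝔥 ζ [] [])) (f a b) (g a b)
  map_smul' c f := by
    funext a b
    exact map_smul (DHom.tens (DHom.mk (Diag.box r) : DHom 𝔥 ζ [] [])) c (f a b)

variable (𝔥 ζ) in
open Classical in
/-- The endomorphism `id ⋆ r`, with a box on the right. -/
def idBoxRight (F : Seq B) (r : SymmetricAlgebra k (Module.Dual k V)) : HomBE 𝔥 ζ F F :=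
  fun a => Pi.single a (DHom.mk (Diag.cast (List.append_nil _) (List.append_nil _)
    (Diag.tens (Diag.id (F.word a)) (Diag.box r))))

/-- The convolution product of morphisms. -/
def starBE {F G F' G' : Seq B} :
    HomBE 𝔥 ζ F G →ₗ[k] HomBE 𝔥 ζ F' G' →ₗ[k] HomBE 𝔥 ζ (F.star F') (G.star G') :=
  LinearMap.mk₂ k
    (fun f h a b => (F.sigma a.1 * (F'.sigma a.2 + G'.sigma b.2)).negOnePow •
      DHom.tens (f a.1 b.1) (h a.2 b.2))
    (fun f f' h => by
      funext a b
      exact (congrArg _ (LinearMap.map_add₂ DHom.tens (f a.1 b.1) (f' a.1 b.1) _)).trans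
        (smul_add _ _ _))
    (fun r f h => by
      funext a b
      exact (congrArg _ (LinearMap.map_smul₂ DHom.tens r (f a.1 b.1) _)).trans
        (smul_comm _ _ _))
    (fun f h h' => by
      funext a b
      exact (congrArg _ (map_add (DHom.tens (f a.1 b.1)) (h a.2 b.2) (h' a.2 b.2))).trans
        (smul_add _ _ _))
    (fun r f h => by
      funext a b
      exact (congrArg _ (map_smul (DHom.tens (f a.1 b.1)) r (h a.2 b.2))).trans
        (smul_comm _ _ _))

/-- The components of cohomological degree congruent to `p` modulo `2`. -/
def partBE {F G : Seq B} (p : ZMod 2) : HomBE 𝔥 ζ F G →ₗ[k] HomBE 𝔥 ζ F G where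
  toFun f a b := if ((F.sigma a + G.sigma b : ℤ) : ZMod 2) = p then f a b else 0
  map_add' f g := by funext a b; dsimp; split_ifs <;> simp
  map_smul' c f := by funext a b; dsimp; split_ifs <;> simp

theorem partBE_apply {F G : Seq B} (p : ZMod 2) (f : HomBE 𝔥 ζ F G) (a : F.ι) (b : G.ι) :
    partBE p f a b = if ((F.sigma a + G.sigma b : ℤ) : ZMod 2) = p then f a b else 0 := rfl

theorem sum_partBE {F G : Seq B} (f : HomBE 𝔥 ζ F G) : ∑ p, partBE p f = f := by
  funext a b
  simp [Finset.sum_apply, partBE_apply]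

theorem partBE_partBE {F G : Seq B} (p q : ZMod 2) (f : HomBE 𝔥 ζ F G) :
    partBE p (partBE q f) = if p = q then partBE q f else 0 := by
  funext a b
  by_cases h : p = q
  · subst h; simp only [partBE_apply, if_true]; split_ifs <;> rfl
  · simp only [partBE_apply, if_neg h]
    split_ifs with h1 h2
    · exact absurd (h1.symm.trans h2) h
    all_goals rfl

theorem compBE_apply {F G K : Seq B} (g : HomBE 𝔥 ζ G K) (f : HomBE 𝔥 ζ F G) (a : F.ι) (c : K.ι) :
    compBE g f a c = ∑ b, DHom.comp (f a b) (g b c) := rfl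

theorem compBE_assoc {F G K L : Seq B} (h : HomBE 𝔥 ζ K L) (g : HomBE 𝔥 ζ G K)
    (f : HomBE 𝔥 ζ F G) : compBE (compBE h g) f = compBE h (compBE g f) := by
  funext a d
  simp only [compBE_apply, map_sum, LinearMap.sum_apply, DHom.comp_assoc]
  exact Finset.sum_comm

theorem idBE_self (F : Seq B) (a : F.ι) : idBE 𝔥 ζ F a a = DHom.mk (Diag.id _) := by
  classical
  exact Pi.single_eq_same (M := fun b => DHom 𝔥 ζ (F.word a) (F.word b)) a _

theorem idBE_ne {F : Seq B} {a b : F.ι} (h : b ≠ a) : idBE 𝔥 ζ F a b = 0 := by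
  classical
  simp only [idBE, reindexBE]
  exact Pi.single_eq_of_ne h _

theorem idBE_comp {F G : Seq B} (f : HomBE 𝔥 ζ F G) : compBE (idBE 𝔥 ζ G) f = f := by
  funext a c
  rw [compBE_apply, Finset.sum_eq_single c]
  · rw [idBE_self, DHom.comp_id]
  · intro b _ hb; rw [idBE_ne hb.symm, map_zero]
  · simp

theorem comp_idBE {F G : Seq B} (f : HomBE 𝔥 ζ F G) : compBE f (idBE 𝔥 ζ F) = f := by
  funext a c
  rw [compBE_apply, Finset.sum_eq_single a]
  · rw [idBE_self, DHom.id_comp]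
  · intro b _ hb; rw [idBE_ne hb, map_zero, LinearMap.zero_apply]
  · simp

theorem zmod_two_add_self (x : ZMod 2) : x + x = 0 := by
  revert x; decide

theorem sigma_cast {F G K : Seq B} (a : F.ι) (b : G.ι) (c : K.ι) :
    ((F.sigma a + K.sigma c : ℤ) : ZMod 2) =
      ((F.sigma a + G.sigma b : ℤ) : ZMod 2) + ((G.sigma b + K.sigma c : ℤ) : ZMod 2) := by
  push_cast
  have := zmod_two_add_self ((G.sigma b : ℤ) : ZMod 2)
  linear_combination -this

theorem partBE_comp {F G K : Seq B} {p q : ZMod 2} {g : HomBE 𝔥 ζ G K} {f : HomBE 𝔥 ζ F G}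
    (hg : partBE p g = g) (hf : partBE q f = f) :
    partBE (p + q) (compBE g f) = compBE g f := by
  funext a c
  rw [partBE_apply]
  split_ifs with h
  · rfl
  · symm
    rw [compBE_apply]
    refine Finset.sum_eq_zero fun b _ => ?_
    rw [← hg, ← hf, partBE_apply, partBE_apply]
    split_ifs with h1 h2
    · exact absurd ((sigma_cast a b c).trans (by rw [h1, h2, add_comm])) h
    all_goals simp

theorem partBE_id (F : Seq B) : partBE 0 (idBE 𝔥 ζ F) = idBE 𝔥 ζ F := by
  funext a b
  rw [partBE_apply]
  split_ifs with h
  · rfl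
  · by_cases hb : b = a
    · subst hb; exact absurd (by push_cast; exact zmod_two_add_self _) h
    · rw [idBE_ne hb]

theorem partBE_boxLeft {F G : Seq B} {p : ZMod 2} {f : HomBE 𝔥 ζ F G} (hf : partBE p f = f)
    (r : SymmetricAlgebra k (Module.Dual k V)) : partBE p (boxLeft r f) = boxLeft r f := by
  funext a b
  rw [partBE_apply]
  split_ifs with h
  · rfl
  · change 0 = (DHom.tens (DHom.mk (Diag.box r)) (f a b) :
      DHom 𝔥 ζ ([] ++ F.word a) ([] ++ G.word b))
    rw [← hf, partBE_apply, if_neg h]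
    exact (map_zero _).symm

theorem boxLeft_comp_left {F G K : Seq B} (r : SymmetricAlgebra k (Module.Dual k V))
    (g : HomBE 𝔥 ζ G K) (f : HomBE 𝔥 ζ F G) :
    boxLeft r (compBE g f) = compBE (boxLeft r g) f := by
  funext a c
  change DHom.tens (DHom.mk (Diag.box r)) (∑ b, DHom.comp (f a b) (g b c)) =
    ∑ b, DHom.comp (f a b) (boxLeft r g b c)
  rw [map_sum]
  refine Finset.sum_congr rfl fun b _ => ?_
  have h := DHom.interchange (DHom.mk (Diag.id [])) (DHom.mk (Diag.box r) : DHom 𝔥 ζ [] [])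
    (f a b) (g b c)
  rw [DHom.id_comp] at h
  have h2 : DHom.tens (DHom.mk (Diag.id [])) (f a b) = f a b := by
    obtain ⟨D⟩ := f a b
    exact DHom.sound (DRel.nil_tens D)
  rw [h2] at h
  exact h

theorem boxLeft_comp_right {F G K : Seq B} (r : SymmetricAlgebra k (Module.Dual k V))
    (g : HomBE 𝔥 ζ G K) (f : HomBE 𝔥 ζ F G) :
    boxLeft r (compBE g f) = compBE g (boxLeft r f) := by
  funext a c
  change DHom.tens (DHom.mk (Diag.box r)) (∑ b, DHom.comp (f a b) (g b c)) =
    ∑ b, DHom.comp (boxLeft r f a b) (g b c)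
  rw [map_sum]
  refine Finset.sum_congr rfl fun b _ => ?_
  have h := DHom.interchange (DHom.mk (Diag.box r) : DHom 𝔥 ζ [] []) (DHom.mk (Diag.id []))
    (f a b) (g b c)
  rw [DHom.comp_id] at h
  have h2 : DHom.tens (DHom.mk (Diag.id [])) (g b c) = g b c := by
    obtain ⟨D⟩ := g b c
    exact DHom.sound (DRel.nil_tens D)
  rw [h2] at h
  exact h

theorem partBE_of_mem {F G : Seq B} {i j : ℤ} {f : HomBE 𝔥 ζ F G} (hf : f ∈ bidegBE 𝔥 ζ F G i j) :
    partBE (i : ZMod 2) f = f := by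
  funext a b
  rw [partBE_apply]
  split_ifs with h
  · rfl
  · by_cases hp : i - j = G.pos b - F.pos a
    · refine (DHom.eq_zero_of_mem_deg ((hf a b).1 hp) fun he => h ?_).symm
      rw [← sub_eq_zero, ← Int.cast_sub, ZMod.intCast_zmod_eq_zero_iff_dvd _ 2]
      obtain ⟨m, hm⟩ := he
      refine ⟨m - j + F.shift a + F.pos a, ?_⟩
      simp only [Seq.sigma]
      push_cast
      linarith
    · exact ((hf a b).2 hp).symm

theorem compBE_mem {F G K : Seq B} {i j i' j' : ℤ} {g : HomBE 𝔥 ζ G K} {f : HomBE 𝔥 ζ F G}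
    (hg : g ∈ bidegBE 𝔥 ζ G K i j) (hf : f ∈ bidegBE 𝔥 ζ F G i' j') :
    compBE g f ∈ bidegBE 𝔥 ζ F K (i + i') (j + j') := by
  intro a c
  have key : ∀ b, DHom.comp (f a b) (g b c) = 0 ∨ (i' - j' = G.pos b - F.pos a ∧
      i - j = K.pos c - G.pos b) := by
    intro b
    by_cases h1 : i' - j' = G.pos b - F.pos a
    · by_cases h2 : i - j = K.pos c - G.pos b
      · exact Or.inr ⟨h1, h2⟩
      · left; rw [(hg b c).2 h2, map_zero]
    · left; rw [(hf a b).2 h1, map_zero, LinearMap.zero_apply]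
  constructor
  · intro h
    rw [compBE_apply]
    refine Submodule.sum_mem _ fun b _ => ?_
    rcases key b with h0 | ⟨h1, h2⟩
    · rw [h0]; exact zero_mem _
    · have h0 : j + j' + K.shift c - F.shift a =
          (j' + G.shift b - F.shift a) + (j + K.shift c - G.shift b) := by ring
      rw [h0]
      exact DHom.comp_mem_deg ((hf a b).1 h1) ((hg b c).1 h2)
  · intro h
    rw [compBE_apply]
    refine Finset.sum_eq_zero fun b _ => (key b).resolve_right fun ⟨h1, h2⟩ => h (by linarith)

theorem idBE_mem (F : Seq B) : idBE 𝔥 ζ F ∈ bidegBE 𝔥 ζ F F 0 0 := by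
  intro a b
  by_cases hb : b = a
  · subst hb
    rw [idBE_self]
    refine ⟨fun _ => Submodule.subset_span ⟨_, ?_, rfl⟩, fun h => absurd (by ring) h⟩
    have h0 : (0 : ℤ) + F.shift b - F.shift b = 0 := by ring
    rw [h0]
    exact Diag.Homog.id _
  · rw [idBE_ne hb]
    exact ⟨fun _ => zero_mem _, fun _ => rfl⟩

end BE

/-! ## Free-monodromic complexes -/

section FM

variable (k : Type uk) [CommRing k] (V : Type uV) [AddCommGroup V] [Module k V]

/-- `Λ`, the exterior algebra of `V*`. -/
abbrev Lam : Type (max uk uV) := ExteriorAlgebra k (Module.Dual k V)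

/-- `R^∨`, the symmetric algebra of `V`. -/
abbrev Rv : Type (max uk uV) := SymmetricAlgebra k V

variable {k V}

/-- The `p`-th power of the sign involution of `Λ`. -/
def invL (p : ZMod 2) : Lam k V →ₐ[k] Lam k V :=
  if p = 0 then AlgHom.id k _ else CliffordAlgebra.involute

/-- `(-1)^p`. -/
def sgn (p : ZMod 2) : ℤ := if p = 0 then 1 else -1

/-- The contraction of `Λ` with `x ∈ V`. -/
def contractV (x : V) : Lam k V →ₗ[k] Lam k V :=
  CliffordAlgebra.contractLeft (Module.Dual.eval k V x)

/-- The contraction of `R^∨` with `r ∈ V*`: the derivation which sends `v ∈ V` to `⟨r, v⟩`. -/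
def contractDual (r : Module.Dual k V) : Rv k V →ₗ[k] Rv k V :=
  (TrivSqZeroExt.sndHom (Rv k V) (Rv k V)).restrictScalars k ∘ₗ
    (SymmetricAlgebra.lift
      (((TrivSqZeroExt.inlAlgHom k (Rv k V) (Rv k V)).toLinearMap ∘ₗ SymmetricAlgebra.ι k V) +
        ((TrivSqZeroExt.inrHom (Rv k V) (Rv k V)).restrictScalars k ∘ₗ
          Algebra.linearMap k (Rv k V) ∘ₗ r))).toLinearMap

theorem contractDual_ι (r : Module.Dual k V) (v : V) :
    contractDual r (SymmetricAlgebra.ι k V v) = algebraMap k _ (r v) := by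
  simp [contractDual, Algebra.algebraMap_eq_smul_one]

theorem contractDual_mul (r : Module.Dual k V) (x y : Rv k V) :
    contractDual r (x * y) = contractDual r x * y + x * contractDual r y := by
  have hfst : ∀ z : Rv k V, (SymmetricAlgebra.lift
      (((TrivSqZeroExt.inlAlgHom k (Rv k V) (Rv k V)).toLinearMap ∘ₗ SymmetricAlgebra.ι k V) +
        ((TrivSqZeroExt.inrHom (Rv k V) (Rv k V)).restrictScalars k ∘ₗ
          Algebra.linearMap k (Rv k V) ∘ₗ r)) z).fst = z := by
    intro z
    change ((TrivSqZeroExt.fstHom k (Rv k V) (Rv k V)).comp (SymmetricAlgebra.lift _)) z =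
      AlgHom.id k _ z
    congr 1
    apply SymmetricAlgebra.algHom_ext
    ext v
    simp
  simp only [contractDual, LinearMap.comp_apply, AlgHom.toLinearMap_apply, map_mul,
    LinearMap.restrictScalars_apply, TrivSqZeroExt.sndHom_apply, TrivSqZeroExt.snd_mul, hfst]
  simp [mul_comm, add_comm]

theorem invL_invL (p q : ZMod 2) (x : Lam k V) : invL p (invL q x) = invL (p + q) x := by
  have h2 : (1 : ZMod 2) + 1 = 0 := zmod_two_add_self 1
  have h1 : (1 : ZMod 2) ≠ 0 := one_ne_zero
  have : ∀ p : ZMod 2, p = 0 ∨ p = 1 := by decide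
  rcases this p with rfl | rfl <;> rcases this q with rfl | rfl <;>
    simp [invL, h2, CliffordAlgebra.involute_involute]

theorem contractV_mul (x : V) (a b : Lam k V) :
    contractV x (a * b) = contractV x a * b + invL 1 a * contractV x b := by
  have h1 : (1 : ZMod 2) ≠ 0 := one_ne_zero
  simp only [contractV, invL, if_neg h1]
  induction a using CliffordAlgebra.left_induction with
  | algebraMap r =>
    rw [CliffordAlgebra.contractLeft_algebraMap_mul, CliffordAlgebra.contractLeft_algebraMap,
      AlgHom.commutes]
    simp
  | add a a' h h' => simp only [add_mul, map_add, h, h']; abel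
  | ι_mul a m h =>
    rw [mul_assoc, CliffordAlgebra.contractLeft_ι_mul, CliffordAlgebra.contractLeft_ι_mul, h,
      map_mul, CliffordAlgebra.involute_ι]
    simp only [mul_add, sub_mul, smul_mul_assoc, mul_assoc, neg_mul]
    abel

theorem contractV_involute (x : V) (a : Lam k V) :
    contractV x (CliffordAlgebra.involute a) = -CliffordAlgebra.involute (contractV x a) := by
  simp only [contractV]
  induction a using CliffordAlgebra.left_induction with
  | algebraMap r =>
    rw [AlgHom.commutes, CliffordAlgebra.contractLeft_algebraMap]
    simp
  | add a a' h h' => simp only [map_add, h, h']; abel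
  | ι_mul a m h =>
    rw [map_mul, CliffordAlgebra.involute_ι, neg_mul, map_neg, CliffordAlgebra.contractLeft_ι_mul,
      CliffordAlgebra.contractLeft_ι_mul, h, map_sub, map_mul, CliffordAlgebra.involute_ι, map_smul]
    simp

theorem contractV_invL (x : V) (p : ZMod 2) (a : Lam k V) :
    contractV x (invL p a) = sgn p • invL p (contractV x a) := by
  have : p = 0 ∨ p = 1 := by revert p; decide
  have h1 : (1 : ZMod 2) ≠ 0 := one_ne_zero
  rcases this with rfl | rfl
  · simp [invL, sgn]
  · simp [invL, sgn, contractV_involute]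

theorem involute_of_mem_pow {n : ℕ} {a : Lam k V}
    (ha : a ∈ LinearMap.range (ExteriorAlgebra.ι k (M := Module.Dual k V)) ^ n) :
    CliffordAlgebra.involute a = (n : ℤ).negOnePow • a := by
  induction ha using Submodule.pow_induction_on_left' with
  | algebraMap r => simp
  | add x y i _ _ hx hy => rw [map_add, hx, hy, smul_add]
  | mem_mul m hm i x _ hx =>
    obtain ⟨v, rfl⟩ := hm
    have h : CliffordAlgebra.involute (ExteriorAlgebra.ι k v) = -ExteriorAlgebra.ι k v :=
      CliffordAlgebra.involute_ι v
    rw [map_mul, hx, h]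
    push_cast
    rw [Int.negOnePow_succ]
    rcases Int.even_or_odd (i : ℤ) with h' | h' <;>
      simp [Int.negOnePow_even, Int.negOnePow_odd, h']

theorem invL_mem_pow {n : ℕ} {a : Lam k V} (p : ZMod 2)
    (ha : a ∈ LinearMap.range (ExteriorAlgebra.ι k (M := Module.Dual k V)) ^ n) :
    invL p a ∈ LinearMap.range (ExteriorAlgebra.ι k (M := Module.Dual k V)) ^ n := by
  rw [invL]
  split_ifs
  · exact ha
  · rw [involute_of_mem_pow ha]
    rcases Int.even_or_odd (n : ℤ) with h | h
    · rw [Int.negOnePow_even _ h, one_smul]; exact ha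
    · rw [Int.negOnePow_odd _ h, Units.neg_smul, one_smul]; exact neg_mem ha

variable {B : Type uB} {M : CoxeterMatrix B} {W : Type uW} [Group W] {cs : CoxeterSystem M W}
  (𝔥 : Realization cs k V) (ζ : LowerTerms M k V)

/-- The free-monodromic morphism space `Λ ⊗ Hom_BE(F, G) ⊗ R^∨` of two sequences. -/
abbrev HomFM (F G : Seq B) : Type (max uB uk uV) :=
  Lam k V ⊗[k] (HomBE 𝔥 ζ F G ⊗[k] Rv k V)

/-- The part of bidegree `(i, j)`, where `V* ⊆ Λ` has bidegree `(1, 2)` and `V ⊆ R^∨` has bidegree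
`(0, -2)`. -/
def bideg (F G : Seq B) (i j : ℤ) : Submodule k (HomFM 𝔥 ζ F G) :=
  Submodule.span k {z | ∃ (p q : ℕ) (i' j' : ℤ) (r : Lam k V) (f : HomBE 𝔥 ζ F G) (x : Rv k V),
    r ∈ LinearMap.range (ExteriorAlgebra.ι k (M := Module.Dual k V)) ^ p ∧
    f ∈ bidegBE 𝔥 ζ F G i' j' ∧ x ∈ LinearMap.range (SymmetricAlgebra.ι k V) ^ q ∧
    i = p + i' ∧ j = 2 * p + j' - 2 * q ∧ z = r ⊗ₜ (f ⊗ₜ x)}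

variable {𝔥 ζ}

/-- Composition, `compFM g f = g ∘ f`:
`(r ⊗ f ⊗ x) ∘ (s ⊗ g ⊗ y) = (-1)^{|f||s|} (r ∧ s) ⊗ (f ∘ g) ⊗ xy`. -/
def compFM {F G K : Seq B} :
    HomFM 𝔥 ζ G K →ₗ[k] HomFM 𝔥 ζ F G →ₗ[k] HomFM 𝔥 ζ F K :=
  ∑ p : ZMod 2, TensorProduct.map₂ ((LinearMap.mul k (Lam k V)).compl₂ (invL p).toLinearMap)
    (TensorProduct.map₂ (compBE ∘ₗ partBE p) (LinearMap.mul k (Rv k V)))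

/-- A morphism `f` of sequences, seen as `1 ⊗ f ⊗ 1`. -/
def ofBE {F G : Seq B} (f : HomBE 𝔥 ζ F G) : HomFM 𝔥 ζ F G := 1 ⊗ₜ (f ⊗ₜ 1)

variable (𝔥 ζ) in
def idFM (F : Seq B) : HomFM 𝔥 ζ F F := ofBE (idBE 𝔥 ζ F)

theorem compFM_tmul {F G K : Seq B} {p : ZMod 2} {f : HomBE 𝔥 ζ G K} (hf : partBE p f = f)
    (r s : Lam k V) (x y : Rv k V) (g : HomBE 𝔥 ζ F G) :
    compFM (r ⊗ₜ (f ⊗ₜ x)) (s ⊗ₜ (g ⊗ₜ y)) = (r * invL p s) ⊗ₜ (compBE f g ⊗ₜ (x * y)) := by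
  simp only [compFM, LinearMap.sum_apply]
  rw [Finset.sum_eq_single p]
  · simp [TensorProduct.map₂_apply_tmul, hf]
  · intro q _ hq
    have : partBE q f = 0 := by rw [← hf, partBE_partBE, if_neg hq]
    simp [TensorProduct.map₂_apply_tmul, this]
  · simp

theorem HomFM.ind {F G : Seq B} {P : HomFM 𝔥 ζ F G → Prop} (h0 : P 0)
    (hadd : ∀ x y, P x → P y → P (x + y))
    (h : ∀ (p : ZMod 2) (r : Lam k V) (f : HomBE 𝔥 ζ F G) (x : Rv k V), partBE p f = f →
      P (r ⊗ₜ (f ⊗ₜ x))) (z : HomFM 𝔥 ζ F G) : P z := by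
  induction z using TensorProduct.induction_on with
  | zero => exact h0
  | add x y hx hy => exact hadd x y hx hy
  | tmul r w =>
    induction w using TensorProduct.induction_on with
    | zero => rw [TensorProduct.tmul_zero]; exact h0
    | add x y hx hy => rw [TensorProduct.tmul_add]; exact hadd _ _ hx hy
    | tmul f x =>
      rw [← sum_partBE f, TensorProduct.sum_tmul, TensorProduct.tmul_sum]
      refine Finset.sum_induction _ P hadd h0 fun p _ => h p r _ x ?_
      rw [partBE_partBE, if_pos rfl]

theorem compFM_assoc {F G K L : Seq B} (h : HomFM 𝔥 ζ K L) (g : HomFM 𝔥 ζ G K)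
    (f : HomFM 𝔥 ζ F G) : compFM (compFM h g) f = compFM h (compFM g f) := by
  induction h using HomFM.ind with
  | h0 => simp
  | hadd x y hx hy => simp only [map_add, LinearMap.add_apply, hx, hy]
  | h p r a x ha =>
    induction g using HomFM.ind with
    | h0 => simp
    | hadd x y hx hy => simp only [map_add, LinearMap.add_apply, hx, hy]
    | h q s b y hb =>
      induction f using HomFM.ind with
      | h0 => simp
      | hadd x y hx hy => simp only [map_add, hx, hy]
      | h q' t c z hc =>
        rw [compFM_tmul ha, compFM_tmul hb, compFM_tmul (partBE_comp ha hb), compFM_tmul ha,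
          map_mul, invL_invL, compBE_assoc, mul_assoc, mul_assoc]

theorem idFM_comp {F G : Seq B} (f : HomFM 𝔥 ζ F G) : compFM (idFM 𝔥 ζ G) f = f := by
  induction f using HomFM.ind with
  | h0 => simp
  | hadd x y hx hy => simp only [map_add, hx, hy]
  | h p r a x ha =>
    rw [idFM, ofBE, compFM_tmul (partBE_id G), idBE_comp, one_mul, one_mul]
    simp [invL]

theorem comp_idFM {F G : Seq B} (f : HomFM 𝔥 ζ F G) : compFM f (idFM 𝔥 ζ F) = f := by
  induction f using HomFM.ind with
  | h0 => simp
  | hadd x y hx hy => simp only [map_add, LinearMap.add_apply, hx, hy]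
  | h p r a x ha =>
    rw [idFM, ofBE, compFM_tmul ha, comp_idBE, map_one, mul_one, mul_one]

theorem compFM_mem {F G K : Seq B} {i j i' j' : ℤ} {g : HomFM 𝔥 ζ G K} {f : HomFM 𝔥 ζ F G}
    (hg : g ∈ bideg 𝔥 ζ G K i j) (hf : f ∈ bideg 𝔥 ζ F G i' j') :
    compFM g f ∈ bideg 𝔥 ζ F K (i + i') (j + j') := by
  induction hg, hf using Submodule.span_induction₂ with
  | mem_mem x y hx hy =>
    obtain ⟨p, q, i1, j1, r, f, x, hr, hf, hx, rfl, rfl, rfl⟩ := hx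
    obtain ⟨p', q', i2, j2, s, g, y, hs, hg, hy, rfl, rfl, rfl⟩ := hy
    rw [compFM_tmul (partBE_of_mem hf)]
    refine Submodule.subset_span ⟨p + p', q + q', i1 + i2, j1 + j2, _, _, _, ?_,
      compBE_mem hf hg, ?_, by push_cast; ring, by push_cast; ring, rfl⟩
    · rw [pow_add]; exact Submodule.mul_mem_mul hr (invL_mem_pow _ hs)
    · rw [pow_add]; exact Submodule.mul_mem_mul hx hy
  | zero_left y hy => simp
  | zero_right x hx => simp
  | add_left x y z _ _ _ h1 h2 => simpa using add_mem h1 h2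
  | add_right x y z _ _ _ h1 h2 => simpa using add_mem h1 h2
  | smul_left r x y _ _ h => simpa using Submodule.smul_mem _ r h
  | smul_right r x y _ _ h => simpa using Submodule.smul_mem _ r h

theorem ofBE_mem {F G : Seq B} {f : HomBE 𝔥 ζ F G} (hf : f ∈ bidegBE 𝔥 ζ F G 0 0) :
    ofBE f ∈ bideg 𝔥 ζ F G 0 0 :=
  Submodule.subset_span ⟨0, 0, 0, 0, 1, _, 1, by simp, hf, by simp, by simp, by simp, rfl⟩

/-- The sign `(-1)^{|z|}` for the cohomological degree. -/
def signFM {F G : Seq B} : HomFM 𝔥 ζ F G →ₗ[k] HomFM 𝔥 ζ F G :=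
  ∑ p : ZMod 2, TensorProduct.map (sgn p • (invL 1).toLinearMap)
    (TensorProduct.map (partBE p) LinearMap.id)

theorem signFM_tmul {F G : Seq B} {p : ZMod 2} {f : HomBE 𝔥 ζ F G} (hf : partBE p f = f)
    (r : Lam k V) (x : Rv k V) :
    signFM (r ⊗ₜ[k] (f ⊗ₜ[k] x)) = (sgn p • invL 1 r) ⊗ₜ[k] (f ⊗ₜ[k] x) := by
  simp only [signFM, LinearMap.sum_apply]
  rw [Finset.sum_eq_single p]
  · simp [hf]
  · intro q _ hq
    have : partBE q f = 0 := by rw [← hf, partBE_partBE, if_neg hq]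
    simp [this]
  · simp

theorem signFM_of_mem {F G : Seq B} {i j : ℤ} {g : HomFM 𝔥 ζ F G} (hg : g ∈ bideg 𝔥 ζ F G i j) :
    signFM g = i.negOnePow • g := by
  have hsgn : ∀ m : ℤ, sgn (m : ZMod 2) = (m.negOnePow : ℤ) := by
    intro m
    rcases Int.even_or_odd m with h | h
    · rw [Int.negOnePow_even _ h, sgn, if_pos ((ZMod.intCast_zmod_eq_zero_iff_dvd _ 2).2
        (even_iff_two_dvd.1 h))]
      rfl
    · rw [Int.negOnePow_odd _ h, sgn, if_neg]
      · rfl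
      · rw [ZMod.intCast_zmod_eq_zero_iff_dvd _ 2]
        exact fun h' => (Int.not_even_iff_odd.2 h) (even_iff_two_dvd.2 h')
  induction hg using Submodule.span_induction with
  | mem x hx =>
    obtain ⟨p, q, i1, j1, r, f, x, hr, hf, hx, rfl, rfl, rfl⟩ := hx
    have h1 : (1 : ZMod 2) ≠ 0 := one_ne_zero
    rw [signFM_tmul (partBE_of_mem hf), hsgn, invL, if_neg h1, involute_of_mem_pow hr,
      Int.negOnePow_add, mul_comm, mul_smul]
    rcases Int.even_or_odd i1 with h | h <;> rcases Int.even_or_odd (p : ℤ) with h' | h' <;>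
      simp [Int.negOnePow_even, Int.negOnePow_odd, h, h', TensorProduct.neg_tmul]
  | zero => simp
  | add x y _ _ hx hy => rw [map_add, hx, hy, smul_add]
  | smul c x _ hx =>
    rw [map_smul, hx]
    rcases Int.even_or_odd i with h | h <;> simp [Int.negOnePow_even, Int.negOnePow_odd, h]

variable (𝔥 ζ) in
/-- A sequence with an endomorphism `δ`, on which no condition is imposed. -/
structure PreComplex : Type (max 1 uB uk uV) where
  seq : Seq B
  δ : HomFM 𝔥 ζ seq seq

/-! ### Convolution of morphisms -/

/-- The embedding of `Λ ⊗ Hom_BE`. -/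
def inclLhd {F G : Seq B} : Lam k V ⊗[k] HomBE 𝔥 ζ F G →ₗ[k] HomFM 𝔥 ζ F G :=
  TensorProduct.map LinearMap.id ((TensorProduct.mk k (HomBE 𝔥 ζ F G) (Rv k V)).flip 1)

/-- The embedding of `Hom_BE ⊗ R^∨`. -/
def inclRhd {F G : Seq B} : HomBE 𝔥 ζ F G ⊗[k] Rv k V →ₗ[k] HomFM 𝔥 ζ F G :=
  TensorProduct.mk k (Lam k V) (HomBE 𝔥 ζ F G ⊗[k] Rv k V) 1

variable (𝔥 ζ) in
/-- The subspace `Λ ⊗ Hom_BE`. -/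
def lhd (F G : Seq B) : Submodule k (HomFM 𝔥 ζ F G) := LinearMap.range inclLhd

variable (𝔥 ζ) in
/-- The subspace `Hom_BE ⊗ R^∨`. -/
def rhd (F G : Seq B) : Submodule k (HomFM 𝔥 ζ F G) := LinearMap.range inclRhd

/-- The convolution of an element of `Λ ⊗ Hom_BE` with an element of `Hom_BE ⊗ R^∨`,
`(r ⊗ f) ⋆ (h ⊗ z) = r ⊗ (f ⋆ h) ⊗ z`. It is written on the whole spaces, with the augmentations
on the factors which are trivial for such elements. -/
def ustar {F G F' G' : Seq B} :
    HomFM 𝔥 ζ F G →ₗ[k] HomFM 𝔥 ζ F' G' →ₗ[k] HomFM 𝔥 ζ (F.star F') (G.star G') :=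
  TensorProduct.map₂
    ((LinearMap.lsmul k (Lam k V)).flip.compl₂ ExteriorAlgebra.algebraMapInv.toLinearMap)
    (TensorProduct.map₂ starBE
      (LinearMap.lsmul k (Rv k V) ∘ₗ SymmetricAlgebra.algebraMapInv.toLinearMap))

theorem ustar_tmul {F G F' G' : Seq B} (r : Lam k V) (f : HomBE 𝔥 ζ F G) (h : HomBE 𝔥 ζ F' G')
    (z : Rv k V) :
    ustar (r ⊗ₜ[k] (f ⊗ₜ[k] (1 : Rv k V))) ((1 : Lam k V) ⊗ₜ[k] (h ⊗ₜ[k] z)) =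
      r ⊗ₜ[k] (starBE f h ⊗ₜ[k] z) := by
  simp [ustar, TensorProduct.map₂_apply_tmul]

/-- The contraction `x ⌢ f` with `x ∈ V`. -/
def contractLeftFM {F G : Seq B} (x : V) : HomFM 𝔥 ζ F G →ₗ[k] HomFM 𝔥 ζ F G :=
  TensorProduct.map (contractV x) LinearMap.id

/-- The contraction `f ⌢ r` with `r ∈ V*`. -/
def contractRightFM {F G : Seq B} (r : Module.Dual k V) : HomFM 𝔥 ζ F G →ₗ[k] HomFM 𝔥 ζ F G :=
  TensorProduct.map LinearMap.id (TensorProduct.map LinearMap.id (contractDual r))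

namespace PreComplex

/-- `φ` is a ring homomorphism from `R^∨` to the endomorphisms of `F` with `φ(x) = x ⌢ δ` for
`x ∈ V`. There is at most one. -/
structure IsMu (F : PreComplex 𝔥 ζ) (φ : Rv k V →ₗ[k] HomFM 𝔥 ζ F.seq F.seq) : Prop where
  map_one : φ 1 = idFM 𝔥 ζ F.seq
  map_mul : ∀ x y, φ (x * y) = compFM (φ x) (φ y)
  map_ι : ∀ x : V, φ (SymmetricAlgebra.ι k V x) = contractLeftFM x F.δ

/-- `φ` is a ring homomorphism from `Λ` to the endomorphisms of `F` with `φ(r) = δ ⌢ r` for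
`r ∈ V*`. There is at most one. -/
structure IsNu (F : PreComplex 𝔥 ζ) (φ : Lam k V →ₗ[k] HomFM 𝔥 ζ F.seq F.seq) : Prop where
  map_one : φ 1 = idFM 𝔥 ζ F.seq
  map_mul : ∀ x y, φ (x * y) = compFM (φ x) (φ y)
  map_ι : ∀ r : Module.Dual k V, φ (ExteriorAlgebra.ι k r) = contractRightFM r F.δ

/-- The ring homomorphism `μ_F` (and a meaningless value if it does not exist). -/
def mu (F : PreComplex 𝔥 ζ) : Rv k V →ₗ[k] HomFM 𝔥 ζ F.seq F.seq := Classical.epsilon F.IsMu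

/-- The ring homomorphism `ν_F` (and a meaningless value if it does not exist). -/
def nu (F : PreComplex 𝔥 ζ) : Lam k V →ₗ[k] HomFM 𝔥 ζ F.seq F.seq := Classical.epsilon F.IsNu

/-- The operation `⋆̂` on morphism spaces: for `f = r f' x` and `h = t h' z` it is
`f ⋆̂ h = (r f' ∘ ν_F(t)) ⋆ (μ_{G'}(x) ∘ h' z)`. -/
def hat (F G F' G' : PreComplex 𝔥 ζ) :
    HomFM 𝔥 ζ F.seq G.seq →ₗ[k] HomFM 𝔥 ζ F'.seq G'.seq →ₗ[k]
      HomFM 𝔥 ζ (F.seq.star F'.seq) (G.seq.star G'.seq) :=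
  ((TensorProduct.map₂ (compFM (F := F.seq) (G := F.seq) (K := G.seq))
      (compFM (F := F'.seq) (G := G'.seq) (K := G'.seq))).compl₁₂
    (TensorProduct.map inclLhd G'.mu ∘ₗ
      (TensorProduct.assoc k (Lam k V) (HomBE 𝔥 ζ F.seq G.seq) (Rv k V)).symm.toLinearMap)
    (TensorProduct.map F.nu inclRhd)).compr₂ (TensorProduct.lift ustar)

theorem hat_tmul (F G F' G' : PreComplex 𝔥 ζ) (r t : Lam k V) (x z : Rv k V)
    (f : HomBE 𝔥 ζ F.seq G.seq) (h : HomBE 𝔥 ζ F'.seq G'.seq) :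
    hat F G F' G' (r ⊗ₜ (f ⊗ₜ x)) (t ⊗ₜ (h ⊗ₜ z)) =
      ustar (compFM (r ⊗ₜ (f ⊗ₜ 1)) (F.nu t)) (compFM (G'.mu x) (1 ⊗ₜ (h ⊗ₜ z))) := rfl

end PreComplex

theorem ofBE_mem_rhd {F G : Seq B} (f : HomBE 𝔥 ζ F G) : ofBE f ∈ rhd 𝔥 ζ F G := ⟨f ⊗ₜ 1, rfl⟩

theorem ofBE_mem_lhd {F G : Seq B} (f : HomBE 𝔥 ζ F G) : ofBE f ∈ lhd 𝔥 ζ F G := ⟨1 ⊗ₜ f, rfl⟩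

theorem compFM_mem_rhd {F G K : Seq B} {g : HomFM 𝔥 ζ G K} {f : HomFM 𝔥 ζ F G}
    (hg : g ∈ rhd 𝔥 ζ G K) (hf : f ∈ rhd 𝔥 ζ F G) : compFM g f ∈ rhd 𝔥 ζ F K := by
  obtain ⟨g, rfl⟩ := hg
  obtain ⟨f, rfl⟩ := hf
  induction g using TensorProduct.induction_on with
  | zero => simp
  | add x y hx hy => simpa using add_mem hx hy
  | tmul g x =>
    induction f using TensorProduct.induction_on with
    | zero => simp
    | add x y hx hy => simpa using add_mem hx hy
    | tmul f y =>
      rw [← sum_partBE g, TensorProduct.sum_tmul, map_sum, map_sum, LinearMap.sum_apply]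
      refine Submodule.sum_mem _ fun p _ => ?_
      have hp : partBE p (partBE p g) = partBE p g := by rw [partBE_partBE, if_pos rfl]
      refine ⟨compBE (partBE p g) f ⊗ₜ (x * y), ?_⟩
      have := compFM_tmul hp (1 : Lam k V) 1 x y f
      simp only [map_one, mul_one] at this
      exact this.symm

theorem compFM_mem_lhd {F G K : Seq B} {g : HomFM 𝔥 ζ G K} {f : HomFM 𝔥 ζ F G}
    (hg : g ∈ lhd 𝔥 ζ G K) (hf : f ∈ lhd 𝔥 ζ F G) : compFM g f ∈ lhd 𝔥 ζ F K := by
  obtain ⟨g, rfl⟩ := hg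
  obtain ⟨f, rfl⟩ := hf
  induction g using TensorProduct.induction_on with
  | zero => simp
  | add x y hx hy => simpa using add_mem hx hy
  | tmul r g =>
    induction f using TensorProduct.induction_on with
    | zero => simp
    | add x y hx hy => simpa using add_mem hx hy
    | tmul s f =>
      rw [← sum_partBE g, TensorProduct.tmul_sum, map_sum, map_sum, LinearMap.sum_apply]
      refine Submodule.sum_mem _ fun p _ => ?_
      have hp : partBE p (partBE p g) = partBE p g := by rw [partBE_partBE, if_pos rfl]
      refine ⟨(r * invL p s) ⊗ₜ compBE (partBE p g) f, ?_⟩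
      have := compFM_tmul hp r s (1 : Rv k V) 1 f
      simp only [mul_one] at this
      exact this.symm

theorem compFM_ofBE {F G K : Seq B} {g : HomBE 𝔥 ζ G K} {f : HomBE 𝔥 ζ F G} :
    compFM (ofBE g) (ofBE f) = ofBE (compBE g f) := by
  rw [← sum_partBE g]
  simp only [ofBE, TensorProduct.sum_tmul, TensorProduct.tmul_sum, map_sum, LinearMap.sum_apply]
  refine Finset.sum_congr rfl fun p _ => ?_
  have hp : partBE p (partBE p g) = partBE p g := by rw [partBE_partBE, if_pos rfl]
  rw [compFM_tmul hp, map_one, mul_one, mul_one]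

/-! The canonical isomorphisms of sequences. -/

def lamSeq (F : Seq B) : HomBE 𝔥 ζ ((Seq.unit B).star F) F :=
  reindexBE (Equiv.punitProd F.ι) (fun _ => rfl)

def lamSeqInv (F : Seq B) : HomBE 𝔥 ζ F ((Seq.unit B).star F) :=
  reindexBE (Equiv.punitProd F.ι).symm (fun _ => rfl)

def rhoSeq (F : Seq B) : HomBE 𝔥 ζ (F.star (Seq.unit B)) F :=
  reindexBE (Equiv.prodPUnit F.ι) (fun _ => List.append_nil _)

def rhoSeqInv (F : Seq B) : HomBE 𝔥 ζ F (F.star (Seq.unit B)) :=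
  reindexBE (Equiv.prodPUnit F.ι).symm (fun _ => (List.append_nil _).symm)

def alphaSeq (F G K : Seq B) : HomBE 𝔥 ζ (F.star (G.star K)) ((F.star G).star K) :=
  reindexBE (Equiv.prodAssoc F.ι G.ι K.ι).symm (fun _ => (List.append_assoc _ _ _).symm)

def alphaSeqInv (F G K : Seq B) : HomBE 𝔥 ζ ((F.star G).star K) (F.star (G.star K)) :=
  reindexBE (Equiv.prodAssoc F.ι G.ι K.ι) (fun _ => List.append_assoc _ _ _)

/-! ### The differential and the category of complexes -/

section Differential

variable [Module.Free k V] [Module.Finite k V]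

/-- The map `κ`: in terms of a basis `e_i` of `V*` and the dual basis `ě_i` of `V` it is
`r ⊗ f ⊗ x ↦ ∑ (ě_i ⌢ r) ⊗ (e_i ⋆ f) ⊗ x`. -/
def kappa {F G : Seq B} : HomFM 𝔥 ζ F G →ₗ[k] HomFM 𝔥 ζ F G :=
  ∑ i, TensorProduct.map (contractV (Module.Free.chooseBasis k V i))
    (TensorProduct.map
      (boxLeft (SymmetricAlgebra.ι k _ ((Module.Free.chooseBasis k V).coord i))) LinearMap.id)

variable (𝔥 ζ) in
/-- `Θ = ∑ 1 ⊗ (id ⋆ e_i) ⊗ ě_i`. -/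
def Theta (F : Seq B) : HomFM 𝔥 ζ F F :=
  ∑ i, 1 ⊗ₜ (idBoxRight 𝔥 ζ F (SymmetricAlgebra.ι k _ ((Module.Free.chooseBasis k V).coord i)) ⊗ₜ
    SymmetricAlgebra.ι k V (Module.Free.chooseBasis k V i))

variable (𝔥 ζ) in
/-- `θ = ∑ e_i ⊗ id ⊗ ě_i`. -/
def theta (F : Seq B) : HomFM 𝔥 ζ F F :=
  ∑ i, ExteriorAlgebra.ι k ((Module.Free.chooseBasis k V).coord i) ⊗ₜ
    (idBE 𝔥 ζ F ⊗ₜ SymmetricAlgebra.ι k V (Module.Free.chooseBasis k V i))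

theorem kappa_tmul {F G : Seq B} (r : Lam k V) (f : HomBE 𝔥 ζ F G) (x : Rv k V) :
    kappa (r ⊗ₜ (f ⊗ₜ x)) = ∑ i, contractV (Module.Free.chooseBasis k V i) r ⊗ₜ
      (boxLeft (SymmetricAlgebra.ι k _ ((Module.Free.chooseBasis k V).coord i)) f ⊗ₜ x) := by
  simp [kappa]

theorem kappa_comp {F G K : Seq B} (g : HomFM 𝔥 ζ G K) (f : HomFM 𝔥 ζ F G) :
    kappa (compFM g f) = compFM (kappa g) f + compFM (signFM g) (kappa f) := by
  induction g using HomFM.ind with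
  | h0 => simp
  | hadd x y hx hy => simp only [map_add, LinearMap.add_apply, hx, hy]; abel
  | h p r a x ha =>
    induction f using HomFM.ind with
    | h0 => simp
    | hadd x y hx hy => simp only [map_add, hx, hy]; abel
    | h q s b y hb =>
      rw [compFM_tmul ha, kappa_tmul, kappa_tmul, kappa_tmul, signFM_tmul ha, map_sum, map_sum,
        LinearMap.sum_apply, ← Finset.sum_add_distrib]
      refine Finset.sum_congr rfl fun i _ => ?_
      rw [compFM_tmul (partBE_boxLeft ha _), compFM_tmul ha, contractV_mul, contractV_invL,
        TensorProduct.add_tmul, ← boxLeft_comp_left, ← boxLeft_comp_right, smul_mul_assoc,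
        mul_smul_comm]

namespace PreComplex

/-- The differential `d(f) = κ(f) + δ ∘ f + (-1)^{|f|+1} f ∘ δ` in cohomological degree `i`. -/
def d (F G : PreComplex 𝔥 ζ) (i : ℤ) : HomFM 𝔥 ζ F.seq G.seq →ₗ[k] HomFM 𝔥 ζ F.seq G.seq :=
  kappa + compFM G.δ + (i + 1).negOnePow • compFM.flip F.δ

/-- The chain maps. -/
def cocycles (F G : PreComplex 𝔥 ζ) : Submodule k (HomFM 𝔥 ζ F.seq G.seq) :=
  bideg 𝔥 ζ F.seq G.seq 0 0 ⊓ LinearMap.ker (d F G 0)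

/-- The null-homotopic maps. -/
def boundaries (F G : PreComplex 𝔥 ζ) : Submodule k (HomFM 𝔥 ζ F.seq G.seq) :=
  (bideg 𝔥 ζ F.seq G.seq (-1) 0).map (d F G (-1))

theorem mem_cocycles {F G : PreComplex 𝔥 ζ} {f : HomFM 𝔥 ζ F.seq G.seq} :
    f ∈ cocycles F G ↔ f ∈ bideg 𝔥 ζ F.seq G.seq 0 0 ∧
      kappa f + compFM G.δ f - compFM f F.δ = 0 := by
  simp [cocycles, d, Int.negOnePow_odd 1 odd_one, sub_eq_add_neg]

theorem d_neg_one {F G : PreComplex 𝔥 ζ} (f : HomFM 𝔥 ζ F.seq G.seq) :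
    d F G (-1) f = kappa f + compFM G.δ f + compFM f F.δ := by
  simp [d]

theorem comp_mem_cocycles {F G K : PreComplex 𝔥 ζ} {g : HomFM 𝔥 ζ G.seq K.seq}
    {f : HomFM 𝔥 ζ F.seq G.seq} (hg : g ∈ cocycles G K) (hf : f ∈ cocycles F G) :
    compFM g f ∈ cocycles F K := by
  rw [mem_cocycles] at hg hf ⊢
  refine ⟨by simpa using compFM_mem hg.1 hf.1, ?_⟩
  have hs : signFM g = g := by simpa using signFM_of_mem hg.1
  have e1 : kappa g = compFM g G.δ - compFM K.δ g := by
    have := hg.2; rw [sub_eq_zero] at this; exact eq_sub_of_add_eq this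
  have e2 : kappa f = compFM f F.δ - compFM G.δ f := by
    have := hf.2; rw [sub_eq_zero] at this; exact eq_sub_of_add_eq this
  rw [kappa_comp, hs, e1, e2]
  simp only [map_sub, LinearMap.sub_apply, compFM_assoc]
  abel

theorem comp_mem_boundaries_right {F G K : PreComplex 𝔥 ζ} {g : HomFM 𝔥 ζ G.seq K.seq}
    {f : HomFM 𝔥 ζ F.seq G.seq} (hg : g ∈ cocycles G K) (hf : f ∈ boundaries F G) :
    compFM g f ∈ boundaries F K := by
  rw [mem_cocycles] at hg
  obtain ⟨h, hh, rfl⟩ := hf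
  refine ⟨compFM g h, by simpa using compFM_mem hg.1 hh, ?_⟩
  have hs : signFM g = g := by simpa using signFM_of_mem hg.1
  have e1 : kappa g = compFM g G.δ - compFM K.δ g := by
    have := hg.2; rw [sub_eq_zero] at this; exact eq_sub_of_add_eq this
  rw [d_neg_one, d_neg_one, kappa_comp, hs, e1]
  simp only [map_add, map_sub, LinearMap.sub_apply, compFM_assoc]
  abel

theorem comp_mem_boundaries_left {F G K : PreComplex 𝔥 ζ} {g : HomFM 𝔥 ζ G.seq K.seq}
    {f : HomFM 𝔥 ζ F.seq G.seq} (hg : g ∈ boundaries G K) (hf : f ∈ cocycles F G) :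
    compFM g f ∈ boundaries F K := by
  rw [mem_cocycles] at hf
  obtain ⟨h, hh, rfl⟩ := hg
  refine ⟨compFM h f, by simpa using compFM_mem hh hf.1, ?_⟩
  have hs : signFM h = -h := by
    simpa [Int.negOnePow_odd (-1) (by decide)] using signFM_of_mem hh
  have e2 : kappa f = compFM f F.δ - compFM G.δ f := by
    have := hf.2; rw [sub_eq_zero] at this; exact eq_sub_of_add_eq this
  rw [d_neg_one, d_neg_one, kappa_comp, hs, e2]
  simp only [map_add, map_sub, map_neg, LinearMap.neg_apply, LinearMap.add_apply, compFM_assoc]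
  abel

theorem kappa_ofBE {F G : Seq B} (f : HomBE 𝔥 ζ F G) : kappa (ofBE f) = 0 := by
  rw [ofBE, kappa_tmul]
  refine Finset.sum_eq_zero fun i _ => ?_
  rw [contractV, CliffordAlgebra.contractLeft_one, TensorProduct.zero_tmul]

theorem id_mem_cocycles (F : PreComplex 𝔥 ζ) : idFM 𝔥 ζ F.seq ∈ cocycles F F := by
  rw [mem_cocycles]
  refine ⟨ofBE_mem (idBE_mem _), ?_⟩
  rw [comp_idFM, idFM_comp, idFM, kappa_ofBE]
  simp

/-- Two chain maps are homotopic if their difference is null-homotopic. -/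
def homotopy (F G : PreComplex 𝔥 ζ) : Setoid (cocycles F G) where
  r f g := f.1 - g.1 ∈ boundaries F G
  iseqv :=
    { refl := fun f => by rw [sub_self]; exact zero_mem _
      symm := fun {f g} h => by rw [← neg_sub]; exact neg_mem h
      trans := fun {f g h} h1 h2 => by
        rw [← sub_add_sub_cancel f.1 g.1 h.1]; exact add_mem h1 h2 }

/-- Chain maps up to homotopy, `H^0_0`. -/
def Hom (F G : PreComplex 𝔥 ζ) : Type (max uB uk uV) := Quotient (homotopy F G)

/-- The morphism represented by a chain map. -/
def homMk {F G : PreComplex 𝔥 ζ} (f : HomFM 𝔥 ζ F.seq G.seq) (hf : f ∈ cocycles F G) : Hom F G :=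
  Quotient.mk (homotopy F G) ⟨f, hf⟩

theorem homMk_eq {F G : PreComplex 𝔥 ζ} {f f' : HomFM 𝔥 ζ F.seq G.seq} {hf : f ∈ cocycles F G}
    {hf' : f' ∈ cocycles F G} : homMk f hf = homMk f' hf' ↔ f - f' ∈ boundaries F G :=
  Quotient.eq (r := homotopy F G)

/-- Composition in the free-monodromic category; `homComp f g` is `f` followed by `g`. -/
def homComp {F G K : PreComplex 𝔥 ζ} (f : Hom F G) (g : Hom G K) : Hom F K :=
  Quotient.liftOn₂ f g (fun f g => homMk (compFM g.1 f.1) (comp_mem_cocycles g.2 f.2)) (by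
    intro f g f' g' hf hg
    rw [homMk_eq]
    have h1 : compFM g.1 f.1 - compFM g'.1 f'.1 =
        compFM (g.1 - g'.1) f.1 + compFM g'.1 (f.1 - f'.1) := by
      simp only [map_sub, LinearMap.sub_apply]; abel
    rw [h1]
    exact add_mem (comp_mem_boundaries_left hg f.2) (comp_mem_boundaries_right g'.2 hf))

theorem homComp_mk {F G K : PreComplex 𝔥 ζ} {f : HomFM 𝔥 ζ F.seq G.seq}
    {g : HomFM 𝔥 ζ G.seq K.seq} (hf : f ∈ cocycles F G) (hg : g ∈ cocycles G K) :
    homComp (homMk f hf) (homMk g hg) = homMk (compFM g f) (comp_mem_cocycles hg hf) := rfl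

theorem hom_ind {F G : PreComplex 𝔥 ζ} {P : Hom F G → Prop}
    (h : ∀ f hf, P (homMk f hf)) (x : Hom F G) : P x := by
  induction x using Quotient.ind with
  | _ z => exact h z.1 z.2

end PreComplex


/-! ### Convolution of complexes -/

namespace PreComplex

/-- The differential of `F ⋆̂ F'`:
`δ_F ⋆̂ id + id ⋆̂ δ_{F'} - ∑ ν_F(e_i) ⋆ μ_{F'}(ě_i)`. -/
def convDelta (F F' : PreComplex 𝔥 ζ) :
    HomFM 𝔥 ζ (F.seq.star F'.seq) (F.seq.star F'.seq) :=
  hat F F F' F' F.δ (idFM 𝔥 ζ F'.seq) + hat F F F' F' (idFM 𝔥 ζ F.seq) F'.δ -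
    ∑ i, ustar (F.nu (ExteriorAlgebra.ι k ((Module.Free.chooseBasis k V).coord i)))
      (F'.mu (SymmetricAlgebra.ι k V (Module.Free.chooseBasis k V i)))

/-- The monodromic convolution product `F ⋆̂ F'`. -/
abbrev conv (F F' : PreComplex 𝔥 ζ) : PreComplex 𝔥 ζ := ⟨F.seq.star F'.seq, convDelta F F'⟩

variable (𝔥 ζ) in
/-- The free-monodromic skyscraper: the empty word with the differential `θ`. -/
abbrev unit : PreComplex 𝔥 ζ := ⟨Seq.unit B, theta 𝔥 ζ (Seq.unit B)⟩

/-- Convolutive free-monodromic complexes: `δ` has bidegree `(1, 0)`, `δ ∘ δ + κ(δ) = Θ`, and `δ`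
lies in `(k ⊕ V*) ⊗ Hom_BE ⊗ (k ⊕ V)`. -/
def IsConvolutive (F : PreComplex 𝔥 ζ) : Prop :=
  F.δ ∈ bideg 𝔥 ζ F.seq F.seq 1 0 ∧
  compFM F.δ F.δ + kappa F.δ = Theta 𝔥 ζ F.seq ∧
  F.δ ∈ Submodule.span k {z | ∃ (r : Lam k V) (f : HomBE 𝔥 ζ F.seq F.seq) (x : Rv k V),
    r ∈ (1 : Submodule k (Lam k V)) ⊔ LinearMap.range (ExteriorAlgebra.ι k) ∧
    x ∈ (1 : Submodule k (Rv k V)) ⊔ LinearMap.range (SymmetricAlgebra.ι k V) ∧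
    z = r ⊗ₜ (f ⊗ₜ x)}

end PreComplex

open PreComplex

variable (𝔥 ζ) in
/-- Objects of the category of convolutive complexes. -/
structure ConvFM : Type (max 1 uB uk uV) where
  pre : PreComplex 𝔥 ζ
  isConvolutive : pre.IsConvolutive

instance : Category (ConvFM 𝔥 ζ) where
  Hom F G := Hom F.pre G.pre
  id F := homMk (idFM 𝔥 ζ F.pre.seq) (id_mem_cocycles F.pre)
  comp f g := homComp f g
  id_comp f := by
    induction f using hom_ind with
    | h f hf => rw [homComp_mk]; congr 1; exact comp_idFM f
  comp_id f := by
    induction f using hom_ind with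
    | h f hf => rw [homComp_mk]; congr 1; exact idFM_comp f
  assoc f g h := by
    induction f using hom_ind with
    | h f hf =>
      induction g using hom_ind with
      | h g hg =>
        induction h using hom_ind with
        | h h hh => simp only [homComp_mk]; congr 1; exact (compFM_assoc h g f).symm

/-- The morphism of convolutive complexes represented by a chain map. -/
def ConvFM.mk' {F G : ConvFM 𝔥 ζ} (f : HomFM 𝔥 ζ F.pre.seq G.pre.seq)
    (hf : f ∈ cocycles F.pre G.pre) : F ⟶ G := homMk f hf

/-- A morphism which admits a lift in `Hom_BE ⊗ R^∨`. -/
def IsRhd {F G : ConvFM 𝔥 ζ} (φ : F ⟶ G) : Prop :=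
  ∃ f hf, f ∈ rhd 𝔥 ζ F.pre.seq G.pre.seq ∧ ConvFM.mk' f hf = φ

/-- A morphism which admits a lift in `Λ ⊗ Hom_BE`. -/
def IsLhd {F G : ConvFM 𝔥 ζ} (φ : F ⟶ G) : Prop :=
  ∃ f hf, f ∈ lhd 𝔥 ζ F.pre.seq G.pre.seq ∧ ConvFM.mk' f hf = φ

theorem isRhd_comp {F G K : ConvFM 𝔥 ζ} {φ : F ⟶ G} {ψ : G ⟶ K} (hφ : IsRhd φ) (hψ : IsRhd ψ) :
    IsRhd (φ ≫ ψ) := by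
  obtain ⟨f, hf, hf', rfl⟩ := hφ
  obtain ⟨g, hg, hg', rfl⟩ := hψ
  exact ⟨_, comp_mem_cocycles hg hf, compFM_mem_rhd hg' hf', rfl⟩

theorem isLhd_comp {F G K : ConvFM 𝔥 ζ} {φ : F ⟶ G} {ψ : G ⟶ K} (hφ : IsLhd φ) (hψ : IsLhd ψ) :
    IsLhd (φ ≫ ψ) := by
  obtain ⟨f, hf, hf', rfl⟩ := hφ
  obtain ⟨g, hg, hg', rfl⟩ := hψ
  exact ⟨_, comp_mem_cocycles hg hf, compFM_mem_lhd hg' hf', rfl⟩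

theorem isRhd_id (F : ConvFM 𝔥 ζ) : IsRhd (𝟙 F) := ⟨_, id_mem_cocycles F.pre, ofBE_mem_rhd _, rfl⟩

theorem isLhd_id (F : ConvFM 𝔥 ζ) : IsLhd (𝟙 F) := ⟨_, id_mem_cocycles F.pre, ofBE_mem_lhd _, rfl⟩

theorem isRhd_ofBE {F G : ConvFM 𝔥 ζ} (f : HomBE 𝔥 ζ F.pre.seq G.pre.seq)
    (hf : ofBE f ∈ cocycles F.pre G.pre) : IsRhd (ConvFM.mk' (ofBE f) hf) :=
  ⟨_, hf, ofBE_mem_rhd f, rfl⟩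

theorem isLhd_ofBE {F G : ConvFM 𝔥 ζ} (f : HomBE 𝔥 ζ F.pre.seq G.pre.seq)
    (hf : ofBE f ∈ cocycles F.pre G.pre) : IsLhd (ConvFM.mk' (ofBE f) hf) :=
  ⟨_, hf, ofBE_mem_lhd f, rfl⟩

variable (𝔥 ζ) in
/-- The subcategory of the convolutive complexes whose morphisms admit a lift in
`Hom_BE ⊗ R^∨`. -/
@[ext] structure ConvRhd : Type (max 1 uB uk uV) where
  of : ConvFM 𝔥 ζ

variable (𝔥 ζ) in
/-- The subcategory of the convolutive complexes whose morphisms admit a lift in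
`Λ ⊗ Hom_BE`. -/
@[ext] structure ConvLhd : Type (max 1 uB uk uV) where
  of : ConvFM 𝔥 ζ

instance : Category (ConvRhd 𝔥 ζ) where
  Hom F G := {φ : F.of ⟶ G.of // IsRhd φ}
  id F := ⟨𝟙 F.of, isRhd_id F.of⟩
  comp φ ψ := ⟨φ.1 ≫ ψ.1, isRhd_comp φ.2 ψ.2⟩

instance : Category (ConvLhd 𝔥 ζ) where
  Hom F G := {φ : F.of ⟶ G.of // IsLhd φ}
  id F := ⟨𝟙 F.of, isLhd_id F.of⟩
  comp φ ψ := ⟨φ.1 ≫ ψ.1, isLhd_comp φ.2 ψ.2⟩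

variable (𝔥 ζ) in
/-- Everything that has to be verified for `⋆̂`, the unit object and the maps `λ`, `ϱ`, `α` to be
well defined on convolutive complexes. -/
structure WellDefined : Prop where
  isMu : ∀ F : ConvFM 𝔥 ζ, F.pre.IsMu F.pre.mu
  mu_mem : ∀ (F : ConvFM 𝔥 ζ) x, F.pre.mu x ∈ rhd 𝔥 ζ F.pre.seq F.pre.seq
  isNu : ∀ F : ConvFM 𝔥 ζ, F.pre.IsNu F.pre.nu
  nu_mem : ∀ (F : ConvFM 𝔥 ζ) r, F.pre.nu r ∈ lhd 𝔥 ζ F.pre.seq F.pre.seq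
  unit_convolutive : (PreComplex.unit 𝔥 ζ).IsConvolutive
  conv_convolutive : ∀ F G : ConvFM 𝔥 ζ, (F.pre.conv G.pre).IsConvolutive
  hat_cocycle : ∀ (F G F' G' : ConvFM 𝔥 ζ), ∀ f ∈ cocycles F.pre G.pre,
    ∀ h ∈ cocycles F'.pre G'.pre,
      hat F.pre G.pre F'.pre G'.pre f h ∈ cocycles (F.pre.conv F'.pre) (G.pre.conv G'.pre)
  hat_boundary_left : ∀ (F G F' G' : ConvFM 𝔥 ζ),
    ∀ f ∈ cocycles F.pre G.pre ⊓ boundaries F.pre G.pre, ∀ h ∈ cocycles F'.pre G'.pre,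
      hat F.pre G.pre F'.pre G'.pre f h ∈ boundaries (F.pre.conv F'.pre) (G.pre.conv G'.pre)
  hat_boundary_right : ∀ (F G F' G' : ConvFM 𝔥 ζ), ∀ f ∈ cocycles F.pre G.pre,
    ∀ h ∈ cocycles F'.pre G'.pre ⊓ boundaries F'.pre G'.pre,
      hat F.pre G.pre F'.pre G'.pre f h ∈ boundaries (F.pre.conv F'.pre) (G.pre.conv G'.pre)
  hat_rhd : ∀ (F G F' G' : ConvFM 𝔥 ζ), ∀ f ∈ rhd 𝔥 ζ F.pre.seq G.pre.seq,
    ∀ h ∈ rhd 𝔥 ζ F'.pre.seq G'.pre.seq, hat F.pre G.pre F'.pre G'.pre f h ∈ rhd 𝔥 ζ _ _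
  hat_lhd : ∀ (F G F' G' : ConvFM 𝔥 ζ), ∀ f ∈ lhd 𝔥 ζ F.pre.seq G.pre.seq,
    ∀ h ∈ lhd 𝔥 ζ F'.pre.seq G'.pre.seq, hat F.pre G.pre F'.pre G'.pre f h ∈ lhd 𝔥 ζ _ _
  lam_cocycle : ∀ F : ConvFM 𝔥 ζ,
    ofBE (lamSeq F.pre.seq) ∈ cocycles ((PreComplex.unit 𝔥 ζ).conv F.pre) F.pre ∧
    ofBE (lamSeqInv F.pre.seq) ∈ cocycles F.pre ((PreComplex.unit 𝔥 ζ).conv F.pre)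
  lam_inv : ∀ F : Seq B, compBE (lamSeqInv F) (lamSeq F) = idBE 𝔥 ζ ((Seq.unit B).star F) ∧
    compBE (lamSeq F) (lamSeqInv F) = idBE 𝔥 ζ F
  rho_cocycle : ∀ F : ConvFM 𝔥 ζ,
    ofBE (rhoSeq F.pre.seq) ∈ cocycles (F.pre.conv (PreComplex.unit 𝔥 ζ)) F.pre ∧
    ofBE (rhoSeqInv F.pre.seq) ∈ cocycles F.pre (F.pre.conv (PreComplex.unit 𝔥 ζ))
  rho_inv : ∀ F : Seq B, compBE (rhoSeqInv F) (rhoSeq F) = idBE 𝔥 ζ (F.star (Seq.unit B)) ∧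
    compBE (rhoSeq F) (rhoSeqInv F) = idBE 𝔥 ζ F
  alpha_cocycle : ∀ F G K : ConvFM 𝔥 ζ,
    ofBE (alphaSeq F.pre.seq G.pre.seq K.pre.seq) ∈
      cocycles (F.pre.conv (G.pre.conv K.pre)) ((F.pre.conv G.pre).conv K.pre) ∧
    ofBE (alphaSeqInv F.pre.seq G.pre.seq K.pre.seq) ∈
      cocycles ((F.pre.conv G.pre).conv K.pre) (F.pre.conv (G.pre.conv K.pre))
  alpha_inv : ∀ F G K : Seq B,
    compBE (alphaSeqInv F G K) (alphaSeq F G K) = idBE 𝔥 ζ (F.star (G.star K)) ∧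
    compBE (alphaSeq F G K) (alphaSeqInv F G K) = idBE 𝔥 ζ ((F.star G).star K)

namespace WellDefined

/-- `F ⋆̂ G`. -/
abbrev obj (wd : WellDefined 𝔥 ζ) (F G : ConvFM 𝔥 ζ) : ConvFM 𝔥 ζ :=
  ⟨F.pre.conv G.pre, wd.conv_convolutive F G⟩

/-- The unit object. -/
abbrev unitObj (wd : WellDefined 𝔥 ζ) : ConvFM 𝔥 ζ := ⟨PreComplex.unit 𝔥 ζ, wd.unit_convolutive⟩

/-- `φ ⋆̂ ψ` on morphisms: it is represented by `f ⋆̂ h` for any chain maps `f`, `h` which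
represent `φ`, `ψ`. -/
def map (wd : WellDefined 𝔥 ζ) {F G F' G' : ConvFM 𝔥 ζ} (φ : F ⟶ G) (ψ : F' ⟶ G') :
    wd.obj F F' ⟶ wd.obj G G' :=
  Quotient.liftOn₂ φ ψ
    (fun f h => homMk (hat F.pre G.pre F'.pre G'.pre f.1 h.1)
      (wd.hat_cocycle F G F' G' f.1 f.2 h.1 h.2)) (by
    intro f h f' h' hf hh
    refine (homMk_eq (F := F.pre.conv F'.pre) (G := G.pre.conv G'.pre)).2 ?_
    have h1 : hat F.pre G.pre F'.pre G'.pre f.1 h.1 - hat F.pre G.pre F'.pre G'.pre f'.1 h'.1 =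
        hat F.pre G.pre F'.pre G'.pre (f.1 - f'.1) h.1 +
          hat F.pre G.pre F'.pre G'.pre f'.1 (h.1 - h'.1) := by
      simp only [map_sub, LinearMap.sub_apply]; abel
    rw [h1]
    exact add_mem
      (wd.hat_boundary_left F G F' G' _ ⟨sub_mem f.2 f'.2, hf⟩ h.1 h.2)
      (wd.hat_boundary_right F G F' G' f'.1 f'.2 _ ⟨sub_mem h.2 h'.2, hh⟩))

theorem isRhd_map (wd : WellDefined 𝔥 ζ) {F G F' G' : ConvFM 𝔥 ζ} {φ : F ⟶ G} {ψ : F' ⟶ G'}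
    (hφ : IsRhd φ) (hψ : IsRhd ψ) : IsRhd (wd.map φ ψ) := by
  obtain ⟨f, hf, hf', rfl⟩ := hφ
  obtain ⟨h, hh, hh', rfl⟩ := hψ
  exact ⟨_, wd.hat_cocycle F G F' G' f hf h hh, wd.hat_rhd F G F' G' f hf' h hh', rfl⟩

theorem isLhd_map (wd : WellDefined 𝔥 ζ) {F G F' G' : ConvFM 𝔥 ζ} {φ : F ⟶ G} {ψ : F' ⟶ G'}
    (hφ : IsLhd φ) (hψ : IsLhd ψ) : IsLhd (wd.map φ ψ) := by
  obtain ⟨f, hf, hf', rfl⟩ := hφ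
  obtain ⟨h, hh, hh', rfl⟩ := hψ
  exact ⟨_, wd.hat_cocycle F G F' G' f hf h hh, wd.hat_lhd F G F' G' f hf' h hh', rfl⟩

/-- A pair of mutually inverse isomorphisms of sequences which are chain maps. -/
def mkIso {F G : ConvFM 𝔥 ζ} (f : HomBE 𝔥 ζ F.pre.seq G.pre.seq)
    (g : HomBE 𝔥 ζ G.pre.seq F.pre.seq) (hf : ofBE f ∈ cocycles F.pre G.pre)
    (hg : ofBE g ∈ cocycles G.pre F.pre) (hgf : compBE g f = idBE 𝔥 ζ _)
    (hfg : compBE f g = idBE 𝔥 ζ _) : F ≅ G where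
  hom := ConvFM.mk' (ofBE f) hf
  inv := ConvFM.mk' (ofBE g) hg
  hom_inv_id := by
    change homComp (homMk _ _) (homMk _ _) = homMk _ _
    rw [homComp_mk]; congr 1; rw [compFM_ofBE, hgf]; rfl
  inv_hom_id := by
    change homComp (homMk _ _) (homMk _ _) = homMk _ _
    rw [homComp_mk]; congr 1; rw [compFM_ofBE, hfg]; rfl

/-- `λ_F : 1 ⋆̂ F ≅ F`. -/
def lam (wd : WellDefined 𝔥 ζ) (F : ConvFM 𝔥 ζ) : wd.obj wd.unitObj F ≅ F :=
  mkIso (F := wd.obj wd.unitObj F) (G := F) (lamSeq F.pre.seq) (lamSeqInv F.pre.seq)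
    (wd.lam_cocycle F).1 (wd.lam_cocycle F).2 (wd.lam_inv _).1 (wd.lam_inv _).2

/-- `ϱ_F : F ⋆̂ 1 ≅ F`. -/
def rho (wd : WellDefined 𝔥 ζ) (F : ConvFM 𝔥 ζ) : wd.obj F wd.unitObj ≅ F :=
  mkIso (F := wd.obj F wd.unitObj) (G := F) (rhoSeq F.pre.seq) (rhoSeqInv F.pre.seq)
    (wd.rho_cocycle F).1 (wd.rho_cocycle F).2 (wd.rho_inv _).1 (wd.rho_inv _).2

/-- `α_{F,G,K} : F ⋆̂ (G ⋆̂ K) ≅ (F ⋆̂ G) ⋆̂ K`. -/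
def alpha (wd : WellDefined 𝔥 ζ) (F G K : ConvFM 𝔥 ζ) :
    wd.obj F (wd.obj G K) ≅ wd.obj (wd.obj F G) K :=
  mkIso (F := wd.obj F (wd.obj G K)) (G := wd.obj (wd.obj F G) K)
    (alphaSeq F.pre.seq G.pre.seq K.pre.seq) (alphaSeqInv F.pre.seq G.pre.seq K.pre.seq)
    (wd.alpha_cocycle F G K).1 (wd.alpha_cocycle F G K).2 (wd.alpha_inv _ _ _).1
    (wd.alpha_inv _ _ _).2

/-- An isomorphism such that it and its inverse lie in the subcategory. -/
def rhdIso {F G : ConvFM 𝔥 ζ} (e : F ≅ G) (h : IsRhd e.hom) (h' : IsRhd e.inv) :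
    (⟨F⟩ : ConvRhd 𝔥 ζ) ≅ ⟨G⟩ where
  hom := ⟨e.hom, h⟩
  inv := ⟨e.inv, h'⟩
  hom_inv_id := Subtype.ext e.hom_inv_id
  inv_hom_id := Subtype.ext e.inv_hom_id

/-- An isomorphism such that it and its inverse lie in the subcategory. -/
def lhdIso {F G : ConvFM 𝔥 ζ} (e : F ≅ G) (h : IsLhd e.hom) (h' : IsLhd e.inv) :
    (⟨F⟩ : ConvLhd 𝔥 ζ) ≅ ⟨G⟩ where
  hom := ⟨e.hom, h⟩
  inv := ⟨e.inv, h'⟩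
  hom_inv_id := Subtype.ext e.hom_inv_id
  inv_hom_id := Subtype.ext e.inv_hom_id

/-- The operations `⋆̂`, `λ`, `ϱ`, `α` on the first subcategory. (The associator in Mathlib goes
in the opposite direction.) -/
@[reducible] def rhdStruct (wd : WellDefined 𝔥 ζ) : MonoidalCategoryStruct (ConvRhd 𝔥 ζ) where
  tensorObj F G := ⟨wd.obj F.of G.of⟩
  whiskerLeft F _ _ φ := ⟨wd.map (𝟙 F.of) φ.1, wd.isRhd_map (isRhd_id _) φ.2⟩
  whiskerRight φ G := ⟨wd.map φ.1 (𝟙 G.of), wd.isRhd_map φ.2 (isRhd_id _)⟩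
  tensorHom φ ψ := ⟨wd.map φ.1 ψ.1, wd.isRhd_map φ.2 ψ.2⟩
  tensorUnit := ⟨wd.unitObj⟩
  associator F G K := (rhdIso (wd.alpha F.of G.of K.of) (isRhd_ofBE _ _)
    (isRhd_ofBE _ _)).symm
  leftUnitor F := rhdIso (wd.lam F.of) (isRhd_ofBE _ _) (isRhd_ofBE _ _)
  rightUnitor F := rhdIso (wd.rho F.of) (isRhd_ofBE _ _) (isRhd_ofBE _ _)

/-- The operations `⋆̂`, `λ`, `ϱ`, `α` on the second subcategory. -/
@[reducible] def lhdStruct (wd : WellDefined 𝔥 ζ) : MonoidalCategoryStruct (ConvLhd 𝔥 ζ) where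
  tensorObj F G := ⟨wd.obj F.of G.of⟩
  whiskerLeft F _ _ φ := ⟨wd.map (𝟙 F.of) φ.1, wd.isLhd_map (isLhd_id _) φ.2⟩
  whiskerRight φ G := ⟨wd.map φ.1 (𝟙 G.of), wd.isLhd_map φ.2 (isLhd_id _)⟩
  tensorHom φ ψ := ⟨wd.map φ.1 ψ.1, wd.isLhd_map φ.2 ψ.2⟩
  tensorUnit := ⟨wd.unitObj⟩
  associator F G K := (lhdIso (wd.alpha F.of G.of K.of) (isLhd_ofBE _ _)
    (isLhd_ofBE _ _)).symm
  leftUnitor F := lhdIso (wd.lam F.of) (isLhd_ofBE _ _) (isLhd_ofBE _ _)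
  rightUnitor F := lhdIso (wd.rho F.of) (isLhd_ofBE _ _) (isLhd_ofBE _ _)

end WellDefined

end Differential

end FM

end FreeMonodromic

end

/-! ### Signs, diagrams up to relations, and matrices of diagrams. -/

open CategoryTheory TensorProduct

noncomputable section

namespace FreeMonodromic

universe uB uW uk uV

/-! ## Signs -/

/-! The product `f ⋆̂ h` factors as `(f ⋆̂ id) ∘ (id ⋆̂ h)` (`hat_eq`; no sign appears because the
values of `μ` are even). Everything is thereby reduced to two operations in one variable: `starId
K`, which sends `r ⊗ f ⊗ x` to `(r ⊗ f) ⋆ μ_K(x)`, and `idStar K`, which sends `t ⊗ h ⊗ z` to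
`ν_K(t) ⋆ (h ⊗ z)`.

Existence of `μ` and `ν`. Because `δ` has degree at most one in both outer factors, `v ⌢ δ` has no
exterior part and `δ ⌢ r` has no part in `V`. Contracting `δδ + κ(δ) = Θ` with `v` shows that `v ⌢
δ` commutes with `δ`, and contracting once more shows that the `v ⌢ δ` commute with each other, so
they extend to the symmetric algebra. The quadratic coefficient of the same equation along a linear
form `r` says `(δ ⌢ r)² = 0`, so the `δ ⌢ r` extend to the exterior algebra. The contraction of the
equation with `r` says that `δ ⌢ r` is a homotopy for the multiplication by `r` on the right.

The differential of `F ⋆̂ G` is `δ_F ⋆ id + id ⋆ δ_G + ∑ (δ_F ⌢ e_i) ⋆ (ě_i ⌢ δ_G)`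
(`convDelta_eq`). Its square is computed term by term. The essential point is that a box to the
right of `F` is the same as a box to the left of `G`: the right boxes which come from the homotopies
`δ_F ⌢ e_i` turn into `id ⋆ κ(δ_G)`, which is the term needed to make the square of `id ⋆ δ_G` equal
to `Θ`. All other cross terms cancel by sign, commutativity of the `ě_i ⌢ δ_G` or anticommutativity
of the `δ_F ⌢ e_i`.

The same mechanism shows that `starId K` and `idStar K` commute with the differentials of the
morphism spaces (`differential_starId`, `differential_idStar`). They also respect composition,
identities and bidegrees, so they preserve cocycles and boundaries, and `⋆̂` descends to homotopy
classes. For `idStar K` the compensation is again between `κ` on the right and the differential of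
`ν_K(t)` on the left (`differential_nu`).

Associativity and units follow from `μ_{F ⋆̂ G} = starId G ∘ μ_F` and `ν_{F ⋆̂ G} = idStar F ∘ ν_G`,
and from the fact that `μ` and `ν` of the unit object are the obvious embeddings. A threefold
product is a composite of three operations in one variable each, in the same order for both
bracketings, so the naturality of `α` holds for all morphisms and needs no interchange law. Pentagon
and triangle are identities between permutations of summands.

Bifunctoriality does need the interchange of `f ⋆̂ id` with `id ⋆̂ h`. This asks `μ` to commute with
`h`, or `ν` to commute with `f`. Contracting the cocycle equation gives the first when `h` has no
exterior part and the second when `f` has no part in `R^∨` (`mu_comm`, `nu_comm`); hence the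
restriction to the two subcategories. -/

theorem negOnePow_eq_sgn (n : ℤ) : (n.negOnePow : ℤ) = sgn (n : ZMod 2) := by
  rcases Int.even_or_odd n with h | h
  · rw [Int.negOnePow_even _ h, sgn, if_pos ((ZMod.intCast_zmod_eq_zero_iff_dvd _ 2).2
      (even_iff_two_dvd.1 h))]
    rfl
  · rw [Int.negOnePow_odd _ h, sgn, if_neg]
    · rfl
    · rw [ZMod.intCast_zmod_eq_zero_iff_dvd _ 2]
      exact fun h' => (Int.not_even_iff_odd.2 h) (even_iff_two_dvd.2 h')

theorem negOnePow_smul {A : Type*} [AddCommGroup A] (n : ℤ) (x : A) :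
    n.negOnePow • x = sgn (n : ZMod 2) • x := by
  rw [Units.smul_def, negOnePow_eq_sgn]

@[simp] theorem sgn_zero : sgn 0 = 1 := rfl

@[simp] theorem sgn_one : sgn 1 = -1 := rfl

theorem sgn_add (p q : ZMod 2) : sgn (p + q) = sgn p * sgn q := by
  revert p q; decide

theorem sgn_mul_self (p : ZMod 2) : sgn p * sgn p = 1 := by
  revert p; decide

theorem zmod_two_cases (p : ZMod 2) : p = 0 ∨ p = 1 := by
  revert p; decide

section Diagrams

variable {B : Type uB} {M : CoxeterMatrix B} {k : Type uk} [CommRing k]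
  {V : Type uV} [AddCommGroup V] [Module k V]
  {W : Type uW} [Group W] {cs : CoxeterSystem M W}
  {𝔥 : Realization cs k V} {ζ : LowerTerms M k V}

/-! ## Transport of morphisms along equalities of words -/

namespace DHom

/-- Transport of a morphism along equalities of its boundary words. -/
protected def cast {w v w' v' : List B} (hw : w = w') (hv : v = v') (f : DHom 𝔥 ζ w v) :
    DHom 𝔥 ζ w' v' := hw ▸ hv ▸ f

@[simp] theorem cast_rfl {w v : List B} (f : DHom 𝔥 ζ w v) : DHom.cast rfl rfl f = f := rfl

theorem mk_cast {w v w' v' : List B} (hw : w = w') (hv : v = v') (D : Diag M k V w v) :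
    (mk (Diag.cast hw hv D) : DHom 𝔥 ζ w' v') = DHom.cast hw hv (mk D) := by
  subst hw hv; rfl

theorem cast_cast {w v w' v' w'' v'' : List B} (hw : w = w') (hv : v = v') (hw' : w' = w'')
    (hv' : v' = v'') (f : DHom 𝔥 ζ w v) :
    DHom.cast hw' hv' (DHom.cast hw hv f) = DHom.cast (hw.trans hw') (hv.trans hv') f := by
  subst hw hv hw' hv'; rfl

theorem cast_smul_int {w v w' v' : List B} (hw : w = w') (hv : v = v') (n : ℤ)
    (f : DHom 𝔥 ζ w v) : DHom.cast hw hv (n • f) = n • DHom.cast hw hv f := by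
  subst hw hv; rfl

theorem comp_cast {w v u w' v' u' : List B} (hw : w = w') (hv : v = v') (hu : u = u')
    (f : DHom 𝔥 ζ w v) (g : DHom 𝔥 ζ v u) :
    comp (DHom.cast hw hv f) (DHom.cast hv hu g) = DHom.cast hw hu (comp f g) := by
  subst hw hv hu; rfl

theorem tens_cast {w v w' v' x y x' y' : List B} (hw : w = w') (hv : v = v') (hx : x = x')
    (hy : y = y') (f : DHom 𝔥 ζ w v) (g : DHom 𝔥 ζ x y) :
    tens (DHom.cast hw hv f) (DHom.cast hx hy g) =
      DHom.cast (by rw [hw, hx]) (by rw [hv, hy]) (tens f g) := by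
  subst hw hv hx hy; rfl

theorem comp_eqId {w v v' : List B} (h : v = v') (f : DHom 𝔥 ζ w v) :
    comp f (mk (Diag.eqId h)) = DHom.cast rfl h f := by
  subst h; exact comp_id f

theorem eqId_comp {w w' v : List B} (h : w' = w) (f : DHom 𝔥 ζ w v) :
    comp (mk (Diag.eqId h)) f = DHom.cast h.symm rfl f := by
  subst h; exact id_comp f

theorem tens_eqId {w v w' v' : List B} (h : w = v) (h' : w' = v') :
    tens (mk (Diag.eqId h) : DHom 𝔥 ζ w v) (mk (Diag.eqId h')) =
      mk (Diag.eqId (by rw [h, h'])) := by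
  subst h h'; exact sound (DRel.id_tens_id _ _)

theorem id_tens_id (w v : List B) :
    tens (mk (Diag.id w) : DHom 𝔥 ζ w w) (mk (Diag.id v)) = mk (Diag.id (w ++ v)) :=
  sound (DRel.id_tens_id _ _)

theorem tens_assoc {w v w' v' w'' v'' : List B} (f : DHom 𝔥 ζ w v) (g : DHom 𝔥 ζ w' v')
    (h : DHom 𝔥 ζ w'' v'') :
    DHom.cast (List.append_assoc _ _ _) (List.append_assoc _ _ _) (tens (tens f g) h) =
      tens f (tens g h) := by
  obtain ⟨D⟩ := f; obtain ⟨E⟩ := g; obtain ⟨F⟩ := h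
  refine (mk_cast _ _ ((D.tens E).tens F)).symm.trans (sound (DRel.tens_assoc D E F))

theorem nil_tens {w v : List B} (f : DHom 𝔥 ζ w v) : tens (mk (Diag.id [])) f = f := by
  obtain ⟨D⟩ := f
  exact sound (DRel.nil_tens D)

theorem tens_nil {w v : List B} (f : DHom 𝔥 ζ w v) :
    DHom.cast (List.append_nil _) (List.append_nil _) (tens f (mk (Diag.id []))) = f := by
  obtain ⟨D⟩ := f
  exact (mk_cast _ _ (D.tens (Diag.id []))).symm.trans (sound (DRel.tens_nil D))

/-- The morphism `f ⋆ r`, with a box on the right. -/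
def boxRight {w v : List B} (r : SymmetricAlgebra k (Module.Dual k V)) (f : DHom 𝔥 ζ w v) :
    DHom 𝔥 ζ w v :=
  DHom.cast (List.append_nil _) (List.append_nil _) (tens f (mk (Diag.box r)))

/-- Interchange with the empty strand: a box to the right of all strands may be drawn at any height.
Together with the next lemma this makes right boxes commute with every morphism. -/
theorem comp_boxRight_id {w v : List B} (r : SymmetricAlgebra k (Module.Dual k V))
    (f : DHom 𝔥 ζ w v) : comp f (boxRight r (mk (Diag.id v))) = boxRight r f := by
  have h := interchange f (mk (Diag.id v)) (mk (Diag.id [])) (mk (Diag.box r) : DHom 𝔥 ζ [] [])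
  rw [comp_id, id_comp] at h
  rw [boxRight, boxRight, h, ← comp_cast _ (List.append_nil v), tens_nil]

theorem boxRight_id_comp {w v : List B} (r : SymmetricAlgebra k (Module.Dual k V))
    (f : DHom 𝔥 ζ w v) : comp (boxRight r (mk (Diag.id w))) f = boxRight r f := by
  have h := interchange (mk (Diag.id w)) f (mk (Diag.box r) : DHom 𝔥 ζ [] []) (mk (Diag.id []))
  rw [comp_id, id_comp] at h
  rw [boxRight, boxRight, h, ← comp_cast _ (List.append_nil w), tens_nil]

/-- A box between `f` and `g` belongs to the right of `f` as much as to the left of `g`. This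
elementary fact is what later lets a homotopy on the left factor cancel `κ` on the right factor. -/
theorem boxRight_tens {w v w' v' : List B} (r : SymmetricAlgebra k (Module.Dual k V))
    (f : DHom 𝔥 ζ w v) (g : DHom 𝔥 ζ w' v') :
    tens (boxRight r f) g = tens f (tens (mk (Diag.box r) : DHom 𝔥 ζ [] []) g) := by
  rw [← tens_assoc]
  exact tens_cast (List.append_nil w) (List.append_nil v) rfl rfl
    (tens f (mk (Diag.box r) : DHom 𝔥 ζ [] [])) g

theorem tens_boxRight {w v w' v' : List B} (r : SymmetricAlgebra k (Module.Dual k V))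
    (f : DHom 𝔥 ζ w v) (g : DHom 𝔥 ζ w' v') :
    tens f (boxRight r g) = boxRight r (tens f g) := by
  have h := tens_cast rfl rfl (List.append_nil w') (List.append_nil v') f
    (tens g (mk (Diag.box r) : DHom 𝔥 ζ [] []))
  rw [cast_rfl] at h
  rw [boxRight, boxRight, h, ← tens_assoc, cast_cast]

theorem tens_mem_deg {w v w' v' : List B} {d e : ℤ} {f : DHom 𝔥 ζ w v} {g : DHom 𝔥 ζ w' v'}
    (hf : f ∈ deg 𝔥 ζ w v d) (hg : g ∈ deg 𝔥 ζ w' v' e) :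
    tens f g ∈ deg 𝔥 ζ (w ++ w') (v ++ v') (d + e) := by
  induction hf, hg using Submodule.span_induction₂ with
  | mem_mem x y hx hy =>
    obtain ⟨D, hD, rfl⟩ := hx
    obtain ⟨E, hE, rfl⟩ := hy
    exact Submodule.subset_span ⟨_, hD.tens hE, rfl⟩
  | zero_left y hy => simp
  | zero_right x hx => simp
  | add_left x y z _ _ _ h1 h2 => simpa using add_mem h1 h2
  | add_right x y z _ _ _ h1 h2 => simpa using add_mem h1 h2
  | smul_left r x y _ _ h => simpa using Submodule.smul_mem _ r h
  | smul_right r x y _ _ h => simpa using Submodule.smul_mem _ r h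

theorem eqId_mem_deg {w v : List B} (h : w = v) :
    (mk (Diag.eqId h) : DHom 𝔥 ζ w v) ∈ deg 𝔥 ζ w v 0 := by
  subst h
  exact Submodule.subset_span ⟨_, Diag.Homog.id _, rfl⟩

end DHom

/-! ## Matrices of morphisms -/

/-- Allows sign identities for homogeneous matrices to be checked on entries: an entry either
vanishes or fixes the parity in terms of the `sigma` of its row and column. -/
theorem eq_zero_or_parity {F G : Seq B} {p : ZMod 2} {f : HomBE 𝔥 ζ F G} (hf : partBE p f = f)
    (a : F.ι) (b : G.ι) : f a b = 0 ∨ ((F.sigma a : ℤ) : ZMod 2) + (G.sigma b : ℤ) = p := by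
  rw [← hf, partBE_apply]
  split_ifs with h
  · right; rw [← h]; push_cast; rfl
  · exact Or.inl rfl

theorem partBE_eq_self {F G : Seq B} {p : ZMod 2} {f : HomBE 𝔥 ζ F G}
    (h : ∀ a b, f a b = 0 ∨ ((F.sigma a : ℤ) : ZMod 2) + (G.sigma b : ℤ) = p) :
    partBE p f = f := by
  funext a b
  rw [partBE_apply]
  split_ifs with h'
  · rfl
  · exact ((h a b).resolve_right fun h'' => h' (by push_cast; exact h'')).symm

theorem sigma_star (F G : Seq B) (a : (F.star G).ι) :
    (F.star G).sigma a = F.sigma a.1 + G.sigma a.2 := by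
  simp only [Seq.sigma, Seq.star, List.length_append]
  push_cast
  ring

/-- The sign only depends on parities, so it is rewritten with exponents in `ZMod 2`; the type
ascription exposes the concatenated words. -/
theorem starBE_apply {F G F' G' : Seq B} (f : HomBE 𝔥 ζ F G) (h : HomBE 𝔥 ζ F' G')
    (a : (F.star F').ι) (b : (G.star G').ι) :
    starBE f h a b = (sgn ((F.sigma a.1 : ZMod 2) * (F'.sigma a.2 + G'.sigma b.2)) •
      DHom.tens (f a.1 b.1) (h a.2 b.2) :
        DHom 𝔥 ζ (F.word a.1 ++ F'.word a.2) (G.word b.1 ++ G'.word b.2)) := by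
  refine (negOnePow_smul (A := DHom 𝔥 ζ (F.word a.1 ++ F'.word a.2) (G.word b.1 ++ G'.word b.2))
    _ _).trans ?_
  push_cast
  rfl

theorem starBE_mk_apply {F G F' G' : Seq B} (f : HomBE 𝔥 ζ F G) (h : HomBE 𝔥 ζ F' G')
    (a : F.ι) (a' : F'.ι) (b : G.ι) (b' : G'.ι) :
    (starBE f h (a, a') (b, b') : DHom 𝔥 ζ (F.word a ++ F'.word a') (G.word b ++ G'.word b')) =
      sgn ((F.sigma a : ZMod 2) * (F'.sigma a' + G'.sigma b')) • DHom.tens (f a b) (h a' b') :=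
  starBE_apply f h (a, a') (b, b')

theorem partBE_starBE {F G F' G' : Seq B} {p q : ZMod 2} {f : HomBE 𝔥 ζ F G}
    {h : HomBE 𝔥 ζ F' G'} (hf : partBE p f = f) (hh : partBE q h = h) :
    partBE (p + q) (starBE f h) = starBE f h := by
  refine partBE_eq_self fun a b => ?_
  rw [starBE_apply, sigma_star, sigma_star]
  rcases eq_zero_or_parity hf a.1 b.1 with h1 | h1
  · left; rw [h1, map_zero, LinearMap.zero_apply, smul_zero]; rfl
  rcases eq_zero_or_parity hh a.2 b.2 with h2 | h2
  · left; rw [h2, map_zero, smul_zero]; rfl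
  right
  rw [← h1, ← h2]; push_cast; ring

theorem DHom.comp_zsmul_zsmul {w v u : List B} (m n : ℤ) (f : DHom 𝔥 ζ w v) (g : DHom 𝔥 ζ v u) :
    DHom.comp (m • f) (n • g) = (m * n) • DHom.comp f g := by
  rw [map_zsmul, map_zsmul, LinearMap.smul_apply, smul_smul, mul_comm]

/-- The Koszul rule: apart from the interchange law for diagrams, a sign arises because `h` moves
past `f₂`. Only these two need a parity; `f` and `h₂` are arbitrary. -/
theorem compBE_starBE {F G K F' G' K' : Seq B} {p q : ZMod 2} (f : HomBE 𝔥 ζ G K)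
    {h : HomBE 𝔥 ζ G' K'} {f₂ : HomBE 𝔥 ζ F G} (h₂ : HomBE 𝔥 ζ F' G') (hh : partBE p h = h)
    (hf₂ : partBE q f₂ = f₂) :
    compBE (starBE f h) (starBE f₂ h₂) = sgn (p * q) • starBE (compBE f f₂) (compBE h h₂) := by
  funext x y
  obtain ⟨a, a'⟩ := x
  obtain ⟨c, c'⟩ := y
  refine (Fintype.sum_prod_type (fun x : G.ι × G'.ι =>
    DHom.comp (starBE f₂ h₂ (a, a') x) (starBE f h x (c, c')))).trans ?_
  refine Eq.trans ?_ (congrArg (sgn (p * q) • ·)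
    (starBE_mk_apply (compBE f f₂) (compBE h h₂) a a' c c')).symm
  change _ = sgn (p * q) • sgn ((F.sigma a : ZMod 2) * (F'.sigma a' + K'.sigma c')) •
    DHom.tens (∑ b, DHom.comp (f₂ a b) (f b c)) (∑ b', DHom.comp (h₂ a' b') (h b' c'))
  rw [LinearMap.map_sum₂, Finset.smul_sum, Finset.smul_sum]
  refine Finset.sum_congr rfl fun b _ => ?_
  rw [map_sum, Finset.smul_sum, Finset.smul_sum]
  refine Finset.sum_congr rfl fun b' _ => ?_
  refine (congrArg₂ (fun (u : DHom 𝔥 ζ (F.word a ++ F'.word a') (G.word b ++ G'.word b'))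
    (v : DHom 𝔥 ζ (G.word b ++ G'.word b') (K.word c ++ K'.word c')) => DHom.comp u v)
    (starBE_mk_apply f₂ h₂ a a' b b') (starBE_mk_apply f h b b' c c')).trans ?_
  rw [DHom.comp_zsmul_zsmul, ← DHom.interchange]
  rcases eq_zero_or_parity hf₂ a b with h1 | h1
  · rw [h1, map_zero, LinearMap.zero_apply, map_zero, LinearMap.zero_apply, smul_zero, smul_zero,
      smul_zero]
  rcases eq_zero_or_parity hh b' c' with h2 | h2
  · rw [h2, map_zero, map_zero, smul_zero, smul_zero, smul_zero]
  rw [smul_smul, ← sgn_add, ← sgn_add, ← h1, ← h2]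
  congr 2
  -- With `p` and `q` expressed through the summands at the ends of the nonzero entries, the signs
  -- agree by an identity in five variables over the field with two elements.
  generalize ((F.sigma a : ℤ) : ZMod 2) = x1
  generalize ((G.sigma b : ℤ) : ZMod 2) = x2
  generalize ((G'.sigma b' : ℤ) : ZMod 2) = x3
  generalize ((K'.sigma c' : ℤ) : ZMod 2) = x4
  generalize ((F'.sigma a' : ℤ) : ZMod 2) = x5
  revert x1 x2 x3 x4 x5; decide

theorem boxLeft_starBE {F G F' G' : Seq B} (r : SymmetricAlgebra k (Module.Dual k V))
    (f : HomBE 𝔥 ζ F G) (h : HomBE 𝔥 ζ F' G') :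
    boxLeft r (starBE f h) = starBE (boxLeft r f) h := by
  funext x y
  obtain ⟨a, a'⟩ := x
  obtain ⟨b, b'⟩ := y
  refine Eq.trans ?_ (starBE_mk_apply (boxLeft r f) h a a' b b').symm
  refine (congrArg (fun u : DHom 𝔥 ζ (F.word a ++ F'.word a') (G.word b ++ G'.word b') =>
    DHom.tens (DHom.mk (Diag.box r) : DHom 𝔥 ζ [] []) u) (starBE_mk_apply f h a a' b b')).trans ?_
  refine (map_zsmul (DHom.tens (DHom.mk (Diag.box r) : DHom 𝔥 ζ [] [])) _ _).trans
    (congrArg _ ?_)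
  exact (DHom.tens_assoc (DHom.mk (Diag.box r) : DHom 𝔥 ζ [] []) (f a b) (h a' b')).symm

theorem idBoxRight_self (F : Seq B) (r : SymmetricAlgebra k (Module.Dual k V)) (a : F.ι) :
    idBoxRight 𝔥 ζ F r a a = DHom.boxRight r (DHom.mk (Diag.id _)) := by
  classical
  refine (Pi.single_eq_same (M := fun b => DHom 𝔥 ζ (F.word a) (F.word b)) a _).trans ?_
  exact DHom.mk_cast _ _ _

theorem idBoxRight_ne {F : Seq B} (r : SymmetricAlgebra k (Module.Dual k V)) {a b : F.ι}
    (h : b ≠ a) : idBoxRight 𝔥 ζ F r a b = 0 := by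
  classical
  simp only [idBoxRight]
  exact Pi.single_eq_of_ne h _

theorem partBE_idBoxRight (F : Seq B) (r : SymmetricAlgebra k (Module.Dual k V)) :
    partBE 0 (idBoxRight 𝔥 ζ F r) = idBoxRight 𝔥 ζ F r := by
  refine partBE_eq_self fun a b => ?_
  by_cases hb : b = a
  · subst hb; right; exact zmod_two_add_self _
  · exact Or.inl (idBoxRight_ne r hb)

/-- Right boxes slide past every entry of the matrix. -/
theorem idBoxRight_comp {F G : Seq B} (r : SymmetricAlgebra k (Module.Dual k V))
    (f : HomBE 𝔥 ζ F G) :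
    compBE (idBoxRight 𝔥 ζ G r) f = compBE f (idBoxRight 𝔥 ζ F r) := by
  funext a c
  rw [compBE_apply, compBE_apply, Finset.sum_eq_single c, Finset.sum_eq_single a]
  · rw [idBoxRight_self, idBoxRight_self, DHom.comp_boxRight_id, DHom.boxRight_id_comp]
  · intro b _ hb; rw [idBoxRight_ne r hb, map_zero, LinearMap.zero_apply]
  · simp
  · intro b _ hb; rw [idBoxRight_ne r hb.symm, map_zero]
  · simp

/-- The matrix form of reading a middle box on either side. Both matrices in the first factor are
diagonal with the same parities, so the signs coincide as well. -/
theorem idBoxRight_starBE {F F' G' : Seq B} (r : SymmetricAlgebra k (Module.Dual k V))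
    (h : HomBE 𝔥 ζ F' G') :
    starBE (idBoxRight 𝔥 ζ F r) h = starBE (idBE 𝔥 ζ F) (boxLeft r h) := by
  funext x y
  obtain ⟨a, a'⟩ := x
  obtain ⟨b, b'⟩ := y
  refine (starBE_mk_apply _ _ a a' b b').trans
    (Eq.trans (congrArg _ ?_) (starBE_mk_apply _ _ a a' b b').symm)
  by_cases hb : b = a
  · subst hb
    rw [idBoxRight_self, idBE_self]
    exact DHom.boxRight_tens r (DHom.mk (Diag.id (F.word b))) (h a' b')
  · rw [idBoxRight_ne r hb, idBE_ne hb, map_zero, LinearMap.zero_apply, LinearMap.zero_apply]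

theorem starBE_idBoxRight (F F' : Seq B) (r : SymmetricAlgebra k (Module.Dual k V)) :
    starBE (idBE 𝔥 ζ F) (idBoxRight 𝔥 ζ F' r) = idBoxRight 𝔥 ζ (F.star F') r := by
  funext x y
  obtain ⟨a, a'⟩ := x
  obtain ⟨b, b'⟩ := y
  refine (starBE_mk_apply _ _ a a' b b').trans ?_
  by_cases hb : b = a
  · by_cases hb' : b' = a'
    · subst hb hb'
      rw [idBE_self, idBoxRight_self, zmod_two_add_self, mul_zero, sgn_zero,
        one_smul, DHom.tens_boxRight, DHom.id_tens_id]
      exact (idBoxRight_self (F.star F') r (b, b')).symm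
    · rw [idBoxRight_ne r hb', map_zero, smul_zero]
      exact (idBoxRight_ne (F := F.star F') (a := (a, a')) (b := (b, b')) r
        fun h => hb' (congrArg Prod.snd h)).symm
  · rw [idBE_ne hb, map_zero, LinearMap.zero_apply, smul_zero]
    exact (idBoxRight_ne (F := F.star F') (a := (a, a')) (b := (b, b')) r
      fun h => hb (congrArg Prod.fst h)).symm

/-! ## Permutations of summands -/

theorem reindexBE_apply {F G : Seq B} (e : F.ι ≃ G.ι) (h : ∀ a, F.word a = G.word (e a))
    (a : F.ι) : (reindexBE e h : HomBE 𝔥 ζ F G) a (e a) = DHom.mk (Diag.eqId (h a)) := by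
  classical
  exact Pi.single_eq_same (M := fun b => DHom 𝔥 ζ (F.word a) (G.word b)) (e a) _

theorem reindexBE_ne {F G : Seq B} (e : F.ι ≃ G.ι) (h : ∀ a, F.word a = G.word (e a))
    {a : F.ι} {b : G.ι} (hb : b ≠ e a) : (reindexBE e h : HomBE 𝔥 ζ F G) a b = 0 := by
  classical
  simp only [reindexBE]
  exact Pi.single_eq_of_ne hb _

theorem reindexBE_congr {F G : Seq B} {e e' : F.ι ≃ G.ι} (he : e = e')
    (h : ∀ a, F.word a = G.word (e a)) (h' : ∀ a, F.word a = G.word (e' a)) :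
    (reindexBE e h : HomBE 𝔥 ζ F G) = reindexBE e' h' := by
  subst he; rfl

theorem compBE_reindexBE_right {F G K : Seq B} (e : F.ι ≃ G.ι) (h : ∀ a, F.word a = G.word (e a))
    (g : HomBE 𝔥 ζ G K) (a : F.ι) (c : K.ι) :
    compBE g (reindexBE e h) a c = DHom.cast (h a).symm rfl (g (e a) c) := by
  rw [compBE_apply, Finset.sum_eq_single (e a)]
  · rw [reindexBE_apply, DHom.eqId_comp]
  · intro b _ hb; rw [reindexBE_ne e h hb, map_zero, LinearMap.zero_apply]
  · simp

theorem compBE_reindexBE_left {F G K : Seq B} (e : G.ι ≃ K.ι) (h : ∀ a, G.word a = K.word (e a))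
    (f : HomBE 𝔥 ζ F G) (a : F.ι) (b : G.ι) :
    compBE (reindexBE e h) f a (e b) = DHom.cast rfl (h b) (f a b) := by
  rw [compBE_apply, Finset.sum_eq_single b]
  · rw [reindexBE_apply, DHom.comp_eqId]
  · intro b' _ hb; rw [reindexBE_ne e h fun h => hb (e.injective h).symm, map_zero]
  · simp

theorem cast_eqId {w v u : List B} (h : w = v) (h' : u = w) :
    DHom.cast h'.symm rfl (DHom.mk (Diag.eqId h) : DHom 𝔥 ζ w v) =
      DHom.mk (Diag.eqId (h'.trans h)) := by
  subst h' h; rfl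

theorem DHom.cast_zero {w v w' v' : List B} (hw : w = w') (hv : v = v') :
    DHom.cast hw hv (0 : DHom 𝔥 ζ w v) = 0 := by
  subst hw hv; rfl

/-- With this and the next lemma, a coherence condition for canonical isomorphisms of sequences
becomes an equality of bijections. -/
theorem compBE_reindexBE_reindexBE {F G K : Seq B} (e : F.ι ≃ G.ι) (e' : G.ι ≃ K.ι)
    (h : ∀ a, F.word a = G.word (e a)) (h' : ∀ a, G.word a = K.word (e' a)) :
    compBE (reindexBE e' h' : HomBE 𝔥 ζ G K) (reindexBE e h) =
      reindexBE (e.trans e') (fun a => (h a).trans (h' (e a))) := by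
  funext a c
  rw [compBE_reindexBE_right]
  by_cases hc : c = e' (e a)
  · subst hc
    rw [reindexBE_apply]
    exact (cast_eqId _ (h a)).trans (reindexBE_apply (𝔥 := 𝔥) (ζ := ζ)
      (e.trans e') (fun a => (h a).trans (h' (e a))) a).symm
  · rw [reindexBE_ne _ _ hc, DHom.cast_zero]
    exact (reindexBE_ne (e.trans e') _ hc).symm

/-- Under `hs` the sign exponent contains `sigma + sigma = 0` on each nonzero entry, so a
permutation of summands which preserves parities introduces no sign. -/
theorem starBE_reindexBE {F G F' G' : Seq B} (e : F.ι ≃ G.ι) (e' : F'.ι ≃ G'.ι)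
    (h : ∀ a, F.word a = G.word (e a)) (h' : ∀ a, F'.word a = G'.word (e' a))
    (hs : ∀ a, F'.sigma a = G'.sigma (e' a)) :
    starBE (reindexBE e h : HomBE 𝔥 ζ F G) (reindexBE e' h') =
      reindexBE (F := F.star F') (G := G.star G') (e.prodCongr e')
        (fun a => congrArg₂ (· ++ ·) (h a.1) (h' a.2)) := by
  funext x y
  obtain ⟨a, a'⟩ := x
  obtain ⟨b, b'⟩ := y
  refine (starBE_mk_apply _ _ a a' b b').trans ?_
  by_cases hb : b = e a
  · by_cases hb' : b' = e' a'
    · subst hb hb'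
      rw [reindexBE_apply, reindexBE_apply, ← hs, zmod_two_add_self, mul_zero, sgn_zero, one_smul,
        DHom.tens_eqId]
      exact (reindexBE_apply (𝔥 := 𝔥) (ζ := ζ) (F := F.star F') (G := G.star G') (e.prodCongr e')
        (fun a => congrArg₂ (· ++ ·) (h a.1) (h' a.2)) (a, a')).symm
    · rw [reindexBE_ne e' h' hb', map_zero, smul_zero]
      exact (reindexBE_ne (F := F.star F') (G := G.star G') (a := (a, a')) (b := (b, b'))
        (e.prodCongr e') _ fun h => hb' (congrArg Prod.snd h)).symm
  · rw [reindexBE_ne e h hb, map_zero, LinearMap.zero_apply, smul_zero]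
    exact (reindexBE_ne (F := F.star F') (G := G.star G') (a := (a, a')) (b := (b, b'))
      (e.prodCongr e') _ fun h => hb (congrArg Prod.fst h)).symm

theorem starBE_idBE (F F' : Seq B) :
    starBE (idBE 𝔥 ζ F) (idBE 𝔥 ζ F') = idBE 𝔥 ζ (F.star F') :=
  (starBE_reindexBE (Equiv.refl _) (Equiv.refl _) (fun _ => rfl) (fun _ => rfl)
    (fun _ => rfl)).trans (reindexBE_congr (by ext <;> rfl) _ _)

theorem reindexBE_mem {F G : Seq B} (e : F.ι ≃ G.ι) (h : ∀ a, F.word a = G.word (e a))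
    (hp : ∀ a, F.pos a = G.pos (e a)) (hs : ∀ a, F.shift a = G.shift (e a)) :
    (reindexBE e h : HomBE 𝔥 ζ F G) ∈ bidegBE 𝔥 ζ F G 0 0 := by
  intro a b
  by_cases hb : b = e a
  · subst hb
    rw [reindexBE_apply, ← hp, ← hs]
    refine ⟨fun _ => ?_, fun h => absurd (by ring) h⟩
    have h0 : (0 : ℤ) + F.shift a - F.shift a = 0 := by ring
    rw [h0]
    exact DHom.eqId_mem_deg _
  · rw [reindexBE_ne _ _ hb]
    exact ⟨fun _ => zero_mem _, fun _ => rfl⟩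

theorem starBE_mem {F G F' G' : Seq B} {i j i' j' : ℤ} {f : HomBE 𝔥 ζ F G} {h : HomBE 𝔥 ζ F' G'}
    (hf : f ∈ bidegBE 𝔥 ζ F G i j) (hh : h ∈ bidegBE 𝔥 ζ F' G' i' j') :
    starBE f h ∈ bidegBE 𝔥 ζ (F.star F') (G.star G') (i + i') (j + j') := by
  intro a b
  rw [starBE_apply]
  by_cases h1 : i - j = G.pos b.1 - F.pos a.1
  · by_cases h2 : i' - j' = G'.pos b.2 - F'.pos a.2
    · constructor
      · intro _
        have h0 : j + j' + (G.star G').shift b - (F.star F').shift a =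
            (j + G.shift b.1 - F.shift a.1) + (j' + G'.shift b.2 - F'.shift a.2) := by
          simp only [Seq.star]; ring
        rw [h0]
        exact zsmul_mem (DHom.tens_mem_deg ((hf _ _).1 h1) ((hh _ _).1 h2)) _
      · intro h3
        exact absurd (by simp only [Seq.star]; linarith) h3
    · rw [(hh _ _).2 h2, map_zero, smul_zero]
      exact ⟨fun _ => zero_mem _, fun _ => rfl⟩
  · rw [(hf _ _).2 h1, map_zero, LinearMap.zero_apply, smul_zero]
    exact ⟨fun _ => zero_mem _, fun _ => rfl⟩

/-! ## The canonical isomorphisms of sequences -/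

theorem lamSeq_inv (F : Seq B) :
    compBE (lamSeqInv F) (lamSeq F) = idBE 𝔥 ζ ((Seq.unit B).star F) ∧
      compBE (lamSeq F) (lamSeqInv F) = idBE 𝔥 ζ F :=
  ⟨(compBE_reindexBE_reindexBE _ _ _ _).trans (reindexBE_congr (Equiv.self_trans_symm _) _ _),
    (compBE_reindexBE_reindexBE _ _ _ _).trans (reindexBE_congr (Equiv.symm_trans_self _) _ _)⟩

theorem rhoSeq_inv (F : Seq B) :
    compBE (rhoSeqInv F) (rhoSeq F) = idBE 𝔥 ζ (F.star (Seq.unit B)) ∧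
      compBE (rhoSeq F) (rhoSeqInv F) = idBE 𝔥 ζ F :=
  ⟨(compBE_reindexBE_reindexBE _ _ _ _).trans (reindexBE_congr (Equiv.self_trans_symm _) _ _),
    (compBE_reindexBE_reindexBE _ _ _ _).trans (reindexBE_congr (Equiv.symm_trans_self _) _ _)⟩

theorem alphaSeq_inv (F G K : Seq B) :
    compBE (alphaSeqInv F G K) (alphaSeq F G K) = idBE 𝔥 ζ (F.star (G.star K)) ∧
      compBE (alphaSeq F G K) (alphaSeqInv F G K) = idBE 𝔥 ζ ((F.star G).star K) :=
  ⟨(compBE_reindexBE_reindexBE _ _ _ _).trans (reindexBE_congr (Equiv.symm_trans_self _) _ _),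
    (compBE_reindexBE_reindexBE _ _ _ _).trans (reindexBE_congr (Equiv.self_trans_symm _) _ _)⟩

/-- The unit summand has `sigma = 0`, which removes the sign, and a diagram next to the empty
diagram is itself. -/
theorem starBE_id_unit_apply {F G : Seq B} (f : HomBE 𝔥 ζ F G) (u u' : Unit) (a : F.ι) (c : G.ι) :
    (starBE (idBE 𝔥 ζ (Seq.unit B)) f (u, a) (u', c) : DHom 𝔥 ζ (F.word a) (G.word c)) =
      f a c := by
  refine (starBE_mk_apply (idBE 𝔥 ζ (Seq.unit B)) f u a u' c).trans ?_
  have h0 : (Seq.unit B).sigma u = 0 := rfl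
  rw [h0, Int.cast_zero, zero_mul, sgn_zero, one_smul]
  exact (congrArg (fun z => DHom.tens z (f a c)) (idBE_self (Seq.unit B) u)).trans
    (DHom.nil_tens (f a c))

theorem starBE_unit_id_apply {F G : Seq B} (f : HomBE 𝔥 ζ F G) (u u' : Unit) (a : F.ι) (c : G.ι) :
    (starBE f (idBE 𝔥 ζ (Seq.unit B)) (a, u) (c, u') :
      DHom 𝔥 ζ (F.word a ++ []) (G.word c ++ [])) = DHom.tens (f a c) (DHom.mk (Diag.id [])) := by
  refine (starBE_mk_apply f (idBE 𝔥 ζ (Seq.unit B)) a u c u').trans ?_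
  have h0 : (Seq.unit B).sigma u = 0 := rfl
  rw [h0, Int.cast_zero, add_zero, mul_zero, sgn_zero, one_smul]
  exact congrArg (DHom.tens (f a c)) (idBE_self (Seq.unit B) u)

/-- Needed for the right unit only: `w ++ []` equals `w` but not by definition, so the right unitor
changes the types of the entries. -/
theorem DHom.cast_tens_nil {w v : List B} (f : DHom 𝔥 ζ w v) :
    DHom.cast rfl (List.append_nil v) (DHom.tens f (DHom.mk (Diag.id []))) =
      DHom.cast (List.append_nil w).symm rfl f := by
  conv_rhs => rw [← DHom.tens_nil f, DHom.cast_cast]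

theorem lamSeq_comp_starBE {F G : Seq B} (f : HomBE 𝔥 ζ F G) :
    compBE (lamSeq G) (starBE (idBE 𝔥 ζ (Seq.unit B)) f) = compBE f (lamSeq F) := by
  funext x c
  obtain ⟨u, a⟩ := x
  exact (compBE_reindexBE_left (F := (Seq.unit B).star F) (G := (Seq.unit B).star G)
    (Equiv.punitProd G.ι) (fun _ => rfl) (starBE (idBE 𝔥 ζ (Seq.unit B)) f)
    (u, a) ((), c)).trans ((starBE_id_unit_apply f u () a c).trans
      (compBE_reindexBE_right (F := (Seq.unit B).star F) (Equiv.punitProd F.ι)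
        (fun _ => rfl) f (u, a) c).symm)

theorem rhoSeq_comp_starBE {F G : Seq B} (f : HomBE 𝔥 ζ F G) :
    compBE (rhoSeq G) (starBE f (idBE 𝔥 ζ (Seq.unit B))) = compBE f (rhoSeq F) := by
  funext x c
  obtain ⟨a, u⟩ := x
  refine (compBE_reindexBE_left (F := F.star (Seq.unit B)) (G := G.star (Seq.unit B))
    (Equiv.prodPUnit G.ι) (fun _ => List.append_nil _) (starBE f (idBE 𝔥 ζ (Seq.unit B)))
    (a, u) (c, ())).trans (Eq.trans ?_ (compBE_reindexBE_right (F := F.star (Seq.unit B))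
      (Equiv.prodPUnit F.ι) (fun _ => List.append_nil _) f (a, u) c).symm)
  exact (congrArg (DHom.cast rfl (List.append_nil (G.word c)))
    (starBE_unit_id_apply f u () a c)).trans (DHom.cast_tens_nil (f a c))

theorem DHom.tens_zsmul {w v w' v' : List B} (n : ℤ) (f : DHom 𝔥 ζ w v) (g : DHom 𝔥 ζ w' v') :
    DHom.tens f (n • g) = n • DHom.tens f g := map_zsmul _ _ _

theorem DHom.zsmul_tens {w v w' v' : List B} (n : ℤ) (f : DHom 𝔥 ζ w v) (g : DHom 𝔥 ζ w' v') :
    DHom.tens (n • f) g = n • DHom.tens f g := by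
  rw [map_zsmul, LinearMap.smul_apply]

theorem DHom.cast_smul_tens_assoc {w v w' v' w'' v'' : List B} {m n : ℤ} (hmn : m = n)
    (f : DHom 𝔥 ζ w v) (g : DHom 𝔥 ζ w' v') (h : DHom 𝔥 ζ w'' v'') :
    DHom.cast rfl (List.append_assoc _ _ _).symm (m • DHom.tens f (DHom.tens g h)) =
      DHom.cast (List.append_assoc _ _ _) rfl (n • DHom.tens (DHom.tens f g) h) := by
  rw [hmn, DHom.cast_smul_int, DHom.cast_smul_int, ← DHom.tens_assoc, DHom.cast_cast]

/-- Both bracketings produce the sign exponent `σ(a)(σ(b) + σ(b') + σ(c) + σ(c')) + σ(b)(σ(c) +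
σ(c'))`, because `sigma` is additive under convolution. Hence the associator carries no sign. -/
theorem alphaSeq_comp_starBE {F G K F' G' K' : Seq B} (f : HomBE 𝔥 ζ F F') (g : HomBE 𝔥 ζ G G')
    (h : HomBE 𝔥 ζ K K') :
    compBE (alphaSeq F' G' K') (starBE f (starBE g h)) =
      compBE (starBE (starBE f g) h) (alphaSeq F G K) := by
  funext x y
  obtain ⟨a, b, c⟩ := x
  obtain ⟨⟨a', b'⟩, c'⟩ := y
  refine (compBE_reindexBE_left (F := F.star (G.star K)) (G := F'.star (G'.star K'))
    (K := (F'.star G').star K') (Equiv.prodAssoc F'.ι G'.ι K'.ι).symm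
    (fun _ => (List.append_assoc _ _ _).symm) _ (a, b, c) (a', b', c')).trans ?_
  refine Eq.trans ?_ (compBE_reindexBE_right (F := F.star (G.star K)) (G := (F.star G).star K)
    (K := (F'.star G').star K')
    (Equiv.prodAssoc F.ι G.ι K.ι).symm
    (fun _ => (List.append_assoc _ _ _).symm) _ (a, b, c) ((a', b'), c')).symm
  have hl : (starBE f (starBE g h) (a, b, c) (a', b', c') :
      DHom 𝔥 ζ (F.word a ++ (G.word b ++ K.word c)) (F'.word a' ++ (G'.word b' ++ K'.word c'))) =
      (sgn ((F.sigma a : ZMod 2) * ((G.star K).sigma (b, c) + (G'.star K').sigma (b', c'))) *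
        sgn ((G.sigma b : ZMod 2) * (K.sigma c + K'.sigma c'))) •
      DHom.tens (f a a') (DHom.tens (g b b') (h c c')) := by
    refine (starBE_mk_apply f (starBE g h) a (b, c) a' (b', c')).trans ?_
    rw [mul_smul]
    refine congrArg _ (Eq.trans ?_ (DHom.tens_zsmul _ (f a a') (DHom.tens (g b b') (h c c'))))
    exact congrArg (fun z => DHom.tens (f a a') z) (starBE_mk_apply g h b c b' c')
  have hr : (starBE (starBE f g) h ((a, b), c) ((a', b'), c') :
      DHom 𝔥 ζ ((F.word a ++ G.word b) ++ K.word c) ((F'.word a' ++ G'.word b') ++ K'.word c')) =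
      (sgn (((F.star G).sigma (a, b) : ZMod 2) * (K.sigma c + K'.sigma c')) *
        sgn ((F.sigma a : ZMod 2) * (G.sigma b + G'.sigma b'))) •
      DHom.tens (DHom.tens (f a a') (g b b')) (h c c') := by
    refine (starBE_mk_apply (starBE f g) h (a, b) c (a', b') c').trans ?_
    rw [mul_smul]
    refine congrArg _ (Eq.trans ?_ (DHom.zsmul_tens _ (DHom.tens (f a a') (g b b')) (h c c')))
    exact congrArg (fun z => DHom.tens z (h c c')) (starBE_mk_apply f g a b a' b')
  refine (congrArg (DHom.cast rfl (List.append_assoc _ _ _).symm) hl).trans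
    (Eq.trans ?_ (congrArg (DHom.cast (List.append_assoc _ _ _) rfl) hr).symm)
  refine DHom.cast_smul_tens_assoc ?_ (f a a') (g b b') (h c c')
  rw [show (G.star K).sigma (b, c) = G.sigma b + K.sigma c from sigma_star G K (b, c),
    show (G'.star K').sigma (b', c') = G'.sigma b' + K'.sigma c' from sigma_star G' K' (b', c'),
    show (F.star G).sigma (a, b) = F.sigma a + G.sigma b from sigma_star F G (a, b),
    ← sgn_add, ← sgn_add]
  congr 1
  push_cast
  ring

end Diagrams

end FreeMonodromic

end

/-! ### Calculus in `Λ ⊗ Hom_BE ⊗ R^∨`: augmentations, derivations, convolution and bidegrees. -/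

open CategoryTheory TensorProduct

noncomputable section

namespace FreeMonodromic

universe uB uW uk uV

section FM

variable {k : Type uk} [CommRing k] {V : Type uV} [AddCommGroup V] [Module k V]
  {B : Type uB} {M : CoxeterMatrix B} {W : Type uW} [Group W] {cs : CoxeterSystem M W}
  {𝔥 : Realization cs k V} {ζ : LowerTerms M k V}

/-! ## Augmentations and derivations of the morphism spaces -/

/-- The augmentation of `Λ`. -/
abbrev epsL : Lam k V →ₐ[k] k := ExteriorAlgebra.algebraMapInv

/-- The augmentation of `R^∨`. -/
abbrev epsR : Rv k V →ₐ[k] k := SymmetricAlgebra.algebraMapInv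

@[simp] theorem epsL_ι (r : Module.Dual k V) : epsL (ExteriorAlgebra.ι k r : Lam k V) = 0 := by
  simp [epsL, ExteriorAlgebra.algebraMapInv]

@[simp] theorem epsR_ι (x : V) : epsR (SymmetricAlgebra.ι k V x) = 0 :=
  SymmetricAlgebra.algebraMapInv_ι x

@[simp] theorem invL_zero (r : Lam k V) : invL 0 r = r := by simp [invL]

@[simp] theorem invL_ι (p : ZMod 2) (r : Module.Dual k V) :
    invL p (ExteriorAlgebra.ι k r : Lam k V) = sgn p • ExteriorAlgebra.ι k r := by
  rcases zmod_two_cases p with rfl | rfl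
  · simp
  · rw [invL, if_neg one_ne_zero, sgn_one, neg_smul, one_smul]
    exact CliffordAlgebra.involute_ι _

@[simp] theorem epsL_invL (p : ZMod 2) (r : Lam k V) : epsL (invL p r) = epsL r := by
  change (epsL.comp (invL p)) r = epsL r
  congr 1
  apply ExteriorAlgebra.hom_ext
  ext r : 1
  simp

theorem epsL_of_mem_pow {n : ℕ} (hn : n ≠ 0) {a : Lam k V}
    (ha : a ∈ LinearMap.range (ExteriorAlgebra.ι k (M := Module.Dual k V)) ^ n) : epsL a = 0 := by
  obtain ⟨n, rfl⟩ := Nat.exists_eq_succ_of_ne_zero hn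
  rw [pow_succ] at ha
  induction ha using Submodule.mul_induction_on' with
  | mem_mul_mem x _ y hy => obtain ⟨v, rfl⟩ := hy; rw [map_mul, epsL_ι, mul_zero]
  | add x _ y _ hx hy => rw [map_add, hx, hy, add_zero]

theorem epsR_of_mem_pow {n : ℕ} (hn : n ≠ 0) {a : Rv k V}
    (ha : a ∈ LinearMap.range (SymmetricAlgebra.ι k V) ^ n) : epsR a = 0 := by
  obtain ⟨n, rfl⟩ := Nat.exists_eq_succ_of_ne_zero hn
  rw [pow_succ] at ha
  induction ha using Submodule.mul_induction_on' with
  | mem_mul_mem x _ y hy => obtain ⟨v, rfl⟩ := hy; rw [map_mul, epsR_ι, mul_zero]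
  | add x _ y _ hx hy => rw [map_add, hx, hy, add_zero]

/-- The projection of `Λ ⊗ Hom_BE ⊗ R^∨` to `Hom_BE ⊗ R^∨`. -/
def augL {F G : Seq B} : HomFM 𝔥 ζ F G →ₗ[k] HomFM 𝔥 ζ F G :=
  TensorProduct.map (Algebra.linearMap k (Lam k V) ∘ₗ epsL.toLinearMap) LinearMap.id

/-- The projection of `Λ ⊗ Hom_BE ⊗ R^∨` to `Λ ⊗ Hom_BE`. -/
def augR {F G : Seq B} : HomFM 𝔥 ζ F G →ₗ[k] HomFM 𝔥 ζ F G :=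
  TensorProduct.map LinearMap.id
    (TensorProduct.map LinearMap.id (Algebra.linearMap k (Rv k V) ∘ₗ epsR.toLinearMap))

/-- The components whose factor in `Hom_BE` has cohomological degree congruent to `p`. -/
def partFM {F G : Seq B} (p : ZMod 2) : HomFM 𝔥 ζ F G →ₗ[k] HomFM 𝔥 ζ F G :=
  TensorProduct.map LinearMap.id (TensorProduct.map (partBE p) LinearMap.id)

/-- The map `f ↦ r ⋆ f` on free-monodromic morphisms, for a polynomial `r`. -/
def boxLeftFM {F G : Seq B} (r : SymmetricAlgebra k (Module.Dual k V)) :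
    HomFM 𝔥 ζ F G →ₗ[k] HomFM 𝔥 ζ F G :=
  TensorProduct.map LinearMap.id (TensorProduct.map (boxLeft r) LinearMap.id)

/-- The `p`-th power of the sign `signFM`. -/
def signPow {F G : Seq B} (p : ZMod 2) : HomFM 𝔥 ζ F G →ₗ[k] HomFM 𝔥 ζ F G :=
  if p = 0 then LinearMap.id else signFM

variable {F G K L F' G' K' H : Seq B}

theorem smul_tmul_tmul_smul (c d : k) (r : Lam k V) (f : HomBE 𝔥 ζ F G) (x : Rv k V) :
    (c • r) ⊗ₜ[k] (f ⊗ₜ[k] (d • x)) = (c * d) • (r ⊗ₜ[k] (f ⊗ₜ[k] x)) := by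
  rw [TensorProduct.tmul_smul, TensorProduct.tmul_smul, ← TensorProduct.smul_tmul', smul_smul,
    mul_comm]

theorem zsmul_tmul (n : ℤ) (r : Lam k V) (f : HomBE 𝔥 ζ F G ⊗[k] Rv k V) :
    (n • r) ⊗ₜ[k] f = n • (r ⊗ₜ[k] f) :=
  map_zsmul ((TensorProduct.mk k _ _).flip f) n r

theorem tmul_zsmul_tmul (n : ℤ) (r : Lam k V) (f : HomBE 𝔥 ζ F G) (x : Rv k V) :
    r ⊗ₜ[k] ((n • f) ⊗ₜ[k] x) = n • (r ⊗ₜ[k] (f ⊗ₜ[k] x)) :=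
  map_zsmul (TensorProduct.mk k _ _ r ∘ₗ (TensorProduct.mk k _ _).flip x) n f

theorem augL_tmul (r : Lam k V) (f : HomBE 𝔥 ζ F G) (x : Rv k V) :
    augL (r ⊗ₜ (f ⊗ₜ x)) = (epsL r • (1 : Lam k V)) ⊗ₜ (f ⊗ₜ x) := by
  simp [augL, Algebra.algebraMap_eq_smul_one]

theorem augR_tmul (r : Lam k V) (f : HomBE 𝔥 ζ F G) (x : Rv k V) :
    augR (r ⊗ₜ (f ⊗ₜ x)) = r ⊗ₜ (f ⊗ₜ (epsR x • (1 : Rv k V))) := by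
  simp [augR, Algebra.algebraMap_eq_smul_one]

theorem partFM_tmul (p : ZMod 2) (r : Lam k V) (f : HomBE 𝔥 ζ F G) (x : Rv k V) :
    partFM p (r ⊗ₜ (f ⊗ₜ x)) = r ⊗ₜ (partBE p f ⊗ₜ x) := rfl

theorem boxLeftFM_tmul (s : SymmetricAlgebra k (Module.Dual k V)) (r : Lam k V)
    (f : HomBE 𝔥 ζ F G) (x : Rv k V) :
    boxLeftFM s (r ⊗ₜ (f ⊗ₜ x)) = r ⊗ₜ (boxLeft s f ⊗ₜ x) := rfl

theorem contractLeftFM_tmul (v : V) (r : Lam k V) (f : HomBE 𝔥 ζ F G) (x : Rv k V) :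
    contractLeftFM v (r ⊗ₜ (f ⊗ₜ x)) = contractV v r ⊗ₜ (f ⊗ₜ x) := rfl

theorem contractRightFM_tmul (s : Module.Dual k V) (r : Lam k V) (f : HomBE 𝔥 ζ F G)
    (x : Rv k V) :
    contractRightFM s (r ⊗ₜ (f ⊗ₜ x)) = r ⊗ₜ (f ⊗ₜ contractDual s x) := rfl

theorem ustar_tmul_tmul (r s : Lam k V) (f : HomBE 𝔥 ζ F G) (h : HomBE 𝔥 ζ F' G') (x z : Rv k V) :
    ustar (r ⊗ₜ[k] (f ⊗ₜ[k] x)) (s ⊗ₜ[k] (h ⊗ₜ[k] z)) =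
      (epsL s • r) ⊗ₜ[k] (starBE f h ⊗ₜ[k] (epsR x • z)) := by
  simp [ustar, TensorProduct.map₂_apply_tmul]

theorem signPow_tmul {p q : ZMod 2} {f : HomBE 𝔥 ζ F G} (hf : partBE q f = f) (r : Lam k V)
    (x : Rv k V) :
    signPow p (r ⊗ₜ (f ⊗ₜ x)) = (sgn (p * q) • invL p r) ⊗ₜ[k] (f ⊗ₜ[k] x) := by
  rcases zmod_two_cases p with rfl | rfl
  · simp [signPow]
  · rw [signPow, if_neg one_ne_zero, signFM_tmul hf, one_mul]

@[simp] theorem signPow_zero (f : HomFM 𝔥 ζ F G) : signPow 0 f = f := rfl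

theorem signPow_one (f : HomFM 𝔥 ζ F G) : signPow 1 f = signFM f := by
  rw [signPow, if_neg one_ne_zero]

/-- The convolution sees only the augmentation of the exterior factor of its second argument. With
the mirror statement `ustar_augR` it lets a full differential `δ` inside `ustar` be traded for its
component with one outer factor removed. -/
theorem ustar_augL (u : HomFM 𝔥 ζ F G) (w : HomFM 𝔥 ζ F' G') : ustar u (augL w) = ustar u w := by
  induction u using HomFM.ind with
  | h0 => simp
  | hadd x y hx hy => simp only [map_add, LinearMap.add_apply, hx, hy]
  | h p r f x hf =>
    induction w using HomFM.ind with
    | h0 => simp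
    | hadd x y hx hy => simp only [map_add, hx, hy]
    | h q s h z hh => rw [augL_tmul, ustar_tmul_tmul, ustar_tmul_tmul]; simp

theorem ustar_augR (u : HomFM 𝔥 ζ F G) (w : HomFM 𝔥 ζ F' G') : ustar (augR u) w = ustar u w := by
  induction u using HomFM.ind with
  | h0 => simp
  | hadd x y hx hy => simp only [map_add, LinearMap.add_apply, hx, hy]
  | h p r f x hf =>
    induction w using HomFM.ind with
    | h0 => simp
    | hadd x y hx hy => simp only [map_add, hx, hy]
    | h q s h z hh => rw [augR_tmul, ustar_tmul_tmul, ustar_tmul_tmul]; simp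

/-- The augmentation of `Λ` is multiplicative and does not notice the sign involution which enters
the composition. -/
theorem augL_comp (g : HomFM 𝔥 ζ G K) (f : HomFM 𝔥 ζ F G) :
    augL (compFM g f) = compFM (augL g) (augL f) := by
  induction g using HomFM.ind with
  | h0 => simp
  | hadd x y hx hy => simp only [map_add, LinearMap.add_apply, hx, hy]
  | h p r a x ha =>
    induction f using HomFM.ind with
    | h0 => simp
    | hadd x y hx hy => simp only [map_add, hx, hy]
    | h q s b y hb =>
      rw [compFM_tmul ha, augL_tmul, augL_tmul, augL_tmul, compFM_tmul ha, map_mul, epsL_invL,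
        map_smul, map_one, smul_mul_smul_comm, one_mul]

theorem augR_comp (g : HomFM 𝔥 ζ G K) (f : HomFM 𝔥 ζ F G) :
    augR (compFM g f) = compFM (augR g) (augR f) := by
  induction g using HomFM.ind with
  | h0 => simp
  | hadd x y hx hy => simp only [map_add, LinearMap.add_apply, hx, hy]
  | h p r a x ha =>
    induction f using HomFM.ind with
    | h0 => simp
    | hadd x y hx hy => simp only [map_add, hx, hy]
    | h q s b y hb =>
      rw [compFM_tmul ha, augR_tmul, augR_tmul, augR_tmul, compFM_tmul ha, map_mul,
        smul_mul_smul_comm, one_mul]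

/-- Contraction with `v` is an odd derivation of `Λ`; the sign which it acquires on passing the
first morphism counts the total cohomological degree, exterior part included. -/
theorem contractLeftFM_comp (v : V) (g : HomFM 𝔥 ζ G K) (f : HomFM 𝔥 ζ F G) :
    contractLeftFM v (compFM g f) =
      compFM (contractLeftFM v g) f + compFM (signFM g) (contractLeftFM v f) := by
  induction g using HomFM.ind with
  | h0 => simp
  | hadd x y hx hy => simp only [map_add, LinearMap.add_apply, hx, hy]; abel
  | h p r a x ha =>
    induction f using HomFM.ind with
    | h0 => simp
    | hadd x y hx hy => simp only [map_add, hx, hy]; abel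
    | h q s b y hb =>
      rw [compFM_tmul ha, contractLeftFM_tmul, contractLeftFM_tmul, contractLeftFM_tmul,
        signFM_tmul ha, compFM_tmul ha, compFM_tmul ha, contractV_mul, contractV_invL,
        TensorProduct.add_tmul, smul_mul_assoc, mul_smul_comm]

/-- `R^∨` sits in even cohomological degree, so here the Leibniz rule has no sign. -/
theorem contractRightFM_comp (r : Module.Dual k V) (g : HomFM 𝔥 ζ G K) (f : HomFM 𝔥 ζ F G) :
    contractRightFM r (compFM g f) =
      compFM (contractRightFM r g) f + compFM g (contractRightFM r f) := by
  induction g using HomFM.ind with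
  | h0 => simp
  | hadd x y hx hy => simp only [map_add, LinearMap.add_apply, hx, hy]; abel
  | h p r a x ha =>
    induction f using HomFM.ind with
    | h0 => simp
    | hadd x y hx hy => simp only [map_add, hx, hy]; abel
    | h q s b y hb =>
      rw [compFM_tmul ha, contractRightFM_tmul, contractRightFM_tmul, contractRightFM_tmul,
        compFM_tmul ha, compFM_tmul ha, contractDual_mul, TensorProduct.tmul_add,
        TensorProduct.tmul_add]

theorem signFM_comp (g : HomFM 𝔥 ζ G K) (f : HomFM 𝔥 ζ F G) :
    signFM (compFM g f) = compFM (signFM g) (signFM f) := by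
  induction g using HomFM.ind with
  | h0 => simp
  | hadd x y hx hy => simp only [map_add, LinearMap.add_apply, hx, hy]
  | h p r a x ha =>
    induction f using HomFM.ind with
    | h0 => simp
    | hadd x y hx hy => simp only [map_add, hx, hy]
    | h q s b y hb =>
      rw [compFM_tmul ha, signFM_tmul ha, signFM_tmul hb, signFM_tmul (partBE_comp ha hb),
        compFM_tmul ha, map_mul, map_zsmul, invL_invL, invL_invL, add_comm p 1, sgn_add]
      congr 1
      rw [smul_mul_smul_comm]

theorem signFM_ofBE {f : HomBE 𝔥 ζ F G} (hf : partBE 0 f = f) : signFM (ofBE f) = ofBE f := by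
  rw [ofBE, signFM_tmul hf]; simp

/-! ## Convolution of morphisms -/

/-- Koszul rule for `ustar`. The part of `w` of parity `p` passes all of `u₂`: the sign from the
middle factor comes from `compBE_starBE`, the one from the exterior factor from the definition of
composition, and together they form `signPow p`. -/
theorem ustar_comp_part (p : ZMod 2) (u : HomFM 𝔥 ζ G K) (w : HomFM 𝔥 ζ G' K')
    (u₂ : HomFM 𝔥 ζ F G) (w₂ : HomFM 𝔥 ζ F' G') :
    compFM (ustar u (partFM p w)) (ustar u₂ w₂) =
      ustar (compFM u (signPow p u₂)) (compFM (partFM p w) w₂) := by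
  induction u using HomFM.ind with
  | h0 => simp
  | hadd x y hx hy => simp only [map_add, LinearMap.add_apply, hx, hy]
  | h p' r f x hf =>
  induction w using HomFM.ind with
  | h0 => simp
  | hadd x y hx hy => simp only [map_add, LinearMap.add_apply, hx, hy]
  | h p₀ s h z _ =>
  induction u₂ using HomFM.ind with
  | h0 => simp
  | hadd x y hx hy => simp only [map_add, LinearMap.add_apply, hx, hy]
  | h q r₂ f₂ x₂ hf₂ =>
  induction w₂ using HomFM.ind with
  | h0 => simp
  | hadd x y hx hy => simp only [map_add, hx, hy]
  | h q' s₂ h₂ z₂ hh₂ =>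
  have hh : partBE p (partBE p h) = partBE p h := by rw [partBE_partBE, if_pos rfl]
  rw [partFM_tmul, ustar_tmul_tmul, ustar_tmul_tmul, compFM_tmul (partBE_starBE hf hh),
    signPow_tmul hf₂, compFM_tmul hf, compFM_tmul hh, ustar_tmul_tmul,
    compBE_starBE f h₂ hh hf₂, map_zsmul, invL_invL]
  generalize sgn (p * q) = n
  rw [map_smul, smul_mul_smul_comm, smul_mul_smul_comm, tmul_zsmul_tmul, mul_smul_comm,
    smul_comm _ n (_ * _), zsmul_tmul, map_mul, map_mul, epsL_invL]

/-- A condition on `augL w` suffices, since the rest of `w` is invisible to `ustar`. This matters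
for `w = δ`, whose middle factors have mixed parities although `δ` itself is odd. -/
theorem ustar_comp {p : ZMod 2} (u : HomFM 𝔥 ζ G K) {w : HomFM 𝔥 ζ G' K'}
    (u₂ : HomFM 𝔥 ζ F G) (w₂ : HomFM 𝔥 ζ F' G') (hw : partFM p (augL w) = augL w) :
    compFM (ustar u w) (ustar u₂ w₂) = ustar (compFM u (signPow p u₂)) (compFM w w₂) := by
  rw [← ustar_augL u w, ← ustar_augL (compFM u _), augL_comp, ← ustar_augL u₂, ← hw,
    ustar_comp_part]

theorem signFM_ustar {p : ZMod 2} (u : HomFM 𝔥 ζ F G) {w : HomFM 𝔥 ζ F' G'}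
    (hw : partFM p (augL w) = augL w) :
    signFM (ustar u w) = sgn p • ustar (signFM u) w := by
  rw [← ustar_augL u w, ← ustar_augL (signFM u) w, ← hw]
  generalize augL w = w
  induction u using HomFM.ind with
  | h0 => simp
  | hadd x y hx hy => simp only [map_add, LinearMap.add_apply, hx, hy, smul_add]
  | h p' r f x hf =>
  induction w using HomFM.ind with
  | h0 => simp
  | hadd x y hx hy => simp only [map_add, hx, hy, smul_add]
  | h p₀ s h z _ =>
  have hh : partBE p (partBE p h) = partBE p h := by rw [partBE_partBE, if_pos rfl]
  rw [partFM_tmul, ustar_tmul_tmul, signFM_tmul (partBE_starBE hf hh), signFM_tmul hf,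
    ustar_tmul_tmul, map_smul, add_comm p', sgn_add, mul_smul, TensorProduct.smul_tmul',
    smul_comm (epsL s)]

theorem contractLeftFM_ustar (v : V) (u : HomFM 𝔥 ζ F G) (w : HomFM 𝔥 ζ F' G') :
    contractLeftFM v (ustar u w) = ustar (contractLeftFM v u) w := by
  induction u using HomFM.ind with
  | h0 => simp
  | hadd x y hx hy => simp only [map_add, LinearMap.add_apply, hx, hy]
  | h p r f x hf =>
  induction w using HomFM.ind with
  | h0 => simp
  | hadd x y hx hy => simp only [map_add, hx, hy]
  | h q s h z hh =>
  rw [contractLeftFM_tmul, ustar_tmul_tmul, ustar_tmul_tmul, contractLeftFM_tmul, map_smul]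

theorem contractRightFM_ustar (t : Module.Dual k V) (u : HomFM 𝔥 ζ F G) (w : HomFM 𝔥 ζ F' G') :
    contractRightFM t (ustar u w) = ustar u (contractRightFM t w) := by
  induction u using HomFM.ind with
  | h0 => simp
  | hadd x y hx hy => simp only [map_add, LinearMap.add_apply, hx, hy]
  | h p r f x hf =>
  induction w using HomFM.ind with
  | h0 => simp
  | hadd x y hx hy => simp only [map_add, hx, hy]
  | h q s h z hh =>
  rw [contractRightFM_tmul, ustar_tmul_tmul, ustar_tmul_tmul, contractRightFM_tmul, map_smul]

theorem ustar_ofBE (f : HomBE 𝔥 ζ F G) (h : HomBE 𝔥 ζ F' G') :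
    ustar (ofBE f) (ofBE h) = ofBE (starBE f h) := ustar_tmul _ _ _ _

theorem ustar_id : ustar (idFM 𝔥 ζ F) (idFM 𝔥 ζ F') = idFM 𝔥 ζ (F.star F') := by
  rw [idFM, idFM, ustar_ofBE, starBE_idBE]; rfl

/-- Transfers the two readings of a middle box to free-monodromic morphisms. -/
theorem ustar_idBoxRight (r : SymmetricAlgebra k (Module.Dual k V)) (w : HomFM 𝔥 ζ F' G') :
    ustar (ofBE (idBoxRight 𝔥 ζ F r)) w = ustar (idFM 𝔥 ζ F) (boxLeftFM r w) := by
  induction w using HomFM.ind with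
  | h0 => simp
  | hadd x y hx hy => simp only [map_add, hx, hy]
  | h q s h z hh =>
  rw [idFM, ofBE, ofBE, boxLeftFM_tmul, ustar_tmul_tmul, ustar_tmul_tmul, idBoxRight_starBE]

theorem idBoxRight_compFM (r : SymmetricAlgebra k (Module.Dual k V)) (f : HomFM 𝔥 ζ F G) :
    compFM (ofBE (idBoxRight 𝔥 ζ G r)) f = compFM f (ofBE (idBoxRight 𝔥 ζ F r)) := by
  induction f using HomFM.ind with
  | h0 => simp
  | hadd x y hx hy => simp only [map_add, LinearMap.add_apply, hx, hy]
  | h q s h z hh =>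
  rw [ofBE, ofBE, compFM_tmul (partBE_idBoxRight G r), compFM_tmul hh, idBoxRight_comp]
  simp

theorem ustar_mem_rhd {u : HomFM 𝔥 ζ F G} (hu : u ∈ rhd 𝔥 ζ F G) (w : HomFM 𝔥 ζ F' G') :
    ustar u w ∈ rhd 𝔥 ζ _ _ := by
  obtain ⟨u, rfl⟩ := hu
  induction u using TensorProduct.induction_on with
  | zero => simp
  | add x y hx hy => simpa using add_mem hx hy
  | tmul f x =>
  induction w using HomFM.ind with
  | h0 => simp
  | hadd x y hx hy => simpa using add_mem hx hy
  | h q s h z hh =>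
  refine ⟨starBE f h ⊗ₜ (epsR x • epsL s • z), ?_⟩
  change (1 : Lam k V) ⊗ₜ _ = ustar ((1 : Lam k V) ⊗ₜ (f ⊗ₜ x)) _
  rw [ustar_tmul_tmul, smul_tmul_tmul_smul, mul_smul, TensorProduct.tmul_smul,
    TensorProduct.tmul_smul, TensorProduct.tmul_smul, TensorProduct.tmul_smul, smul_comm]

theorem ustar_mem_lhd (u : HomFM 𝔥 ζ F G) {w : HomFM 𝔥 ζ F' G'} (hw : w ∈ lhd 𝔥 ζ F' G') :
    ustar u w ∈ lhd 𝔥 ζ _ _ := by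
  obtain ⟨w, rfl⟩ := hw
  induction w using TensorProduct.induction_on with
  | zero => simp
  | add x y hx hy => simpa using add_mem hx hy
  | tmul s h =>
  induction u using HomFM.ind with
  | h0 => simp
  | hadd x y hx hy => simpa using add_mem hx hy
  | h q r f x hf =>
  refine ⟨(epsR x • epsL s • r) ⊗ₜ starBE f h, ?_⟩
  change (epsR x • epsL s • r) ⊗ₜ (starBE f h ⊗ₜ (1 : Rv k V)) =
    ustar _ (s ⊗ₜ (h ⊗ₜ (1 : Rv k V)))
  rw [ustar_tmul_tmul, smul_tmul_tmul_smul, ← TensorProduct.smul_tmul', ← TensorProduct.smul_tmul',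
    smul_smul, mul_comm]

/-- Tensors with a positive power of `V` on the left or of `V*` on the right are killed by the
augmentations; on the remaining ones the bidegrees add up. -/
theorem ustar_mem {i j i' j' : ℤ} {u : HomFM 𝔥 ζ F G} {w : HomFM 𝔥 ζ F' G'}
    (hu : u ∈ bideg 𝔥 ζ F G i j) (hw : w ∈ bideg 𝔥 ζ F' G' i' j') :
    ustar u w ∈ bideg 𝔥 ζ (F.star F') (G.star G') (i + i') (j + j') := by
  induction hu, hw using Submodule.span_induction₂ with
  | mem_mem x y hx hy =>
    obtain ⟨p, q, i1, j1, r, f, x, hr, hf, hx, rfl, rfl, rfl⟩ := hx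
    obtain ⟨p', q', i2, j2, s, g, y, hs, hg, hy, rfl, rfl, rfl⟩ := hy
    rw [ustar_tmul_tmul]
    by_cases hp' : p' = 0
    · by_cases hq : q = 0
      · subst hp' hq
        refine Submodule.subset_span ⟨p, q', i1 + i2, j1 + j2, _, _, _, Submodule.smul_mem _ _ hr,
          starBE_mem hf hg, Submodule.smul_mem _ _ hy, ?_, ?_, rfl⟩ <;> push_cast <;> ring
      · rw [epsR_of_mem_pow hq hx]; simp
    · rw [epsL_of_mem_pow hp' hs]; simp
  | zero_left y hy => simp
  | zero_right x hx => simp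
  | add_left x y z _ _ _ h1 h2 => simpa using add_mem h1 h2
  | add_right x y z _ _ _ h1 h2 => simpa using add_mem h1 h2
  | smul_left r x y _ _ h => simpa using Submodule.smul_mem _ r h
  | smul_right r x y _ _ h => simpa using Submodule.smul_mem _ r h

/-- Without exterior part the cohomological degree is that of the middle factor, `R^∨` being in
degree zero. -/
theorem partFM_augL_of_mem {i j : ℤ} {w : HomFM 𝔥 ζ F G} (hw : w ∈ bideg 𝔥 ζ F G i j) :
    partFM (i : ZMod 2) (augL w) = augL w := by
  induction hw using Submodule.span_induction with
  | mem x hx =>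
    obtain ⟨p, q, i1, j1, r, f, x, hr, hf, hx, rfl, rfl, rfl⟩ := hx
    rw [augL_tmul]
    by_cases hp : p = 0
    · subst hp
      rw [partFM_tmul, Nat.cast_zero, zero_add, partBE_of_mem hf]
    · rw [epsL_of_mem_pow hp hr]; simp
  | zero => simp
  | add x y _ _ hx hy => rw [map_add, map_add, hx, hy]
  | smul c x _ hx => rw [map_smul, map_smul, hx]

/-! ### Contractions and bidegrees. -/

theorem contractV_of_mem_one {v : V} {r : Lam k V}
    (hr : r ∈ LinearMap.range (ExteriorAlgebra.ι k (M := Module.Dual k V)) ^ 0) :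
    contractV v r = 0 := by
  rw [pow_zero, Submodule.mem_one] at hr
  obtain ⟨c, rfl⟩ := hr
  exact CliffordAlgebra.contractLeft_algebraMap _ _ _

theorem contractV_ι (v : V) (r : Module.Dual k V) :
    contractV v (ExteriorAlgebra.ι k r : Lam k V) = algebraMap k _ (r v) :=
  CliffordAlgebra.contractLeft_ι (Q := (0 : QuadraticForm k (Module.Dual k V)))
    (Module.Dual.eval k V v) r

theorem contractV_mem_pow {v : V} {n : ℕ} {r : Lam k V}
    (hr : r ∈ LinearMap.range (ExteriorAlgebra.ι k (M := Module.Dual k V)) ^ (n + 1)) :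
    contractV v r ∈ LinearMap.range (ExteriorAlgebra.ι k (M := Module.Dual k V)) ^ n := by
  induction n generalizing r with
  | zero =>
    rw [zero_add, pow_one] at hr
    obtain ⟨r, rfl⟩ := hr
    rw [pow_zero, Submodule.mem_one]
    exact ⟨r v, (contractV_ι v r).symm⟩
  | succ n ih =>
    rw [pow_succ'] at hr
    induction hr using Submodule.mul_induction_on' with
    | mem_mul_mem x hx y hy =>
      rw [contractV_mul]
      refine add_mem ?_ ?_
      · obtain ⟨r, rfl⟩ := hx
        rw [contractV_ι, ← Algebra.smul_def]
        exact Submodule.smul_mem _ _ hy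
      · rw [pow_succ']
        exact Submodule.mul_mem_mul (by simpa using invL_mem_pow 1 (n := 1) (by simpa using hx))
          (ih hy)
    | add x _ y _ hx hy => rw [map_add]; exact add_mem hx hy

theorem contractDual_algebraMap (r : Module.Dual k V) (c : k) :
    contractDual r (algebraMap k (Rv k V) c) = 0 := by
  have h : contractDual r (1 : Rv k V) = 0 := by
    have := contractDual_mul r (1 : Rv k V) 1
    simpa using this
  rw [Algebra.algebraMap_eq_smul_one, map_smul, h, smul_zero]

theorem contractDual_mem_pow {r : Module.Dual k V} {n : ℕ} {x : Rv k V}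
    (hx : x ∈ LinearMap.range (SymmetricAlgebra.ι k V) ^ (n + 1)) :
    contractDual r x ∈ LinearMap.range (SymmetricAlgebra.ι k V) ^ n := by
  induction n generalizing x with
  | zero =>
    rw [zero_add, pow_one] at hx
    obtain ⟨v, rfl⟩ := hx
    rw [pow_zero, Submodule.mem_one]
    exact ⟨r v, (contractDual_ι _ _).symm⟩
  | succ n ih =>
    rw [pow_succ'] at hx
    induction hx using Submodule.mul_induction_on' with
    | mem_mul_mem x hx y hy =>
      rw [contractDual_mul]
      refine add_mem ?_ ?_
      · obtain ⟨v, rfl⟩ := hx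
        rw [contractDual_ι, ← Algebra.smul_def]
        exact Submodule.smul_mem _ _ hy
      · rw [pow_succ']
        exact Submodule.mul_mem_mul hx (ih hy)
    | add x _ y _ hx hy => rw [map_add]; exact add_mem hx hy

theorem contractLeftFM_mem {i j : ℤ} {f : HomFM 𝔥 ζ F G} (hf : f ∈ bideg 𝔥 ζ F G i j) (v : V) :
    contractLeftFM v f ∈ bideg 𝔥 ζ F G (i - 1) (j - 2) := by
  induction hf using Submodule.span_induction with
  | mem x hx =>
    obtain ⟨p, q, i1, j1, r, f, x, hr, hf, hx, rfl, rfl, rfl⟩ := hx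
    rw [contractLeftFM_tmul]
    cases p with
    | zero => rw [contractV_of_mem_one hr]; simp
    | succ p =>
      refine Submodule.subset_span ⟨p, q, i1, j1, _, _, _, contractV_mem_pow hr, hf, hx, ?_, ?_,
        rfl⟩ <;> push_cast <;> ring
  | zero => simp
  | add x y _ _ hx hy => rw [map_add]; exact add_mem hx hy
  | smul c x _ hx => rw [map_smul]; exact Submodule.smul_mem _ c hx

theorem contractRightFM_mem {i j : ℤ} {f : HomFM 𝔥 ζ F G} (hf : f ∈ bideg 𝔥 ζ F G i j)
    (t : Module.Dual k V) : contractRightFM t f ∈ bideg 𝔥 ζ F G i (j + 2) := by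
  induction hf using Submodule.span_induction with
  | mem x hx =>
    obtain ⟨p, q, i1, j1, r, f, x, hr, hf, hx, rfl, rfl, rfl⟩ := hx
    rw [contractRightFM_tmul]
    cases q with
    | zero =>
      rw [pow_zero, Submodule.mem_one] at hx
      obtain ⟨c, rfl⟩ := hx
      rw [contractDual_algebraMap]; simp
    | succ q =>
      refine Submodule.subset_span ⟨p, q, i1, j1, _, _, _, hr, hf, contractDual_mem_pow hx, ?_, ?_,
        rfl⟩ <;> push_cast <;> ring
  | zero => simp
  | add x y _ _ hx hy => rw [map_add]; exact add_mem hx hy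
  | smul c x _ hx => rw [map_smul]; exact Submodule.smul_mem _ c hx

theorem augL_mem {i j : ℤ} {f : HomFM 𝔥 ζ F G} (hf : f ∈ bideg 𝔥 ζ F G i j) :
    augL f ∈ bideg 𝔥 ζ F G i j := by
  induction hf using Submodule.span_induction with
  | mem x hx =>
    obtain ⟨p, q, i1, j1, r, f, x, hr, hf, hx, rfl, rfl, rfl⟩ := hx
    rw [augL_tmul]
    by_cases hp : p = 0
    · subst hp
      exact Submodule.subset_span ⟨0, q, i1, j1, _, _, _,
        by rw [pow_zero]; exact Submodule.smul_mem _ _ (Submodule.one_le.1 le_rfl), hf, hx, rfl, rfl, rfl⟩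
    · rw [epsL_of_mem_pow hp hr]; simp
  | zero => simp
  | add x y _ _ hx hy => rw [map_add]; exact add_mem hx hy
  | smul c x _ hx => rw [map_smul]; exact Submodule.smul_mem _ c hx

theorem augR_mem {i j : ℤ} {f : HomFM 𝔥 ζ F G} (hf : f ∈ bideg 𝔥 ζ F G i j) :
    augR f ∈ bideg 𝔥 ζ F G i j := by
  induction hf using Submodule.span_induction with
  | mem x hx =>
    obtain ⟨p, q, i1, j1, r, f, x, hr, hf, hx, rfl, rfl, rfl⟩ := hx
    rw [augR_tmul]
    by_cases hq : q = 0
    · subst hq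
      exact Submodule.subset_span ⟨p, 0, i1, j1, _, _, _, hr, hf,
        by rw [pow_zero]; exact Submodule.smul_mem _ _ (Submodule.one_le.1 le_rfl), rfl, rfl, rfl⟩
    · rw [epsR_of_mem_pow hq hx]; simp
  | zero => simp
  | add x y _ _ hx hy => rw [map_add]; exact add_mem hx hy
  | smul c x _ hx => rw [map_smul]; exact Submodule.smul_mem _ c hx

theorem contractV_contractV_comm (v v' : V) (r : Lam k V) :
    contractV v (contractV v' r) = -contractV v' (contractV v r) :=
  CliffordAlgebra.contractLeft_comm _ _ _

/-! ### Compatibility of `κ` with convolution, contractions and augmentation. -/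

section Differential

variable [Module.Free k V] [Module.Finite k V]

/-- `κ` contracts the exterior factor and puts a box on the far left; both come from the first
argument alone. -/
theorem kappa_ustar (u : HomFM 𝔥 ζ F G) (w : HomFM 𝔥 ζ F' G') :
    kappa (ustar u w) = ustar (kappa u) w := by
  induction u using HomFM.ind with
  | h0 => simp
  | hadd x y hx hy => simp only [map_add, LinearMap.add_apply, hx, hy]
  | h p r f x hf =>
  induction w using HomFM.ind with
  | h0 => simp
  | hadd x y hx hy => simp only [map_add, hx, hy]
  | h q s h z hh =>
  rw [ustar_tmul_tmul, kappa_tmul, kappa_tmul, map_sum, LinearMap.sum_apply]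
  refine Finset.sum_congr rfl fun i _ => ?_
  rw [ustar_tmul_tmul, map_smul, boxLeft_starBE]

/-- Two contractions of the exterior algebra anticommute. -/
theorem kappa_contractLeftFM (v : V) (f : HomFM 𝔥 ζ F G) :
    kappa (contractLeftFM v f) = -contractLeftFM v (kappa f) := by
  induction f using HomFM.ind with
  | h0 => simp
  | hadd x y hx hy => simp only [map_add, hx, hy]; abel
  | h p r f x hf =>
  rw [contractLeftFM_tmul, kappa_tmul, kappa_tmul, map_sum, ← Finset.sum_neg_distrib]
  refine Finset.sum_congr rfl fun i _ => ?_
  rw [contractLeftFM_tmul, contractV_contractV_comm, TensorProduct.neg_tmul]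

theorem kappa_contractRightFM (t : Module.Dual k V) (f : HomFM 𝔥 ζ F G) :
    kappa (contractRightFM t f) = contractRightFM t (kappa f) := by
  induction f using HomFM.ind with
  | h0 => simp
  | hadd x y hx hy => simp only [map_add, hx, hy]
  | h p r f x hf =>
  rw [contractRightFM_tmul, kappa_tmul, kappa_tmul, map_sum]
  rfl

theorem kappa_augR (f : HomFM 𝔥 ζ F G) : kappa (augR f) = augR (kappa f) := by
  induction f using HomFM.ind with
  | h0 => simp
  | hadd x y hx hy => simp only [map_add, hx, hy]
  | h p r f x hf =>
  rw [augR_tmul, kappa_tmul, kappa_tmul, map_sum]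
  simp only [augR_tmul]

theorem kappa_of_mem_rhd {f : HomFM 𝔥 ζ F G} (hf : f ∈ rhd 𝔥 ζ F G) : kappa f = 0 := by
  obtain ⟨f, rfl⟩ := hf
  induction f using TensorProduct.induction_on with
  | zero => simp
  | add x y hx hy => rw [map_add, map_add, hx, hy, add_zero]
  | tmul f x =>
    refine (kappa_tmul (1 : Lam k V) f x).trans (Finset.sum_eq_zero fun i _ => ?_)
    rw [contractV, CliffordAlgebra.contractLeft_one, TensorProduct.zero_tmul]

end Differential

theorem contractLeftFM_of_mem_rhd {f : HomFM 𝔥 ζ F G} (hf : f ∈ rhd 𝔥 ζ F G) (v : V) :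
    contractLeftFM v f = 0 := by
  obtain ⟨f, rfl⟩ := hf
  change contractV v (1 : Lam k V) ⊗ₜ[k] f = 0
  rw [contractV, CliffordAlgebra.contractLeft_one, TensorProduct.zero_tmul]

theorem contractRightFM_of_mem_lhd {f : HomFM 𝔥 ζ F G} (hf : f ∈ lhd 𝔥 ζ F G)
    (t : Module.Dual k V) : contractRightFM t f = 0 := by
  obtain ⟨f, rfl⟩ := hf
  induction f using TensorProduct.induction_on with
  | zero => simp
  | add x y hx hy => rw [map_add, map_add, hx, hy, add_zero]
  | tmul r f =>
    refine (contractRightFM_tmul t r f 1).trans ?_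
    rw [← map_one (algebraMap k (Rv k V)), contractDual_algebraMap]; simp

theorem augL_of_mem_rhd {f : HomFM 𝔥 ζ F G} (hf : f ∈ rhd 𝔥 ζ F G) : augL f = f := by
  obtain ⟨f, rfl⟩ := hf
  induction f using TensorProduct.induction_on with
  | zero => simp
  | add x y hx hy => rw [map_add, map_add, hx, hy]
  | tmul f x =>
    refine (augL_tmul (1 : Lam k V) f x).trans ?_
    rw [map_one, one_smul]; rfl

theorem augR_of_mem_lhd {f : HomFM 𝔥 ζ F G} (hf : f ∈ lhd 𝔥 ζ F G) : augR f = f := by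
  obtain ⟨f, rfl⟩ := hf
  induction f using TensorProduct.induction_on with
  | zero => simp
  | add x y hx hy => rw [map_add, map_add, hx, hy]
  | tmul r f =>
    refine (augR_tmul r f 1).trans ?_
    rw [map_one, one_smul]; rfl

end FM

end FreeMonodromic

end

/-! ### Consequences of convolutivity, and the existence of `μ` and `ν`. -/

open CategoryTheory TensorProduct

noncomputable section

namespace FreeMonodromic

universe uB uW uk uV

section FM

variable {k : Type uk} [CommRing k] {V : Type uV} [AddCommGroup V] [Module k V]
  {B : Type uB} {M : CoxeterMatrix B} {W : Type uW} [Group W] {cs : CoxeterSystem M W}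
  {𝔥 : Realization cs k V} {ζ : LowerTerms M k V}

variable {F G K L F' G' K' H : Seq B}

/-! ## Elements of degree at most one in both outer factors -/

variable (𝔥 ζ F G) in
/-- The subspace `(k ⊕ V*) ⊗ Hom_BE ⊗ (k ⊕ V)`. -/
def linSpan : Submodule k (HomFM 𝔥 ζ F G) :=
  Submodule.span k {z | ∃ (r : Lam k V) (f : HomBE 𝔥 ζ F G) (x : Rv k V),
    r ∈ (1 : Submodule k (Lam k V)) ⊔ LinearMap.range (ExteriorAlgebra.ι k) ∧
    x ∈ (1 : Submodule k (Rv k V)) ⊔ LinearMap.range (SymmetricAlgebra.ι k V) ∧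
    z = r ⊗ₜ (f ⊗ₜ x)}

theorem mem_one_sup_lam {r : Lam k V} :
    r ∈ (1 : Submodule k (Lam k V)) ⊔ LinearMap.range (ExteriorAlgebra.ι k) ↔
      ∃ (c : k) (t : Module.Dual k V), r = algebraMap k _ c + ExteriorAlgebra.ι k t := by
  rw [Submodule.mem_sup]
  constructor
  · rintro ⟨y, hy, z, ⟨t, rfl⟩, rfl⟩
    obtain ⟨c, rfl⟩ := Submodule.mem_one.1 hy
    exact ⟨c, t, rfl⟩
  · rintro ⟨c, t, rfl⟩
    exact ⟨_, Submodule.mem_one.2 ⟨c, rfl⟩, _, ⟨t, rfl⟩, rfl⟩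

theorem mem_one_sup_rv {x : Rv k V} :
    x ∈ (1 : Submodule k (Rv k V)) ⊔ LinearMap.range (SymmetricAlgebra.ι k V) ↔
      ∃ (c : k) (v : V), x = algebraMap k _ c + SymmetricAlgebra.ι k V v := by
  rw [Submodule.mem_sup]
  constructor
  · rintro ⟨y, hy, z, ⟨t, rfl⟩, rfl⟩
    obtain ⟨c, rfl⟩ := Submodule.mem_one.1 hy
    exact ⟨c, t, rfl⟩
  · rintro ⟨c, t, rfl⟩
    exact ⟨_, Submodule.mem_one.2 ⟨c, rfl⟩, _, ⟨t, rfl⟩, rfl⟩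

theorem tmul_mem_linSpan (c : k) (t : Module.Dual k V) (f : HomBE 𝔥 ζ F G) (d : k) (v : V) :
    (algebraMap k _ c + ExteriorAlgebra.ι k t : Lam k V) ⊗ₜ
      (f ⊗ₜ (algebraMap k _ d + SymmetricAlgebra.ι k V v)) ∈ linSpan 𝔥 ζ F G :=
  Submodule.subset_span ⟨_, _, _, mem_one_sup_lam.2 ⟨c, t, rfl⟩, mem_one_sup_rv.2 ⟨d, v, rfl⟩, rfl⟩

/-- To prove a statement about `(k ⊕ V*) ⊗ Hom_BE ⊗ (k ⊕ V)` it suffices to check it on the tensors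
`1 ⊗ f ⊗ x`, `t ⊗ f ⊗ x` with `x` of degree at most one. -/
theorem linSpan_induction {P : (z : HomFM 𝔥 ζ F G) → z ∈ linSpan 𝔥 ζ F G → Prop}
    (h0 : P 0 (zero_mem _))
    (hadd : ∀ x y hx hy, P x hx → P y hy → P (x + y) (add_mem hx hy))
    (h : ∀ (c : k) (t : Module.Dual k V) (f : HomBE 𝔥 ζ F G) (d : k) (v : V),
      P ((algebraMap k _ c + ExteriorAlgebra.ι k t : Lam k V) ⊗ₜ
        (f ⊗ₜ (algebraMap k _ d + SymmetricAlgebra.ι k V v))) (tmul_mem_linSpan c t f d v))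
    {z : HomFM 𝔥 ζ F G} (hz : z ∈ linSpan 𝔥 ζ F G) : P z hz := by
  -- The span is generated additively by scalar multiples of the given tensors; a scalar can be
  -- absorbed in the middle factor, which is why no case for scalar multiplication is required.
  refine Submodule.closure_induction (p := fun z hz => P z hz) h0
    (fun x y hx hy => hadd x y hx hy) ?_ hz
  rintro a z ⟨r, f, x, hr, hx, rfl⟩
  obtain ⟨c, t, rfl⟩ := mem_one_sup_lam.1 hr
  obtain ⟨d, v, rfl⟩ := mem_one_sup_rv.1 hx
  have key := h c t (a • f) d v
  have e : (algebraMap k _ c + ExteriorAlgebra.ι k t : Lam k V) ⊗ₜ[k]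
      ((a • f) ⊗ₜ[k] (algebraMap k _ d + SymmetricAlgebra.ι k V v)) =
      a • ((algebraMap k _ c + ExteriorAlgebra.ι k t : Lam k V) ⊗ₜ[k]
        (f ⊗ₜ[k] (algebraMap k _ d + SymmetricAlgebra.ι k V v))) := by
    rw [← TensorProduct.smul_tmul', TensorProduct.tmul_smul]
  -- `P` depends on a membership proof, so the equality `e` is transported over a variable endpoint.
  have key' : ∀ (y : HomFM 𝔥 ζ F G) (hy : y ∈ linSpan 𝔥 ζ F G),
      (algebraMap k _ c + ExteriorAlgebra.ι k t : Lam k V) ⊗ₜ[k]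
        ((a • f) ⊗ₜ[k] (algebraMap k _ d + SymmetricAlgebra.ι k V v)) = y → P y hy := by
    rintro _ _ rfl
    exact key
  exact key' _ _ e

theorem ofBE_mem_linSpan (f : HomBE 𝔥 ζ F G) : ofBE f ∈ linSpan 𝔥 ζ F G := by
  rw [ofBE]
  simpa using tmul_mem_linSpan 1 0 f 1 0

theorem contractV_linear (v : V) (c : k) (t : Module.Dual k V) :
    contractV v (algebraMap k _ c + ExteriorAlgebra.ι k t : Lam k V) = algebraMap k _ (t v) := by
  rw [map_add, contractV_ι, contractV_of_mem_one (by rw [pow_zero]; exact Submodule.mem_one.2 ⟨c, rfl⟩),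
    zero_add]

theorem contractDual_linear (t : Module.Dual k V) (d : k) (v : V) :
    contractDual t (algebraMap k _ d + SymmetricAlgebra.ι k V v) = algebraMap k _ (t v) := by
  rw [map_add, contractDual_ι, contractDual_algebraMap, zero_add]

theorem contractLeftFM_mem_linSpan {z : HomFM 𝔥 ζ F G} (hz : z ∈ linSpan 𝔥 ζ F G) (v : V) :
    contractLeftFM v z ∈ linSpan 𝔥 ζ F G := by
  induction hz using linSpan_induction with
  | h0 => simp
  | hadd x y _ _ hx hy => rw [map_add]; exact add_mem hx hy
  | h c t f d w =>
    rw [contractLeftFM_tmul, contractV_linear]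
    simpa using tmul_mem_linSpan (t v) 0 f d w

theorem contractRightFM_mem_linSpan {z : HomFM 𝔥 ζ F G} (hz : z ∈ linSpan 𝔥 ζ F G)
    (s : Module.Dual k V) : contractRightFM s z ∈ linSpan 𝔥 ζ F G := by
  induction hz using linSpan_induction with
  | h0 => simp
  | hadd x y _ _ hx hy => rw [map_add]; exact add_mem hx hy
  | h c t f d w =>
    rw [contractRightFM_tmul, contractDual_linear]
    simpa using tmul_mem_linSpan c t f (s w) 0

/-- Contraction of an element of `k ⊕ V*` is a scalar, so no exterior factor is left. This is the
reason for the linearity condition on `δ`: it puts `μ` in `Hom_BE ⊗ R^∨` and, by the mirror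
argument, `ν` in `Λ ⊗ Hom_BE`. -/
theorem contractLeftFM_mem_rhd {z : HomFM 𝔥 ζ F G} (hz : z ∈ linSpan 𝔥 ζ F G) (v : V) :
    contractLeftFM v z ∈ rhd 𝔥 ζ F G := by
  induction hz using linSpan_induction with
  | h0 => simp
  | hadd x y _ _ hx hy => rw [map_add]; exact add_mem hx hy
  | h c t f d w =>
    rw [contractLeftFM_tmul, contractV_linear, Algebra.algebraMap_eq_smul_one,
      ← TensorProduct.smul_tmul']
    exact Submodule.smul_mem _ _ ⟨_, rfl⟩

theorem contractRightFM_mem_lhd {z : HomFM 𝔥 ζ F G} (hz : z ∈ linSpan 𝔥 ζ F G)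
    (s : Module.Dual k V) : contractRightFM s z ∈ lhd 𝔥 ζ F G := by
  induction hz using linSpan_induction with
  | h0 => simp
  | hadd x y _ _ hx hy => rw [map_add]; exact add_mem hx hy
  | h c t f d w =>
    rw [contractRightFM_tmul, contractDual_linear, Algebra.algebraMap_eq_smul_one (s w),
      TensorProduct.tmul_smul, TensorProduct.tmul_smul]
    exact Submodule.smul_mem _ _ ⟨_ ⊗ₜ f, rfl⟩

theorem ustar_mem_linSpan {u : HomFM 𝔥 ζ F G} {w : HomFM 𝔥 ζ F' G'}
    (hu : u ∈ linSpan 𝔥 ζ F G) (hw : w ∈ linSpan 𝔥 ζ F' G') :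
    ustar u w ∈ linSpan 𝔥 ζ (F.star F') (G.star G') := by
  induction hu using linSpan_induction with
  | h0 => simp
  | hadd x y _ _ hx hy => rw [map_add, LinearMap.add_apply]; exact add_mem hx hy
  | h c t f d v =>
  induction hw using linSpan_induction with
  | h0 => simp
  | hadd x y _ _ hx hy => rw [map_add]; exact add_mem hx hy
  | h c' t' f' d' v' =>
  rw [ustar_tmul_tmul, smul_tmul_tmul_smul]
  exact Submodule.smul_mem _ _ (tmul_mem_linSpan _ _ _ _ _)

/-! ## Coefficients of polynomials along a line -/

/-- The coefficient of `X ^ n` under the homomorphism `R^∨ → k[X]`, `v ↦ ⟨r, v⟩ X`. -/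
def coefR (r : Module.Dual k V) (n : ℕ) : Rv k V →ₗ[k] k :=
  Polynomial.lcoeff k n ∘ₗ (SymmetricAlgebra.lift (r.smulRight (Polynomial.X : Polynomial k))).toLinearMap

/-- The map which replaces the factor in `R^∨` by one of its coefficients along a line. -/
def coefFM (r : Module.Dual k V) (n : ℕ) : HomFM 𝔥 ζ F G →ₗ[k] HomFM 𝔥 ζ F G :=
  TensorProduct.map LinearMap.id
    (TensorProduct.map LinearMap.id (Algebra.linearMap k (Rv k V) ∘ₗ coefR r n))

theorem coefFM_tmul (t : Module.Dual k V) (n : ℕ) (r : Lam k V) (f : HomBE 𝔥 ζ F G) (x : Rv k V) :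
    coefFM t n (r ⊗ₜ (f ⊗ₜ x)) = r ⊗ₜ (f ⊗ₜ algebraMap k (Rv k V) (coefR t n x)) := rfl

theorem coefR_two_mul (t : Module.Dual k V) (x y : Rv k V) :
    coefR t 2 (x * y) =
      coefR t 0 x * coefR t 2 y + coefR t 1 x * coefR t 1 y + coefR t 2 x * coefR t 0 y := by
  simp [coefR, Polynomial.coeff_mul, Finset.Nat.antidiagonal_succ]
  ring

theorem coefR_linear (t : Module.Dual k V) (n : ℕ) (d : k) (v : V) :
    coefR t n (algebraMap k _ d + SymmetricAlgebra.ι k V v) =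
      (if n = 0 then d else 0) + (if n = 1 then t v else 0) := by
  simp [coefR, Polynomial.coeff_C, Polynomial.coeff_X, eq_comm]

/-- The Cauchy product in degree two. For elements of degree at most one in `R^∨` only the middle
term survives, and there the first coefficient is the contraction. -/
theorem coefFM_two_comp (t : Module.Dual k V) (g : HomFM 𝔥 ζ G K) (f : HomFM 𝔥 ζ F G) :
    coefFM t 2 (compFM g f) = compFM (coefFM t 0 g) (coefFM t 2 f) +
      compFM (coefFM t 1 g) (coefFM t 1 f) + compFM (coefFM t 2 g) (coefFM t 0 f) := by
  induction g using HomFM.ind with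
  | h0 => simp
  | hadd x y hx hy => simp only [map_add, LinearMap.add_apply, hx, hy]; abel
  | h p r a x ha =>
    induction f using HomFM.ind with
    | h0 => simp
    | hadd x y hx hy => simp only [map_add, hx, hy]; abel
    | h q s b y hb =>
      simp only [coefFM_tmul, compFM_tmul ha, coefR_two_mul, map_add, map_mul,
        TensorProduct.tmul_add]

theorem coefFM_two_of_linear {z : HomFM 𝔥 ζ F G} (hz : z ∈ linSpan 𝔥 ζ F G)
    (t : Module.Dual k V) : coefFM t 2 z = 0 := by
  induction hz using linSpan_induction with
  | h0 => simp
  | hadd x y _ _ hx hy => rw [map_add, hx, hy, add_zero]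
  | h c t f d w => rw [coefFM_tmul, coefR_linear]; simp

theorem coefFM_one_of_linear {z : HomFM 𝔥 ζ F G} (hz : z ∈ linSpan 𝔥 ζ F G)
    (t : Module.Dual k V) : coefFM t 1 z = contractRightFM t z := by
  induction hz using linSpan_induction with
  | h0 => simp
  | hadd x y _ _ hx hy => rw [map_add, hx, hy, map_add]
  | h c t f d w => rw [coefFM_tmul, coefR_linear, contractRightFM_tmul, contractDual_linear]; simp

/-! ## Boxes on the right -/

theorem DHom.boxRight_add {w v : List B} (r s : SymmetricAlgebra k (Module.Dual k V))
    (f : DHom 𝔥 ζ w v) : DHom.boxRight (r + s) f = DHom.boxRight r f + DHom.boxRight s f := by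
  have h : (DHom.mk (Diag.box (r + s)) : DHom 𝔥 ζ [] []) =
    DHom.mk (Diag.box r) + DHom.mk (Diag.box s) := DHom.sound (DRel.box_add r s)
  have hc : ∀ {w v w' v' : List B} (hw : w = w') (hv : v = v') (x y : DHom 𝔥 ζ w v),
      DHom.cast hw hv (x + y) = DHom.cast hw hv x + DHom.cast hw hv y := by
    rintro w v _ _ rfl rfl x y; rfl
  rw [DHom.boxRight, h, map_add, hc]; rfl

theorem DHom.boxRight_smul {w v : List B} (c : k) (r : SymmetricAlgebra k (Module.Dual k V))
    (f : DHom 𝔥 ζ w v) : DHom.boxRight (c • r) f = c • DHom.boxRight r f := by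
  have h : (DHom.mk (Diag.box (c • r)) : DHom 𝔥 ζ [] []) = c • DHom.mk (Diag.box r) :=
    DHom.sound (DRel.box_smul c r)
  have hc : ∀ {w v w' v' : List B} (hw : w = w') (hv : v = v') (x : DHom 𝔥 ζ w v),
      DHom.cast hw hv (c • x) = c • DHom.cast hw hv x := by
    rintro w v _ _ rfl rfl x; rfl
  rw [DHom.boxRight, h, map_smul, hc]; rfl

variable (𝔥 ζ F) in
/-- The map `r ↦ id ⋆ r`, for linear forms `r`. -/
def boxRightHom : Module.Dual k V →ₗ[k] HomBE 𝔥 ζ F F where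
  toFun r := idBoxRight 𝔥 ζ F (SymmetricAlgebra.ι k _ r)
  map_add' r s := by
    funext a b
    by_cases hb : b = a
    · subst hb
      refine Eq.trans ?_ (congrArg₂ (· + ·) (idBoxRight_self F _ b) (idBoxRight_self F _ b)).symm
      rw [idBoxRight_self, map_add, DHom.boxRight_add]
    · refine Eq.trans ?_ (congrArg₂ (· + ·) (idBoxRight_ne _ hb) (idBoxRight_ne _ hb)).symm
      rw [idBoxRight_ne _ hb, add_zero]
  map_smul' c r := by
    funext a b
    change _ = c • idBoxRight 𝔥 ζ F (SymmetricAlgebra.ι k _ r) a b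
    by_cases hb : b = a
    · subst hb
      refine Eq.trans ?_ (congrArg (c • ·) (idBoxRight_self F _ b)).symm
      rw [idBoxRight_self, map_smul, DHom.boxRight_smul]
    · refine Eq.trans ?_ (congrArg (c • ·) (idBoxRight_ne _ hb)).symm
      rw [idBoxRight_ne _ hb, smul_zero]

/-! ### Contractions of the equation `δδ + κ(δ) = Θ`. -/

section Differential

variable [Module.Free k V] [Module.Finite k V]

/-- The basis of `V` which is used in the definition of `κ` and `Θ`. -/
local notation "bV" => Module.Free.chooseBasis k V

theorem sum_coord_smul (r : Module.Dual k V) : ∑ i, r (bV i) • (bV).coord i = r := by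
  refine (bV).ext fun j => ?_
  simp

theorem sum_smul_basis (v : V) : ∑ i, (bV).coord i v • bV i = v := (bV).sum_repr v

theorem Theta_mem_rhd (F : Seq B) : Theta 𝔥 ζ F ∈ rhd 𝔥 ζ F F :=
  Submodule.sum_mem _ fun _ _ => ⟨_, rfl⟩

theorem Theta_mem_linSpan (F : Seq B) : Theta 𝔥 ζ F ∈ linSpan 𝔥 ζ F F := by
  refine Submodule.sum_mem _ fun i _ => ?_
  simpa using tmul_mem_linSpan (𝔥 := 𝔥) (ζ := ζ) 1 0 _ 0 (bV i)

theorem augR_Theta (F : Seq B) : augR (Theta 𝔥 ζ F) = 0 := by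
  rw [Theta, map_sum]
  refine Finset.sum_eq_zero fun i _ => ?_
  rw [augR_tmul, epsR_ι]; simp

/-- `Θ` comes from the canonical element of `V* ⊗ V`, so contracting its `V` with `r` returns `r`.
Likewise for the following expansions: sums over dual bases are removed by `sum_coord_smul` and
`sum_smul_basis`. -/
theorem contractRightFM_Theta (r : Module.Dual k V) (F : Seq B) :
    contractRightFM r (Theta 𝔥 ζ F) = ofBE (idBoxRight 𝔥 ζ F (SymmetricAlgebra.ι k _ r)) := by
  rw [Theta, map_sum]
  change _ = (1 : Lam k V) ⊗ₜ[k] (boxRightHom 𝔥 ζ F r ⊗ₜ[k] (1 : Rv k V))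
  conv_rhs => rw [← sum_coord_smul r]
  rw [map_sum, TensorProduct.sum_tmul, TensorProduct.tmul_sum]
  refine Finset.sum_congr rfl fun i _ => ?_
  rw [contractRightFM_tmul, contractDual_ι, map_smul, TensorProduct.smul_tmul,
    Algebra.algebraMap_eq_smul_one]
  rfl

theorem kappa_eq_sum (f : HomFM 𝔥 ζ F G) :
    kappa f = ∑ i, boxLeftFM (SymmetricAlgebra.ι k _ ((bV).coord i)) (contractLeftFM (bV i) f) := by
  induction f using HomFM.ind with
  | h0 => simp
  | hadd x y hx hy => simp only [map_add, hx, hy, Finset.sum_add_distrib]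
  | h p r f x hf => rw [kappa_tmul]; rfl

theorem ustar_Theta (F F' : Seq B) :
    ustar (idFM 𝔥 ζ F) (Theta 𝔥 ζ F') = Theta 𝔥 ζ (F.star F') := by
  rw [Theta, Theta, map_sum]
  refine Finset.sum_congr rfl fun i _ => ?_
  rw [idFM, ofBE, ustar_tmul, starBE_idBoxRight]

theorem coefFM_kappa (t : Module.Dual k V) (n : ℕ) (f : HomFM 𝔥 ζ F G) :
    coefFM t n (kappa f) = kappa (coefFM t n f) := by
  induction f using HomFM.ind with
  | h0 => simp
  | hadd x y hx hy => simp only [map_add, hx, hy]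
  | h p r f x hf =>
  rw [coefFM_tmul, kappa_tmul, kappa_tmul, map_sum]
  rfl

namespace PreComplex

variable {F G F' G' K H : PreComplex 𝔥 ζ}

namespace IsConvolutive

theorem mem_linSpan (hF : F.IsConvolutive) : F.δ ∈ linSpan 𝔥 ζ F.seq F.seq := hF.2.2

theorem signFM_delta (hF : F.IsConvolutive) : signFM F.δ = -F.δ := by
  rw [signFM_of_mem hF.1, Int.negOnePow_one, Units.neg_smul, one_smul]

theorem contractLeft_mem_rhd (hF : F.IsConvolutive) (v : V) :
    contractLeftFM v F.δ ∈ rhd 𝔥 ζ F.seq F.seq := contractLeftFM_mem_rhd hF.mem_linSpan v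

theorem contractRight_mem_lhd (hF : F.IsConvolutive) (r : Module.Dual k V) :
    contractRightFM r F.δ ∈ lhd 𝔥 ζ F.seq F.seq := contractRightFM_mem_lhd hF.mem_linSpan r

/-- Contract the defining equation with `v`. `Θ` has no exterior part, and neither has `v ⌢ δ`, so
the term with `κ` vanishes too; as `δ` is odd, what remains of `δδ` is a commutator. -/
theorem contractLeft_comm_delta (hF : F.IsConvolutive) (v : V) :
    compFM F.δ (contractLeftFM v F.δ) = compFM (contractLeftFM v F.δ) F.δ := by
  have h := congrArg (contractLeftFM v) hF.2.1
  rw [contractLeftFM_of_mem_rhd (Theta_mem_rhd _), map_add, contractLeftFM_comp, hF.signFM_delta,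
    ← neg_eq_iff_eq_neg.2 (kappa_contractLeftFM v F.δ),
    kappa_of_mem_rhd (hF.contractLeft_mem_rhd v), neg_zero, add_zero, map_neg, LinearMap.neg_apply,
    ← sub_eq_add_neg, sub_eq_zero] at h
  exact h.symm

theorem signFM_contractLeft (hF : F.IsConvolutive) (v : V) :
    signFM (contractLeftFM v F.δ) = contractLeftFM v F.δ := by
  rw [signFM_of_mem (contractLeftFM_mem hF.1 v), sub_self, Int.negOnePow_zero, one_smul]

/-- Contract `contractLeft_comm_delta` a second time. The elements `v ⌢ δ` are even and have zero
contraction, so only `δ` is hit. -/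
theorem contractLeft_comm (hF : F.IsConvolutive) (v v' : V) :
    compFM (contractLeftFM v F.δ) (contractLeftFM v' F.δ) =
      compFM (contractLeftFM v' F.δ) (contractLeftFM v F.δ) := by
  have h := congrArg (contractLeftFM v) (hF.contractLeft_comm_delta v')
  rw [contractLeftFM_comp, contractLeftFM_comp,
    contractLeftFM_of_mem_rhd (hF.contractLeft_mem_rhd v'), map_zero, map_zero, add_zero,
    LinearMap.zero_apply, zero_add, hF.signFM_contractLeft] at h
  exact h

/-- The derivation `(-) ⌢ r` applied to the defining equation: `δ ⌢ r` is a homotopy for the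
multiplication by `r` on the right. -/
theorem contractRight_relation (hF : F.IsConvolutive) (r : Module.Dual k V) :
    compFM (contractRightFM r F.δ) F.δ + compFM F.δ (contractRightFM r F.δ) +
      kappa (contractRightFM r F.δ) =
        ofBE (idBoxRight 𝔥 ζ F.seq (SymmetricAlgebra.ι k _ r)) := by
  rw [kappa_contractRightFM, ← contractRightFM_comp, ← map_add, hF.2.1, contractRightFM_Theta]

theorem augR_contractRight (hF : F.IsConvolutive) (r : Module.Dual k V) :
    augR (contractRightFM r F.δ) = contractRightFM r F.δ :=
  augR_of_mem_lhd (hF.contractRight_mem_lhd r)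

theorem augL_contractLeft (hF : F.IsConvolutive) (v : V) :
    augL (contractLeftFM v F.δ) = contractLeftFM v F.δ :=
  augL_of_mem_rhd (hF.contractLeft_mem_rhd v)

/-- Since `δ ⌢ r` and the box have no part in `V`, the same relation holds for the component of `δ`
in `Λ ⊗ End_BE`, the only one visible in the first argument of `ustar`. -/
theorem contractRight_relation_augR (hF : F.IsConvolutive) (r : Module.Dual k V) :
    compFM (contractRightFM r F.δ) (augR F.δ) + compFM (augR F.δ) (contractRightFM r F.δ) +
      kappa (contractRightFM r F.δ) =
        ofBE (idBoxRight 𝔥 ζ F.seq (SymmetricAlgebra.ι k _ r)) := by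
  have h := congrArg augR (hF.contractRight_relation r)
  rw [map_add, map_add, augR_comp, augR_comp, ← kappa_augR, hF.augR_contractRight,
    augR_of_mem_lhd (ofBE_mem_lhd _)] at h
  exact h

theorem augR_delta_sq (hF : F.IsConvolutive) :
    compFM (augR F.δ) (augR F.δ) + kappa (augR F.δ) = 0 := by
  have h := congrArg augR hF.2.1
  rwa [map_add, augR_comp, ← kappa_augR, augR_Theta] at h

theorem kappa_delta_mem_rhd (hF : F.IsConvolutive) : kappa F.δ ∈ rhd 𝔥 ζ F.seq F.seq := by
  rw [kappa_eq_sum]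
  refine Submodule.sum_mem _ fun i _ => ?_
  obtain ⟨z, hz⟩ := hF.contractLeft_mem_rhd (bV i)
  rw [← hz]
  exact ⟨TensorProduct.map (boxLeft _) LinearMap.id z, rfl⟩

/-- Here `κ` is still applied to all of `δ`: it lowers the exterior degree and `δ` is linear there,
so `κ(δ)` survives the augmentation unchanged and depends precisely on the component which `augL`
removes from `δ`. -/
theorem augL_delta_sq (hF : F.IsConvolutive) :
    compFM (augL F.δ) (augL F.δ) + kappa F.δ = Theta 𝔥 ζ F.seq := by
  have h := congrArg augL hF.2.1
  rwa [map_add, augL_comp, augL_of_mem_rhd hF.kappa_delta_mem_rhd,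
    augL_of_mem_rhd (Theta_mem_rhd _)] at h

theorem augL_delta_comm (hF : F.IsConvolutive) (v : V) :
    compFM (augL F.δ) (contractLeftFM v F.δ) = compFM (contractLeftFM v F.δ) (augL F.δ) := by
  have h := congrArg augL (hF.contractLeft_comm_delta v)
  rwa [augL_comp, augL_comp, hF.augL_contractLeft] at h

/-- Compare quadratic coefficients along `r` in the defining equation. `δ`, `κ(δ)` and `Θ` have
none, and that of `δδ` is the square of the linear coefficient `δ ⌢ r`. Contracting twice with `r`
would only give twice this square, which is not enough when `2` is not cancellable. -/
theorem contractRight_sq (hF : F.IsConvolutive) (r : Module.Dual k V) :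
    compFM (contractRightFM r F.δ) (contractRightFM r F.δ) = 0 := by
  have h := congrArg (coefFM r 2) hF.2.1
  rw [map_add, coefFM_two_comp, coefFM_kappa, coefFM_two_of_linear hF.mem_linSpan,
    coefFM_one_of_linear hF.mem_linSpan, coefFM_two_of_linear (Theta_mem_linSpan _)] at h
  simpa using h

end IsConvolutive

end PreComplex

end Differential

/-! ## The endomorphism algebra of a sequence -/

variable (𝔥 ζ) in
/-- The endomorphism algebra of a sequence for the composition of free-monodromic morphisms. -/
def EndFM (F : Seq B) : Type (max uB uk uV) := HomFM 𝔥 ζ F F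

instance (F : Seq B) : AddCommGroup (EndFM 𝔥 ζ F) :=
  inferInstanceAs (AddCommGroup (HomFM 𝔥 ζ F F))

instance (F : Seq B) : Module k (EndFM 𝔥 ζ F) := inferInstanceAs (Module k (HomFM 𝔥 ζ F F))

instance (F : Seq B) : Ring (EndFM 𝔥 ζ F) where
  mul f g := compFM (𝔥 := 𝔥) (ζ := ζ) (F := F) (G := F) (K := F) f g
  one := idFM 𝔥 ζ F
  left_distrib f g h := map_add (compFM (𝔥 := 𝔥) (ζ := ζ) (F := F) (G := F) (K := F) f) g h
  right_distrib f g h := LinearMap.map_add₂ (compFM (𝔥 := 𝔥) (ζ := ζ) (F := F) (G := F) (K := F)) f g h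
  zero_mul f := LinearMap.map_zero₂ (compFM (𝔥 := 𝔥) (ζ := ζ) (F := F) (G := F) (K := F)) f
  mul_zero f := map_zero (compFM (𝔥 := 𝔥) (ζ := ζ) (F := F) (G := F) (K := F) f)
  mul_assoc f g h := compFM_assoc f g h
  one_mul f := idFM_comp f
  mul_one f := comp_idFM f
  -- Integer multiples are those of the additive group already present, so that the two structures
  -- agree.
  zsmul := (inferInstance : SubNegMonoid (EndFM 𝔥 ζ F)).zsmul
  zsmul_zero' := (inferInstance : SubNegMonoid (EndFM 𝔥 ζ F)).zsmul_zero'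
  zsmul_succ' := (inferInstance : SubNegMonoid (EndFM 𝔥 ζ F)).zsmul_succ'
  zsmul_neg' := (inferInstance : SubNegMonoid (EndFM 𝔥 ζ F)).zsmul_neg'
  neg_add_cancel := neg_add_cancel

instance (F : Seq B) : Algebra k (EndFM 𝔥 ζ F) :=
  Algebra.ofModule
    (fun c f g => LinearMap.map_smul₂ (compFM (𝔥 := 𝔥) (ζ := ζ) (F := F) (G := F) (K := F)) c f g)
    (fun c f g => map_smul (compFM (𝔥 := 𝔥) (ζ := ζ) (F := F) (G := F) (K := F) f) c g)

theorem contractDual_add (r s : Module.Dual k V) (x : Rv k V) :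
    contractDual (r + s) x = contractDual r x + contractDual s x := by
  induction x using SymmetricAlgebra.induction with
  | algebraMap c => simp only [contractDual_algebraMap, add_zero]
  | ι v => simp only [contractDual_ι, LinearMap.add_apply, map_add]
  | mul a b ha hb => simp only [contractDual_mul, ha, hb]; ring
  | add a b ha hb => simp only [map_add, ha, hb]; abel

theorem contractDual_smul (c : k) (r : Module.Dual k V) (x : Rv k V) :
    contractDual (c • r) x = c • contractDual r x := by
  induction x using SymmetricAlgebra.induction with
  | algebraMap c => simp only [contractDual_algebraMap, smul_zero]
  | ι v => simp only [contractDual_ι, LinearMap.smul_apply, Algebra.algebraMap_eq_smul_one,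
      smul_assoc]
  | mul a b ha hb =>
    simp only [contractDual_mul, ha, hb, smul_add, smul_mul_assoc, mul_smul_comm]
  | add a b ha hb => simp only [map_add, ha, hb, smul_add]

namespace PreComplex

/-! ### Existence of `μ` and `ν` by universal properties. -/

section Existence

variable [Module.Free k V] [Module.Finite k V] {F : PreComplex 𝔥 ζ}

variable (F) in
/-- The map `x ↦ x ⌢ δ`. -/
def muLin : V →ₗ[k] EndFM 𝔥 ζ F.seq where
  toFun v := contractLeftFM v F.δ
  map_add' v v' := by
    generalize F.δ = z
    change (contractLeftFM (v + v') z : HomFM 𝔥 ζ F.seq F.seq) =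
      contractLeftFM v z + contractLeftFM v' z
    simp only [contractLeftFM, contractV, map_add, TensorProduct.map_add_left, LinearMap.add_apply]
  map_smul' c v := by
    generalize F.δ = z
    change (contractLeftFM (c • v) z : HomFM 𝔥 ζ F.seq F.seq) = c • contractLeftFM v z
    simp only [contractLeftFM, contractV, map_smul, TensorProduct.map_smul_left,
      LinearMap.smul_apply]

variable (F) in
/-- The map `r ↦ δ ⌢ r`. -/
def nuLin : Module.Dual k V →ₗ[k] EndFM 𝔥 ζ F.seq where
  toFun r := contractRightFM r F.δ
  map_add' r s := by
    generalize F.δ = z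
    change (contractRightFM (r + s) z : HomFM 𝔥 ζ F.seq F.seq) =
      contractRightFM r z + contractRightFM s z
    have h : contractDual (r + s) = contractDual r + contractDual s :=
      LinearMap.ext (contractDual_add r s)
    simp only [contractRightFM, h, TensorProduct.map_add_right, LinearMap.add_apply]
  map_smul' c r := by
    generalize F.δ = z
    change (contractRightFM (c • r) z : HomFM 𝔥 ζ F.seq F.seq) = c • contractRightFM r z
    have h : contractDual (c • r) = c • contractDual r := LinearMap.ext (contractDual_smul c r)
    simp only [contractRightFM, h, TensorProduct.map_smul_right, LinearMap.smul_apply]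

/-- The universal property of the symmetric algebra needs a commutative target. The commuting
contractions `v ⌢ δ` generate a commutative subalgebra of the endomorphisms, and the homomorphism is
constructed with values there. -/
theorem exists_isMu (hF : F.IsConvolutive) : ∃ φ, F.IsMu φ := by
  have hc : ∀ a ∈ Set.range (muLin F), ∀ b ∈ Set.range (muLin F), a * b = b * a := by
    rintro _ ⟨v, rfl⟩ _ ⟨v', rfl⟩
    exact hF.contractLeft_comm v v'
  let _ : CommRing (Algebra.adjoin k (Set.range (muLin F))) :=
    { (inferInstance : Ring (Algebra.adjoin k (Set.range (muLin F)))) with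
      mul_comm := fun a b => (Algebra.isMulCommutative_adjoin k hc).is_comm.comm a b }
  let ψ : V →ₗ[k] Algebra.adjoin k (Set.range (muLin F)) :=
    { toFun := fun v => ⟨muLin F v, Algebra.subset_adjoin ⟨v, rfl⟩⟩
      map_add' := fun v v' => Subtype.ext (map_add (muLin F) v v')
      map_smul' := fun c v => Subtype.ext (map_smul (muLin F) c v) }
  let Φ : Rv k V →ₐ[k] EndFM 𝔥 ζ F.seq :=
    (Algebra.adjoin k (Set.range (muLin F))).val.comp (SymmetricAlgebra.lift ψ)
  refine ⟨Φ.toLinearMap, map_one Φ, map_mul Φ, fun v => ?_⟩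
  change ((SymmetricAlgebra.lift ψ (SymmetricAlgebra.ι k V v) : Algebra.adjoin k _) :
    EndFM 𝔥 ζ F.seq) = _
  rw [SymmetricAlgebra.lift_ι_apply]
  rfl

/-- Universal property of the exterior algebra, whose hypothesis is `contractRight_sq`. -/
theorem exists_isNu (hF : F.IsConvolutive) : ∃ φ, F.IsNu φ := by
  let Φ : Lam k V →ₐ[k] EndFM 𝔥 ζ F.seq :=
    ExteriorAlgebra.lift k ⟨nuLin F, fun r => hF.contractRight_sq r⟩
  refine ⟨Φ.toLinearMap, map_one Φ, map_mul Φ, fun r => ?_⟩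
  exact ExteriorAlgebra.lift_ι_apply k (nuLin F) _ r

theorem isMu_mu (hF : F.IsConvolutive) : F.IsMu F.mu := Classical.epsilon_spec (exists_isMu hF)

theorem isNu_nu (hF : F.IsConvolutive) : F.IsNu F.nu := Classical.epsilon_spec (exists_isNu hF)

end Existence

end PreComplex

end FM

end FreeMonodromic

end

/-! ### The homomorphisms `μ`, `ν`, and the operations `- ⋆̂ id` and `id ⋆̂ -`. -/

open CategoryTheory TensorProduct

noncomputable section

namespace FreeMonodromic

universe uB uW uk uV

section FM

variable {k : Type uk} [CommRing k] {V : Type uV} [AddCommGroup V] [Module k V]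
  {B : Type uB} {M : CoxeterMatrix B} {W : Type uW} [Group W] {cs : CoxeterSystem M W}
  {𝔥 : Realization cs k V} {ζ : LowerTerms M k V}

attribute [local irreducible] compBE starBE partBE compFM ustar contractLeftFM contractRightFM
  kappa signFM partFM boxLeft

/-! ## Signs in compositions of convolutions -/

section Signs

variable {F G K L F' G' K' H : Seq B}

theorem bideg_congr {i j i' j' : ℤ} (hi : i = i') (hj : j = j') {f : HomFM 𝔥 ζ F G}
    (hf : f ∈ bideg 𝔥 ζ F G i j) : f ∈ bideg 𝔥 ζ F G i' j' := hi ▸ hj ▸ hf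

theorem partFM_comp {g : HomFM 𝔥 ζ G K} {f : HomFM 𝔥 ζ F G} (hg : partFM 0 g = g)
    (hf : partFM 0 f = f) : partFM 0 (compFM g f) = compFM g f := by
  -- Both arguments are replaced by even parts of themselves; the claim then makes sense, and is
  -- linear, in arbitrary `g` and `f`.
  rw [← hg, ← hf]
  clear hf hg
  induction g using HomFM.ind with
  | h0 => simp
  | hadd x y hx hy => simp only [map_add, LinearMap.add_apply, hx, hy]
  | h p r a x ha =>
  induction f using HomFM.ind with
  | h0 => simp
  | hadd x y hx hy => simp only [map_add, hx, hy]
  | h q s b y hb =>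
  have h0 : ∀ {F G : Seq B} (a : HomBE 𝔥 ζ F G), partBE 0 (partBE 0 a) = partBE 0 a := fun a => by
    rw [partBE_partBE, if_pos rfl]
  rw [partFM_tmul, partFM_tmul, compFM_tmul (h0 a), partFM_tmul]
  have := partBE_comp (h0 a) (h0 b)
  rw [add_zero] at this
  rw [this]

theorem partFM_idFM : partFM 0 (idFM 𝔥 ζ F) = idFM 𝔥 ζ F := by
  rw [idFM, ofBE, partFM_tmul, partBE_id]

theorem signFM_idFM : signFM (idFM 𝔥 ζ F) = idFM 𝔥 ζ F := signFM_ofBE (partBE_id F)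

theorem signPow_of_even {f : HomFM 𝔥 ζ F G} (hf : signFM f = f) (p : ZMod 2) :
    signPow p f = f := by
  rcases zmod_two_cases p with rfl | rfl
  · rfl
  · rw [signPow_one, hf]

theorem sum_partFM (f : HomFM 𝔥 ζ F G) : ∑ p, partFM p f = f := by
  induction f using HomFM.ind with
  | h0 => simp
  | hadd x y hx hy => simp only [map_add, Finset.sum_add_distrib, hx, hy]
  | h p r f x hf =>
    simp only [partFM_tmul]
    rw [← TensorProduct.tmul_sum, ← TensorProduct.sum_tmul, sum_partBE]

/-- Passing an even `u₂` costs no sign, whatever the parities in `w`; so `w` may be split into its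
parts. -/
theorem ustar_comp_of_even (u : HomFM 𝔥 ζ G K) (w : HomFM 𝔥 ζ G' K') {u₂ : HomFM 𝔥 ζ F G}
    (hu : signFM u₂ = u₂) (w₂ : HomFM 𝔥 ζ F' G') :
    compFM (ustar u w) (ustar u₂ w₂) = ustar (compFM u u₂) (compFM w w₂) := by
  conv_lhs => rw [← sum_partFM w]
  conv_rhs => rw [← sum_partFM w]
  simp only [map_sum, LinearMap.sum_apply, ustar_comp_part, signPow_of_even hu]

theorem ustar_comp_even (u : HomFM 𝔥 ζ G K) {w : HomFM 𝔥 ζ G' K'} (u₂ : HomFM 𝔥 ζ F G)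
    (w₂ : HomFM 𝔥 ζ F' G') (hw : partFM 0 (augL w) = augL w) :
    compFM (ustar u w) (ustar u₂ w₂) = ustar (compFM u u₂) (compFM w w₂) :=
  (ustar_comp u u₂ w₂ hw).trans (by rw [signPow_zero])

theorem ustar_comp_odd (u : HomFM 𝔥 ζ G K) {w : HomFM 𝔥 ζ G' K'} (u₂ : HomFM 𝔥 ζ F G)
    (w₂ : HomFM 𝔥 ζ F' G') (hw : partFM 1 (augL w) = augL w) :
    compFM (ustar u w) (ustar u₂ w₂) = ustar (compFM u (signFM u₂)) (compFM w w₂) := by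
  rw [ustar_comp u u₂ w₂ hw, signPow_one]

theorem idFM_mem_rhd (F : Seq B) : idFM 𝔥 ζ F ∈ rhd 𝔥 ζ F F := ofBE_mem_rhd _

theorem idFM_mem_lhd (F : Seq B) : idFM 𝔥 ζ F ∈ lhd 𝔥 ζ F F := ofBE_mem_lhd _

theorem augL_idFM : augL (idFM 𝔥 ζ F) = idFM 𝔥 ζ F := augL_of_mem_rhd (ofBE_mem_rhd _)

theorem partFM_augL_idFM : partFM 0 (augL (idFM 𝔥 ζ F)) = augL (idFM 𝔥 ζ F) := by
  rw [augL_idFM, partFM_idFM]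

theorem ustar_id_comp (u : HomFM 𝔥 ζ G K) (u₂ : HomFM 𝔥 ζ F G) (w₂ : HomFM 𝔥 ζ F' G') :
    compFM (ustar u (idFM 𝔥 ζ G')) (ustar u₂ w₂) = ustar (compFM u u₂) w₂ := by
  rw [ustar_comp_even _ _ _ partFM_augL_idFM, idFM_comp]

theorem comp_id_ustar (u : HomFM 𝔥 ζ F G) (w : HomFM 𝔥 ζ G' K') (w₂ : HomFM 𝔥 ζ F' G') :
    compFM (ustar u w) (ustar (idFM 𝔥 ζ F) w₂) = ustar u (compFM w w₂) := by
  rw [ustar_comp_of_even _ _ signFM_idFM, comp_idFM]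

/-- The middle box once more: precomposed to the left factor on its right, it becomes a box on the
left of the right factor. -/
theorem ustar_comp_idBoxRight (u : HomFM 𝔥 ζ F G) (r : SymmetricAlgebra k (Module.Dual k V))
    (w : HomFM 𝔥 ζ F' G') :
    ustar (compFM u (ofBE (idBoxRight 𝔥 ζ F r))) w = ustar u (boxLeftFM r w) := by
  rw [← ustar_id_comp, ustar_idBoxRight, ustar_id_comp, comp_idFM]

end Signs

namespace PreComplex

variable {F : PreComplex 𝔥 ζ}

/-! ## Properties of `μ` and `ν` -/

theorem IsMu.algebraMap {φ : Rv k V →ₗ[k] HomFM 𝔥 ζ F.seq F.seq} (hφ : F.IsMu φ) (c : k) :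
    φ (algebraMap k _ c) = c • idFM 𝔥 ζ F.seq := by
  rw [Algebra.algebraMap_eq_smul_one, map_smul, hφ.map_one]

theorem IsNu.algebraMap {φ : Lam k V →ₗ[k] HomFM 𝔥 ζ F.seq F.seq} (hφ : F.IsNu φ) (c : k) :
    φ (algebraMap k _ c) = c • idFM 𝔥 ζ F.seq := by
  rw [Algebra.algebraMap_eq_smul_one, map_smul, hφ.map_one]

/-- `μ` and `ν` are obtained by choice. Uniqueness, by induction on generators, permits computing
them from any candidate; this is how they are found for convolutions and for the unit. -/
theorem IsMu.unique {φ ψ : Rv k V →ₗ[k] HomFM 𝔥 ζ F.seq F.seq} (hφ : F.IsMu φ) (hψ : F.IsMu ψ) :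
    φ = ψ := by
  ext x
  induction x using SymmetricAlgebra.induction with
  | algebraMap c => rw [hφ.algebraMap, hψ.algebraMap]
  | ι v => rw [hφ.map_ι, hψ.map_ι]
  | mul a b ha hb => rw [hφ.map_mul, hψ.map_mul, ha, hb]
  | add a b ha hb => rw [map_add, map_add, ha, hb]

theorem IsNu.unique {φ ψ : Lam k V →ₗ[k] HomFM 𝔥 ζ F.seq F.seq} (hφ : F.IsNu φ) (hψ : F.IsNu ψ) :
    φ = ψ := by
  refine LinearMap.ext fun x => ?_
  induction x using ExteriorAlgebra.induction with
  | algebraMap c => rw [hφ.algebraMap, hψ.algebraMap]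
  | ι v => rw [hφ.map_ι, hψ.map_ι]
  | mul a b ha hb => rw [hφ.map_mul, hψ.map_mul, ha, hb]
  | add a b ha hb => rw [map_add, map_add, ha, hb]

section Differential

variable [Module.Free k V] [Module.Finite k V]

/-- The basis of `V` which is used in the definition of `κ` and `Θ`. -/
local notation "bV" => Module.Free.chooseBasis k V

namespace IsConvolutive

theorem mu_one (hF : F.IsConvolutive) : F.mu 1 = idFM 𝔥 ζ F.seq := (isMu_mu hF).map_one

theorem nu_one (hF : F.IsConvolutive) : F.nu 1 = idFM 𝔥 ζ F.seq := (isNu_nu hF).map_one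

theorem mu_mul (hF : F.IsConvolutive) (x y : Rv k V) : F.mu (x * y) = compFM (F.mu x) (F.mu y) :=
  (isMu_mu hF).map_mul x y

theorem nu_mul (hF : F.IsConvolutive) (x y : Lam k V) : F.nu (x * y) = compFM (F.nu x) (F.nu y) :=
  (isNu_nu hF).map_mul x y

theorem mu_ι (hF : F.IsConvolutive) (v : V) :
    F.mu (SymmetricAlgebra.ι k V v) = contractLeftFM v F.δ := (isMu_mu hF).map_ι v

theorem nu_ι (hF : F.IsConvolutive) (r : Module.Dual k V) :
    F.nu (ExteriorAlgebra.ι k r) = contractRightFM r F.δ := (isNu_nu hF).map_ι r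

theorem mu_algebraMap (hF : F.IsConvolutive) (c : k) :
    F.mu (algebraMap k _ c) = c • idFM 𝔥 ζ F.seq := (isMu_mu hF).algebraMap c

theorem nu_algebraMap (hF : F.IsConvolutive) (c : k) :
    F.nu (algebraMap k _ c) = c • idFM 𝔥 ζ F.seq := (isNu_nu hF).algebraMap c

theorem mu_mem_rhd (hF : F.IsConvolutive) (x : Rv k V) : F.mu x ∈ rhd 𝔥 ζ F.seq F.seq := by
  induction x using SymmetricAlgebra.induction with
  | algebraMap c => rw [hF.mu_algebraMap]; exact Submodule.smul_mem _ _ (ofBE_mem_rhd _)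
  | ι v => rw [hF.mu_ι]; exact hF.contractLeft_mem_rhd v
  | mul a b ha hb => rw [hF.mu_mul]; exact compFM_mem_rhd ha hb
  | add a b ha hb => rw [map_add]; exact add_mem ha hb

theorem nu_mem_lhd (hF : F.IsConvolutive) (x : Lam k V) : F.nu x ∈ lhd 𝔥 ζ F.seq F.seq := by
  induction x using ExteriorAlgebra.induction with
  | algebraMap c => rw [hF.nu_algebraMap]; exact Submodule.smul_mem _ _ (ofBE_mem_lhd _)
  | ι v => rw [hF.nu_ι]; exact hF.contractRight_mem_lhd v
  | mul a b ha hb => rw [hF.nu_mul]; exact compFM_mem_lhd ha hb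
  | add a b ha hb => rw [map_add]; exact add_mem ha hb

theorem augL_mu (hF : F.IsConvolutive) (x : Rv k V) : augL (F.mu x) = F.mu x :=
  augL_of_mem_rhd (hF.mu_mem_rhd x)

theorem mu_mem (hF : F.IsConvolutive) {n : ℕ} {x : Rv k V}
    (hx : x ∈ LinearMap.range (SymmetricAlgebra.ι k V) ^ n) :
    F.mu x ∈ bideg 𝔥 ζ F.seq F.seq 0 (-2 * n) := by
  induction n generalizing x with
  | zero =>
    obtain ⟨c, rfl⟩ := Submodule.mem_one.1 (by rwa [pow_zero] at hx)
    rw [hF.mu_algebraMap]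
    exact bideg_congr (by simp) (by simp) (Submodule.smul_mem _ c (ofBE_mem (idBE_mem F.seq)))
  | succ n ih =>
    rw [pow_succ] at hx
    induction hx using Submodule.mul_induction_on' with
    | mem_mul_mem a ha b hb =>
      obtain ⟨v, rfl⟩ := hb
      rw [hF.mu_mul, hF.mu_ι]
      exact bideg_congr (by ring) (by push_cast; ring)
        (compFM_mem (ih ha) (contractLeftFM_mem hF.1 v))
    | add a _ b _ ha hb => rw [map_add]; exact add_mem ha hb

theorem nu_mem (hF : F.IsConvolutive) {n : ℕ} {x : Lam k V}
    (hx : x ∈ LinearMap.range (ExteriorAlgebra.ι k (M := Module.Dual k V)) ^ n) :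
    F.nu x ∈ bideg 𝔥 ζ F.seq F.seq n (2 * n) := by
  induction n generalizing x with
  | zero =>
    obtain ⟨c, rfl⟩ := Submodule.mem_one.1 (by rwa [pow_zero] at hx)
    rw [hF.nu_algebraMap]
    exact bideg_congr (by simp) (by simp) (Submodule.smul_mem _ c (ofBE_mem (idBE_mem F.seq)))
  | succ n ih =>
    rw [pow_succ] at hx
    induction hx using Submodule.mul_induction_on' with
    | mem_mul_mem a ha b hb =>
      obtain ⟨v, rfl⟩ := hb
      rw [hF.nu_mul, hF.nu_ι]
      exact bideg_congr (by push_cast; ring) (by push_cast; ring)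
        (compFM_mem (ih ha) (contractRightFM_mem hF.1 v))
    | add a _ b _ ha hb => rw [map_add]; exact add_mem ha hb

theorem partFM_contractLeft (hF : F.IsConvolutive) (v : V) :
    partFM 0 (contractLeftFM v F.δ) = contractLeftFM v F.δ := by
  have h := partFM_augL_of_mem (contractLeftFM_mem hF.1 v)
  rw [hF.augL_contractLeft] at h
  simpa using h

/-- `v ⌢ δ` has cohomological degree zero and no exterior part, so its middle factor is even.
Therefore convolution with values of `μ` on the right never creates a sign. -/
theorem partFM_mu (hF : F.IsConvolutive) (x : Rv k V) : partFM 0 (F.mu x) = F.mu x := by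
  induction x using SymmetricAlgebra.induction with
  | algebraMap c => rw [hF.mu_algebraMap, map_smul, partFM_idFM]
  | ι v => rw [hF.mu_ι, hF.partFM_contractLeft]
  | mul a b ha hb => rw [hF.mu_mul, partFM_comp ha hb]
  | add a b ha hb => rw [map_add, map_add, ha, hb]

theorem partFM_augL_mu (hF : F.IsConvolutive) (x : Rv k V) :
    partFM 0 (augL (F.mu x)) = augL (F.mu x) := by rw [hF.augL_mu, hF.partFM_mu]

theorem partFM_augL_delta (hF : F.IsConvolutive) :
    partFM 1 (augL (augL F.δ)) = augL (augL F.δ) := by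
  simpa using partFM_augL_of_mem (augL_mem hF.1)

theorem signFM_augR_delta (hF : F.IsConvolutive) : signFM (augR F.δ) = -augR F.δ := by
  rw [signFM_of_mem (augR_mem hF.1), Int.negOnePow_one, Units.neg_smul, one_smul]

theorem signFM_contractRight (hF : F.IsConvolutive) (r : Module.Dual k V) :
    signFM (contractRightFM r F.δ) = -contractRightFM r F.δ := by
  rw [signFM_of_mem (contractRightFM_mem hF.1 r), Int.negOnePow_one, Units.neg_smul, one_smul]

/-- `δ ⌢ r` is of cohomological degree one, like `r`, so `ν` intertwines the two sign involutions.
-/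
theorem signFM_nu (hF : F.IsConvolutive) (t : Lam k V) : signFM (F.nu t) = F.nu (invL 1 t) := by
  induction t using ExteriorAlgebra.induction with
  | algebraMap c => rw [AlgHom.commutes, hF.nu_algebraMap, map_smul, signFM_idFM]
  | ι r =>
    rw [invL_ι, hF.nu_ι, hF.signFM_contractRight, sgn_one, neg_one_smul, map_neg, hF.nu_ι]
  | mul a b ha hb => rw [hF.nu_mul, signFM_comp, map_mul, hF.nu_mul, ha, hb]
  | add a b ha hb => simp only [map_add, ha, hb]

theorem signPow_nu (hF : F.IsConvolutive) (p : ZMod 2) (t : Lam k V) :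
    signPow p (F.nu t) = F.nu (invL p t) := by
  rcases zmod_two_cases p with rfl | rfl
  · simp
  · rw [signPow_one, hF.signFM_nu]

theorem augL_delta_comm_mu (hF : F.IsConvolutive) (x : Rv k V) :
    compFM (augL F.δ) (F.mu x) = compFM (F.mu x) (augL F.δ) := by
  induction x using SymmetricAlgebra.induction with
  | algebraMap c =>
    simp only [hF.mu_algebraMap, map_smul, LinearMap.smul_apply, comp_idFM, idFM_comp]
  | ι v => rw [hF.mu_ι, hF.augL_delta_comm]
  | mul a b ha hb => rw [hF.mu_mul, ← compFM_assoc, ha, compFM_assoc, hb, compFM_assoc]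
  | add a b ha hb => simp only [map_add, LinearMap.add_apply, ha, hb]

theorem _root_.FreeMonodromic.sum_smul_ofBE_idBoxRight (P : Seq B) (r : Module.Dual k V) :
    ∑ i, r (bV i) • ofBE (idBoxRight 𝔥 ζ P (SymmetricAlgebra.ι k _ ((bV).coord i))) =
      ofBE (idBoxRight 𝔥 ζ P (SymmetricAlgebra.ι k _ r)) := by
  change _ = (1 : Lam k V) ⊗ₜ[k] (boxRightHom 𝔥 ζ P r ⊗ₜ[k] (1 : Rv k V))
  conv_rhs => rw [← sum_coord_smul r]
  rw [map_sum, TensorProduct.sum_tmul, TensorProduct.tmul_sum]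
  refine Finset.sum_congr rfl fun i _ => ?_
  rw [map_smul, ← TensorProduct.smul_tmul', TensorProduct.tmul_smul]
  rfl

theorem mu_ι_sum (hF : F.IsConvolutive) (v : V) : F.mu (SymmetricAlgebra.ι k V v) =
    ∑ i, (bV).coord i v • contractLeftFM (bV i) F.δ := by
  conv_lhs => rw [← sum_smul_basis (k := k) v]
  simp only [map_sum, map_smul, hF.mu_ι]

theorem nu_ι_sum (hF : F.IsConvolutive) (r : Module.Dual k V) : F.nu (ExteriorAlgebra.ι k r) =
    ∑ i, r (bV i) • contractRightFM ((bV).coord i) F.δ := by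
  conv_lhs => rw [← sum_coord_smul r]
  simp only [map_sum, map_smul, hF.nu_ι]

/-- For any `a`, `κ` plus the graded commutator with `a` is an odd derivation for composition: `κ`
is one, and the terms `u a v` cancel. -/
theorem _root_.FreeMonodromic.kappa_commutator_comp {P : Seq B} (a u v : HomFM 𝔥 ζ P P) :
    kappa (compFM u v) + compFM a (compFM u v) - compFM (signFM (compFM u v)) a =
      compFM (kappa u + compFM a u - compFM (signFM u) a) v +
        compFM (signFM u) (kappa v + compFM a v - compFM (signFM v) a) := by
  rw [kappa_comp, signFM_comp, ← compFM_assoc, map_sub, map_sub, map_add, map_add,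
    LinearMap.sub_apply, LinearMap.add_apply, ← compFM_assoc (signFM u) a v,
    compFM_assoc (signFM u) (signFM v) a]
  abel

/-- The other side of `differential_nu` satisfies the same Leibniz rule, because contraction is an
odd derivation and right boxes are central. -/
theorem nu_contractV_mul (hF : F.IsConvolutive) (v : V) (r : SymmetricAlgebra k (Module.Dual k V))
    (a b : Lam k V) :
    compFM (F.nu (contractV v (a * b))) (ofBE (idBoxRight 𝔥 ζ F.seq r)) =
      compFM (compFM (F.nu (contractV v a)) (ofBE (idBoxRight 𝔥 ζ F.seq r))) (F.nu b) +
        compFM (signFM (F.nu a)) (compFM (F.nu (contractV v b)) (ofBE (idBoxRight 𝔥 ζ F.seq r))) := by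
  rw [contractV_mul, map_add, map_add, LinearMap.add_apply, hF.nu_mul, hF.nu_mul,
    ← hF.signFM_nu, compFM_assoc, compFM_assoc, compFM_assoc, idBoxRight_compFM]

theorem differential_nu_ι (hF : F.IsConvolutive) (r : Module.Dual k V) :
    kappa (F.nu (ExteriorAlgebra.ι k r)) + compFM (augR F.δ) (F.nu (ExteriorAlgebra.ι k r)) -
      compFM (signFM (F.nu (ExteriorAlgebra.ι k r))) (augR F.δ) =
        ofBE (idBoxRight 𝔥 ζ F.seq (SymmetricAlgebra.ι k _ r)) := by
  rw [hF.nu_ι, hF.signFM_contractRight, map_neg, LinearMap.neg_apply, sub_neg_eq_add,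
    ← hF.contractRight_relation_augR r]
  abel

/-- The differential of `ν(t)` for the differential `u ↦ κ(u) + δ u - (-1)^{|u|} u δ`, where `δ` is
replaced by its component in `Λ ⊗ End_BE`. -/
theorem differential_nu (hF : F.IsConvolutive) (t : Lam k V) :
    kappa (F.nu t) + compFM (augR F.δ) (F.nu t) - compFM (signFM (F.nu t)) (augR F.δ) =
      ∑ i, compFM (F.nu (contractV (bV i) t))
        (ofBE (idBoxRight 𝔥 ζ F.seq (SymmetricAlgebra.ι k _ ((bV).coord i)))) := by
  -- Both sides obey the same graded Leibniz rule in `t`, so the substance is the case of `V*`,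
  -- where the formula is the contracted defining equation.
  induction t using ExteriorAlgebra.induction with
  | algebraMap c =>
    have h : ∀ v : V, contractV v (algebraMap k (Lam k V) c) = 0 := fun v =>
      CliffordAlgebra.contractLeft_algebraMap _ _ _
    have h0 : kappa (idFM 𝔥 ζ F.seq) = 0 := kappa_ofBE _
    simp [h, hF.nu_algebraMap, signFM_idFM, comp_idFM, idFM_comp, h0]
  | ι r =>
    have h : ∀ v : V, contractV v (ExteriorAlgebra.ι k r : Lam k V) = algebraMap k _ (r v) :=
      fun v => contractV_ι v r
    simp only [h, hF.nu_algebraMap, map_smul, LinearMap.smul_apply, idFM_comp]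
    rw [sum_smul_ofBE_idBoxRight, hF.differential_nu_ι]
  | mul a b ha hb =>
    simp only [hF.nu_contractV_mul]
    rw [Finset.sum_add_distrib, hF.nu_mul, kappa_commutator_comp, ha, hb]
    simp only [map_sum, LinearMap.sum_apply]
  | add a b ha hb =>
    simp only [map_add, LinearMap.add_apply, Finset.sum_add_distrib, ← ha, ← hb]
    abel

end IsConvolutive

end Differential

/-! ## Convolution with identities -/

section Whisker

variable {P Q R : Seq B}

variable (F P Q) in
/-- The map `f ↦ f ⋆̂ id_F`. -/
def starId : HomFM 𝔥 ζ P Q →ₗ[k] HomFM 𝔥 ζ (P.star F.seq) (Q.star F.seq) :=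
  TensorProduct.lift (ustar.compl₁₂ inclLhd F.mu) ∘ₗ
    (TensorProduct.assoc k (Lam k V) (HomBE 𝔥 ζ P Q) (Rv k V)).symm.toLinearMap

variable (F P Q) in
/-- The map `h ↦ id_F ⋆̂ h`. -/
def idStar : HomFM 𝔥 ζ P Q →ₗ[k] HomFM 𝔥 ζ (F.seq.star P) (F.seq.star Q) :=
  TensorProduct.lift (ustar.compl₁₂ F.nu inclRhd)

theorem starId_tmul (r : Lam k V) (f : HomBE 𝔥 ζ P Q) (x : Rv k V) :
    starId F P Q (r ⊗ₜ (f ⊗ₜ x)) = ustar (r ⊗ₜ (f ⊗ₜ 1)) (F.mu x) := rfl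

theorem idStar_tmul (r : Lam k V) (f : HomBE 𝔥 ζ P Q) (x : Rv k V) :
    idStar F P Q (r ⊗ₜ (f ⊗ₜ x)) = ustar (F.nu r) (1 ⊗ₜ (f ⊗ₜ x)) := rfl

/-- The exterior factor of `f ⋆̂ id` is that of `f`. Mirrored below for `id ⋆̂ h` and `R^∨`. -/
theorem contractLeftFM_starId (v : V) (f : HomFM 𝔥 ζ P Q) :
    contractLeftFM v (starId F P Q f) = starId F P Q (contractLeftFM v f) := by
  induction f using HomFM.ind with
  | h0 => simp
  | hadd x y hx hy => simp only [map_add, hx, hy]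
  | h p r f x hf =>
    rw [starId_tmul, contractLeftFM_tmul, starId_tmul, contractLeftFM_ustar, contractLeftFM_tmul]

theorem contractRightFM_idStar (t : Module.Dual k V) (f : HomFM 𝔥 ζ P Q) :
    contractRightFM t (idStar F P Q f) = idStar F P Q (contractRightFM t f) := by
  induction f using HomFM.ind with
  | h0 => simp
  | hadd x y hx hy => simp only [map_add, hx, hy]
  | h p r f x hf =>
    rw [idStar_tmul, contractRightFM_tmul, idStar_tmul, contractRightFM_ustar,
      contractRightFM_tmul]

theorem partFM_augL_tmul {p : ZMod 2} {f : HomBE 𝔥 ζ P Q} (hf : partBE p f = f) (r : Lam k V)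
    (x : Rv k V) : partFM p (augL (r ⊗ₜ[k] (f ⊗ₜ[k] x))) = augL (r ⊗ₜ[k] (f ⊗ₜ[k] x)) := by
  rw [augL_tmul, partFM_tmul, hf]

section Differential

variable [Module.Free k V] [Module.Finite k V]

/-- The basis of `V` which is used in the definition of `κ` and `Θ`. -/
local notation "bV" => Module.Free.chooseBasis k V

/-- The composite puts `μ(x)` over `ν(t)` in opposite tensor factors; they exchange without sign
because `μ(x)` is even. All later statements about `⋆̂` go through this factorization. -/
theorem hat_eq {F G F' G' : PreComplex 𝔥 ζ} (hG : G'.IsConvolutive)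
    (f : HomFM 𝔥 ζ F.seq G.seq) (h : HomFM 𝔥 ζ F'.seq G'.seq) :
    hat F G F' G' f h = compFM (starId G' F.seq G.seq f) (idStar F F'.seq G'.seq h) := by
  induction f using HomFM.ind with
  | h0 => simp
  | hadd x y hx hy => simp only [map_add, LinearMap.add_apply, hx, hy]
  | h p r f x hf =>
  induction h using HomFM.ind with
  | h0 => simp
  | hadd x y hx hy => simp only [map_add, hx, hy]
  | h q t h z hh =>
  rw [hat_tmul, starId_tmul, idStar_tmul, ustar_comp_even _ _ _ (hG.partFM_augL_mu x)]

theorem starId_of_mem_lhd (hF : F.IsConvolutive) {f : HomFM 𝔥 ζ P Q} (hf : f ∈ lhd 𝔥 ζ P Q) :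
    starId F P Q f = ustar f (idFM 𝔥 ζ F.seq) := by
  obtain ⟨f, rfl⟩ := hf
  induction f using TensorProduct.induction_on with
  | zero => simp
  | add x y hx hy => simp only [map_add, LinearMap.add_apply, hx, hy]
  | tmul r f => rw [← hF.mu_one]; rfl

theorem idStar_of_mem_rhd (hF : F.IsConvolutive) {f : HomFM 𝔥 ζ P Q} (hf : f ∈ rhd 𝔥 ζ P Q) :
    idStar F P Q f = ustar (idFM 𝔥 ζ F.seq) f := by
  obtain ⟨f, rfl⟩ := hf
  rw [← hF.nu_one]; rfl

theorem starId_id (hF : F.IsConvolutive) :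
    starId F P P (idFM 𝔥 ζ P) = idFM 𝔥 ζ (P.star F.seq) := by
  rw [starId_of_mem_lhd hF (idFM_mem_lhd P), ustar_id]

theorem idStar_id (hF : F.IsConvolutive) :
    idStar F P P (idFM 𝔥 ζ P) = idFM 𝔥 ζ (F.seq.star P) := by
  rw [idStar_of_mem_rhd hF (idFM_mem_rhd P), ustar_id]

/-- `μ` is multiplicative and even. -/
theorem starId_comp (hF : F.IsConvolutive) (g : HomFM 𝔥 ζ Q R) (f : HomFM 𝔥 ζ P Q) :
    starId F P R (compFM g f) = compFM (starId F Q R g) (starId F P Q f) := by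
  induction g using HomFM.ind with
  | h0 => simp
  | hadd x y hx hy => simp only [map_add, LinearMap.add_apply, hx, hy]
  | h p r a x ha =>
  induction f using HomFM.ind with
  | h0 => simp
  | hadd x y hx hy => simp only [map_add, hx, hy]
  | h q s b y hb =>
  rw [starId_tmul, starId_tmul, ustar_comp_even _ _ _ (hF.partFM_augL_mu x), compFM_tmul ha,
    compFM_tmul ha, starId_tmul, hF.mu_mul, mul_one]

/-- The middle factor of `g` passes `ν` of the exterior factor of `f`; by `signPow_nu` the resulting
sign can be put inside `ν`, where it is the sign in the definition of composition. -/
theorem idStar_comp (hF : F.IsConvolutive) (g : HomFM 𝔥 ζ Q R) (f : HomFM 𝔥 ζ P Q) :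
    idStar F P R (compFM g f) = compFM (idStar F Q R g) (idStar F P Q f) := by
  induction g using HomFM.ind with
  | h0 => simp
  | hadd x y hx hy => simp only [map_add, LinearMap.add_apply, hx, hy]
  | h p r a x ha =>
  induction f using HomFM.ind with
  | h0 => simp
  | hadd x y hx hy => simp only [map_add, hx, hy]
  | h q s b y hb =>
  rw [idStar_tmul, idStar_tmul, ustar_comp _ _ _ (partFM_augL_tmul ha 1 x), compFM_tmul ha,
    compFM_tmul ha, idStar_tmul, hF.nu_mul, hF.signPow_nu, map_one, mul_one]

theorem signFM_starId (hF : F.IsConvolutive) (f : HomFM 𝔥 ζ P Q) :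
    signFM (starId F P Q f) = starId F P Q (signFM f) := by
  induction f using HomFM.ind with
  | h0 => simp
  | hadd x y hx hy => simp only [map_add, hx, hy]
  | h p r f x hf =>
    rw [starId_tmul, signFM_ustar _ (hF.partFM_augL_mu x), signFM_tmul hf, signFM_tmul hf,
      starId_tmul, sgn_zero, one_smul]

theorem signFM_idStar (hF : F.IsConvolutive) (f : HomFM 𝔥 ζ P Q) :
    signFM (idStar F P Q f) = idStar F P Q (signFM f) := by
  induction f using HomFM.ind with
  | h0 => simp
  | hadd x y hx hy => simp only [map_add, hx, hy]
  | h p r f x hf =>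
    rw [idStar_tmul, signFM_ustar _ (partFM_augL_tmul hf 1 x), signFM_tmul hf, idStar_tmul,
      hF.signFM_nu, map_zsmul, map_zsmul, LinearMap.smul_apply]

theorem starId_mem_rhd {f : HomFM 𝔥 ζ P Q} (hf : f ∈ rhd 𝔥 ζ P Q) :
    starId F P Q f ∈ rhd 𝔥 ζ _ _ := by
  obtain ⟨f, rfl⟩ := hf
  induction f using TensorProduct.induction_on with
  | zero => simp
  | add x y hx hy => simp only [map_add]; exact add_mem hx hy
  | tmul f x => exact ustar_mem_rhd ⟨f ⊗ₜ 1, rfl⟩ _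

theorem starId_mem_lhd (hF : F.IsConvolutive) {f : HomFM 𝔥 ζ P Q} (hf : f ∈ lhd 𝔥 ζ P Q) :
    starId F P Q f ∈ lhd 𝔥 ζ _ _ := by
  rw [starId_of_mem_lhd hF hf]; exact ustar_mem_lhd _ (ofBE_mem_lhd _)

theorem idStar_mem_rhd (hF : F.IsConvolutive) {f : HomFM 𝔥 ζ P Q} (hf : f ∈ rhd 𝔥 ζ P Q) :
    idStar F P Q f ∈ rhd 𝔥 ζ _ _ := by
  rw [idStar_of_mem_rhd hF hf]; exact ustar_mem_rhd (ofBE_mem_rhd _) _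

theorem idStar_mem_lhd {f : HomFM 𝔥 ζ P Q} (hf : f ∈ lhd 𝔥 ζ P Q) :
    idStar F P Q f ∈ lhd 𝔥 ζ _ _ := by
  obtain ⟨f, rfl⟩ := hf
  induction f using TensorProduct.induction_on with
  | zero => simp
  | add x y hx hy => simp only [map_add]; exact add_mem hx hy
  | tmul r f => exact ustar_mem_lhd _ ⟨1 ⊗ₜ f, rfl⟩

/-- `μ(x)` has the bidegree of `x`, so moving `x` into the second factor changes nothing. -/
theorem starId_mem (hF : F.IsConvolutive) {i j : ℤ} {f : HomFM 𝔥 ζ P Q}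
    (hf : f ∈ bideg 𝔥 ζ P Q i j) : starId F P Q f ∈ bideg 𝔥 ζ _ _ i j := by
  induction hf using Submodule.span_induction with
  | mem x hx =>
    obtain ⟨p, q, i1, j1, r, f, x, hr, hf, hx, rfl, rfl, rfl⟩ := hx
    have h1 : r ⊗ₜ (f ⊗ₜ 1) ∈ bideg 𝔥 ζ P Q (p + i1) (2 * p + j1) :=
      Submodule.subset_span ⟨p, 0, i1, j1, r, f, 1, hr, hf, by simp, rfl, by simp, rfl⟩
    exact bideg_congr (by ring) (by ring) (ustar_mem h1 (hF.mu_mem hx))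
  | zero => simp
  | add x y _ _ hx hy => rw [map_add]; exact add_mem hx hy
  | smul c x _ hx => rw [map_smul]; exact Submodule.smul_mem _ _ hx

theorem idStar_mem (hF : F.IsConvolutive) {i j : ℤ} {f : HomFM 𝔥 ζ P Q}
    (hf : f ∈ bideg 𝔥 ζ P Q i j) : idStar F P Q f ∈ bideg 𝔥 ζ _ _ i j := by
  induction hf using Submodule.span_induction with
  | mem x hx =>
    obtain ⟨p, q, i1, j1, r, f, x, hr, hf, hx, rfl, rfl, rfl⟩ := hx
    have h1 : 1 ⊗ₜ (f ⊗ₜ x) ∈ bideg 𝔥 ζ P Q i1 (j1 - 2 * q) :=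
      Submodule.subset_span ⟨0, q, i1, j1, 1, f, x, by simp, hf, hx, by simp, by simp, rfl⟩
    exact bideg_congr (by ring) (by ring) (ustar_mem (hF.nu_mem hr) h1)
  | zero => simp
  | add x y _ _ hx hy => rw [map_add]; exact add_mem hx hy
  | smul c x _ hx => rw [map_smul]; exact Submodule.smul_mem _ _ hx

/-- For `z` of degree at most one in `R^∨`, the constant part contributes `z ⋆ id` through the
augmentation, and the linear part is expanded in the basis, where its coefficients are the
contractions of `z`. -/
theorem starId_eq_of_mem_linSpan (hF : F.IsConvolutive) {z : HomFM 𝔥 ζ P Q}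
    (hz : z ∈ linSpan 𝔥 ζ P Q) :
    starId F P Q z = ustar z (idFM 𝔥 ζ F.seq) +
      ∑ i, ustar (contractRightFM ((bV).coord i) z) (contractLeftFM (bV i) F.δ) := by
  induction hz using linSpan_induction with
  | h0 => simp
  | hadd x y _ _ hx hy =>
    simp only [map_add, LinearMap.add_apply, hx, hy, Finset.sum_add_distrib]; abel
  | h c t f d v =>
    rw [starId_tmul, map_add F.mu, map_add (ustar _), hF.mu_algebraMap, hF.mu_ι_sum,
      ← ustar_augR _ (idFM 𝔥 ζ F.seq), augR_tmul, map_add epsR, epsR_ι, AlgHom.commutes, add_zero,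
      TensorProduct.tmul_smul, TensorProduct.tmul_smul, map_sum, map_smul, map_smul,
      LinearMap.smul_apply]
    congr 1
    refine Finset.sum_congr rfl fun i _ => ?_
    rw [contractRightFM_tmul, contractDual_linear, Algebra.algebraMap_eq_smul_one ((bV).coord i v),
      TensorProduct.tmul_smul, TensorProduct.tmul_smul, map_smul, map_smul, LinearMap.smul_apply]

theorem idStar_eq_of_mem_linSpan (hF : F.IsConvolutive) {z : HomFM 𝔥 ζ P Q}
    (hz : z ∈ linSpan 𝔥 ζ P Q) :
    idStar F P Q z = ustar (idFM 𝔥 ζ F.seq) z +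
      ∑ i, ustar (contractRightFM ((bV).coord i) F.δ) (contractLeftFM (bV i) z) := by
  induction hz using linSpan_induction with
  | h0 => simp
  | hadd x y _ _ hx hy =>
    simp only [map_add, hx, hy, Finset.sum_add_distrib]; abel
  | h c t f d v =>
    rw [idStar_tmul, map_add F.nu, map_add ustar, LinearMap.add_apply, hF.nu_algebraMap,
      hF.nu_ι_sum, ← ustar_augL (idFM 𝔥 ζ F.seq), augL_tmul, map_add epsL, epsL_ι,
      AlgHom.commutes, add_zero, ← TensorProduct.smul_tmul', map_sum, LinearMap.sum_apply,
      map_smul, map_smul, LinearMap.smul_apply]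
    congr 1
    refine Finset.sum_congr rfl fun i _ => ?_
    rw [contractLeftFM_tmul, contractV_linear, Algebra.algebraMap_eq_smul_one (t (bV i)),
      ← TensorProduct.smul_tmul', map_smul, map_smul, LinearMap.smul_apply]

theorem kappa_starId (f : HomFM 𝔥 ζ P Q) :
    kappa (starId F P Q f) = starId F P Q (kappa f) := by
  induction f using HomFM.ind with
  | h0 => simp
  | hadd x y hx hy => simp only [map_add, hx, hy]
  | h p r f x hf =>
    rw [starId_tmul, kappa_ustar, kappa_tmul, kappa_tmul, map_sum, map_sum, LinearMap.sum_apply]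
    rfl

/-- Only `augL δ` is visible in the second slot, and it commutes with `μ(x)`; the sign is the price
for moving the odd `δ` past `f`. -/
theorem ustar_delta_starId (hF : F.IsConvolutive) (f : HomFM 𝔥 ζ P Q) :
    compFM (ustar (idFM 𝔥 ζ Q) F.δ) (starId F P Q f) =
      compFM (starId F P Q (signFM f)) (ustar (idFM 𝔥 ζ P) F.δ) := by
  rw [← ustar_augL _ F.δ, ← ustar_augL _ F.δ]
  induction f using HomFM.ind with
  | h0 => simp
  | hadd x y hx hy => simp only [map_add, LinearMap.add_apply, hx, hy]
  | h p r f x hf =>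
    rw [starId_tmul, ustar_comp_odd _ _ _ hF.partFM_augL_delta, idFM_comp, signFM_tmul hf,
      signFM_tmul hf, starId_tmul, comp_id_ustar, hF.augL_delta_comm_mu]

/-- `id ⋆̂ -` does not commute with `κ` by itself, since `κ` of the convolution acts on `ν(r)`.
Adding the commutator with `δ_F ⋆ id` gives the full derivative of `ν(r)`, which `differential_nu`
expresses by right boxes; read on the other side, these are the left boxes of `κ` on the given
morphism. -/
theorem idStar_kappa (hF : F.IsConvolutive) (f : HomFM 𝔥 ζ P Q) :
    kappa (idStar F P Q f) + compFM (ustar F.δ (idFM 𝔥 ζ Q)) (idStar F P Q f) -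
      compFM (idStar F P Q (signFM f)) (ustar F.δ (idFM 𝔥 ζ P)) = idStar F P Q (kappa f) := by
  rw [← ustar_augR F.δ, ← ustar_augR F.δ]
  induction f using HomFM.ind with
  | h0 => simp
  | hadd x y hx hy =>
    simp only [map_add, LinearMap.add_apply, ← hx, ← hy]; abel
  | h p r f x hf =>
    have h1 : signPow p (augR F.δ) = sgn p • augR F.δ := by
      rcases zmod_two_cases p with rfl | rfl
      · simp
      · rw [signPow_one, hF.signFM_augR_delta, sgn_one, neg_one_smul]
    rw [signFM_tmul hf, idStar_tmul, idStar_tmul, kappa_ustar, ustar_id_comp,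
      ustar_comp _ _ _ (partFM_augL_tmul hf 1 x), comp_idFM, h1]
    -- One factor `(-1)^p` stems from the sign of `r ⊗ f ⊗ x`, the other from moving `f` past the
    -- odd `δ`; they cancel.
    have h2 : compFM (F.nu (sgn p • invL 1 r)) (sgn p • augR F.δ) =
        compFM (signFM (F.nu r)) (augR F.δ) := by
      rw [map_zsmul, map_zsmul, map_zsmul, LinearMap.smul_apply, smul_smul, sgn_mul_self, one_smul,
        hF.signFM_nu]
    have h3 := congrArg (fun u => ustar u (1 ⊗ₜ (f ⊗ₜ x) : HomFM 𝔥 ζ P Q)) (hF.differential_nu r)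
    simp only [map_sub, map_add, LinearMap.sub_apply, LinearMap.add_apply, map_sum,
      LinearMap.sum_apply] at h3
    rw [h2, h3, kappa_tmul, map_sum]
    refine Finset.sum_congr rfl fun i _ => ?_
    rw [ustar_comp_idBoxRight, idStar_tmul, boxLeftFM_tmul]

end Differential

end Whisker

end PreComplex

end FM

end FreeMonodromic

end

/-! ### Convolutivity of `F ⋆̂ G`, the differentials, and the interchange law. -/

open CategoryTheory TensorProduct

noncomputable section

namespace FreeMonodromic

universe uB uW uk uV

section FM

variable {k : Type uk} [CommRing k] {V : Type uV} [AddCommGroup V] [Module k V]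
  {B : Type uB} {M : CoxeterMatrix B} {W : Type uW} [Group W] {cs : CoxeterSystem M W}
  {𝔥 : Realization cs k V} {ζ : LowerTerms M k V}
  [Module.Free k V] [Module.Finite k V]

attribute [local irreducible] compBE starBE partBE compFM ustar contractLeftFM contractRightFM
  kappa signFM partFM signPow boxLeft

/-- The basis of `V` which is used in the definition of `κ` and `Θ`. -/
local notation "bV" => Module.Free.chooseBasis k V

/-- Pairs `(i, j)` and `(j, i)` cancel. The diagonal is a separate hypothesis because antisymmetry
alone gives only `2 g(i, i) = 0`. -/
theorem sum_sum_eq_zero_of_antisymm {ι A : Type*} [Fintype ι] [AddCommGroup A] {g : ι → ι → A}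
    (h0 : ∀ i, g i i = 0) (h : ∀ i j, g i j + g j i = 0) : ∑ i, ∑ j, g i j = 0 := by
  classical
  rw [← Fintype.sum_prod_type' g]
  refine Finset.sum_involution (fun p _ => p.swap) (fun p _ => h _ _) ?_ (fun _ _ => Finset.mem_univ _)
    (fun _ _ => rfl)
  rintro ⟨i, j⟩ _ hij e
  obtain rfl : j = i := congrArg Prod.fst e
  exact hij (h0 _)

namespace PreComplex

variable {F G K F' G' K' : PreComplex 𝔥 ζ}

/-! ## The differential of a convolution -/

/-- The grouping is adapted to the identities below: `κ` of the third summand goes with its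
anticommutator with the first, and the result completes the square of the second. -/
theorem compFM_add_three {P : Seq B} (x y z : HomFM 𝔥 ζ P P) :
    compFM (x + y + z) (x + y + z) + kappa (x + y + z) =
      (compFM x x + kappa x) + (compFM x y + compFM y x) +
        (compFM y y + (compFM x z + compFM z x + kappa z)) + (compFM y z + compFM z y) +
        compFM z z + kappa y := by
  simp only [map_add, LinearMap.add_apply]
  abel

/-- Both `δ_F ⋆̂ id` and `id ⋆̂ δ_G` contain the cross term `∑ ν_F(e_i) ⋆ μ_G(ě_i)`; the correction
in the definition removes one of the two copies. -/
theorem convDelta_eq (hF : F.IsConvolutive) (hG : G.IsConvolutive) :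
    convDelta F G = ustar F.δ (idFM 𝔥 ζ G.seq) + ustar (idFM 𝔥 ζ F.seq) G.δ +
      ∑ i, ustar (contractRightFM ((bV).coord i) F.δ) (contractLeftFM (bV i) G.δ) := by
  rw [convDelta, hat_eq hG, hat_eq hG, idStar_id hF, starId_id hG, comp_idFM, idFM_comp,
    starId_eq_of_mem_linSpan hG hF.mem_linSpan, idStar_eq_of_mem_linSpan hF hG.mem_linSpan]
  simp only [hF.nu_ι, hG.mu_ι]
  abel

/-- The cross term can be absorbed on either side. This form is adapted to `- ⋆̂ id` and to
contractions with `V`, the next one to `id ⋆̂ -` and to contractions with `V*`. -/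
theorem convDelta_eq_starId (hF : F.IsConvolutive) (hG : G.IsConvolutive) :
    convDelta F G = starId G F.seq F.seq F.δ + ustar (idFM 𝔥 ζ F.seq) G.δ := by
  rw [convDelta_eq hF hG, starId_eq_of_mem_linSpan hG hF.mem_linSpan]
  abel

theorem convDelta_eq_idStar (hF : F.IsConvolutive) (hG : G.IsConvolutive) :
    convDelta F G = ustar F.δ (idFM 𝔥 ζ G.seq) + idStar F G.seq G.seq G.δ := by
  rw [convDelta_eq hF hG, idStar_eq_of_mem_linSpan hF hG.mem_linSpan]
  abel

theorem contractLeftFM_convDelta (hF : F.IsConvolutive) (hG : G.IsConvolutive) (v : V) :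
    contractLeftFM v (convDelta F G) = starId G F.seq F.seq (contractLeftFM v F.δ) := by
  rw [convDelta_eq_starId hF hG, map_add, contractLeftFM_starId, contractLeftFM_ustar,
    contractLeftFM_of_mem_rhd (idFM_mem_rhd _), map_zero, LinearMap.zero_apply, add_zero]

theorem contractRightFM_convDelta (hF : F.IsConvolutive) (hG : G.IsConvolutive)
    (r : Module.Dual k V) :
    contractRightFM r (convDelta F G) = idStar F G.seq G.seq (contractRightFM r G.δ) := by
  rw [convDelta_eq_idStar hF hG, map_add, contractRightFM_idStar, contractRightFM_ustar,
    contractRightFM_of_mem_lhd (idFM_mem_lhd _), map_zero, zero_add]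

theorem convDelta_mem (hF : F.IsConvolutive) (hG : G.IsConvolutive) :
    convDelta F G ∈ bideg 𝔥 ζ (F.seq.star G.seq) (F.seq.star G.seq) 1 0 := by
  rw [convDelta_eq_starId hF hG]
  refine add_mem (starId_mem hG hF.1) ?_
  exact bideg_congr (by ring) (by ring) (ustar_mem (ofBE_mem (idBE_mem F.seq)) hG.1)

theorem convDelta_mem_linSpan (hF : F.IsConvolutive) (hG : G.IsConvolutive) :
    convDelta F G ∈ linSpan 𝔥 ζ (F.seq.star G.seq) (F.seq.star G.seq) := by
  rw [convDelta_eq hF hG]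
  refine add_mem (add_mem (ustar_mem_linSpan hF.mem_linSpan (ofBE_mem_linSpan _))
    (ustar_mem_linSpan (ofBE_mem_linSpan _) hG.mem_linSpan)) (Submodule.sum_mem _ fun i _ => ?_)
  exact ustar_mem_linSpan (contractRightFM_mem_linSpan hF.mem_linSpan _)
    (contractLeftFM_mem_linSpan hG.mem_linSpan _)

/-- Only `augR δ_F` is visible, and it solves the equation with `Θ` removed. -/
theorem left_sq (hF : F.IsConvolutive) :
    compFM (ustar F.δ (idFM 𝔥 ζ G.seq)) (ustar F.δ (idFM 𝔥 ζ G.seq)) +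
      kappa (ustar F.δ (idFM 𝔥 ζ G.seq)) = 0 := by
  rw [← ustar_augR F.δ, ustar_id_comp, kappa_ustar, ← LinearMap.add_apply, ← map_add,
    hF.augR_delta_sq, map_zero, LinearMap.zero_apply]

/-- Here `id ⋆ κ(δ_G)` is not `κ` of `id ⋆ δ_G`, which vanishes; it has to be supplied by
`left_cross`. -/
theorem right_sq (hG : G.IsConvolutive) :
    compFM (ustar (idFM 𝔥 ζ F.seq) G.δ) (ustar (idFM 𝔥 ζ F.seq) G.δ) +
      ustar (idFM 𝔥 ζ F.seq) (kappa G.δ) = Theta 𝔥 ζ (F.seq.star G.seq) := by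
  rw [← ustar_augL _ G.δ, comp_id_ustar, ← map_add, hG.augL_delta_sq, ustar_Theta]

/-- Two odd morphisms in different tensor factors anticommute. -/
theorem left_right_anticomm (hF : F.IsConvolutive) (hG : G.IsConvolutive) :
    compFM (ustar F.δ (idFM 𝔥 ζ G.seq)) (ustar (idFM 𝔥 ζ F.seq) G.δ) +
      compFM (ustar (idFM 𝔥 ζ F.seq) G.δ) (ustar F.δ (idFM 𝔥 ζ G.seq)) = 0 := by
  rw [← ustar_augL _ G.δ, ← ustar_augR F.δ, ustar_id_comp,
    ustar_comp_odd _ _ _ hG.partFM_augL_delta, comp_idFM, idFM_comp, comp_idFM,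
    hF.signFM_augR_delta, map_neg, LinearMap.neg_apply, add_neg_cancel]

/-- Summand by summand, the homotopy relation for `δ_F ⌢ e_i` leaves a right box `e_i` on `F`. Moved
to the left of `ě_i ⌢ δ_G`, these boxes add up to `κ(δ_G)`. -/
theorem left_cross (hF : F.IsConvolutive) (hG : G.IsConvolutive) :
    compFM (ustar F.δ (idFM 𝔥 ζ G.seq))
      (∑ i, ustar (contractRightFM ((bV).coord i) F.δ) (contractLeftFM (bV i) G.δ)) +
    compFM (∑ i, ustar (contractRightFM ((bV).coord i) F.δ) (contractLeftFM (bV i) G.δ))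
      (ustar F.δ (idFM 𝔥 ζ G.seq)) +
    kappa (∑ i, ustar (contractRightFM ((bV).coord i) F.δ) (contractLeftFM (bV i) G.δ)) =
      ustar (idFM 𝔥 ζ F.seq) (kappa G.δ) := by
  rw [← ustar_augR F.δ, kappa_eq_sum G.δ]
  simp only [map_sum, LinearMap.sum_apply]
  rw [← Finset.sum_add_distrib, ← Finset.sum_add_distrib]
  refine Finset.sum_congr rfl fun i _ => ?_
  have h0 := hG.partFM_augL_mu (SymmetricAlgebra.ι k V (bV i))
  rw [hG.mu_ι] at h0
  have h := congrArg (fun u => ustar u (contractLeftFM (bV i) G.δ))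
    (hF.contractRight_relation_augR ((bV).coord i))
  simp only [map_add, LinearMap.add_apply] at h
  rw [ustar_id_comp, ustar_comp_even _ _ _ h0, comp_idFM, kappa_ustar, ← ustar_idBoxRight, ← h]
  abel

/-- `ě_i ⌢ δ_G` commutes with `augL δ_G`, while the odd `δ_F ⌢ e_i` produces opposite signs in the
two orders. -/
theorem right_cross (hF : F.IsConvolutive) (hG : G.IsConvolutive) :
    compFM (ustar (idFM 𝔥 ζ F.seq) G.δ)
      (∑ i, ustar (contractRightFM ((bV).coord i) F.δ) (contractLeftFM (bV i) G.δ)) +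
    compFM (∑ i, ustar (contractRightFM ((bV).coord i) F.δ) (contractLeftFM (bV i) G.δ))
      (ustar (idFM 𝔥 ζ F.seq) G.δ) = 0 := by
  rw [← ustar_augL _ G.δ]
  simp only [map_sum, LinearMap.sum_apply]
  rw [← Finset.sum_add_distrib]
  refine Finset.sum_eq_zero fun i _ => ?_
  rw [ustar_comp_odd _ _ _ hG.partFM_augL_delta, comp_id_ustar, idFM_comp,
    hF.signFM_contractRight, hG.augL_delta_comm, map_neg, LinearMap.neg_apply, neg_add_cancel]

/-- In the double sum the first factors, values of `ν` on products of two elements of `V*`, are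
alternating in the indices, and the second factors are symmetric. -/
theorem cross_sq (hF : F.IsConvolutive) (hG : G.IsConvolutive) :
    compFM (∑ i, ustar (contractRightFM ((bV).coord i) F.δ) (contractLeftFM (bV i) G.δ))
      (∑ i, ustar (contractRightFM ((bV).coord i) F.δ) (contractLeftFM (bV i) G.δ)) = 0 := by
  simp only [map_sum, LinearMap.sum_apply]
  have h : ∀ i j, compFM
      (ustar (contractRightFM ((bV).coord j) F.δ) (contractLeftFM (bV j) G.δ))
      (ustar (contractRightFM ((bV).coord i) F.δ) (contractLeftFM (bV i) G.δ)) =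
      ustar (F.nu (ExteriorAlgebra.ι k ((bV).coord j) * ExteriorAlgebra.ι k ((bV).coord i)))
        (compFM (contractLeftFM (bV j) G.δ) (contractLeftFM (bV i) G.δ)) := fun i j => by
    have h0 := hG.partFM_augL_mu (SymmetricAlgebra.ι k V (bV j))
    rw [hG.mu_ι] at h0
    rw [ustar_comp_even _ _ _ h0, hF.nu_mul, hF.nu_ι, hF.nu_ι]
  simp only [h]
  refine sum_sum_eq_zero_of_antisymm (fun i => ?_) fun i j => ?_
  · rw [ExteriorAlgebra.ι_sq_zero, map_zero, map_zero, LinearMap.zero_apply]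
  · rw [hG.contractLeft_comm (bV j), ← LinearMap.add_apply, ← map_add, ← map_add,
      ExteriorAlgebra.ι_add_mul_swap, map_zero, map_zero, LinearMap.zero_apply]

theorem convDelta_sq (hF : F.IsConvolutive) (hG : G.IsConvolutive) : compFM (convDelta F G) (convDelta F G) + kappa (convDelta F G) =
    Theta 𝔥 ζ (F.seq.star G.seq) := by
  have h1 := left_sq (G := G) hF
  have h2 := right_sq (F := F) hG
  have h3 := left_right_anticomm hF hG
  have h4 := left_cross hF hG
  have h5 := right_cross hF hG
  have h6 := cross_sq hF hG
  have h7 : kappa (ustar (idFM 𝔥 ζ F.seq) G.δ) = 0 := by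
    rw [kappa_ustar, kappa_of_mem_rhd (idFM_mem_rhd _), map_zero, LinearMap.zero_apply]
  rw [convDelta_eq hF hG]
  rw [compFM_add_three, h1, h3, h4, h2, h5, h6, h7]
  simp only [zero_add, add_zero]

theorem conv_isConvolutive (hF : F.IsConvolutive) (hG : G.IsConvolutive) : (F.conv G).IsConvolutive :=
  ⟨convDelta_mem hF hG, convDelta_sq hF hG, convDelta_mem_linSpan hF hG⟩

/-- `starId` is multiplicative and commutes with contraction by `V`, so both sides satisfy the
conditions which characterize `μ`. This is the source of associativity; `nu_conv` is its mirror
image. -/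
theorem mu_conv (hF : F.IsConvolutive) (hG : G.IsConvolutive)
    (x : Rv k V) : (F.conv G).mu x = starId G F.seq F.seq (F.mu x) := by
  have h : (F.conv G).IsMu (starId G F.seq F.seq ∘ₗ F.mu) :=
    { map_one := by rw [LinearMap.comp_apply, hF.mu_one, starId_id hG]
      map_mul := fun x y => by simp only [LinearMap.comp_apply, hF.mu_mul, starId_comp hG]
      map_ι := fun v => by
        rw [LinearMap.comp_apply, hF.mu_ι, contractLeftFM_convDelta hF hG] }
  exact LinearMap.congr_fun ((isMu_mu (conv_isConvolutive hF hG)).unique h) x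

theorem nu_conv (hF : F.IsConvolutive) (hG : G.IsConvolutive)
    (t : Lam k V) : (F.conv G).nu t = idStar F G.seq G.seq (G.nu t) := by
  have h : (F.conv G).IsNu (idStar F G.seq G.seq ∘ₗ G.nu) :=
    { map_one := by rw [LinearMap.comp_apply, hG.nu_one, idStar_id hF]
      map_mul := fun x y => by simp only [LinearMap.comp_apply, hG.nu_mul, idStar_comp hF]
      map_ι := fun v => by
        rw [LinearMap.comp_apply, hG.nu_ι, contractRightFM_convDelta hF hG] }
  exact LinearMap.congr_fun ((isNu_nu (conv_isConvolutive hF hG)).unique h) t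

/-! ## Compatibility with the differentials of the morphism spaces -/

variable (F G) in
/-- The differential of the morphism space, with the sign expressed by `signFM`. -/
def differential : HomFM 𝔥 ζ F.seq G.seq →ₗ[k] HomFM 𝔥 ζ F.seq G.seq :=
  kappa + compFM G.δ - compFM.flip F.δ ∘ₗ signFM

theorem differential_apply (f : HomFM 𝔥 ζ F.seq G.seq) :
    differential F G f = kappa f + compFM G.δ f - compFM (signFM f) F.δ := rfl

theorem d_eq_differential {i j : ℤ} {f : HomFM 𝔥 ζ F.seq G.seq}
    (hf : f ∈ bideg 𝔥 ζ F.seq G.seq i j) : d F G i f = differential F G f := by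
  rw [differential_apply, signFM_of_mem hf, negOnePow_smul, map_zsmul, LinearMap.smul_apply,
    ← negOnePow_smul, sub_eq_add_neg]
  change kappa f + compFM G.δ f + (i + 1).negOnePow • compFM f F.δ = _
  congr 1
  rw [Int.negOnePow_succ]
  simp

theorem mem_cocycles' {f : HomFM 𝔥 ζ F.seq G.seq} :
    f ∈ cocycles F G ↔ f ∈ bideg 𝔥 ζ F.seq G.seq 0 0 ∧ differential F G f = 0 := by
  constructor
  · rintro ⟨h1, h2⟩
    exact ⟨h1, (d_eq_differential h1).symm.trans h2⟩
  · rintro ⟨h1, h2⟩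
    exact ⟨h1, (d_eq_differential h1).trans h2⟩

/-- Write both differentials in the form of `convDelta_eq_starId`. The terms with `id ⋆ δ_K` cancel
by `ustar_delta_starId`, and the others are `starId` of the terms of the differential of `f`. -/
theorem differential_starId (hF : F.IsConvolutive) (hG : G.IsConvolutive) (hK : K.IsConvolutive)
    (f : HomFM 𝔥 ζ F.seq G.seq) :
    differential (F.conv K) (G.conv K) (starId K F.seq G.seq f) =
      starId K F.seq G.seq (differential F G f) := by
  change kappa _ + compFM (convDelta G K) _ - compFM (signFM _) (convDelta F K) = _
  rw [differential_apply, map_sub, map_add, kappa_starId, signFM_starId hK,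
    convDelta_eq_starId hF hK, convDelta_eq_starId hG hK, starId_comp hK, starId_comp hK,
    map_add compFM, LinearMap.add_apply, map_add (compFM (starId K F.seq G.seq (signFM f))),
    ustar_delta_starId hK]
  abel

/-- The terms with `K.δ ⋆ id` do not cancel by themselves; together with `κ` they give `idStar` of
`κ(f)` by `idStar_kappa`. -/
theorem differential_idStar (hF : F.IsConvolutive) (hG : G.IsConvolutive) (hK : K.IsConvolutive)
    (f : HomFM 𝔥 ζ F.seq G.seq) :
    differential (K.conv F) (K.conv G) (idStar K F.seq G.seq f) =
      idStar K F.seq G.seq (differential F G f) := by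
  change kappa _ + compFM (convDelta K G) _ - compFM (signFM _) (convDelta K F) = _
  rw [differential_apply, map_sub, map_add, ← idStar_kappa hK, signFM_idStar hK, idStar_comp hK,
    idStar_comp hK]
  have h1 : compFM (convDelta K G) (idStar K F.seq G.seq f) =
      compFM (ustar K.δ (idFM 𝔥 ζ G.seq)) (idStar K F.seq G.seq f) +
        compFM (idStar K G.seq G.seq G.δ) (idStar K F.seq G.seq f) := by
    rw [convDelta_eq_idStar hK hG, map_add, LinearMap.add_apply]
  have h2 : compFM (idStar K F.seq G.seq (signFM f)) (convDelta K F) =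
      compFM (idStar K F.seq G.seq (signFM f)) (ustar K.δ (idFM 𝔥 ζ F.seq)) +
        compFM (idStar K F.seq G.seq (signFM f)) (idStar K F.seq F.seq F.δ) := by
    rw [convDelta_eq_idStar hK hF, map_add]
  refine (congrArg₂ (fun y z => kappa (idStar K F.seq G.seq f) + y - z) h1 h2).trans ?_
  abel

theorem starId_mem_cocycles (hF : F.IsConvolutive) (hG : G.IsConvolutive) (hK : K.IsConvolutive)
    {f : HomFM 𝔥 ζ F.seq G.seq} (hf : f ∈ cocycles F G) :
    starId K F.seq G.seq f ∈ cocycles (F.conv K) (G.conv K) := by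
  rw [mem_cocycles'] at hf ⊢
  exact ⟨starId_mem hK hf.1, by rw [differential_starId hF hG hK, hf.2, map_zero]⟩

theorem idStar_mem_cocycles (hF : F.IsConvolutive) (hG : G.IsConvolutive) (hK : K.IsConvolutive)
    {f : HomFM 𝔥 ζ F.seq G.seq} (hf : f ∈ cocycles F G) :
    idStar K F.seq G.seq f ∈ cocycles (K.conv F) (K.conv G) := by
  rw [mem_cocycles'] at hf ⊢
  exact ⟨idStar_mem hK hf.1, by rw [differential_idStar hF hG hK, hf.2, map_zero]⟩

theorem starId_mem_boundaries (hF : F.IsConvolutive) (hG : G.IsConvolutive) (hK : K.IsConvolutive)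
    {f : HomFM 𝔥 ζ F.seq G.seq} (hf : f ∈ boundaries F G) :
    starId K F.seq G.seq f ∈ boundaries (F.conv K) (G.conv K) := by
  obtain ⟨h, hh, rfl⟩ := hf
  refine ⟨starId K F.seq G.seq h, starId_mem hK hh, ?_⟩
  exact (d_eq_differential (F := F.conv K) (G := G.conv K) (starId_mem hK hh)).trans
    ((differential_starId hF hG hK h).trans (congrArg _ (d_eq_differential hh).symm))

theorem idStar_mem_boundaries (hF : F.IsConvolutive) (hG : G.IsConvolutive) (hK : K.IsConvolutive)
    {f : HomFM 𝔥 ζ F.seq G.seq} (hf : f ∈ boundaries F G) :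
    idStar K F.seq G.seq f ∈ boundaries (K.conv F) (K.conv G) := by
  obtain ⟨h, hh, rfl⟩ := hf
  refine ⟨idStar K F.seq G.seq h, idStar_mem hK hh, ?_⟩
  exact (d_eq_differential (F := K.conv F) (G := K.conv G) (idStar_mem hK hh)).trans
    ((differential_idStar hF hG hK h).trans (congrArg _ (d_eq_differential hh).symm))

/-! ## The interchange law -/

/-- Contract the cocycle equation of `h` with `v`. Since `h` has no exterior part, only the two
differentials are hit, and `h` intertwines `v ⌢ δ`. -/
theorem mu_comm (hF : F.IsConvolutive) (hG : G.IsConvolutive) {h : HomFM 𝔥 ζ F.seq G.seq}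
    (hc : h ∈ cocycles F G) (hr : h ∈ rhd 𝔥 ζ F.seq G.seq) (x : Rv k V) :
    compFM (G.mu x) h = compFM h (F.mu x) := by
  induction x using SymmetricAlgebra.induction with
  | algebraMap c =>
    rw [hF.mu_algebraMap, hG.mu_algebraMap, map_smul, map_smul, LinearMap.smul_apply, idFM_comp,
      comp_idFM]
  | ι v =>
    rw [mem_cocycles] at hc
    have h0 := congrArg (contractLeftFM v) hc.2
    have hs : signFM h = h := by simpa using signFM_of_mem hc.1
    rw [kappa_of_mem_rhd hr, zero_add, map_sub, contractLeftFM_comp, contractLeftFM_comp,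
      contractLeftFM_of_mem_rhd hr, map_zero, map_zero, map_zero, LinearMap.zero_apply, add_zero,
      zero_add, hs, sub_eq_zero] at h0
    rw [hF.mu_ι, hG.mu_ι, h0]
  | mul a b ha hb => rw [hG.mu_mul, compFM_assoc, hb, ← compFM_assoc, ha, compFM_assoc, hF.mu_mul]
  | add a b ha hb => simp only [map_add, LinearMap.add_apply, ha, hb]

/-- The mirror argument: contract the cocycle equation with `r`, when `h` has no part in `R^∨`. -/
theorem nu_comm (hF : F.IsConvolutive) (hG : G.IsConvolutive) {h : HomFM 𝔥 ζ F.seq G.seq}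
    (hc : h ∈ cocycles F G) (hl : h ∈ lhd 𝔥 ζ F.seq G.seq) (x : Lam k V) :
    compFM (G.nu x) h = compFM h (F.nu x) := by
  induction x using ExteriorAlgebra.induction with
  | algebraMap c =>
    rw [hF.nu_algebraMap, hG.nu_algebraMap, map_smul, map_smul, LinearMap.smul_apply, idFM_comp,
      comp_idFM]
  | ι r =>
    rw [mem_cocycles] at hc
    have h0 := congrArg (contractRightFM r) hc.2
    rw [map_sub, map_add, ← kappa_contractRightFM, contractRightFM_comp, contractRightFM_comp,
      contractRightFM_of_mem_lhd hl, map_zero, map_zero, map_zero, map_zero, LinearMap.zero_apply,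
      add_zero, zero_add, zero_add, sub_eq_zero] at h0
    rw [hF.nu_ι, hG.nu_ι, h0]
  | mul a b ha hb => rw [hG.nu_mul, compFM_assoc, hb, ← compFM_assoc, ha, compFM_assoc, hF.nu_mul]
  | add a b ha hb => simp only [map_add, LinearMap.add_apply, ha, hb]

/-- For `f = f' ⊗ x` the two composites differ in whether `μ(x)` stands above or below `h`, which is
`mu_comm`; the even middle factor of `h` causes no sign. Only `h` has to be a cocycle. -/
theorem interchange_rhd (hF : F.IsConvolutive) (hG : G.IsConvolutive) (hF' : F'.IsConvolutive)
    (hG' : G'.IsConvolutive) {f : HomFM 𝔥 ζ F.seq G.seq} (hf : f ∈ rhd 𝔥 ζ F.seq G.seq)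
    {h : HomFM 𝔥 ζ F'.seq G'.seq} (hh : h ∈ cocycles F' G') (hr : h ∈ rhd 𝔥 ζ F'.seq G'.seq) :
    compFM (starId G' F.seq G.seq f) (idStar F F'.seq G'.seq h) =
      compFM (idStar G F'.seq G'.seq h) (starId F' F.seq G.seq f) := by
  have h0 : partFM 0 (augL h) = augL h := by simpa using partFM_augL_of_mem (mem_cocycles.1 hh).1
  rw [idStar_of_mem_rhd hF hr, idStar_of_mem_rhd hG hr]
  obtain ⟨f, rfl⟩ := hf
  induction f using TensorProduct.induction_on with
  | zero => simp
  | add x y hx hy => simp only [map_add, LinearMap.add_apply, hx, hy]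
  | tmul f x =>
    change compFM (ustar (1 ⊗ₜ (f ⊗ₜ 1)) (G'.mu x)) (ustar (idFM 𝔥 ζ F.seq) h) =
      compFM (ustar (idFM 𝔥 ζ G.seq) h) (ustar (1 ⊗ₜ (f ⊗ₜ 1)) (F'.mu x))
    rw [comp_id_ustar, ustar_comp_even _ _ _ h0, idFM_comp, mu_comm hF' hG' hh hr]

/-- Now `ν(t)` has to pass `f`, so it is `f` which must be a cocycle, and `nu_comm` applies. -/
theorem interchange_lhd (hF : F.IsConvolutive) (hG : G.IsConvolutive) (hF' : F'.IsConvolutive)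
    (hG' : G'.IsConvolutive) {f : HomFM 𝔥 ζ F.seq G.seq} (hf : f ∈ cocycles F G)
    (hl : f ∈ lhd 𝔥 ζ F.seq G.seq) {h : HomFM 𝔥 ζ F'.seq G'.seq}
    (hh : h ∈ lhd 𝔥 ζ F'.seq G'.seq) :
    compFM (starId G' F.seq G.seq f) (idStar F F'.seq G'.seq h) =
      compFM (idStar G F'.seq G'.seq h) (starId F' F.seq G.seq f) := by
  have h0 : signFM f = f := by simpa using signFM_of_mem (mem_cocycles.1 hf).1
  rw [starId_of_mem_lhd hG' hl, starId_of_mem_lhd hF' hl]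
  obtain ⟨h, rfl⟩ := hh
  induction h using TensorProduct.induction_on with
  | zero => simp
  | add x y hx hy => simp only [map_add, LinearMap.add_apply, hx, hy]
  | tmul t h =>
    change compFM (ustar f (idFM 𝔥 ζ G'.seq)) (ustar (F.nu t) (1 ⊗ₜ (h ⊗ₜ 1))) =
      compFM (ustar (G.nu t) (1 ⊗ₜ (h ⊗ₜ 1))) (ustar f (idFM 𝔥 ζ F'.seq))
    rw [ustar_id_comp, ustar_comp_of_even _ _ h0, comp_idFM, nu_comm hF hG hf hl]

end PreComplex

end FM

end FreeMonodromic

end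

/-! ### The associator and the unitors as chain maps. -/

open CategoryTheory TensorProduct

noncomputable section

namespace FreeMonodromic

universe uB uW uk uV

section FM

variable {k : Type uk} [CommRing k] {V : Type uV} [AddCommGroup V] [Module k V]
  {B : Type uB} {M : CoxeterMatrix B} {W : Type uW} [Group W] {cs : CoxeterSystem M W}
  {𝔥 : Realization cs k V} {ζ : LowerTerms M k V}

attribute [local irreducible] compBE starBE partBE compFM ustar contractLeftFM contractRightFM
  kappa signFM partFM signPow PreComplex.starId PreComplex.idStar

/-! ## Composition with isomorphisms of sequences -/

section Seq

variable {F G K F' G' K' : Seq B}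

/-- An isomorphism of sequences has degree zero and passes exterior factors without sign; on the
other side, in `tmul_comp_ofBE`, nothing has to be passed. -/
theorem ofBE_comp_tmul {e : HomBE 𝔥 ζ G K} (he : e ∈ bidegBE 𝔥 ζ G K 0 0) (r : Lam k V)
    (f : HomBE 𝔥 ζ F G) (x : Rv k V) :
    compFM (ofBE e) (r ⊗ₜ (f ⊗ₜ x)) = r ⊗ₜ (compBE e f ⊗ₜ x) := by
  have h0 : partBE 0 e = e := by simpa using partBE_of_mem he
  rw [ofBE, compFM_tmul h0, invL_zero, one_mul, one_mul]

theorem tmul_comp_ofBE (e : HomBE 𝔥 ζ F G) (r : Lam k V) (f : HomBE 𝔥 ζ G K) (x : Rv k V) :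
    compFM (r ⊗ₜ (f ⊗ₜ x)) (ofBE e) = r ⊗ₜ (compBE f e ⊗ₜ x) := by
  conv_lhs => rw [← sum_partBE f]
  conv_rhs => rw [← sum_partBE f]
  simp only [TensorProduct.sum_tmul, TensorProduct.tmul_sum, map_sum, LinearMap.sum_apply]
  refine Finset.sum_congr rfl fun p _ => ?_
  have hp : partBE p (partBE p f) = partBE p f := by rw [partBE_partBE, if_pos rfl]
  rw [ofBE, compFM_tmul hp, map_one, mul_one, mul_one]

theorem alphaSeq_mem (F G K : Seq B) : (alphaSeq F G K : HomBE 𝔥 ζ _ _) ∈ bidegBE 𝔥 ζ _ _ 0 0 :=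
  reindexBE_mem (F := F.star (G.star K)) (G := (F.star G).star K) _ _
    (fun _ => (add_assoc _ _ _).symm) (fun _ => (add_assoc _ _ _).symm)

theorem alphaSeqInv_mem (F G K : Seq B) :
    (alphaSeqInv F G K : HomBE 𝔥 ζ _ _) ∈ bidegBE 𝔥 ζ _ _ 0 0 :=
  reindexBE_mem (F := (F.star G).star K) (G := F.star (G.star K)) _ _
    (fun _ => add_assoc _ _ _) (fun _ => add_assoc _ _ _)

theorem lamSeq_mem (F : Seq B) : (lamSeq F : HomBE 𝔥 ζ _ _) ∈ bidegBE 𝔥 ζ _ _ 0 0 :=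
  reindexBE_mem (F := (Seq.unit B).star F) (G := F) _ _ (fun _ => zero_add _) (fun _ => zero_add _)

theorem lamSeqInv_mem (F : Seq B) : (lamSeqInv F : HomBE 𝔥 ζ _ _) ∈ bidegBE 𝔥 ζ _ _ 0 0 :=
  reindexBE_mem (F := F) (G := (Seq.unit B).star F) _ _ (fun _ => (zero_add _).symm)
    (fun _ => (zero_add _).symm)

theorem rhoSeq_mem (F : Seq B) : (rhoSeq F : HomBE 𝔥 ζ _ _) ∈ bidegBE 𝔥 ζ _ _ 0 0 :=
  reindexBE_mem (F := F.star (Seq.unit B)) (G := F) _ _ (fun _ => add_zero _) (fun _ => add_zero _)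

theorem rhoSeqInv_mem (F : Seq B) : (rhoSeqInv F : HomBE 𝔥 ζ _ _) ∈ bidegBE 𝔥 ζ _ _ 0 0 :=
  reindexBE_mem (F := F) (G := F.star (Seq.unit B)) _ _ (fun _ => (add_zero _).symm)
    (fun _ => (add_zero _).symm)

theorem ustar_ustar_tmul (r s t : Lam k V) (f : HomBE 𝔥 ζ F F') (g : HomBE 𝔥 ζ G G')
    (h : HomBE 𝔥 ζ K K') (x y z : Rv k V) :
    ustar (r ⊗ₜ[k] (f ⊗ₜ[k] x)) (ustar (s ⊗ₜ[k] (g ⊗ₜ[k] y)) (t ⊗ₜ[k] (h ⊗ₜ[k] z))) =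
      (epsL t * epsL s * (epsR x * epsR y)) • (r ⊗ₜ[k] (starBE f (starBE g h) ⊗ₜ[k] z)) := by
  rw [ustar_tmul_tmul, ustar_tmul_tmul, map_smul epsL, smul_smul, smul_tmul_tmul_smul, smul_eq_mul]

theorem ustar_tmul_ustar (r s t : Lam k V) (f : HomBE 𝔥 ζ F F') (g : HomBE 𝔥 ζ G G')
    (h : HomBE 𝔥 ζ K K') (x y z : Rv k V) :
    ustar (ustar (r ⊗ₜ[k] (f ⊗ₜ[k] x)) (s ⊗ₜ[k] (g ⊗ₜ[k] y))) (t ⊗ₜ[k] (h ⊗ₜ[k] z)) =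
      (epsL t * epsL s * (epsR x * epsR y)) •
        (r ⊗ₜ[k] (starBE (starBE f g) h ⊗ₜ[k] z)) := by
  rw [ustar_tmul_tmul, ustar_tmul_tmul, map_smul epsR, smul_smul, smul_tmul_tmul_smul, smul_eq_mul]

theorem alphaSeq_comp_ustar (u : HomFM 𝔥 ζ F F') (v : HomFM 𝔥 ζ G G') (w : HomFM 𝔥 ζ K K') :
    compFM (ofBE (alphaSeq F' G' K')) (ustar u (ustar v w)) =
      compFM (ustar (ustar u v) w) (ofBE (alphaSeq F G K)) := by
  induction u using HomFM.ind with
  | h0 => simp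
  | hadd x y hx hy => simp only [map_add, LinearMap.add_apply, hx, hy]
  | h p r f x hf =>
  induction v using HomFM.ind with
  | h0 => simp
  | hadd x y hx hy => simp only [map_add, LinearMap.add_apply, hx, hy]
  | h q s g y hg =>
  induction w using HomFM.ind with
  | h0 => simp
  | hadd x y hx hy => simp only [map_add, LinearMap.add_apply, hx, hy]
  | h q' t h z hh =>
  rw [ustar_ustar_tmul, ustar_tmul_ustar, map_smul, map_smul, LinearMap.smul_apply,
    ofBE_comp_tmul (alphaSeq_mem F' G' K'), tmul_comp_ofBE, alphaSeq_comp_starBE]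

/-- On the empty word there is only one region, so left and right boxes coincide. This gives `κ(θ) =
Θ` for the unit object. -/
theorem boxLeft_idBE_unit (r : SymmetricAlgebra k (Module.Dual k V)) :
    boxLeft r (idBE 𝔥 ζ (Seq.unit B)) = idBoxRight 𝔥 ζ (Seq.unit B) r := by
  funext a b
  refine Eq.trans ?_ (idBoxRight_self (Seq.unit B) r a).symm
  refine (congrArg (fun z => (DHom.tens (DHom.mk (Diag.box r)) z : DHom 𝔥 ζ [] []))
    (idBE_self (Seq.unit B) a)).trans ?_
  exact (DHom.tens_nil (DHom.mk (Diag.box r) : DHom 𝔥 ζ [] [])).trans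
    (DHom.nil_tens (DHom.mk (Diag.box r) : DHom 𝔥 ζ [] [])).symm

/-- If `e` intertwines two endomorphisms, its inverse intertwines them in the other direction. -/
theorem intertwine_symm {e : HomBE 𝔥 ζ F G} {e' : HomBE 𝔥 ζ G F}
    (h1 : compBE e' e = idBE 𝔥 ζ F) (h2 : compBE e e' = idBE 𝔥 ζ G) {a : HomFM 𝔥 ζ F F}
    {b : HomFM 𝔥 ζ G G} (h : compFM (ofBE e) a = compFM b (ofBE e)) :
    compFM (ofBE e') b = compFM a (ofBE e') := by
  -- Insert `e e' = id` after `b`, apply `h`, and cancel `e' e`.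
  have h3 : compFM b (compFM (ofBE e) (ofBE e')) = b := by
    rw [compFM_ofBE, h2]; exact comp_idFM b
  have h4 : ∀ c : HomFM 𝔥 ζ G F, compFM (ofBE e') (compFM (ofBE e) c) = c := fun c => by
    rw [← compFM_assoc, compFM_ofBE, h1]; exact idFM_comp c
  rw [← h3, ← compFM_assoc b, ← h, compFM_assoc, h4]

theorem intertwine_comp {P₀ P₁ P₂ P₃ Q₀ Q₁ Q₂ Q₃ : Seq B} {e₀ : HomFM 𝔥 ζ P₀ Q₀}
    {e₁ : HomFM 𝔥 ζ P₁ Q₁} {e₂ : HomFM 𝔥 ζ P₂ Q₂} {e₃ : HomFM 𝔥 ζ P₃ Q₃}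
    {x : HomFM 𝔥 ζ P₁ P₀} {y : HomFM 𝔥 ζ P₂ P₁} {z : HomFM 𝔥 ζ P₃ P₂} {x' : HomFM 𝔥 ζ Q₁ Q₀}
    {y' : HomFM 𝔥 ζ Q₂ Q₁} {z' : HomFM 𝔥 ζ Q₃ Q₂} (hx : compFM e₀ x = compFM x' e₁)
    (hy : compFM e₁ y = compFM y' e₂) (hz : compFM e₂ z = compFM z' e₃) :
    compFM e₀ (compFM x (compFM y z)) = compFM (compFM (compFM x' y') z') e₃ := by
  rw [← compFM_assoc, hx, compFM_assoc, ← compFM_assoc e₁, hy, compFM_assoc, hz, compFM_assoc,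
    compFM_assoc]

end Seq

variable [Module.Free k V] [Module.Finite k V]

/-- The basis of `V` which is used in the definition of `κ` and `Θ`. -/
local notation "bV" => Module.Free.chooseBasis k V

namespace PreComplex

variable {F G K : PreComplex 𝔥 ζ} {P Q P' Q' : Seq B}

/-- `κ` vanishes on morphisms without exterior part, so a morphism of sequences is a chain map as
soon as it intertwines the differentials. -/
theorem ofBE_mem_cocycles {e : HomBE 𝔥 ζ F.seq G.seq} (he : e ∈ bidegBE 𝔥 ζ F.seq G.seq 0 0)
    (h : compFM (ofBE e) F.δ = compFM G.δ (ofBE e)) : ofBE e ∈ cocycles F G := by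
  rw [mem_cocycles, kappa_ofBE, h, zero_add, sub_self]
  exact ⟨ofBE_mem he, rfl⟩

/-! ## Associativity -/

theorem starId_ustar_tmul (u : HomFM 𝔥 ζ P P') (s : Lam k V) (g : HomBE 𝔥 ζ Q Q') (y : Rv k V) :
    starId K (P.star Q) (P'.star Q') (ustar u (s ⊗ₜ (g ⊗ₜ y))) =
      ustar (ustar u (s ⊗ₜ (g ⊗ₜ 1))) (K.mu y) := by
  induction u using HomFM.ind with
  | h0 => simp
  | hadd x y hx hy => simp only [map_add, LinearMap.add_apply, hx, hy]
  | h p r f x hf =>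
    rw [ustar_tmul_tmul, ustar_tmul_tmul, starId_tmul, map_smul,
      TensorProduct.tmul_smul, TensorProduct.tmul_smul, map_smul, map_smul, LinearMap.smul_apply]

theorem idStar_ustar_tmul (s : Lam k V) (g : HomBE 𝔥 ζ P P') (y : Rv k V) (w : HomFM 𝔥 ζ Q Q') :
    idStar F (P.star Q) (P'.star Q') (ustar (s ⊗ₜ (g ⊗ₜ y)) w) =
      ustar (F.nu s) (ustar (1 ⊗ₜ (g ⊗ₜ y)) w) := by
  induction w using HomFM.ind with
  | h0 => simp
  | hadd x y hx hy => simp only [map_add, hx, hy]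
  | h p t h z hh =>
    rw [ustar_tmul_tmul, ustar_tmul_tmul, idStar_tmul, map_smul, ← TensorProduct.smul_tmul',
      map_smul, map_smul, LinearMap.smul_apply]

/-- `R^∨` is carried by the last factor, so `- ⋆̂ id_K` only affects `w`; its mirror image uses that
`Λ` is carried by the first factor. -/
theorem alphaSeq_comp_ustar_starId (u : HomFM 𝔥 ζ P P') (w : HomFM 𝔥 ζ Q Q') :
    compFM (ofBE (alphaSeq P' Q' K.seq)) (ustar u (starId K Q Q' w)) =
      compFM (starId K (P.star Q) (P'.star Q') (ustar u w)) (ofBE (alphaSeq P Q K.seq)) := by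
  induction w using HomFM.ind with
  | h0 => simp
  | hadd x y hx hy => simp only [map_add, LinearMap.add_apply, hx, hy]
  | h p s g y hg => rw [starId_tmul, alphaSeq_comp_ustar, starId_ustar_tmul]

theorem alphaSeq_comp_idStar_ustar (v : HomFM 𝔥 ζ P P') (w : HomFM 𝔥 ζ Q Q') :
    compFM (ofBE (alphaSeq F.seq P' Q')) (idStar F (P.star Q) (P'.star Q') (ustar v w)) =
      compFM (ustar (idStar F P P' v) w) (ofBE (alphaSeq F.seq P Q)) := by
  induction v using HomFM.ind with
  | h0 => simp
  | hadd x y hx hy => simp only [map_add, LinearMap.add_apply, hx, hy]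
  | h p s g y hg => rw [idStar_ustar_tmul, alphaSeq_comp_ustar, idStar_tmul]

/-- After `mu_conv`, `μ` of `G ⋆̂ K` is `starId K` applied to `μ_G`, and the previous intertwining
relation finishes the argument. -/
theorem alphaSeq_comp_starId (hG : G.IsConvolutive) (hK : K.IsConvolutive) (f : HomFM 𝔥 ζ P Q) :
    compFM (ofBE (alphaSeq Q G.seq K.seq)) (starId (G.conv K) P Q f) =
      compFM (starId K (P.star G.seq) (Q.star G.seq) (starId G P Q f))
        (ofBE (alphaSeq P G.seq K.seq)) := by
  induction f using HomFM.ind with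
  | h0 => simp
  | hadd x y hx hy => simp only [map_add, LinearMap.add_apply, hx, hy]
  | h p r f x hf =>
    rw [starId_tmul, starId_tmul, mu_conv hG hK]
    exact alphaSeq_comp_ustar_starId _ _

theorem alphaSeq_comp_idStar_starId (g : HomFM 𝔥 ζ P Q) :
    compFM (ofBE (alphaSeq F.seq Q K.seq))
      (idStar F (P.star K.seq) (Q.star K.seq) (starId K P Q g)) =
      compFM (starId K (F.seq.star P) (F.seq.star Q) (idStar F P Q g))
        (ofBE (alphaSeq F.seq P K.seq)) := by
  induction g using HomFM.ind with
  | h0 => simp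
  | hadd x y hx hy => simp only [map_add, LinearMap.add_apply, hx, hy]
  | h p r g x hg =>
    rw [starId_tmul, alphaSeq_comp_idStar_ustar, idStar_tmul, idStar_tmul, starId_ustar_tmul]

theorem alphaSeq_comp_idStar (hF : F.IsConvolutive) (hG : G.IsConvolutive) (h : HomFM 𝔥 ζ P Q) :
    compFM (ofBE (alphaSeq F.seq G.seq Q))
      (idStar F (G.seq.star P) (G.seq.star Q) (idStar G P Q h)) =
      compFM (idStar (F.conv G) P Q h) (ofBE (alphaSeq F.seq G.seq P)) := by
  induction h using HomFM.ind with
  | h0 => simp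
  | hadd x y hx hy => simp only [map_add, LinearMap.add_apply, hx, hy]
  | h p r h x hh =>
    rw [idStar_tmul, idStar_tmul, alphaSeq_comp_idStar_ustar, nu_conv hF hG]

/-- Both differentials are sums of three terms, one for each of `δ_F`, `δ_G`, `δ_K`, with the cross
terms hidden in `starId`; `α` matches them one by one. -/
theorem alphaSeq_comp_convDelta (hF : F.IsConvolutive) (hG : G.IsConvolutive)
    (hK : K.IsConvolutive) :
    compFM (ofBE (alphaSeq F.seq G.seq K.seq)) (convDelta F (G.conv K)) =
      compFM (convDelta (F.conv G) K) (ofBE (alphaSeq F.seq G.seq K.seq)) := by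
  have h1 : convDelta F (G.conv K) = starId (G.conv K) F.seq F.seq F.δ +
      (ustar (idFM 𝔥 ζ F.seq) (starId K G.seq G.seq G.δ) +
        ustar (idFM 𝔥 ζ F.seq) (ustar (idFM 𝔥 ζ G.seq) K.δ)) := by
    rw [convDelta_eq_starId hF (conv_isConvolutive hG hK), ← map_add, ← convDelta_eq_starId hG hK]
  have h2 : convDelta (F.conv G) K =
      starId K (F.seq.star G.seq) (F.seq.star G.seq) (starId G F.seq F.seq F.δ) +
      (starId K (F.seq.star G.seq) (F.seq.star G.seq) (ustar (idFM 𝔥 ζ F.seq) G.δ) +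
        ustar (ustar (idFM 𝔥 ζ F.seq) (idFM 𝔥 ζ G.seq)) K.δ) := by
    rw [convDelta_eq_starId (conv_isConvolutive hF hG) hK, ← add_assoc, ← map_add,
      ← convDelta_eq_starId hF hG, ustar_id]
  rw [h1, h2]
  simp only [map_add, LinearMap.add_apply]
  exact congrArg₂ (· + ·) (alphaSeq_comp_starId hG hK _)
    (congrArg₂ (· + ·) (alphaSeq_comp_ustar_starId _ _) (alphaSeq_comp_ustar _ _ _))

theorem alphaSeq_mem_cocycles (hF : F.IsConvolutive) (hG : G.IsConvolutive)
    (hK : K.IsConvolutive) :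
    ofBE (alphaSeq F.seq G.seq K.seq) ∈ cocycles (F.conv (G.conv K)) ((F.conv G).conv K) :=
  ofBE_mem_cocycles (F := F.conv (G.conv K)) (G := (F.conv G).conv K)
    (alphaSeq_mem F.seq G.seq K.seq) (alphaSeq_comp_convDelta hF hG hK)

theorem alphaSeqInv_mem_cocycles (hF : F.IsConvolutive) (hG : G.IsConvolutive)
    (hK : K.IsConvolutive) :
    ofBE (alphaSeqInv F.seq G.seq K.seq) ∈ cocycles ((F.conv G).conv K) (F.conv (G.conv K)) :=
  ofBE_mem_cocycles (F := (F.conv G).conv K) (G := F.conv (G.conv K))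
    (alphaSeqInv_mem F.seq G.seq K.seq) (intertwine_symm (alphaSeq_inv F.seq G.seq K.seq).1
      (alphaSeq_inv F.seq G.seq K.seq).2 (alphaSeq_comp_convDelta hF hG hK))

/-- Each side is a composite of three operations applied to `f`, `g`, `h` in this order, and `α`
passes them one at a time. No two of them are exchanged, so no cocycle or subcategory condition is
needed. -/
theorem alphaSeq_comp_hat {F' G' K' : PreComplex 𝔥 ζ} (hF : F.IsConvolutive)
    (hG : G.IsConvolutive) (hG' : G'.IsConvolutive) (hK' : K'.IsConvolutive)
    (f : HomFM 𝔥 ζ F.seq F'.seq) (g : HomFM 𝔥 ζ G.seq G'.seq) (h : HomFM 𝔥 ζ K.seq K'.seq) :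
    compFM (ofBE (alphaSeq F'.seq G'.seq K'.seq))
      (hat F F' (G.conv K) (G'.conv K') f (hat G G' K K' g h)) =
    compFM (hat (F.conv G) (F'.conv G') K K' (hat F F' G G' f g) h)
      (ofBE (alphaSeq F.seq G.seq K.seq)) := by
  have h1 : hat F F' (G.conv K) (G'.conv K') f (hat G G' K K' g h) =
      compFM (starId (G'.conv K') F.seq F'.seq f)
        (compFM (idStar F (G.seq.star K'.seq) (G'.seq.star K'.seq) (starId K' G.seq G'.seq g))
          (idStar F (G.seq.star K.seq) (G.seq.star K'.seq) (idStar G K.seq K'.seq h))) := by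
    rw [hat_eq (conv_isConvolutive hG' hK'), hat_eq hK', ← idStar_comp hF]
  have h2 : hat (F.conv G) (F'.conv G') K K' (hat F F' G G' f g) h =
      compFM (compFM (starId K' (F.seq.star G'.seq) (F'.seq.star G'.seq)
          (starId G' F.seq F'.seq f))
        (starId K' (F.seq.star G.seq) (F.seq.star G'.seq) (idStar F G.seq G'.seq g)))
        (idStar (F.conv G) K.seq K'.seq h) := by
    rw [hat_eq hK', hat_eq hG', ← starId_comp hK']
  rw [h1, h2]
  exact intertwine_comp (alphaSeq_comp_starId hG' hK' f)
    (alphaSeq_comp_idStar_starId (F := F) (K := K') g) (alphaSeq_comp_idStar hF hG h)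

/-! ## The unit object -/

variable (𝔥 ζ) in
-- The `e_i` anticommute in `Λ` and the `ě_i` commute in `R^∨`.
theorem theta_unit_sq : compFM (theta 𝔥 ζ (Seq.unit B)) (theta 𝔥 ζ (Seq.unit B)) = 0 := by
  simp only [theta, map_sum, LinearMap.sum_apply, compFM_tmul (partBE_id _), invL_zero]
  refine sum_sum_eq_zero_of_antisymm (fun i => ?_) fun i j => ?_
  · rw [ExteriorAlgebra.ι_sq_zero, TensorProduct.zero_tmul]
  · rw [mul_comm (SymmetricAlgebra.ι k V (bV j)), ← TensorProduct.add_tmul,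
      ExteriorAlgebra.ι_add_mul_swap, TensorProduct.zero_tmul]

variable (𝔥 ζ) in
theorem kappa_theta_unit : kappa (theta 𝔥 ζ (Seq.unit B)) = Theta 𝔥 ζ (Seq.unit B) := by
  classical
  rw [theta, map_sum, Theta]
  refine Finset.sum_congr rfl fun i _ => ?_
  rw [kappa_tmul, Finset.sum_eq_single i]
  · rw [contractV_ι, (bV).coord_apply, (bV).repr_self, Finsupp.single_eq_same, map_one,
      boxLeft_idBE_unit]
  · intro j _ hj
    rw [contractV_ι, (bV).coord_apply, (bV).repr_self, Finsupp.single_eq_of_ne (by simpa [eq_comm] using hj),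
      map_zero, TensorProduct.zero_tmul]
  · intro h; exact absurd (Finset.mem_univ i) h

variable (𝔥 ζ) in
theorem unit_isConvolutive : (unit 𝔥 ζ).IsConvolutive := by
  refine ⟨?_, ?_, ?_⟩
  · refine Submodule.sum_mem _ fun i _ => Submodule.subset_span ?_
    exact ⟨1, 1, 0, 0, _, _, _, by rw [pow_one]; exact ⟨_, rfl⟩, idBE_mem _,
      by rw [pow_one]; exact ⟨_, rfl⟩, by simp, by simp, rfl⟩
  · change compFM (theta 𝔥 ζ (Seq.unit B)) (theta 𝔥 ζ (Seq.unit B)) +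
      kappa (theta 𝔥 ζ (Seq.unit B)) = _
    rw [theta_unit_sq, kappa_theta_unit, zero_add]
  · refine Submodule.sum_mem _ fun i _ => Submodule.subset_span ?_
    exact ⟨_, _, _, Submodule.mem_sup_right ⟨_, rfl⟩, Submodule.mem_sup_right ⟨_, rfl⟩, rfl⟩

variable (𝔥 ζ) in
-- Contracting the canonical element `θ` with `v` returns `v`. Consequently `- ⋆̂ id` with the unit
-- leaves `r ⊗ f ⊗ x` unchanged up to the unitor; likewise for `ν` on the other side.
theorem mu_unit (x : Rv k V) :
    (unit 𝔥 ζ).mu x = (1 : Lam k V) ⊗ₜ[k] (idBE 𝔥 ζ (Seq.unit B) ⊗ₜ[k] x) := by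
  have h : (unit 𝔥 ζ).IsMu (TensorProduct.mk k _ _ (1 : Lam k V) ∘ₗ
      TensorProduct.mk k _ _ (idBE 𝔥 ζ (Seq.unit B))) :=
    { map_one := rfl
      map_mul := fun x y => by
        simp only [LinearMap.comp_apply, TensorProduct.mk_apply]
        rw [compFM_tmul (partBE_id _), idBE_comp, map_one, mul_one]
      map_ι := fun v => by
        simp only [LinearMap.comp_apply, TensorProduct.mk_apply]
        change _ = contractLeftFM v (theta 𝔥 ζ (Seq.unit B))
        conv_lhs => rw [← sum_smul_basis (k := k) v]
        rw [theta, map_sum, map_sum, TensorProduct.tmul_sum, TensorProduct.tmul_sum]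
        refine Finset.sum_congr rfl fun i _ => ?_
        rw [contractLeftFM_tmul, contractV_ι, map_smul, TensorProduct.tmul_smul,
          TensorProduct.tmul_smul, Algebra.algebraMap_eq_smul_one, TensorProduct.smul_tmul'] }
  exact LinearMap.congr_fun ((isMu_mu (unit_isConvolutive 𝔥 ζ)).unique h) x

variable (𝔥 ζ) in
theorem nu_unit (t : Lam k V) :
    (unit 𝔥 ζ).nu t = t ⊗ₜ[k] (idBE 𝔥 ζ (Seq.unit B) ⊗ₜ[k] (1 : Rv k V)) := by
  have h : (unit 𝔥 ζ).IsNu ((TensorProduct.mk k _ _).flip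
      (idBE 𝔥 ζ (Seq.unit B) ⊗ₜ[k] (1 : Rv k V))) :=
    { map_one := rfl
      map_mul := fun x y => by
        simp only [LinearMap.flip_apply, TensorProduct.mk_apply]
        rw [compFM_tmul (partBE_id _), idBE_comp, invL_zero, mul_one]
      map_ι := fun r => by
        simp only [LinearMap.flip_apply, TensorProduct.mk_apply]
        change _ = contractRightFM r (theta 𝔥 ζ (Seq.unit B))
        conv_lhs => rw [← sum_coord_smul r]
        rw [theta, map_sum, map_sum, TensorProduct.sum_tmul]
        refine Finset.sum_congr rfl fun i _ => ?_
        rw [contractRightFM_tmul, contractDual_ι, map_smul, Algebra.algebraMap_eq_smul_one,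
          TensorProduct.tmul_smul, TensorProduct.tmul_smul, TensorProduct.smul_tmul'] }
  exact LinearMap.congr_fun ((isNu_nu (unit_isConvolutive 𝔥 ζ)).unique h) t

theorem lamSeq_comp_idStar (f : HomFM 𝔥 ζ P Q) :
    compFM (ofBE (lamSeq Q)) (idStar (unit 𝔥 ζ) P Q f) = compFM f (ofBE (lamSeq P)) := by
  induction f using HomFM.ind with
  | h0 => simp
  | hadd x y hx hy => simp only [map_add, LinearMap.add_apply, hx, hy]
  | h p r f x hf =>
    rw [idStar_tmul, nu_unit, ustar_tmul, ofBE_comp_tmul (lamSeq_mem Q), lamSeq_comp_starBE,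
      tmul_comp_ofBE]

theorem rhoSeq_comp_starId (f : HomFM 𝔥 ζ P Q) :
    compFM (ofBE (rhoSeq Q)) (starId (unit 𝔥 ζ) P Q f) = compFM f (ofBE (rhoSeq P)) := by
  induction f using HomFM.ind with
  | h0 => simp
  | hadd x y hx hy => simp only [map_add, LinearMap.add_apply, hx, hy]
  | h p r f x hf =>
    rw [starId_tmul, mu_unit, ustar_tmul, ofBE_comp_tmul (rhoSeq_mem Q), rhoSeq_comp_starBE,
      tmul_comp_ofBE]

/-- `θ` has positive degree in both outer factors, so `θ ⋆ id` and `id ⋆ θ` vanish and only one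
summand remains in the differential of a convolution with the unit. -/
theorem augR_theta (F : Seq B) : augR (theta 𝔥 ζ F) = 0 := by
  rw [theta, map_sum]
  refine Finset.sum_eq_zero fun i _ => ?_
  rw [augR_tmul, epsR_ι]; simp

theorem augL_theta (F : Seq B) : augL (theta 𝔥 ζ F) = 0 := by
  rw [theta, map_sum]
  refine Finset.sum_eq_zero fun i _ => ?_
  rw [augL_tmul, epsL_ι]; simp

theorem convDelta_unit_left (hF : F.IsConvolutive) :
    convDelta (unit 𝔥 ζ) F = idStar (unit 𝔥 ζ) F.seq F.seq F.δ := by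
  rw [convDelta_eq_idStar (unit_isConvolutive 𝔥 ζ) hF, ← ustar_augR, augR_theta, map_zero,
    LinearMap.zero_apply, zero_add]

theorem convDelta_unit_right (hF : F.IsConvolutive) :
    convDelta F (unit 𝔥 ζ) = starId (unit 𝔥 ζ) F.seq F.seq F.δ := by
  rw [convDelta_eq_starId hF (unit_isConvolutive 𝔥 ζ), ← ustar_augL, augL_theta, map_zero, add_zero]

theorem lamSeq_comp_convDelta (hF : F.IsConvolutive) :
    compFM (ofBE (lamSeq F.seq)) (convDelta (unit 𝔥 ζ) F) = compFM F.δ (ofBE (lamSeq F.seq)) := by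
  rw [convDelta_unit_left hF, lamSeq_comp_idStar]

theorem rhoSeq_comp_convDelta (hF : F.IsConvolutive) :
    compFM (ofBE (rhoSeq F.seq)) (convDelta F (unit 𝔥 ζ)) = compFM F.δ (ofBE (rhoSeq F.seq)) := by
  rw [convDelta_unit_right hF, rhoSeq_comp_starId]

theorem lamSeq_mem_cocycles (hF : F.IsConvolutive) :
    ofBE (lamSeq F.seq) ∈ cocycles ((unit 𝔥 ζ).conv F) F :=
  ofBE_mem_cocycles (F := (unit 𝔥 ζ).conv F) (lamSeq_mem F.seq) (lamSeq_comp_convDelta hF)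

theorem lamSeqInv_mem_cocycles (hF : F.IsConvolutive) :
    ofBE (lamSeqInv F.seq) ∈ cocycles F ((unit 𝔥 ζ).conv F) :=
  ofBE_mem_cocycles (G := (unit 𝔥 ζ).conv F) (lamSeqInv_mem F.seq)
    (intertwine_symm (lamSeq_inv F.seq).1 (lamSeq_inv F.seq).2 (lamSeq_comp_convDelta hF))

theorem rhoSeq_mem_cocycles (hF : F.IsConvolutive) :
    ofBE (rhoSeq F.seq) ∈ cocycles (F.conv (unit 𝔥 ζ)) F :=
  ofBE_mem_cocycles (F := F.conv (unit 𝔥 ζ)) (rhoSeq_mem F.seq) (rhoSeq_comp_convDelta hF)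

theorem rhoSeqInv_mem_cocycles (hF : F.IsConvolutive) :
    ofBE (rhoSeqInv F.seq) ∈ cocycles F (F.conv (unit 𝔥 ζ)) :=
  ofBE_mem_cocycles (G := F.conv (unit 𝔥 ζ)) (rhoSeqInv_mem F.seq)
    (intertwine_symm (rhoSeq_inv F.seq).1 (rhoSeq_inv F.seq).2 (rhoSeq_comp_convDelta hF))

end PreComplex

end FM

end FreeMonodromic

end

/-! ### Coherence for sequences, functoriality, and descent to homotopy classes. -/

open CategoryTheory TensorProduct

noncomputable section

namespace FreeMonodromic

universe uB uW uk uV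

section FM

variable {k : Type uk} [CommRing k] {V : Type uV} [AddCommGroup V] [Module k V]
  {B : Type uB} {M : CoxeterMatrix B} {W : Type uW} [Group W] {cs : CoxeterSystem M W}
  {𝔥 : Realization cs k V} {ζ : LowerTerms M k V}

/-! ## Coherence of the isomorphisms of sequences -/

/-- Supplies the hypothesis of `starBE_reindexBE` that the permutation preserves parities, so that
`id ⋆ α` is again a permutation without signs; `sigma_unit_star` does this for `id ⋆ λ`. -/
theorem sigma_assoc (F G K : Seq B) (a : (F.star (G.star K)).ι) :
    (F.star (G.star K)).sigma a =
      ((F.star G).star K).sigma ((Equiv.prodAssoc F.ι G.ι K.ι).symm a) := by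
  refine (sigma_star _ _ _).trans (Eq.trans ?_ (sigma_star _ _ _).symm)
  refine (congrArg _ (sigma_star _ _ _)).trans (Eq.trans (add_assoc _ _ _).symm ?_)
  exact congrArg (· + _) (sigma_star F G (a.1, a.2.1)).symm

theorem sigma_unit_star (F : Seq B) (a : ((Seq.unit B).star F).ι) :
    ((Seq.unit B).star F).sigma a = F.sigma (Equiv.punitProd F.ι a) := by
  rw [sigma_star]
  exact zero_add _

/-- All five maps are permutations of summands without signs, and the two composite bijections agree
pointwise by definition. The triangle is proved the same way. -/
theorem alphaSeq_pentagon (F G K L : Seq B) :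
    compBE (alphaSeq (F.star G) K L) (alphaSeq F G (K.star L)) =
      (compBE (compBE (starBE (alphaSeq F G K) (idBE 𝔥 ζ L)) (alphaSeq F (G.star K) L))
        (starBE (idBE 𝔥 ζ F) (alphaSeq G K L)) :
        HomBE 𝔥 ζ (F.star (G.star (K.star L))) (((F.star G).star K).star L)) := by
  refine Eq.trans ?_ (compBE_assoc _ _ _).symm
  have h1 := starBE_reindexBE (𝔥 := 𝔥) (ζ := ζ) (F := F.star (G.star K))
    (G := (F.star G).star K) (F' := L) (G' := L) (Equiv.prodAssoc F.ι G.ι K.ι).symm (Equiv.refl _)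
    (fun _ => (List.append_assoc _ _ _).symm) (fun _ => rfl) (fun _ => rfl)
  have h2 := starBE_reindexBE (𝔥 := 𝔥) (ζ := ζ) (F := F) (G := F) (F' := G.star (K.star L))
    (G' := (G.star K).star L) (Equiv.refl _) (Equiv.prodAssoc G.ι K.ι L.ι).symm
    (fun _ => rfl) (fun _ => (List.append_assoc _ _ _).symm) (sigma_assoc G K L)
  refine (compBE_reindexBE_reindexBE (F := F.star (G.star (K.star L)))
    (G := (F.star G).star (K.star L)) (K := ((F.star G).star K).star L)
    (Equiv.prodAssoc F.ι G.ι (K.ι × L.ι)).symm (Equiv.prodAssoc (F.ι × G.ι) K.ι L.ι).symm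
    (fun _ => (List.append_assoc _ _ _).symm)
    (fun _ => (List.append_assoc _ _ _).symm)).trans ?_
  refine Eq.trans ?_ (congrArg₂ (fun x y => compBE x (compBE (alphaSeq F (G.star K) L) y))
    h1 h2).symm
  refine Eq.trans ?_ (congrArg (compBE _) (compBE_reindexBE_reindexBE
    (F := F.star (G.star (K.star L))) (G := F.star ((G.star K).star L))
    (K := (F.star (G.star K)).star L) _ _ _ _)).symm
  refine Eq.trans ?_ (compBE_reindexBE_reindexBE
    (F := F.star (G.star (K.star L))) (G := (F.star (G.star K)).star L)
    (K := ((F.star G).star K).star L) _ _ _ _).symm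
  exact reindexBE_congr (F := F.star (G.star (K.star L))) (G := ((F.star G).star K).star L)
    (Equiv.ext fun _ => rfl) _ _

theorem alphaSeq_triangle (F G : Seq B) :
    compBE (starBE (rhoSeq F) (idBE 𝔥 ζ G)) (alphaSeq F (Seq.unit B) G) =
      (starBE (idBE 𝔥 ζ F) (lamSeq G) :
        HomBE 𝔥 ζ (F.star ((Seq.unit B).star G)) (F.star G)) := by
  have h1 := starBE_reindexBE (𝔥 := 𝔥) (ζ := ζ) (F := F.star (Seq.unit B)) (G := F) (F' := G)
    (G' := G) (Equiv.prodPUnit F.ι) (Equiv.refl _) (fun _ => List.append_nil _) (fun _ => rfl)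
    (fun _ => rfl)
  have h2 := starBE_reindexBE (𝔥 := 𝔥) (ζ := ζ) (F := F) (G := F) (F' := (Seq.unit B).star G)
    (G' := G) (Equiv.refl _) (Equiv.punitProd G.ι) (fun _ => rfl) (fun _ => rfl)
    (sigma_unit_star G)
  refine (congrArg (fun x => compBE x (alphaSeq F (Seq.unit B) G)) h1).trans ?_
  refine Eq.trans ?_ h2.symm
  refine (compBE_reindexBE_reindexBE (F := F.star ((Seq.unit B).star G))
    (G := (F.star (Seq.unit B)).star G) (K := F.star G) _ _ _ _).trans ?_
  exact reindexBE_congr (F := F.star ((Seq.unit B).star G)) (G := F.star G)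
    (Equiv.ext fun _ => rfl) _ _

theorem lamSeq_unit : (lamSeq (Seq.unit B) : HomBE 𝔥 ζ _ _) = rhoSeq (Seq.unit B) :=
  reindexBE_congr (F := (Seq.unit B).star (Seq.unit B)) (G := Seq.unit B)
    (Equiv.ext fun _ => rfl) _ _

variable [Module.Free k V] [Module.Finite k V]

namespace PreComplex

variable {F G K F' G' K' : PreComplex 𝔥 ζ}

/-! ## Functoriality of the convolution -/

theorem hat_id_left (hG' : G'.IsConvolutive) (h : HomFM 𝔥 ζ F'.seq G'.seq) :
    hat F F F' G' (idFM 𝔥 ζ F.seq) h = idStar F F'.seq G'.seq h := by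
  rw [hat_eq hG', starId_id hG', idFM_comp]

theorem hat_id_right (hF : F.IsConvolutive) (hG' : G'.IsConvolutive)
    (f : HomFM 𝔥 ζ F.seq G.seq) :
    hat F G G' G' f (idFM 𝔥 ζ G'.seq) = starId G' F.seq G.seq f := by
  rw [hat_eq hG', idStar_id hF, comp_idFM]

theorem hat_ofBE_id (hF : F.IsConvolutive) (hG' : G'.IsConvolutive)
    (f : HomBE 𝔥 ζ F.seq G.seq) :
    hat F G G' G' (ofBE f) (idFM 𝔥 ζ G'.seq) = ofBE (starBE f (idBE 𝔥 ζ G'.seq)) := by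
  rw [hat_id_right hF hG', starId_of_mem_lhd hG' (ofBE_mem_lhd f), idFM, ustar_ofBE]

theorem hat_id_ofBE (hF : F.IsConvolutive) (hG' : G'.IsConvolutive)
    (f : HomBE 𝔥 ζ F'.seq G'.seq) :
    hat F F F' G' (idFM 𝔥 ζ F.seq) (ofBE f) = ofBE (starBE (idBE 𝔥 ζ F.seq) f) := by
  rw [hat_id_left hG', idStar_of_mem_rhd hF (ofBE_mem_rhd f), idFM, ustar_ofBE]

theorem hat_id_id (hF : F.IsConvolutive) (hG : G.IsConvolutive) :
    hat F F G G (idFM 𝔥 ζ F.seq) (idFM 𝔥 ζ G.seq) = idFM 𝔥 ζ (F.seq.star G.seq) := by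
  rw [hat_id_left hG, idStar_id hF]

theorem hat_mem_cocycles (hF : F.IsConvolutive) (hG : G.IsConvolutive) (hF' : F'.IsConvolutive)
    (hG' : G'.IsConvolutive) {f : HomFM 𝔥 ζ F.seq G.seq} (hf : f ∈ cocycles F G)
    {h : HomFM 𝔥 ζ F'.seq G'.seq} (hh : h ∈ cocycles F' G') :
    hat F G F' G' f h ∈ cocycles (F.conv F') (G.conv G') := by
  rw [hat_eq hG']
  exact comp_mem_cocycles (F := F.conv F') (G := F.conv G') (K := G.conv G')
    (starId_mem_cocycles hF hG hG' hf) (idStar_mem_cocycles hF' hG' hF hh)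

/-- Expanded into operations in one variable, the two sides have the same outer factors and differ
by the exchange of `f ⋆̂ id` with `id ⋆̂ g'`. Hence a condition on the pair `f`, `g'` suffices. -/
theorem hat_comp (hF : F.IsConvolutive) (hG' : G'.IsConvolutive) (hK' : K'.IsConvolutive)
    {f : HomFM 𝔥 ζ F.seq G.seq} {g : HomFM 𝔥 ζ G.seq K.seq} {f' : HomFM 𝔥 ζ F'.seq G'.seq}
    {g' : HomFM 𝔥 ζ G'.seq K'.seq}
    (hfg : compFM (starId K' F.seq G.seq f) (idStar F G'.seq K'.seq g') =
      compFM (idStar G G'.seq K'.seq g') (starId G' F.seq G.seq f)) :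
    hat F K F' K' (compFM g f) (compFM g' f') =
      compFM (hat G K G' K' g g') (hat F G F' G' f f') := by
  rw [hat_eq hK', hat_eq hK', hat_eq hG', starId_comp hK', idStar_comp hF]
  rw [compFM_assoc, ← compFM_assoc (starId K' F.seq G.seq f), hfg, compFM_assoc, compFM_assoc]

end PreComplex

open PreComplex

variable (𝔥 ζ) in
theorem wellDefined : WellDefined 𝔥 ζ where
  isMu F := isMu_mu F.isConvolutive
  mu_mem F := F.isConvolutive.mu_mem_rhd
  isNu F := isNu_nu F.isConvolutive
  nu_mem F := F.isConvolutive.nu_mem_lhd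
  unit_convolutive := unit_isConvolutive 𝔥 ζ
  conv_convolutive F G := conv_isConvolutive F.isConvolutive G.isConvolutive
  hat_cocycle F G F' G' f hf h hh := hat_mem_cocycles F.isConvolutive G.isConvolutive
    F'.isConvolutive G'.isConvolutive hf hh
  -- A boundary stays a boundary under `- ⋆̂ id`, and then under composition with the cocycle `id ⋆̂
  -- h`; the other side is analogous.
  hat_boundary_left F G F' G' f hf h hh := by
    rw [hat_eq G'.isConvolutive]
    exact comp_mem_boundaries_left (F := F.pre.conv F'.pre) (G := F.pre.conv G'.pre)
      (K := G.pre.conv G'.pre)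
      (starId_mem_boundaries F.isConvolutive G.isConvolutive G'.isConvolutive hf.2)
      (idStar_mem_cocycles F'.isConvolutive G'.isConvolutive F.isConvolutive hh)
  hat_boundary_right F G F' G' f hf h hh := by
    rw [hat_eq G'.isConvolutive]
    exact comp_mem_boundaries_right (F := F.pre.conv F'.pre) (G := F.pre.conv G'.pre)
      (K := G.pre.conv G'.pre)
      (starId_mem_cocycles F.isConvolutive G.isConvolutive G'.isConvolutive hf)
      (idStar_mem_boundaries F'.isConvolutive G'.isConvolutive F.isConvolutive hh.2)
  hat_rhd F G F' G' f hf h hh := by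
    rw [hat_eq G'.isConvolutive]
    exact compFM_mem_rhd (starId_mem_rhd hf) (idStar_mem_rhd F.isConvolutive hh)
  hat_lhd F G F' G' f hf h hh := by
    rw [hat_eq G'.isConvolutive]
    exact compFM_mem_lhd (starId_mem_lhd G'.isConvolutive hf) (idStar_mem_lhd hh)
  lam_cocycle F := ⟨lamSeq_mem_cocycles F.isConvolutive, lamSeqInv_mem_cocycles F.isConvolutive⟩
  lam_inv := lamSeq_inv
  rho_cocycle F := ⟨rhoSeq_mem_cocycles F.isConvolutive, rhoSeqInv_mem_cocycles F.isConvolutive⟩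
  rho_inv := rhoSeq_inv
  alpha_cocycle F G K :=
    ⟨alphaSeq_mem_cocycles F.isConvolutive G.isConvolutive K.isConvolutive,
      alphaSeqInv_mem_cocycles F.isConvolutive G.isConvolutive K.isConvolutive⟩
  alpha_inv := alphaSeq_inv

/-! ## The coherence conditions -/

theorem PreComplex.homMk_congr {F G : PreComplex 𝔥 ζ} {f f' : HomFM 𝔥 ζ F.seq G.seq}
    {hf : f ∈ cocycles F G} {hf' : f' ∈ cocycles F G} (h : f = f') : homMk f hf = homMk f' hf' := by
  subst h; rfl

namespace WellDefined

variable (wd : WellDefined 𝔥 ζ)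

theorem map_lam {F G : ConvFM 𝔥 ζ} (φ : F ⟶ G) :
    wd.map (𝟙 wd.unitObj) φ ≫ (wd.lam G).hom = (wd.lam F).hom ≫ φ := by
  induction φ using hom_ind with
  | h f hf =>
    refine homMk_congr (F := (PreComplex.unit 𝔥 ζ).conv F.pre) (G := G.pre) ?_
    exact (congrArg (compFM _) (hat_id_left G.isConvolutive f)).trans (lamSeq_comp_idStar f)

theorem map_rho {F G : ConvFM 𝔥 ζ} (φ : F ⟶ G) :
    wd.map φ (𝟙 wd.unitObj) ≫ (wd.rho G).hom = (wd.rho F).hom ≫ φ := by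
  induction φ using hom_ind with
  | h f hf =>
    refine homMk_congr (F := F.pre.conv (PreComplex.unit 𝔥 ζ)) (G := G.pre) ?_
    exact (congrArg (compFM _) (hat_id_right F.isConvolutive (unit_isConvolutive 𝔥 ζ) f)).trans
      (rhoSeq_comp_starId f)

attribute [local irreducible] hat compFM in
theorem map_alpha {F F' G G' K K' : ConvFM 𝔥 ζ} (φ : F ⟶ F') (ψ : G ⟶ G') (χ : K ⟶ K') :
    wd.map φ (wd.map ψ χ) ≫ (wd.alpha F' G' K').hom =
      (wd.alpha F G K).hom ≫ wd.map (wd.map φ ψ) χ := by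
  induction φ using hom_ind with
  | h f hf =>
  induction ψ using hom_ind with
  | h g hg =>
  induction χ using hom_ind with
  | h h hh =>
    exact homMk_congr (F := F.pre.conv (G.pre.conv K.pre))
      (G := (F'.pre.conv G'.pre).conv K'.pre) (alphaSeq_comp_hat F.isConvolutive G.isConvolutive
        G'.isConvolutive K'.isConvolutive f g h)

/-- A morphism which is represented by an isomorphism, or more generally a morphism of
sequences. -/
def RepBE {F G : ConvFM 𝔥 ζ} (φ : F ⟶ G) (f : HomBE 𝔥 ζ F.pre.seq G.pre.seq) : Prop :=
  ∃ hf, φ = ConvFM.mk' (ofBE f) hf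

theorem RepBE.ext {F G : ConvFM 𝔥 ζ} {φ ψ : F ⟶ G} {f g : HomBE 𝔥 ζ F.pre.seq G.pre.seq}
    (hφ : RepBE φ f) (hψ : RepBE ψ g) (h : f = g) : φ = ψ := by
  obtain ⟨hf, rfl⟩ := hφ
  obtain ⟨hg, rfl⟩ := hψ
  subst h; rfl

theorem RepBE.comp {F G K : ConvFM 𝔥 ζ} {φ : F ⟶ G} {ψ : G ⟶ K}
    {f : HomBE 𝔥 ζ F.pre.seq G.pre.seq} {g : HomBE 𝔥 ζ G.pre.seq K.pre.seq}
    (hφ : RepBE φ f) (hψ : RepBE ψ g) : RepBE (φ ≫ ψ) (compBE g f) := by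
  obtain ⟨hf, rfl⟩ := hφ
  obtain ⟨hg, rfl⟩ := hψ
  exact ⟨by rw [← compFM_ofBE]; exact comp_mem_cocycles hg hf, homMk_congr compFM_ofBE⟩

theorem RepBE.map_id_left (F : ConvFM 𝔥 ζ) {G G' : ConvFM 𝔥 ζ} {φ : G ⟶ G'}
    {f : HomBE 𝔥 ζ G.pre.seq G'.pre.seq} (hφ : RepBE φ f) :
    RepBE (F := wd.obj F G) (G := wd.obj F G') (wd.map (𝟙 F) φ)
      (starBE (idBE 𝔥 ζ F.pre.seq) f) := by
  obtain ⟨hf, rfl⟩ := hφ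
  have e := hat_id_ofBE F.isConvolutive G'.isConvolutive f
  refine ⟨?_, homMk_congr (F := F.pre.conv G.pre) (G := F.pre.conv G'.pre) e⟩
  rw [← e]
  exact wd.hat_cocycle F F G G' _ (id_mem_cocycles F.pre) _ hf

theorem RepBE.map_id_right (G : ConvFM 𝔥 ζ) {F F' : ConvFM 𝔥 ζ} {φ : F ⟶ F'}
    {f : HomBE 𝔥 ζ F.pre.seq F'.pre.seq} (hφ : RepBE φ f) :
    RepBE (F := wd.obj F G) (G := wd.obj F' G) (wd.map φ (𝟙 G))
      (starBE f (idBE 𝔥 ζ G.pre.seq)) := by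
  obtain ⟨hf, rfl⟩ := hφ
  have e := hat_ofBE_id (G := F'.pre) F.isConvolutive G.isConvolutive f
  refine ⟨?_, homMk_congr (F := F.pre.conv G.pre) (G := F'.pre.conv G.pre) e⟩
  rw [← e]
  exact wd.hat_cocycle F F' G G _ hf _ (id_mem_cocycles G.pre)

theorem alpha_rep (F G K : ConvFM 𝔥 ζ) :
    RepBE (wd.alpha F G K).hom (alphaSeq F.pre.seq G.pre.seq K.pre.seq) := ⟨_, rfl⟩

theorem lam_rep (F : ConvFM 𝔥 ζ) : RepBE (wd.lam F).hom (lamSeq F.pre.seq) := ⟨_, rfl⟩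

theorem rho_rep (F : ConvFM 𝔥 ζ) : RepBE (wd.rho F).hom (rhoSeq F.pre.seq) := ⟨_, rfl⟩

end WellDefined

end FM

end FreeMonodromic

end

/-! ### The coherence conditions and the two monoidal categories. -/

open CategoryTheory TensorProduct

noncomputable section

namespace FreeMonodromic

universe uB uW uk uV

section FM

variable {k : Type uk} [CommRing k] {V : Type uV} [AddCommGroup V] [Module k V]
  {B : Type uB} {M : CoxeterMatrix B} {W : Type uW} [Group W] {cs : CoxeterSystem M W}
  {𝔥 : Realization cs k V} {ζ : LowerTerms M k V}

variable [Module.Free k V] [Module.Finite k V]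

open PreComplex

namespace WellDefined

variable (wd : WellDefined 𝔥 ζ)

theorem pentagon (F G K L : ConvFM 𝔥 ζ) :
    (wd.alpha F G (wd.obj K L)).hom ≫ (wd.alpha (wd.obj F G) K L).hom =
      wd.map (𝟙 F) (wd.alpha G K L).hom ≫ (wd.alpha F (wd.obj G K) L).hom ≫
        wd.map (wd.alpha F G K).hom (𝟙 L) :=
  ((wd.alpha_rep F G (wd.obj K L)).comp (wd.alpha_rep (wd.obj F G) K L)).ext
    (((wd.alpha_rep G K L).map_id_left wd F).comp ((wd.alpha_rep F (wd.obj G K) L).comp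
      ((wd.alpha_rep F G K).map_id_right wd L)))
    (alphaSeq_pentagon F.pre.seq G.pre.seq K.pre.seq L.pre.seq)

theorem triangle (F G : ConvFM 𝔥 ζ) :
    (wd.alpha F wd.unitObj G).hom ≫ wd.map (wd.rho F).hom (𝟙 G) =
      wd.map (𝟙 F) (wd.lam G).hom :=
  ((wd.alpha_rep F wd.unitObj G).comp ((wd.rho_rep F).map_id_right wd G)).ext
    ((wd.lam_rep G).map_id_left wd F) (alphaSeq_triangle F.pre.seq G.pre.seq)

theorem lam_unit : (wd.lam wd.unitObj).hom = (wd.rho wd.unitObj).hom :=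
  (wd.lam_rep wd.unitObj).ext (wd.rho_rep wd.unitObj) lamSeq_unit

theorem map_id (F G : ConvFM 𝔥 ζ) : wd.map (𝟙 F) (𝟙 G) = 𝟙 (wd.obj F G) :=
  homMk_congr (F := F.pre.conv G.pre) (G := F.pre.conv G.pre)
    (hat_id_id F.isConvolutive G.isConvolutive)

/-- `ψ` and `φ'` are the outer factors in `hat_comp`, so they may be arbitrary morphisms of the
large category; only `φ` and `ψ'` are exchanged. -/
theorem map_comp_of_isRhd {F G K F' G' K' : ConvFM 𝔥 ζ} {φ : F ⟶ G} (ψ : G ⟶ K)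
    (φ' : F' ⟶ G') {ψ' : G' ⟶ K'} (hφ : IsRhd φ) (hψ' : IsRhd ψ') :
    wd.map (φ ≫ ψ) (φ' ≫ ψ') = wd.map φ φ' ≫ wd.map ψ ψ' := by
  obtain ⟨f, hf, hf', rfl⟩ := hφ
  obtain ⟨g', hg', hg'', rfl⟩ := hψ'
  induction ψ using hom_ind with
  | h g hg =>
  induction φ' using hom_ind with
  | h f' hf₁ =>
    exact homMk_congr (F := F.pre.conv F'.pre) (G := K.pre.conv K'.pre)
      (hat_comp F.isConvolutive G'.isConvolutive K'.isConvolutive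
        (interchange_rhd F.isConvolutive G.isConvolutive G'.isConvolutive K'.isConvolutive
          hf' hg' hg''))

theorem map_comp_of_isLhd {F G K F' G' K' : ConvFM 𝔥 ζ} {φ : F ⟶ G} (ψ : G ⟶ K)
    (φ' : F' ⟶ G') {ψ' : G' ⟶ K'} (hφ : IsLhd φ) (hψ' : IsLhd ψ') :
    wd.map (φ ≫ ψ) (φ' ≫ ψ') = wd.map φ φ' ≫ wd.map ψ ψ' := by
  obtain ⟨f, hf, hf', rfl⟩ := hφ
  obtain ⟨g', hg', hg'', rfl⟩ := hψ'
  induction ψ using hom_ind with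
  | h g hg =>
  induction φ' using hom_ind with
  | h f' hf₁ =>
    exact homMk_congr (F := F.pre.conv F'.pre) (G := K.pre.conv K'.pre)
      (hat_comp F.isConvolutive G'.isConvolutive K'.isConvolutive
        (interchange_lhd F.isConvolutive G.isConvolutive G'.isConvolutive K'.isConvolutive
          hf hf' hg''))

theorem map_alpha_inv {F F' G G' K K' : ConvFM 𝔥 ζ} (φ : F ⟶ F') (ψ : G ⟶ G') (χ : K ⟶ K') :
    wd.map (wd.map φ ψ) χ ≫ (wd.alpha F' G' K').inv =
      (wd.alpha F G K).inv ≫ wd.map φ (wd.map ψ χ) := by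
  rw [Iso.comp_inv_eq, Category.assoc, Iso.eq_inv_comp, map_alpha]

/-- The functor `F ⋆̂ -` applied to an isomorphism of the first subcategory. -/
def mapIsoLeft (F : ConvFM 𝔥 ζ) {G G' : ConvFM 𝔥 ζ} (e : G ≅ G') (h : IsRhd e.hom)
    (h' : IsRhd e.inv) : wd.obj F G ≅ wd.obj F G' where
  hom := wd.map (𝟙 F) e.hom
  inv := wd.map (𝟙 F) e.inv
  hom_inv_id := by
    rw [← wd.map_comp_of_isRhd _ _ (isRhd_id F) h', e.hom_inv_id, Category.comp_id, map_id]
  inv_hom_id := by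
    rw [← wd.map_comp_of_isRhd _ _ (isRhd_id F) h, e.inv_hom_id, Category.comp_id, map_id]

/-- The functor `- ⋆̂ G` applied to an isomorphism of the first subcategory. -/
def mapIsoRight {F F' : ConvFM 𝔥 ζ} (e : F ≅ F') (G : ConvFM 𝔥 ζ) (h : IsRhd e.hom)
    (h' : IsRhd e.inv) : wd.obj F G ≅ wd.obj F' G where
  hom := wd.map e.hom (𝟙 G)
  inv := wd.map e.inv (𝟙 G)
  hom_inv_id := by
    rw [← wd.map_comp_of_isRhd _ _ h (isRhd_id G), e.hom_inv_id, Category.comp_id, map_id]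
  inv_hom_id := by
    rw [← wd.map_comp_of_isRhd _ _ h' (isRhd_id G), e.inv_hom_id, Category.comp_id, map_id]

/-- In a monoidal category as formalized the associator is the inverse of `α`, so the pentagon is
inverted. It must first be an equation of isomorphisms; `id ⋆̂ α` and `α ⋆̂ id` are invertible
because `⋆̂` is functorial on the first subcategory, to which `α` and its inverse belong. The
resulting equation lives in the large category and thus serves both subcategories. -/
theorem pentagon_inv (F G K L : ConvFM 𝔥 ζ) :
    wd.map (wd.alpha F G K).inv (𝟙 L) ≫ (wd.alpha F (wd.obj G K) L).inv ≫
        wd.map (𝟙 F) (wd.alpha G K L).inv =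
      (wd.alpha (wd.obj F G) K L).inv ≫ (wd.alpha F G (wd.obj K L)).inv := by
  have h : wd.alpha F G (wd.obj K L) ≪≫ wd.alpha (wd.obj F G) K L =
      wd.mapIsoLeft F (wd.alpha G K L) (isRhd_ofBE _ _) (isRhd_ofBE _ _) ≪≫
        wd.alpha F (wd.obj G K) L ≪≫
        wd.mapIsoRight (wd.alpha F G K) L (isRhd_ofBE _ _) (isRhd_ofBE _ _) :=
    Iso.ext (wd.pentagon F G K L)
  exact (Category.assoc _ _ _).symm.trans (congrArg Iso.inv h).symm

theorem triangle_inv (F G : ConvFM 𝔥 ζ) :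
    (wd.alpha F wd.unitObj G).inv ≫ wd.map (𝟙 F) (wd.lam G).hom =
      wd.map (wd.rho F).hom (𝟙 G) := by
  rw [Iso.inv_comp_eq, triangle]

theorem comp_eq_of_rhd {F G K L G' : ConvRhd 𝔥 ζ} {φ : F ⟶ G} {ψ : G ⟶ K} {χ : K ⟶ L}
    {φ' : F ⟶ G'} {ψ' : G' ⟶ L} (e : φ.1 ≫ ψ.1 ≫ χ.1 = φ'.1 ≫ ψ'.1) :
    φ ≫ ψ ≫ χ = φ' ≫ ψ' :=
  Subtype.ext e

theorem comp_eq_of_lhd {F G K L G' : ConvLhd 𝔥 ζ} {φ : F ⟶ G} {ψ : G ⟶ K} {χ : K ⟶ L}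
    {φ' : F ⟶ G'} {ψ' : G' ⟶ L} (e : φ.1 ≫ ψ.1 ≫ χ.1 = φ'.1 ≫ ψ'.1) :
    φ ≫ ψ ≫ χ = φ' ≫ ψ' :=
  Subtype.ext e

attribute [local irreducible] WellDefined.map WellDefined.alpha in
/-- The monoidal structure on the first subcategory. -/
abbrev rhdMonoidal : MonoidalCategory (ConvRhd 𝔥 ζ) where
  __ := wd.rhdStruct
  tensorHom_def {F G F' G'} φ ψ := Subtype.ext (by
    -- Write `φ ⋆̂ ψ` as `φ ⋆̂ id` followed by `id ⋆̂ ψ`.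
    have := wd.map_comp_of_isRhd (ψ := 𝟙 G.of) (φ' := 𝟙 F'.of) φ.2 ψ.2
    rw [Category.comp_id, Category.id_comp] at this
    exact this)
  id_tensorHom_id F G := Subtype.ext (wd.map_id F.of G.of)
  tensorHom_comp_tensorHom φ φ' ψ ψ' :=
    Subtype.ext (wd.map_comp_of_isRhd ψ.1 φ'.1 φ.2 ψ'.2).symm
  whiskerLeft_id F G := Subtype.ext (wd.map_id F.of G.of)
  id_whiskerRight F G := Subtype.ext (wd.map_id F.of G.of)
  associator_naturality φ ψ χ := Subtype.ext (wd.map_alpha_inv φ.1 ψ.1 χ.1)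
  leftUnitor_naturality φ := Subtype.ext (wd.map_lam φ.1)
  rightUnitor_naturality φ := Subtype.ext (wd.map_rho φ.1)
  pentagon F G K L := comp_eq_of_rhd (wd.pentagon_inv F.of G.of K.of L.of)
  triangle F G := Subtype.ext (wd.triangle_inv F.of G.of)

attribute [local irreducible] WellDefined.map WellDefined.alpha in
/-- The monoidal structure on the second subcategory. -/
abbrev lhdMonoidal : MonoidalCategory (ConvLhd 𝔥 ζ) where
  __ := wd.lhdStruct
  tensorHom_def {F G F' G'} φ ψ := Subtype.ext (by
    have := wd.map_comp_of_isLhd (ψ := 𝟙 G.of) (φ' := 𝟙 F'.of) φ.2 ψ.2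
    rw [Category.comp_id, Category.id_comp] at this
    exact this)
  id_tensorHom_id F G := Subtype.ext (wd.map_id F.of G.of)
  tensorHom_comp_tensorHom φ φ' ψ ψ' :=
    Subtype.ext (wd.map_comp_of_isLhd ψ.1 φ'.1 φ.2 ψ'.2).symm
  whiskerLeft_id F G := Subtype.ext (wd.map_id F.of G.of)
  id_whiskerRight F G := Subtype.ext (wd.map_id F.of G.of)
  associator_naturality φ ψ χ := Subtype.ext (wd.map_alpha_inv φ.1 ψ.1 χ.1)
  leftUnitor_naturality φ := Subtype.ext (wd.map_lam φ.1)
  rightUnitor_naturality φ := Subtype.ext (wd.map_rho φ.1)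
  pentagon F G K L := comp_eq_of_lhd (wd.pentagon_inv F.of G.of K.of L.of)
  triangle F G := Subtype.ext (wd.triangle_inv F.of G.of)

end WellDefined

end FM

end FreeMonodromic

end

open CategoryTheory FreeMonodromic in
theorem mainTheorem6 {B : Type*} [Finite B] {M : CoxeterMatrix B} {W : Type*} [Group W]
    {cs : CoxeterSystem M W} {k : Type*} [CommRing k] [IsDomain k] {V : Type*} [AddCommGroup V]
    [Module k V] [Module.Free k V] [Module.Finite k V]
    (𝔥 : Realization cs k V) (ζ : LowerTerms M k V) :
    ∃ wd : WellDefined 𝔥 ζ,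
      -- `λ`, `ϱ` and `α` are natural with respect to all morphisms of convolutive complexes
      (∀ (F G : ConvFM 𝔥 ζ) (φ : F ⟶ G),
        wd.map (𝟙 wd.unitObj) φ ≫ (wd.lam G).hom = (wd.lam F).hom ≫ φ) ∧
      (∀ (F G : ConvFM 𝔥 ζ) (φ : F ⟶ G),
        wd.map φ (𝟙 wd.unitObj) ≫ (wd.rho G).hom = (wd.rho F).hom ≫ φ) ∧
      (∀ (F F' G G' K K' : ConvFM 𝔥 ζ) (φ : F ⟶ F') (ψ : G ⟶ G') (χ : K ⟶ K'),
        wd.map φ (wd.map ψ χ) ≫ (wd.alpha F' G' K').hom =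
          (wd.alpha F G K).hom ≫ wd.map (wd.map φ ψ) χ) ∧
      -- the pentagon
      (∀ F G K L : ConvFM 𝔥 ζ,
        (wd.alpha F G (wd.obj K L)).hom ≫ (wd.alpha (wd.obj F G) K L).hom =
          wd.map (𝟙 F) (wd.alpha G K L).hom ≫ (wd.alpha F (wd.obj G K) L).hom ≫
            wd.map (wd.alpha F G K).hom (𝟙 L)) ∧
      -- the triangle
      (∀ F G : ConvFM 𝔥 ζ,
        (wd.alpha F wd.unitObj G).hom ≫ wd.map (wd.rho F).hom (𝟙 G) =
          wd.map (𝟙 F) (wd.lam G).hom) ∧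
      -- the two unitors agree on the unit object
      (wd.lam wd.unitObj).hom = (wd.rho wd.unitObj).hom ∧
      -- both subcategories are monoidal with these structures
      (∃ m : MonoidalCategory (ConvRhd 𝔥 ζ), m.toMonoidalCategoryStruct = wd.rhdStruct) ∧
      (∃ m : MonoidalCategory (ConvLhd 𝔥 ζ), m.toMonoidalCategoryStruct = wd.lhdStruct) := by
  have wd := wellDefined 𝔥 ζ
  exact ⟨wd, fun _ _ φ => wd.map_lam φ, fun _ _ φ => wd.map_rho φ,
    fun _ _ _ _ _ _ φ ψ χ => wd.map_alpha φ ψ χ, wd.pentagon, wd.triangle, wd.lam_unit,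
    ⟨wd.rhdMonoidal, rfl⟩, ⟨wd.lhdMonoidal, rfl⟩⟩
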